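/- Definitions. A surface $Z$ is a two-dimensional topological manifold, possibly with boundary (Hausdorff); $\operatorname{Int} Z = Z\setminus\partial Z$. A foliated surface $(Z,\Delta)$ is a surface $Z$ with a one-dimensional foliation $\Delta$ (a set of leaves) such that each connected component of $\partial Z$ is a leaf of $\Delta$. A set is saturated if it is a union of leaves; a homeomorphism is foliated if it maps leaves onto leaves. The sets $\mathbb{R}\times J$, with $J\subset\mathbb{R}$ an interval, are foliated by the lines $\mathbb{R}\times\{t\}$, $t\in J$. A leaf $\omega\subset\operatorname{Int} Z$ (respectively $\omega\subset\partial Z$) is regular if it has an open saturated neighbourhood $U$ such that the pair $(\overline U,U)$ is foliated homeomorphic to $(\mathbb{R}\times[-1,1],\ \mathbb{R}\times(-1,1))$ (respectively to $(\mathbb{R}\times[0,1],\ \mathbb{R}\times[0,1))$) via a homeomorphism sending $\omega$ onto $\mathbb{R}\times\{0\}$. A leaf that is not regular is called singular. A strip is a set $S\subset\mathbb{R}^2$ such that for some real $u<v$ one has $\mathbb{R}\times(u,v)\subset S\subset\mathbb{R}\times[u,v]$ and $S$ is open in $\mathbb{R}\times[u,v]$. Its boundary intervals are the connected components of $S\cap(\mathbb{R}\times\{u,v\})$,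 and its canonical foliation consists of the lines $\mathbb{R}\times\{t\}$, $t\in(u,v)$, and of the boundary intervals. A striped atlas on $Z$ is a quotient map $q:\bigsqcup_{\lambda\in\Lambda}S_\lambda\to Z$ from the disjoint union of an at most countable family of strips, for which there are families $\{X_\gamma\}_{\gamma\in\Gamma}$, $\{Y_\gamma\}_{\gamma\in\Gamma}$ of boundary intervals of the strips, all the $X_\gamma$ and $Y_\gamma$ being mutually distinct, such that (a) $q$ is injective on the complement of $\bigcup_\gamma (X_\gamma\cup Y_\gamma)$; (b) $q(X_\gamma)=q(Y_\gamma)$ for each $\gamma\in\Gamma$; (c) for each $\gamma\in\Gamma$ the restrictions $q|_{X_\gamma}$ and $q|_{Y_\gamma}$ are embeddings with closed images in $Z$. The foliated surface $(Z,\Delta)$ admits a striped atlas if there is such a $q$ for which $\Delta$ is the canonical foliation, that is, the leaves of $\Delta$ are precisely the images under $q$ of the leaves of the canonical foliations of the strips. Theorem. Let $(Z,\Delta)$ be a foliated surface with countable base such that each leaf of $\Delta$ is homeomorphic to $\mathbb{R}$ and is a closed subset of $Z$. Then the following conditions are equivalent: (1) $(Z,\Delta)$ admits a striped atlas; (2)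 the family of all singular leaves of $\Delta$ is locally finite, i.e. each point of $Z$ has a neighbourhood meeting only finitely many singular leaves. -/

import Mathlib

open Set Topology
open scoped NNReal

/-- A one-dimensional foliation on a surface `Z` (possibly with boundary) that is tangent to the
boundary, given by a foliated atlas.  Charts take values in open subsets of the half plane
`ℝ × [0,∞)`, and transition maps have locally the form `(x, y) ↦ (f (x, y), g y)`.
Interior charts are those whose image avoids `ℝ × {0}`.  As the foliation is horizontal in every
chart, each connected component of the boundary of `Z` is a leaf.
(That `Z` is Hausdorff with countable base is assumed separately.) -/
structure Foliation (Z : Type*) [TopologicalSpace Z] where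
  atlas : Set (OpenPartialHomeomorph Z (ℝ × ℝ≥0))
  cover : ∀ z : Z, ∃ φ ∈ atlas, z ∈ φ.source
  compatible : ∀ φ ∈ atlas, ∀ ψ ∈ atlas, ∀ z ∈ φ.source ∩ ψ.source,
    ∃ N ∈ 𝓝 z, N ⊆ φ.source ∩ ψ.source ∧
      ∀ a ∈ N, ∀ b ∈ N, (φ a).2 = (φ b).2 → (ψ a).2 = (ψ b).2

namespace Foliation

variable {Z : Type*} [TopologicalSpace Z] (F : Foliation Z)

/-- Two points lie on a common plaque: in some chart of the atlas they are joined by a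
horizontal segment. -/
def SamePlaque (a b : Z) : Prop :=
  ∃ φ ∈ F.atlas, a ∈ φ.source ∧ b ∈ φ.source ∧ (φ a).2 = (φ b).2 ∧
    ∀ x ∈ uIcc (φ a).1 (φ b).1, (x, (φ a).2) ∈ φ.target

/-- The equivalence relation of lying on the same leaf: being joined by a finite chain of
plaques. -/
def leafSetoid : Setoid Z := Relation.EqvGen.setoid F.SamePlaque

/-- The set of all leaves. -/
def leaves : Set (Set Z) := F.leafSetoid.classes

/-- The boundary of the surface: the points sent to `ℝ × {0}` by some chart. -/
def boundary : Set Z := {z | ∃ φ ∈ F.atlas, z ∈ φ.source ∧ (φ z).2 = 0}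

/-- A set is saturated if it is a union of leaves. -/
def IsSaturated (U : Set Z) : Prop :=
  ∀ ω ∈ F.leaves, (ω ∩ U).Nonempty → ω ⊆ U

/-- The leaf `ω` has an open saturated neighbourhood `U` such that the pair `(closure U, U)` is
foliated homeomorphic to `(ℝ × J, ℝ × I)`, with `ℝ × J` foliated by the lines `ℝ × {t}`,
by a homeomorphism taking `ω` onto `ℝ × {0}`. -/
def HasProductNhd (ω : Set Z) (J I : Set ℝ) : Prop :=
  ∃ U : Set Z, IsOpen U ∧ ω ⊆ U ∧ F.IsSaturated U ∧
    ∃ h : closure U ≃ₜ ℝ × J,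
      (∀ a b : closure U, F.leafSetoid (a : Z) (b : Z) ↔ (h a).2 = (h b).2) ∧
      (∀ a : closure U, (a : Z) ∈ U ↔ ((h a).2 : ℝ) ∈ I) ∧
      (∀ a : closure U, (a : Z) ∈ ω ↔ ((h a).2 : ℝ) = 0)

/-- Regular leaves: two-sided product neighbourhoods for leaves in the interior of the surface,
one-sided ones for leaves in its boundary. -/
def IsRegularLeaf (ω : Set Z) : Prop :=
  (ω ⊆ F.boundaryᶜ ∧ F.HasProductNhd ω (Icc (-1) 1) (Ioo (-1) 1)) ∨
  (ω ⊆ F.boundary ∧ F.HasProductNhd ω (Icc 0 1) (Ico 0 1))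

/-- The family of all singular, i.e. not regular, leaves. -/
def singularLeaves : Set (Set Z) := {ω ∈ F.leaves | ¬ F.IsRegularLeaf ω}

end Foliation

/-- A strip: a set `S` with `ℝ × (u,v) ⊆ S ⊆ ℝ × [u,v]`, open in `ℝ × [u,v]`. -/
structure Strip where
  u : ℝ
  v : ℝ
  u_lt_v : u < v
  carrier : Set (ℝ × ℝ)
  contains_open : univ ×ˢ Ioo u v ⊆ carrier
  subset_closed : carrier ⊆ univ ×ˢ Icc u v
  rel_open : ∃ O : Set (ℝ × ℝ), IsOpen O ∧ carrier = O ∩ univ ×ˢ Icc u v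

namespace Strip

/-- The boundary `S ∩ ℝ × {u, v}` of a strip. -/
def boundary (S : Strip) : Set (ℝ × ℝ) := {p ∈ S.carrier | p.2 = S.u ∨ p.2 = S.v}

/-- The boundary intervals: the connected components of the boundary of the strip. -/
def boundaryIntervals (S : Strip) : Set (Set (ℝ × ℝ)) :=
  {I | ∃ p ∈ S.boundary, I = connectedComponentIn S.boundary p}

/-- The leaves of the canonical foliation of a strip: the lines `ℝ × {t}` with `u < t < v`, and
the boundary intervals. -/
def leaves (S : Strip) : Set (Set (ℝ × ℝ)) :=
  {L | ∃ t ∈ Ioo S.u S.v, L = univ ×ˢ {t}} ∪ S.boundaryIntervals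

/-- The disjoint union of a family of strips, with the disjoint union topology. -/
abbrev DisjUnion {Λ : Type} (S : Λ → Strip) : Type := Σ l, (S l).carrier

/-- A subset of a single strip, as a subset of the disjoint union. -/
def inSum {Λ : Type} (S : Λ → Strip) (l : Λ) (A : Set (ℝ × ℝ)) : Set (DisjUnion S) :=
  Sigma.mk l '' (Subtype.val ⁻¹' A)

/-- The boundary intervals of the disjoint union of strips. -/
def sumBoundaryIntervals {Λ : Type} (S : Λ → Strip) : Set (Set (DisjUnion S)) :=
  {A | ∃ l, ∃ I ∈ (S l).boundaryIntervals, A = inSum S l I}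

/-- The leaves of the canonical foliation on the disjoint union of strips. -/
def sumLeaves {Λ : Type} (S : Λ → Strip) : Set (Set (DisjUnion S)) :=
  {A | ∃ l, ∃ L ∈ (S l).leaves, A = inSum S l L}

end Strip

/-- The map `q` from a disjoint union of strips is a striped atlas: a quotient map gluing
boundary intervals `X γ` with boundary intervals `Y γ`. -/
structure IsStripedAtlas {Z : Type*} [TopologicalSpace Z] {Λ : Type} (S : Λ → Strip)
    (q : Strip.DisjUnion S → Z) : Prop where
  isQuotientMap : IsQuotientMap q
  gluing : ∃ (Γ : Type) (X Y : Γ → Set (Strip.DisjUnion S)),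
    (∀ γ, X γ ∈ Strip.sumBoundaryIntervals S) ∧ (∀ γ, Y γ ∈ Strip.sumBoundaryIntervals S) ∧
    Function.Injective X ∧ Function.Injective Y ∧ Disjoint (range X) (range Y) ∧
    InjOn q ((⋃ γ, X γ) ∪ ⋃ γ, Y γ)ᶜ ∧
    (∀ γ, q '' X γ = q '' Y γ) ∧
    (∀ γ, IsClosedEmbedding ((X γ).domRestrict q)) ∧
    (∀ γ, IsClosedEmbedding ((Y γ).domRestrict q))

/-- The foliated surface `(Z, F)` admits a striped atlas: there is a striped atlas on `Z` with at
most countably many strips whose canonical foliation, consisting of the images of the canonical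
leaves of the strips, is `F`. -/
def Foliation.AdmitsStripedAtlas {Z : Type*} [TopologicalSpace Z] (F : Foliation Z) : Prop :=
  ∃ (Λ : Type) (_ : Countable Λ) (S : Λ → Strip) (q : Strip.DisjUnion S → Z),
    IsStripedAtlas S q ∧ F.leaves = (fun A => q '' A) '' Strip.sumLeaves S

open Filter

/-! ### Real functions of one variable: openness, extrema, intermediate values. -/

/-- One-dimensional invariance of domain. -/
lemma image_mem_nhds_of_injOn_Ioo {f : ℝ → ℝ} {a b x : ℝ} (hc : ContinuousOn f (Ioo a b))
    (hi : InjOn f (Ioo a b)) (hx : x ∈ Ioo a b) {N : Set ℝ} (hN : N ∈ 𝓝 x) : f '' N ∈ 𝓝 (f x) := by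
  have hN' : N ∩ Ioo a b ∈ 𝓝 x := inter_mem hN (Ioo_mem_nhds hx.1 hx.2)
  obtain ⟨δ, hδ, hball⟩ := Metric.mem_nhds_iff.1 hN'
  have hsub : Icc (x - δ / 2) (x + δ / 2) ⊆ N ∩ Ioo a b := fun y hy => hball (by
    rw [Metric.mem_ball, Real.dist_eq, abs_lt]; constructor <;> linarith [hy.1, hy.2])
  have hc' := hc.mono (hsub.trans inter_subset_right)
  have hl : x - δ / 2 ∈ Icc (x - δ / 2) (x + δ / 2) := ⟨le_rfl, by linarith⟩
  have hr : x + δ / 2 ∈ Icc (x - δ / 2) (x + δ / 2) := ⟨by linarith, le_rfl⟩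
  have hm : x ∈ Icc (x - δ / 2) (x + δ / 2) := ⟨by linarith, by linarith⟩
  rcases hc.strictMonoOn_of_injOn_Ioo (hx.1.trans hx.2) hi with h | h
  · refine mem_of_superset (Icc_mem_nhds (h (hsub hl).2 (hsub hm).2 (by linarith))
      (h (hsub hm).2 (hsub hr).2 (by linarith))) ?_
    refine (intermediate_value_Icc (by linarith) hc').trans (image_mono (hsub.trans inter_subset_left))
  · refine mem_of_superset (Icc_mem_nhds (h (hsub hm).2 (hsub hr).2 (by linarith))
      (h (hsub hl).2 (hsub hm).2 (by linarith))) ?_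
    refine (intermediate_value_Icc' (by linarith) hc').trans (image_mono (hsub.trans inter_subset_left))

/-- Rolle's argument: equal values at two points force a local extremum in between. -/
lemma injOn_Ioo_of_not_isLocalExtr {f : ℝ → ℝ} {a b : ℝ} (hc : ContinuousOn f (Ioo a b))
    (h : ∀ x ∈ Ioo a b, ¬ IsLocalExtr f x) : InjOn f (Ioo a b) := by
  have key : ∀ x ∈ Ioo a b, ∀ y ∈ Ioo a b, x < y → f x ≠ f y := by
    intro x hx y hy hxy hf
    obtain ⟨c, hc', he⟩ := exists_isLocalExtr_Ioo hxy
      (hc.mono fun z hz => ⟨hx.1.trans_le hz.1, hz.2.trans_lt hy.2⟩) hf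
    exact h c ⟨hx.1.trans hc'.1, hc'.2.trans hy.2⟩ he
  intro x hx y hy hf
  rcases lt_trichotomy x y with h1 | h1 | h1
  · exact (key x hx y hy h1 hf).elim
  · exact h1
  · exact (key y hy x hx h1 hf.symm).elim

/-- The image of every neighbourhood contains values on both sides of `f x`. With the preceding
lemma this turns openness of a function into injectivity. -/
lemma not_isLocalExtr_of_image_mem_nhds {α : Type*} [TopologicalSpace α] {f : α → ℝ} {x : α}
    (h : ∀ N ∈ 𝓝 x, f '' N ∈ 𝓝 (f x)) : ¬ IsLocalExtr f x := by
  rintro (he | he)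
  · have := h _ he
    obtain ⟨δ, hδ, hb⟩ := Metric.mem_nhds_iff.1 this
    obtain ⟨y, hy, hfy⟩ := hb (show f x - δ / 2 ∈ _ by
      rw [Metric.mem_ball, Real.dist_eq, abs_lt]; constructor <;> linarith)
    have : f x ≤ f y := hy
    linarith
  · have := h _ he
    obtain ⟨δ, hδ, hb⟩ := Metric.mem_nhds_iff.1 this
    obtain ⟨y, hy, hfy⟩ := hb (show f x + δ / 2 ∈ _ by
      rw [Metric.mem_ball, Real.dist_eq, abs_lt]; constructor <;> linarith)
    have : f y ≤ f x := hy
    linarith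

/-- A fibrewise intermediate value theorem. -/
lemma eventually_exists_fiber_eq {α : Type*} [TopologicalSpace α] {J : Set α} {X : ℝ → α → ℝ}
    {x₀ δ : ℝ} {s₀ : α} (hδ : 0 < δ)
    (hc : ∀ s ∈ J, ContinuousOn (fun x => X x s) (Icc (x₀ - δ) (x₀ + δ)))
    (hl : ContinuousWithinAt (X (x₀ - δ)) J s₀) (hr : ContinuousWithinAt (X (x₀ + δ)) J s₀)
    (hmono : X (x₀ - δ) s₀ < X x₀ s₀ ∧ X x₀ s₀ < X (x₀ + δ) s₀ ∨
      X (x₀ + δ) s₀ < X x₀ s₀ ∧ X x₀ s₀ < X (x₀ - δ) s₀) :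
    ∀ᶠ p in 𝓝 (X x₀ s₀) ×ˢ 𝓝[J] s₀, ∃ x ∈ Ioo (x₀ - δ) (x₀ + δ), X x p.2 = p.1 := by
  have hJ : ∀ᶠ p in 𝓝 (X x₀ s₀) ×ˢ 𝓝[J] s₀, p.2 ∈ J :=
    tendsto_snd.eventually eventually_mem_nhdsWithin
  have h1 : Tendsto (fun p : ℝ × α => p.1) (𝓝 (X x₀ s₀) ×ˢ 𝓝[J] s₀) (𝓝 (X x₀ s₀)) := tendsto_fst
  have h2 : Tendsto (fun p : ℝ × α => X (x₀ - δ) p.2) (𝓝 (X x₀ s₀) ×ˢ 𝓝[J] s₀)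
      (𝓝 (X (x₀ - δ) s₀)) := hl.tendsto.comp tendsto_snd
  have h3 : Tendsto (fun p : ℝ × α => X (x₀ + δ) p.2) (𝓝 (X x₀ s₀) ×ˢ 𝓝[J] s₀)
      (𝓝 (X (x₀ + δ) s₀)) := hr.tendsto.comp tendsto_snd
  rcases hmono with ⟨ha, hb⟩ | ⟨ha, hb⟩
  · filter_upwards [hJ, h2.eventually_lt h1 ha, h1.eventually_lt h3 hb] with p hp hp1 hp2
    exact intermediate_value_Ioo (by linarith) (hc _ hp) ⟨hp1, hp2⟩
  · filter_upwards [hJ, h3.eventually_lt h1 ha, h1.eventually_lt h2 hb] with p hp hp1 hp2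
    exact intermediate_value_Ioo' (by linarith) (hc _ hp) ⟨hp1, hp2⟩

lemma IsOpen.exists_eq_Ioo {s : Set ℝ} (ho : IsOpen s) (hc : IsPreconnected s) (hne : s.Nonempty)
    (hb : BddBelow s) (ha : BddAbove s) : ∃ a b, a < b ∧ s = Ioo a b := by
  have hs : s = Ioo (sInf s) (sSup s) := by
    apply Subset.antisymm
    · intro x hx
      obtain ⟨δ, hδ, hball⟩ := Metric.isOpen_iff.1 ho x hx
      constructor
      · refine (csInf_le hb (hball (show x - δ / 2 ∈ _ from ?_))).trans_lt (by linarith)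
        rw [Metric.mem_ball, Real.dist_eq, abs_lt]; constructor <;> linarith
      · refine lt_of_lt_of_le (by linarith) (le_csSup ha (hball (show x + δ / 2 ∈ _ from ?_)))
        rw [Metric.mem_ball, Real.dist_eq, abs_lt]; constructor <;> linarith
    · intro x hx
      obtain ⟨y, hy, hyx⟩ := exists_lt_of_csInf_lt hne hx.1
      obtain ⟨z, hz, hxz⟩ := exists_lt_of_lt_csSup hne hx.2
      exact hc.ordConnected.out hy hz ⟨hyx.le, hxz.le⟩
  refine ⟨_, _, ?_, hs⟩
  obtain ⟨x, hx⟩ := hne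
  rw [hs] at hx
  exact hx.1.trans hx.2

/-- The last time before `p` that a point of `[c, p]` lies outside an open set. -/
lemma exists_last_exit {A : Set ℝ} {m p : ℝ} (hmp : m ≤ p) (hm : m ∉ A) (hp : p ∈ A)
    (hA : ∃ O, IsOpen O ∧ A ∩ Icc m p = O ∩ Icc m p) :
    ∃ c, m ≤ c ∧ c < p ∧ c ∉ A ∧ ∀ x ∈ Ioc c p, x ∈ A := by
  obtain ⟨O, hO, hAO⟩ := hA
  have hiff : ∀ x ∈ Icc m p, x ∈ A ↔ x ∈ O := fun x hx =>
    ⟨fun h => (hAO.subset ⟨h, hx⟩).1, fun h => (hAO.superset ⟨h, hx⟩).1⟩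
  have hK : IsCompact (Icc m p ∩ Oᶜ) := isCompact_Icc.inter_right hO.isClosed_compl
  have hne : (Icc m p ∩ Oᶜ).Nonempty := ⟨m, ⟨le_rfl, hmp⟩, fun h => hm ((hiff m ⟨le_rfl, hmp⟩).2 h)⟩
  have hc := hK.sSup_mem hne
  set c := sSup (Icc m p ∩ Oᶜ)
  have hcA : c ∉ A := fun h => hc.2 ((hiff c hc.1).1 h)
  refine ⟨c, hc.1.1, lt_of_le_of_ne hc.1.2 fun h => hcA (h ▸ hp), hcA, fun x hx => ?_⟩
  by_contra hxA
  have hx' : x ∈ Icc m p := ⟨hc.1.1.trans hx.1.le, hx.2⟩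
  exact absurd (le_csSup hK.bddAbove ⟨hx', fun h => hxA ((hiff x hx').2 h)⟩) (not_le.2 hx.1)

/-! ### Connected one-dimensional manifolds with signs. -/

/-- The weight adds `(1 / 2) ^ n` for each nonempty member of a countable basis contained in the
set. It measures the room for an arc: a parameter over `U` may have length at most `w U`, so lengths
stay bounded along chains, and every genuine extension gains some length to spend. -/
lemma exists_strictly_monotone_weight (X : Type*) [TopologicalSpace X]
    [SecondCountableTopology X] [Nonempty X] :
    ∃ w : Set X → ℝ, (∀ U, 0 ≤ w U) ∧ (∀ U V, U ⊆ V → w U ≤ w V) ∧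
      ∀ U V, U ⊆ V → (∃ O, IsOpen O ∧ O.Nonempty ∧ O ⊆ V ∧ Disjoint O U) → w U < w V := by
  classical
  obtain ⟨b, hbc, -, hb⟩ := TopologicalSpace.exists_countable_basis X
  obtain ⟨x₀⟩ := ‹Nonempty X›
  have hne : b.Nonempty := by
    obtain ⟨v, hv, -⟩ := hb.exists_subset_of_mem_open (mem_univ x₀) isOpen_univ
    exact ⟨v, hv⟩
  obtain ⟨B, rfl⟩ := hbc.exists_eq_range hne
  let a : Set X → ℕ → ℝ := fun U n => if (B n).Nonempty ∧ B n ⊆ U then (1 / 2 : ℝ) ^ n else 0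
  have ha0 : ∀ U n, 0 ≤ a U n := fun U n => by simp only [a]; split_ifs <;> positivity
  have ha1 : ∀ U n, a U n ≤ (1 / 2 : ℝ) ^ n := fun U n => by
    simp only [a]; split_ifs
    · exact le_rfl
    · positivity
  have hs : ∀ U, Summable (a U) := fun U =>
    Summable.of_nonneg_of_le (ha0 U) (ha1 U) summable_geometric_two
  have hle : ∀ U V, U ⊆ V → ∀ n, a U n ≤ a V n := by
    intro U V h n
    by_cases hU : (B n).Nonempty ∧ B n ⊆ U
    · simp only [a]; rw [if_pos hU, if_pos ⟨hU.1, hU.2.trans h⟩]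
    · calc a U n = 0 := if_neg hU
        _ ≤ _ := ha0 V n
  refine ⟨fun U => ∑' n, a U n, fun U => tsum_nonneg (ha0 U),
    fun U V h => (hs U).tsum_le_tsum (hle U V h) (hs V), ?_⟩
  rintro U V h ⟨O, hO, ⟨x, hx⟩, hOV, hOU⟩
  obtain ⟨v, ⟨n, rfl⟩, hxn, hn⟩ := hb.exists_subset_of_mem_open hx hO
  refine Summable.tsum_lt_tsum (i := n) (hle U V h) ?_ (hs U) (hs V)
  have h1 : ¬ ((B n).Nonempty ∧ B n ⊆ U) := fun h' => disjoint_left.1 hOU (hn hxn) (h'.2 hxn)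
  simp only [a]
  rw [if_neg h1, if_pos ⟨⟨x, hxn⟩, hn.trans hOV⟩]
  positivity

/-- A parametrized open arc in `X`, of length at most `w U`, together with a compatible choice of
signs. -/
structure SignedArc {X ι : Type*} [TopologicalSpace X] (w : Set X → ℝ)
    (φ : ι → OpenPartialHomeomorph X ℝ) (σ : ι → X → ℤˣ) where
  U : Set X
  h : X → ℝ
  o : X → ℤˣ
  isOpen : IsOpen U
  isPreconnected : IsPreconnected U
  continuousOn : ContinuousOn h U
  injOn : InjOn h U
  bound : ∀ p ∈ U, ∀ q ∈ U, h p - h q ≤ w U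
  sign : ∀ i, ContinuousOn (fun x => σ i x * o x) (U ∩ (φ i).source)

namespace SignedArc

variable {X ι : Type*} [TopologicalSpace X] {w : Set X → ℝ}
  {φ : ι → OpenPartialHomeomorph X ℝ} {σ : ι → X → ℤˣ}

def Le (A B : SignedArc w φ σ) : Prop := A.U ⊆ B.U ∧ ∀ x ∈ A.U, A.h x = B.h x ∧ A.o x = B.o x

lemma Le.trans {A B D : SignedArc w φ σ} (h : A.Le B) (h' : B.Le D) : A.Le D :=
  ⟨h.1.trans h'.1, fun x hx => ⟨(h.2 x hx).1.trans (h'.2 x (h.1 hx)).1,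
    (h.2 x hx).2.trans (h'.2 x (h.1 hx)).2⟩⟩

/-- Only the parameter is reversed, not the signs. This exchanges the two ends of the arc, so that
it suffices to study ends where the parameter tends to its supremum. -/
def neg (A : SignedArc w φ σ) : SignedArc w φ σ where
  U := A.U
  h := fun x => -A.h x
  o := A.o
  isOpen := A.isOpen
  isPreconnected := A.isPreconnected
  continuousOn := A.continuousOn.neg
  injOn := fun x hx y hy hxy => A.injOn hx hy (neg_injective hxy)
  bound := fun p hp q hq => by have := A.bound q hq p hp; linarith
  sign := A.sign

lemma neg_le {A B : SignedArc w φ σ} (h : A.neg.Le B) : A.Le B.neg :=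
  ⟨h.1, fun x hx => ⟨by have := (h.2 x hx).1; simp only [neg] at this ⊢; linarith, (h.2 x hx).2⟩⟩

/-- The bound is the union of the chain. Any two of its points lie in a common member, whose length
bound passes to the union because `w` is monotone. -/
lemma chain_bound (hw : ∀ U V : Set X, U ⊆ V → w U ≤ w V) {c : Set (SignedArc w φ σ)}
    (hc : IsChain Le c) (hne : c.Nonempty) : ∃ B, ∀ A ∈ c, A.Le B := by
  classical
  obtain ⟨A₀, hA₀⟩ := hne
  have hcomp : ∀ A ∈ c, ∀ B ∈ c, A.Le B ∨ B.Le A := by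
    intro A hA B hB
    by_cases h : A = B
    · exact Or.inl (h ▸ ⟨Subset.rfl, fun x _ => ⟨rfl, rfl⟩⟩)
    · exact hc hA hB h
  have hagree : ∀ A ∈ c, ∀ B ∈ c, ∀ x ∈ A.U, x ∈ B.U → A.h x = B.h x ∧ A.o x = B.o x := by
    intro A hA B hB x hxA hxB
    rcases hcomp A hA B hB with h | h
    · exact h.2 x hxA
    · exact ⟨(h.2 x hxB).1.symm, (h.2 x hxB).2.symm⟩
  let D : Set X := ⋃ A ∈ c, A.U
  have hD : ∀ x ∈ D, ∃ A ∈ c, x ∈ A.U := fun x hx => by simpa [D] using hx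
  have : Nonempty (SignedArc w φ σ) := ⟨A₀⟩
  -- `a x` is a member of the chain containing `x`; by `hagree` the values at `x` do not depend on
  -- this choice.
  choose! a ha hax using hD
  have hsub : ∀ A ∈ c, A.U ⊆ D := fun A hA => subset_biUnion_of_mem (u := fun A => U A) hA
  have hval : ∀ A ∈ c, ∀ x ∈ A.U, A.h x = (a x).h x ∧ A.o x = (a x).o x := fun A hA x hx =>
    hagree A hA _ (ha x (hsub A hA hx)) x hx (hax x (hsub A hA hx))
  refine ⟨⟨D, fun x => (a x).h x, fun x => (a x).o x, isOpen_biUnion fun A _ => A.isOpen, ?_, ?_,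
    ?_, ?_, ?_⟩, fun A hA => ⟨hsub A hA, hval A hA⟩⟩
  · have : D = ⋃₀ (U '' c) := by simp [D, sUnion_image]
    rw [this]
    apply IsPreconnected.sUnion_directed
    · rintro _ ⟨A, hA, rfl⟩ _ ⟨B, hB, rfl⟩
      rcases hcomp A hA B hB with h | h
      · exact ⟨B.U, ⟨B, hB, rfl⟩, h.1, Subset.rfl⟩
      · exact ⟨A.U, ⟨A, hA, rfl⟩, Subset.rfl, h.1⟩
    · rintro _ ⟨A, hA, rfl⟩
      exact A.isPreconnected
  · intro x hx
    refine ContinuousAt.continuousWithinAt ?_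
    refine ((a x).continuousOn.continuousAt ((a x).isOpen.mem_nhds (hax x hx))).congr ?_
    filter_upwards [(a x).isOpen.mem_nhds (hax x hx)] with y hy
    exact (hval _ (ha x hx) y hy).1
  · intro x hx y hy hxy
    rcases hcomp _ (ha x hx) _ (ha y hy) with h | h
    · refine (a y).injOn (h.1 (hax x hx)) (hax y hy) ?_
      rw [← (h.2 x (hax x hx)).1]; exact hxy
    · refine (a x).injOn (hax x hx) (h.1 (hax y hy)) ?_
      rw [← (h.2 y (hax y hy)).1]; exact hxy
  · intro x hx y hy
    rcases hcomp _ (ha x hx) _ (ha y hy) with h | h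
    · have := (a y).bound x (h.1 (hax x hx)) y (hax y hy)
      rw [← (h.2 x (hax x hx)).1] at this
      exact this.trans (hw _ _ (hsub _ (ha y hy)))
    · have := (a x).bound x (hax x hx) y (h.1 (hax y hy))
      rw [← (h.2 y (hax y hy)).1] at this
      exact this.trans (hw _ _ (hsub _ (ha x hx)))
  · rintro i x ⟨hx, hxi⟩
    refine ContinuousAt.continuousWithinAt ?_
    refine (((a x).sign i).continuousAt (((a x).isOpen.inter (φ i).open_source).mem_nhds
      ⟨hax x hx, hxi⟩)).congr ?_
    filter_upwards [(a x).isOpen.mem_nhds (hax x hx)] with y hy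
    rw [(hval _ (ha x hx) y hy).2]

section

variable (hcov : ∀ x, ∃ i, x ∈ (φ i).source)
include hcov

lemma image_mem_nhds (A : SignedArc w φ σ) {x : X} (hx : x ∈ A.U) {N : Set X} (hN : N ∈ 𝓝 x) :
    A.h '' N ∈ 𝓝 (A.h x) := by
  obtain ⟨i, hi⟩ := hcov x
  have hx' : (φ i).symm (φ i x) = x := (φ i).left_inv hi
  have ht := (φ i).map_source hi
  have hcs : ContinuousAt (φ i).symm (φ i x) := (φ i).continuousAt_symm ht
  have hU : (φ i).symm ⁻¹' A.U ∈ 𝓝 (φ i x) := hcs (by rw [hx']; exact A.isOpen.mem_nhds hx)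
  obtain ⟨δ, hδ, hball⟩ := Metric.mem_nhds_iff.1 (inter_mem hU ((φ i).open_target.mem_nhds ht))
  rw [Real.ball_eq_Ioo] at hball
  have hc : ContinuousOn (A.h ∘ (φ i).symm) (Ioo (φ i x - δ) (φ i x + δ)) :=
    A.continuousOn.comp ((φ i).continuousOn_symm.mono fun y hy => (hball hy).2)
      fun y hy => (hball hy).1
  have hinj : InjOn (A.h ∘ (φ i).symm) (Ioo (φ i x - δ) (φ i x + δ)) := fun y hy z hz hyz =>
    (φ i).symm.injOn (hball hy).2 (hball hz).2 (A.injOn (hball hy).1 (hball hz).1 hyz)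
  have := image_mem_nhds_of_injOn_Ioo hc hinj (x := φ i x) ⟨by linarith, by linarith⟩
    (hcs (by rw [hx']; exact hN))
  rw [Function.comp, hx'] at this
  refine mem_of_superset this ?_
  rintro _ ⟨y, hy, rfl⟩
  exact ⟨_, hy, rfl⟩

lemma isOpen_image (A : SignedArc w φ σ) : IsOpen (A.h '' A.U) := by
  rw [isOpen_iff_mem_nhds]
  rintro _ ⟨x, hx, rfl⟩
  exact A.image_mem_nhds hcov hx (A.isOpen.mem_nhds hx)

/-- At an end of an arc that is an interior point of a chart, the parameter tends to its supremum
or to its infimum. -/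
lemma exists_tendsto_end [T2Space X] (A : SignedArc w φ σ) (ψ : OpenPartialHomeomorph X ℝ)
    {c p : ℝ} (hcp : c < p) (ht : Icc c p ⊆ ψ.target) (hc : ψ.symm c ∉ A.U)
    (hU : ∀ x ∈ Ioc c p, ψ.symm x ∈ A.U) :
    ∃ B, Tendsto (A.h ∘ ψ.symm) (𝓝[>] c) (𝓝 B) ∧
      ((∀ u ∈ A.U, A.h u < B) ∨ (∀ u ∈ A.U, B < A.h u)) := by
  have hU' : ∀ x ∈ Ioo c p, ψ.symm x ∈ A.U := fun x hx => hU x ⟨hx.1, hx.2.le⟩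
  have ht' : ∀ x ∈ Ioo c p, x ∈ ψ.target := fun x hx => ht ⟨hx.1.le, hx.2.le⟩
  have hcont : ContinuousOn (A.h ∘ ψ.symm) (Ioo c p) :=
    A.continuousOn.comp (ψ.continuousOn_symm.mono ht') hU'
  have hinj : InjOn (A.h ∘ ψ.symm) (Ioo c p) := fun y hy z hz hyz =>
    ψ.symm.injOn (ht' y hy) (ht' z hz) (A.injOn (hU' y hy) (hU' z hz) hyz)
  have hp : ψ.symm p ∈ A.U := hU p ⟨hcp, le_rfl⟩
  have hB : ∃ B, Tendsto (A.h ∘ ψ.symm) (𝓝[>] c) (𝓝 B) := by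
    rcases hcont.strictMonoOn_of_injOn_Ioo hcp hinj with h | h
    · refine ⟨_, h.monotoneOn.tendsto_nhdsWithin_Ioo_right (nonempty_Ioo.2 hcp) ⟨A.h (ψ.symm p) - w A.U, ?_⟩⟩
      rintro _ ⟨y, hy, rfl⟩
      have := A.bound _ hp _ (hU' y hy)
      simp only [Function.comp]; linarith
    · refine ⟨_, h.antitoneOn.tendsto_nhdsWithin_Ioo_right (nonempty_Ioo.2 hcp) ⟨A.h (ψ.symm p) + w A.U, ?_⟩⟩
      rintro _ ⟨y, hy, rfl⟩
      have := A.bound _ (hU' y hy) _ hp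
      simp only [Function.comp]; linarith
  obtain ⟨B, hB⟩ := hB
  have hev : ∀ᶠ x in 𝓝[>] c, x ∈ Ioo c p := Ioo_mem_nhdsGT hcp
  -- If the value `B` were taken at `u`, openness and injectivity of the parameter would force the
  -- points of the arc near `ψ.symm c` to be close to `u`, against the Hausdorff property.
  have hBU : B ∉ A.h '' A.U := by
    rintro ⟨u, hu, rfl⟩
    have hne : u ≠ ψ.symm c := fun h => hc (h ▸ hu)
    obtain ⟨N, N', hN, hN', huN, hcN, hd⟩ := t2_separation hne
    have h1 : ∀ᶠ x in 𝓝[>] c, A.h (ψ.symm x) ∈ A.h '' (N ∩ A.U) := hB (A.image_mem_nhds hcov hu ((hN.inter A.isOpen).mem_nhds ⟨huN, hu⟩))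
    have h2 : ∀ᶠ x in 𝓝[>] c, ψ.symm x ∈ N' :=
      ((ψ.continuousAt_symm (ht ⟨le_rfl, hcp.le⟩)).tendsto.mono_left nhdsWithin_le_nhds)
        (hN'.mem_nhds hcN)
    obtain ⟨x, ⟨v, hv, hvx⟩, hx2, hx3⟩ := (h1.and (h2.and hev)).exists
    have := A.injOn hv.2 (hU' x hx3) hvx
    exact disjoint_left.1 hd hv.1 (this ▸ hx2)
  refine ⟨B, hB, ?_⟩
  by_contra! hcon
  obtain ⟨⟨u, hu, huB⟩, v, hv, hvB⟩ := hcon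
  exact hBU ((A.isPreconnected.image _ A.continuousOn).ordConnected.out ⟨v, hv, rfl⟩ ⟨u, hu, rfl⟩
    ⟨hvB, huB⟩)

-- By the intermediate value theorem the segment over `(c, p)` already takes every value between
-- that at `p` and the supremum `B`; injectivity leaves no room for such values elsewhere.
omit hcov in
lemma mem_tail (A : SignedArc w φ σ) (ψ : OpenPartialHomeomorph X ℝ)
    {c p B : ℝ} (hcp : c < p) (ht : Icc c p ⊆ ψ.target)
    (hU : ∀ x ∈ Ioc c p, ψ.symm x ∈ A.U) (hB : Tendsto (A.h ∘ ψ.symm) (𝓝[>] c) (𝓝 B))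
    (hub : ∀ u ∈ A.U, A.h u < B) {u : X} (hu : u ∈ A.U) (hpu : A.h (ψ.symm p) < A.h u) :
    ∃ x ∈ Ioo c p, ψ.symm x = u := by
  have hev : ∀ᶠ x in 𝓝[>] c, x ∈ Ioo c p := Ioo_mem_nhdsGT hcp
  obtain ⟨x, hx1, hx2⟩ := ((hB.eventually_const_lt (hub u hu)).and hev).exists
  have hcont : ContinuousOn (A.h ∘ ψ.symm) (Icc x p) :=
    A.continuousOn.comp (ψ.continuousOn_symm.mono fun y hy => ht ⟨hx2.1.le.trans hy.1, hy.2⟩)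
      fun y hy => hU y ⟨hx2.1.trans_le hy.1, hy.2⟩
  obtain ⟨y, hy, hyu⟩ := intermediate_value_Ioo' hx2.2.le hcont ⟨hpu, hx1⟩
  exact ⟨y, ⟨hx2.1.trans hy.1, hy.2⟩, A.injOn (hU y ⟨hx2.1.trans hy.1, hy.2.le⟩) hu hyu⟩

-- If the chart interval `(l, c]` is free of the arc, it can be appended with an affine parameter.
-- Its signs `τ` match those of the arc after multiplication by one constant, because the overlap is
-- connected.
omit hcov in
lemma exists_extension
    (hw' : ∀ U V : Set X, U ⊆ V → (∃ O, IsOpen O ∧ O.Nonempty ∧ O ⊆ V ∧ Disjoint O U) → w U < w V)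
    (A : SignedArc w φ σ) (ψ : OpenPartialHomeomorph X ℝ) (τ : X → ℤˣ)
    (hτ : ∀ i, ContinuousOn (fun x => σ i x * τ x) (ψ.source ∩ (φ i).source))
    {l c p B : ℝ} (hlc : l < c) (hcp : c < p) (ht : Icc l p ⊆ ψ.target)
    (hU : ∀ x ∈ Ioc c p, ψ.symm x ∈ A.U) (hl : ∀ x ∈ Ioc l c, ψ.symm x ∉ A.U)
    (hτA : ContinuousOn (fun x => τ x * A.o x) (A.U ∩ ψ.source))
    (hB : Tendsto (A.h ∘ ψ.symm) (𝓝[>] c) (𝓝 B))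
    (hub : ∀ u ∈ A.U, A.h u < B) : ∃ A', A.Le A' ∧ ¬ A'.U ⊆ A.U := by
  classical
  have htt : ∀ x, l < x → x < p → x ∈ ψ.target := fun x h1 h2 => ht ⟨h1.le, h2.le⟩
  let V : Set X := ψ.symm '' Ioo l p
  have hVs : V ⊆ ψ.source := by
    rintro _ ⟨x, hx, rfl⟩; exact ψ.map_target (htt x hx.1 hx.2)
  have hVo : IsOpen V := ψ.symm.isOpen_image_of_subset_source isOpen_Ioo fun x hx => htt x hx.1 hx.2
  have hψV : ∀ x ∈ V, ψ x ∈ Ioo l p := by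
    rintro _ ⟨x, hx, rfl⟩; rwa [ψ.right_inv (htt x hx.1 hx.2)]
  have hVU : ∀ x ∈ V, (x ∈ A.U ↔ c < ψ x) := by
    rintro _ ⟨x, hx, rfl⟩
    rw [ψ.right_inv (htt x hx.1 hx.2)]
    constructor
    · intro h; by_contra hcx; exact hl x ⟨hx.1, not_lt.1 hcx⟩ h
    · intro h; exact hU x ⟨h, hx.2.le⟩
  have hlw : w A.U < w (A.U ∪ V) := by
    refine hw' _ _ subset_union_left ⟨ψ.symm '' Ioo l c, ?_, ?_, ?_, ?_⟩
    · exact ψ.symm.isOpen_image_of_subset_source isOpen_Ioo fun x hx => htt x hx.1 (hx.2.trans hcp)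
    · exact (nonempty_Ioo.2 hlc).image _
    · exact (image_mono (Ioo_subset_Ioo_right hcp.le)).trans subset_union_right
    · rw [disjoint_left]
      rintro _ ⟨x, hx, rfl⟩ h
      exact hl x ⟨hx.1, hx.2.le⟩ h
  -- The slope `κ` is chosen so that the length `κ * (c - l)` of the new part fits into the gain of
  -- weight.
  obtain ⟨κ, hκ, hκw⟩ : ∃ κ > 0, κ * (c - l) ≤ w (A.U ∪ V) - w A.U :=
    ⟨(w (A.U ∪ V) - w A.U) / (c - l), div_pos (by linarith) (by linarith),
      by rw [div_mul_cancel₀ _ (by linarith : (c - l) ≠ 0)]⟩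
  -- the overlap is connected, so the signs agree up to a global sign
  have hov : IsPreconnected (ψ.symm '' Ioo c p) :=
    isPreconnected_Ioo.image _ (ψ.continuousOn_symm.mono fun x hx => htt x (hlc.trans hx.1) hx.2)
  have hovs : ψ.symm '' Ioo c p ⊆ A.U ∩ ψ.source := by
    rintro _ ⟨x, hx, rfl⟩
    exact ⟨hU x ⟨hx.1, hx.2.le⟩, ψ.map_target (htt x (hlc.trans hx.1) hx.2)⟩
  obtain ⟨κ', hκ'⟩ : ∃ κ' : ℤˣ, ∀ x ∈ ψ.symm '' Ioo c p, A.o x = κ' * τ x := by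
    refine ⟨τ (ψ.symm ((c + p) / 2)) * A.o (ψ.symm ((c + p) / 2)), fun x hx => ?_⟩
    have := hov.constant_of_mapsTo (T := univ) (isDiscrete_univ_iff.2 inferInstance)
      (hτA.mono hovs) (mapsTo_univ _ _) hx
      (mem_image_of_mem _ (show (c + p) / 2 ∈ Ioo c p from ⟨by linarith, by linarith⟩))
    rw [← this, mul_right_comm, Int.units_mul_self, one_mul]
  let h' : X → ℝ := fun x => if x ∈ A.U then A.h x else B + κ * (c - ψ x)
  let o' : X → ℤˣ := fun x => if x ∈ A.U then A.o x else κ' * τ x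
  have ho'V : ∀ x ∈ V, o' x = κ' * τ x := by
    intro x hx
    by_cases hxU : x ∈ A.U
    · simp only [o', if_pos hxU]
      refine hκ' x ⟨ψ x, ⟨(hVU x hx).1 hxU, (hψV x hx).2⟩, ψ.left_inv (hVs hx)⟩
    · simp only [o', if_neg hxU]
  have hnew : ∀ x ∈ A.U ∪ V, x ∉ A.U → B ≤ h' x ∧ h' x ≤ B + κ * (c - l) ∧ x ∈ V := by
    intro x hx hxU
    have hxV : x ∈ V := hx.resolve_left hxU
    have h1 : ψ x ≤ c := by by_contra h; exact hxU ((hVU x hxV).2 (not_le.1 h))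
    simp only [h', if_neg hxU]
    refine ⟨by nlinarith, ?_, hxV⟩
    have := (hψV x hxV).1
    nlinarith
  have hold : ∀ x ∈ A.U, h' x = A.h x := fun x hx => if_pos hx
  refine ⟨⟨A.U ∪ V, h', o', A.isOpen.union hVo, ?_, ?_, ?_, ?_, ?_⟩,
    ⟨subset_union_left, fun x hx => ⟨(hold x hx).symm, (if_pos hx).symm⟩⟩, ?_⟩
  · refine IsPreconnected.union' ⟨ψ.symm ((c + p) / 2), hU _ ⟨by linarith, by linarith⟩,
      mem_image_of_mem _ ⟨by linarith, by linarith⟩⟩ A.isPreconnected ?_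
    exact isPreconnected_Ioo.image _ (ψ.continuousOn_symm.mono fun x hx => htt x hx.1 hx.2)
  · intro x hx
    refine ContinuousAt.continuousWithinAt ?_
    by_cases hxU : x ∈ A.U
    · refine (A.continuousOn.continuousAt (A.isOpen.mem_nhds hxU)).congr ?_
      filter_upwards [A.isOpen.mem_nhds hxU] with y hy using (hold y hy).symm
    · have hxV := (hnew x hx hxU).2.2
      have hψc : ContinuousAt ψ x := ψ.continuousAt (hVs hxV)
      have h1 : ψ x ≤ c := by by_contra h; exact hxU ((hVU x hxV).2 (not_le.1 h))
      -- compare with a function of the chart coordinate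
      let g : ℝ → ℝ := fun y => if c < y then A.h (ψ.symm y) else B + κ * (c - y)
      have hgc : ContinuousAt g (ψ x) := by
        rcases h1.lt_or_eq with h1 | h1
        · have : ContinuousAt (fun y => B + κ * (c - y)) (ψ x) := by fun_prop
          refine this.congr ?_
          filter_upwards [Iio_mem_nhds h1] with y hy
          simp only [g]; rw [if_neg (not_lt.2 (le_of_lt hy))]
        · rw [h1, continuousAt_iff_continuous_left'_right']
          have hgcv : g c = B := by simp [g]
          constructor
          · have h2 : Tendsto (fun y => B + κ * (c - y)) (𝓝[<] c) (𝓝 (B + κ * (c - c))) :=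
              (Continuous.tendsto (by fun_prop) c).mono_left nhdsWithin_le_nhds
            rw [ContinuousWithinAt, hgcv]
            rw [sub_self, mul_zero, add_zero] at h2
            refine h2.congr' ?_
            filter_upwards [self_mem_nhdsWithin] with y hy
            simp only [g]; rw [if_neg (not_lt.2 (le_of_lt hy))]
          · rw [ContinuousWithinAt, hgcv]
            refine hB.congr' ?_
            filter_upwards [self_mem_nhdsWithin] with y hy
            simp only [g]; rw [if_pos (by exact hy)]; rfl
      refine (ContinuousAt.comp (f := ψ) (g := g) hgc hψc).congr ?_
      filter_upwards [hVo.mem_nhds hxV] with y hy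
      by_cases hyU : y ∈ A.U
      · simp only [Function.comp, g, h', if_pos hyU, if_pos ((hVU y hy).1 hyU), ψ.left_inv (hVs hy)]
      · simp only [Function.comp, g, h', if_neg hyU]
        rw [if_neg (fun h => hyU ((hVU y hy).2 h))]
  · intro x hx y hy hxy
    by_cases hxU : x ∈ A.U <;> by_cases hyU : y ∈ A.U
    · rw [hold x hxU, hold y hyU] at hxy; exact A.injOn hxU hyU hxy
    · have := (hnew y hy hyU).1; have := hub x hxU; rw [hold x hxU] at hxy; linarith
    · have := (hnew x hx hxU).1; have := hub y hyU; rw [hold y hyU] at hxy; linarith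
    · have hx' := (hnew x hx hxU).2.2
      have hy' := (hnew y hy hyU).2.2
      simp only [h', if_neg hxU, if_neg hyU] at hxy
      refine ψ.injOn (hVs hx') (hVs hy') ?_
      have : κ * (c - ψ x) = κ * (c - ψ y) := by linarith
      have := mul_left_cancel₀ hκ.ne' this
      linarith
  -- The old part stays within `w A.U` of its limit `B` and the new part rises at most `κ * (c - l)`
  -- above `B`; together this is at most the new weight.
  · have hBw : ∀ q ∈ A.U, B - A.h q ≤ w A.U := by
      intro q hq
      have : Tendsto (fun x => A.h (ψ.symm x) - A.h q) (𝓝[>] c) (𝓝 (B - A.h q)) :=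
        Tendsto.sub_const hB _
      refine le_of_tendsto this ?_
      filter_upwards [Ioo_mem_nhdsGT hcp] with x hx
      exact A.bound _ (hU x ⟨hx.1, hx.2.le⟩) q hq
    have h0 : 0 ≤ w A.U := by
      have := A.bound _ (hU p ⟨hcp, le_rfl⟩) _ (hU p ⟨hcp, le_rfl⟩)
      linarith
    intro x hx y hy
    by_cases hxU : x ∈ A.U <;> by_cases hyU : y ∈ A.U
    · rw [hold x hxU, hold y hyU]; have := A.bound x hxU y hyU; linarith
    · have := (hnew y hy hyU).1; have := hub x hxU; rw [hold x hxU]; linarith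
    · have := (hnew x hx hxU).2.1; have := hBw y hyU; rw [hold y hyU]; linarith
    · have := (hnew x hx hxU).2.1; have := (hnew y hy hyU).1; linarith
  · rintro i x ⟨hx, hxi⟩
    refine ContinuousAt.continuousWithinAt ?_
    by_cases hxU : x ∈ A.U
    · refine ((A.sign i).continuousAt ((A.isOpen.inter (φ i).open_source).mem_nhds
        ⟨hxU, hxi⟩)).congr ?_
      filter_upwards [A.isOpen.mem_nhds hxU] with y hy
      simp only [o', if_pos hy]
    · have hxV := (hnew x hx hxU).2.2
      have := ((hτ i).continuousAt ((ψ.open_source.inter (φ i).open_source).mem_nhds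
        ⟨hVs hxV, hxi⟩)).const_mul κ'
      refine this.congr ?_
      filter_upwards [hVo.mem_nhds hxV] with y hy
      rw [ho'V y hy, mul_left_comm]
  · intro h
    have : ψ.symm c ∈ V := mem_image_of_mem _ ⟨hlc, hcp⟩
    exact hl c ⟨hlc, le_rfl⟩ (h (Or.inr this))

end

end SignedArc

namespace SignedArc

variable {X ι : Type*} [TopologicalSpace X] {w : Set X → ℝ}
  {φ : ι → OpenPartialHomeomorph X ℝ} {σ : ι → X → ℤˣ}

lemma exists_open_inter_eq (A : SignedArc w φ σ) (ψ : OpenPartialHomeomorph X ℝ) {K : Set ℝ}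
    (hK : K ⊆ ψ.target) :
    ∃ O, IsOpen O ∧ {x | ψ.symm x ∈ A.U} ∩ K = O ∩ K := by
  refine ⟨ψ.target ∩ ψ.symm ⁻¹' A.U, ψ.continuousOn_symm.isOpen_inter_preimage ψ.open_target A.isOpen, ?_⟩
  ext x
  simp only [mem_inter_iff, mem_ofPred_eq, mem_preimage]
  exact ⟨fun h => ⟨⟨hK h.2, h.1⟩, h.2⟩, fun h => ⟨h.1.2, h.2⟩⟩

variable (hcov : ∀ x, ∃ i, x ∈ (φ i).source)
include hcov

/-- A maximal arc both of whose ends converge to the same point `ψ.symm c` misses at most that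
point. -/
lemma compl_subset_singleton [T2Space X] [PreconnectedSpace X] (A : SignedArc w φ σ)
    (ψ : OpenPartialHomeomorph X ℝ)
    {p' c p : ℝ} (hpc : p' < c) (hcp : c < p) (ht : Icc p' p ⊆ ψ.target)
    (hU : ∀ x ∈ Ioc c p, ψ.symm x ∈ A.U) (hU' : ∀ x ∈ Ico p' c, ψ.symm x ∈ A.U)
    (hup : ∀ u ∈ A.U, A.h (ψ.symm p) < A.h u → ∃ x ∈ Ioo c p, ψ.symm x = u)
    (hlo : ∀ u ∈ A.U, A.h u < A.h (ψ.symm p') → ∃ x ∈ Ioo p' c, ψ.symm x = u) :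
    A.Uᶜ ⊆ {ψ.symm c} := by
  classical
  set α := A.h (ψ.symm p')
  set β := A.h (ψ.symm p)
  have hp : ψ.symm p ∈ A.U := hU p ⟨hcp, le_rfl⟩
  have hp' : ψ.symm p' ∈ A.U := hU' p' ⟨le_rfl, hpc⟩
  have hord := (A.isPreconnected.image _ A.continuousOn).ordConnected
  have hIcc : Icc α β ⊆ A.h '' A.U := hord.out ⟨_, hp', rfl⟩ ⟨_, hp, rfl⟩
  have hK1 : IsCompact (ψ.symm '' Icc p' p) := isCompact_Icc.image_of_continuousOn
    (ψ.continuousOn_symm.mono ht)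
  have : Nonempty X := ⟨ψ.symm p⟩
  let g := Function.invFunOn A.h A.U
  have hg : ∀ y ∈ A.h '' A.U, g y ∈ A.U ∧ A.h (g y) = y := fun y hy =>
    Function.invFunOn_pos hy
  have hgc : ContinuousOn g (Icc α β) := by
    intro y hy
    refine ContinuousAt.continuousWithinAt ?_
    obtain ⟨hgU, hgy⟩ := hg y (hIcc hy)
    intro N hN
    have h1 := A.image_mem_nhds hcov hgU (inter_mem hN (A.isOpen.mem_nhds hgU))
    rw [hgy] at h1
    rw [mem_map]
    refine mem_of_superset h1 ?_
    rintro _ ⟨u, ⟨huN, huU⟩, rfl⟩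
    have h2 := hg (A.h u) ⟨u, huU, rfl⟩
    rwa [mem_preimage, A.injOn h2.1 huU h2.2]
  have hK2 : IsCompact (g '' Icc α β) := isCompact_Icc.image_of_continuousOn hgc
  -- With the extra point the arc is the union of two compact segments, one in the chart and one in
  -- the parameter. It is also open, so by connectedness it is the whole space.
  have heq : A.U ∪ {ψ.symm c} = ψ.symm '' Icc p' p ∪ g '' Icc α β := by
    apply Subset.antisymm
    · rintro u (hu | rfl)
      · by_cases h1 : β < A.h u
        · obtain ⟨x, hx, rfl⟩ := hup u hu h1
          exact Or.inl ⟨x, ⟨hpc.le.trans hx.1.le, hx.2.le⟩, rfl⟩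
        · by_cases h2 : A.h u < α
          · obtain ⟨x, hx, rfl⟩ := hlo u hu h2
            exact Or.inl ⟨x, ⟨hx.1.le, hx.2.le.trans hcp.le⟩, rfl⟩
          · refine Or.inr ⟨A.h u, ⟨not_lt.1 h2, not_lt.1 h1⟩, ?_⟩
            have h3 := hg (A.h u) ⟨u, hu, rfl⟩
            exact A.injOn h3.1 hu h3.2
      · exact Or.inl ⟨c, ⟨hpc.le, hcp.le⟩, rfl⟩
    · rintro u (⟨x, hx, rfl⟩ | ⟨y, hy, rfl⟩)
      · rcases lt_trichotomy x c with h | h | h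
        · exact Or.inl (hU' x ⟨hx.1, h⟩)
        · exact Or.inr (by rw [h]; rfl)
        · exact Or.inl (hU x ⟨h, hx.2⟩)
      · exact Or.inl (hg y (hIcc hy)).1
  have hcl : IsClosed (A.U ∪ {ψ.symm c}) := heq ▸ (hK1.union hK2).isClosed
  have hop : IsOpen (A.U ∪ {ψ.symm c}) := by
    have h1 : A.U ∪ {ψ.symm c} = A.U ∪ ψ.symm '' Ioo p' p := by
      apply Subset.antisymm
      · rintro u (hu | rfl)
        · exact Or.inl hu
        · exact Or.inr ⟨c, ⟨hpc, hcp⟩, rfl⟩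
      · rw [heq]
        exact union_subset (heq ▸ subset_union_left)
          ((image_mono Ioo_subset_Icc_self).trans subset_union_left)
    rw [h1]
    exact A.isOpen.union (ψ.symm.isOpen_image_of_subset_source isOpen_Ioo fun x hx =>
      ht (Ioo_subset_Icc_self hx))
  rcases isClopen_iff.1 ⟨hcl, hop⟩ with h | h
  · exact absurd (h ▸ Or.inl hp : ψ.symm p ∈ (∅ : Set X)) (notMem_empty _)
  · intro x hx
    exact ((h ▸ mem_univ x : x ∈ A.U ∪ {ψ.symm c})).resolve_left hx

/-- By maximality the arc cannot be extended past `c`, so it accumulates at `c` from the left as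
well. There it arrives with an end, and this must be the end of small parameters, since all values
near the supremum are taken to the right of `c`. An arc has only one such end, so it sits at `c`
itself, and `compl_subset_singleton` applies. -/
lemma compl_subsingleton_of_maximal_aux [T2Space X] [PreconnectedSpace X]
    (hw' : ∀ U V : Set X, U ⊆ V → (∃ O, IsOpen O ∧ O.Nonempty ∧ O ⊆ V ∧ Disjoint O U) → w U < w V)
    (A : SignedArc w φ σ) (hmax : ∀ A', A.Le A' → A'.U ⊆ A.U)
    (ψ : OpenPartialHomeomorph X ℝ) (τ : X → ℤˣ)
    (hτ : ∀ i, ContinuousOn (fun x => σ i x * τ x) (ψ.source ∩ (φ i).source))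
    (hτA : ContinuousOn (fun x => τ x * A.o x) (A.U ∩ ψ.source))
    {l c p B : ℝ} (hlc : l < c) (hcp : c < p) (ht : Icc l p ⊆ ψ.target)
    (hc : ψ.symm c ∉ A.U) (hU : ∀ x ∈ Ioc c p, ψ.symm x ∈ A.U)
    (hB : Tendsto (A.h ∘ ψ.symm) (𝓝[>] c) (𝓝 B)) (hub : ∀ u ∈ A.U, A.h u < B) :
    A.Uᶜ.Subsingleton := by
  have htcp : Icc c p ⊆ ψ.target := fun x hx => ht ⟨hlc.le.trans hx.1, hx.2⟩
  have hup : ∀ u ∈ A.U, A.h (ψ.symm p) < A.h u → ∃ x ∈ Ioo c p, ψ.symm x = u := fun u hu hpu =>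
    A.mem_tail ψ hcp htcp hU hB hub hu hpu
  have hleft : ∀ l', l ≤ l' → l' < c → ∃ q ∈ Ioo l' c, ψ.symm q ∈ A.U := by
    intro l' hl' hl'c
    by_contra! hcon
    obtain ⟨A', hA', hn⟩ := A.exists_extension hw' ψ τ hτ hl'c hcp
      (fun x hx => ht ⟨hl'.trans hx.1, hx.2⟩) hU
      (fun x hx => by
        rcases hx.2.lt_or_eq with h | h
        · exact hcon x ⟨hx.1, h⟩
        · exact h ▸ hc) hτA hB hub
    exact hn (hmax A' hA')
  let ψ' := ψ.transHomeomorph (Homeomorph.neg ℝ)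
  have hsymm : ∀ x, ψ'.symm x = ψ.symm (-x) := fun x => rfl
  have htar : ∀ x, x ∈ ψ'.target ↔ -x ∈ ψ.target := fun x => Iff.rfl
  -- the component of a point to the left of `c` ends on the right at a point where the parameter
  -- tends to its infimum
  have hend : ∀ q ∈ Ioo l c, ψ.symm q ∈ A.U → ∃ d, q < d ∧ d ≤ c ∧ ψ.symm d ∉ A.U ∧
      (∀ x ∈ Ico q d, ψ.symm x ∈ A.U) ∧ ∃ B', Tendsto (A.h ∘ ψ'.symm) (𝓝[>] (-d)) (𝓝 B') ∧
        ∀ u ∈ A.U, B' < A.h u := by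
    intro q hq hqU
    have hsub : Icc (-c) (-q) ⊆ ψ'.target := fun x hx => (htar x).2
      (ht ⟨by linarith [hq.1, hx.2], by linarith [hx.1]⟩)
    obtain ⟨d, hd1, hd2, hd3, hd4⟩ := exists_last_exit (A := {x | ψ'.symm x ∈ A.U})
      (m := -c) (p := -q) (by linarith [hq.2]) (by simpa [hsymm] using hc) (by simpa [hsymm] using hqU)
      (A.exists_open_inter_eq ψ' hsub)
    have hsub' : Icc d (-q) ⊆ ψ'.target := fun x hx => hsub ⟨hd1.trans hx.1, hx.2⟩
    obtain ⟨B', hB', hBd⟩ := A.exists_tendsto_end hcov ψ' hd2 hsub' hd3 hd4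
    refine ⟨-d, by linarith, by linarith, by simpa [hsymm] using hd3, fun x hx => ?_, B', by
      rwa [neg_neg], ?_⟩
    · have := hd4 (-x) ⟨by linarith [hx.2], by linarith [hx.1]⟩
      simpa [hsymm] using this
    · rcases hBd with h | h
      -- Values beyond that at `p` occur only to the right of `c`, whereas these would occur to the
      -- left of it.
      · exfalso
        have h1 : ∃ u ∈ A.U, A.h (ψ.symm p) < A.h u := by
          have := hB.eventually_const_lt (hub _ (hU p ⟨hcp, le_rfl⟩))
          obtain ⟨x, hx1, hx2⟩ := (this.and (Ioo_mem_nhdsGT hcp)).exists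
          exact ⟨_, hU x ⟨hx2.1, hx2.2.le⟩, hx1⟩
        obtain ⟨u, hu, hpu⟩ := h1
        have h2 := hB'.eventually_const_lt (hpu.trans (h u hu))
        obtain ⟨x, hx1, hx2⟩ := (h2.and (Ioo_mem_nhdsGT hd2)).exists
        have hxU : ψ'.symm x ∈ A.U := hd4 x ⟨hx2.1, hx2.2.le⟩
        obtain ⟨y, hy, hyx⟩ := hup _ hxU hx1
        have h3 : y = -x := ψ.symm.injOn (htcp ⟨hy.1.le, hy.2.le⟩)
          ((htar x).1 (hsub' ⟨hx2.1.le, hx2.2.le⟩)) hyx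
        linarith [hy.1, hx2.1]
      · exact h
  have hlow : ∀ q ∈ Ioo l c, ∀ d, q < d → d ≤ c → (∀ x ∈ Ico q d, ψ.symm x ∈ A.U) →
      (∃ B', Tendsto (A.h ∘ ψ'.symm) (𝓝[>] (-d)) (𝓝 B') ∧ ∀ u ∈ A.U, B' < A.h u) →
      ∀ u ∈ A.U, A.h u < A.h (ψ.symm q) → ∃ x ∈ Ioo q d, ψ.symm x = u := by
    rintro q hq d hqd hdc hqU ⟨B', hB', hBl⟩ u hu huq
    have := A.neg.mem_tail ψ' (c := -d) (p := -q) (B := -B') (by linarith)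
      (fun x hx => (htar x).2 (ht ⟨by linarith [hq.1, hx.2], by linarith [hx.1]⟩))
      (fun x hx => hqU (-x) ⟨by linarith [hx.2], by linarith [hx.1]⟩)
      (by exact hB'.neg) (fun v hv => neg_lt_neg (hBl v hv)) hu
      (by simp only [neg, hsymm, neg_neg]; linarith)
    obtain ⟨x, hx, hxu⟩ := this
    exact ⟨-x, ⟨by linarith [hx.2], by linarith [hx.1]⟩, hxu⟩
  obtain ⟨p', hp', hpU'⟩ := hleft l le_rfl hlc
  obtain ⟨d, hd1, hd2, hd3, hd4, hd5⟩ := hend p' hp' hpU'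
  have hlo := hlow p' hp' d hd1 hd2 hd4 hd5
  -- If `d < c`, the arc would come back between `d` and `c` and end there once more at the infimum;
  -- but all sufficiently small values are taken to the left of `d`.
  have hdc : d = c := by
    by_contra hne
    have hdc : d < c := lt_of_le_of_ne hd2 hne
    obtain ⟨q, hq, hqU⟩ := hleft d (hp'.1.le.trans hd1.le) hdc
    obtain ⟨d', hd1', hd2', -, hd4', B', hB', hBl⟩ := hend q ⟨hp'.1.trans (hd1.trans hq.1), hq.2⟩ hqU
    obtain ⟨B₁, hB₁, hBl₁⟩ := hd5
    have h1 : ∃ u ∈ A.U, A.h u < A.h (ψ.symm p') := by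
      have := hB₁.eventually_lt_const (hBl₁ _ hpU')
      obtain ⟨x, hx1, hx2⟩ := (this.and (Ioo_mem_nhdsGT (show -d < -p' by linarith))).exists
      exact ⟨_, hd4 (-x) ⟨by linarith [hx2.2], by linarith [hx2.1]⟩, hx1⟩
    obtain ⟨u, hu, hup'⟩ := h1
    have h2 := hB'.eventually_lt_const ((hBl u hu).trans hup')
    obtain ⟨x, hx1, hx2⟩ := (h2.and (Ioo_mem_nhdsGT (show -d' < -q by linarith))).exists
    have hxU : ψ.symm (-x) ∈ A.U := hd4' (-x) ⟨by linarith [hx2.2], by linarith [hx2.1]⟩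
    obtain ⟨y, hy, hyx⟩ := hlo _ hxU hx1
    have h3 : y = -x := ψ.symm.injOn (ht ⟨by linarith [hp'.1, hy.1], by linarith [hy.2]⟩)
      (ht ⟨by linarith [hq.1, hp'.1, hx2.2], by linarith [hx2.1]⟩) hyx
    linarith [hy.2, hx2.2, hq.1]
  subst hdc
  exact subsingleton_singleton.anti (A.compl_subset_singleton hcov ψ hd1 hcp
    (fun x hx => ht ⟨hp'.1.le.trans hx.1, hx.2⟩) hU hd4 hup hlo)

/-- If the arc is closed, connectedness makes it everything. Otherwise a chart at a limit point
outside it leads into the arc and so meets one of its ends; reversing the chart or the parameter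
puts this end in the position of the preceding lemma. -/
lemma compl_subsingleton_of_maximal [T2Space X] [PreconnectedSpace X]
    (hσ : ∀ i j, ContinuousOn (fun x => σ i x * σ j x) ((φ i).source ∩ (φ j).source))
    (hw' : ∀ U V : Set X, U ⊆ V → (∃ O, IsOpen O ∧ O.Nonempty ∧ O ⊆ V ∧ Disjoint O U) → w U < w V)
    (A : SignedArc w φ σ) (hmax : ∀ A', A.Le A' → A'.U ⊆ A.U) (hne : A.U.Nonempty) :
    A.Uᶜ.Subsingleton := by
  by_cases hcl : IsClosed A.U
  · rcases isClopen_iff.1 ⟨hcl, A.isOpen⟩ with h | h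
    · exact absurd h hne.ne_empty
    · rw [h, compl_univ]; exact subsingleton_empty
  obtain ⟨m, hm, hmU⟩ : ∃ m ∈ closure A.U, m ∉ A.U := by
    by_contra! h; exact hcl (isClosed_of_closure_subset h)
  obtain ⟨i, hi⟩ := hcov m
  obtain ⟨δ, hδ, hball⟩ := Metric.isOpen_iff.1 (φ i).open_target _ ((φ i).map_source hi)
  rw [Real.ball_eq_Ioo] at hball
  have hO : IsOpen ((φ i).symm '' Ioo (φ i m - δ) (φ i m + δ)) :=
    (φ i).symm.isOpen_image_of_subset_source isOpen_Ioo hball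
  obtain ⟨_, ⟨x, hx, rfl⟩, hxU⟩ := mem_closure_iff.1 hm _ hO
    ⟨φ i m, ⟨by linarith, by linarith⟩, (φ i).left_inv hi⟩
  -- one of the two directions of the chart leads from `m` to a point of the arc
  obtain ⟨ψ, hψs, m', l, p, hm', hl, hp, ht, hpU⟩ : ∃ ψ : OpenPartialHomeomorph X ℝ,
      ψ.source = (φ i).source ∧ ∃ m' l p, ψ.symm m' = m ∧ l < m' ∧ m' ≤ p ∧ Icc l p ⊆ ψ.target ∧
        ψ.symm p ∈ A.U := by
    rcases le_total (φ i m) x with h | h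
    · exact ⟨φ i, rfl, φ i m, φ i m - δ / 2, x, (φ i).left_inv hi, by linarith, h,
        fun y hy => hball ⟨by linarith [hy.1], hy.2.trans_lt hx.2⟩, hxU⟩
    · refine ⟨(φ i).transHomeomorph (Homeomorph.neg ℝ), rfl, -φ i m, -φ i m - δ / 2, -x, ?_,
        by linarith, by linarith, fun y hy => ?_, ?_⟩
      · change (φ i).symm (- -φ i m) = m
        rw [neg_neg, (φ i).left_inv hi]
      · change -y ∈ (φ i).target
        exact hball ⟨by linarith [hx.1, hy.2], by linarith [hy.1]⟩
      · change (φ i).symm (- -x) ∈ A.U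
        rwa [neg_neg]
  have hτ : ∀ j, ContinuousOn (fun x => σ j x * σ i x) (ψ.source ∩ (φ j).source) := fun j => by
    rw [hψs, inter_comm]; exact hσ j i
  have hτA : ContinuousOn (fun x => σ i x * A.o x) (A.U ∩ ψ.source) := by rw [hψs]; exact A.sign i
  have hm'U : ψ.symm m' ∉ A.U := by rwa [hm']
  obtain ⟨c, hc1, hc2, hc3, hc4⟩ := exists_last_exit (A := {x | ψ.symm x ∈ A.U}) hp hm'U hpU
    (A.exists_open_inter_eq ψ fun y hy => ht ⟨hl.le.trans hy.1, hy.2⟩)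
  obtain ⟨B, hB, hBd⟩ := A.exists_tendsto_end hcov ψ hc2
    (fun y hy => ht ⟨hl.le.trans (hc1.trans hy.1), hy.2⟩) hc3 hc4
  rcases hBd with hBd | hBd
  · exact A.compl_subsingleton_of_maximal_aux hcov hw' hmax ψ (σ i) hτ hτA (hl.trans_le hc1) hc2 ht
      hc3 hc4 hB hBd
  · exact A.neg.compl_subsingleton_of_maximal_aux hcov hw' (fun A' hA' => hmax A'.neg (neg_le hA'))
      ψ (σ i) hτ hτA (hl.trans_le hc1) hc2 ht hc3 hc4 (by exact hB.neg)
      (fun u hu => neg_lt_neg (hBd u hu))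

lemma exists_nonempty (hw0 : ∀ U, 0 ≤ w U)
    (hσ : ∀ i j, ContinuousOn (fun x => σ i x * σ j x) ((φ i).source ∩ (φ j).source))
    (hw' : ∀ U V : Set X, U ⊆ V → (∃ O, IsOpen O ∧ O.Nonempty ∧ O ⊆ V ∧ Disjoint O U) → w U < w V)
    (x₀ : X) : ∃ A : SignedArc w φ σ, A.U.Nonempty := by
  obtain ⟨i, hi⟩ := hcov x₀
  obtain ⟨δ, hδ, hball⟩ := Metric.isOpen_iff.1 (φ i).open_target _ ((φ i).map_source hi)
  rw [Real.ball_eq_Ioo] at hball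
  set U := (φ i).symm '' Ioo (φ i x₀ - δ) (φ i x₀ + δ) with hU
  have hO : IsOpen U := (φ i).symm.isOpen_image_of_subset_source isOpen_Ioo hball
  have hx₀ : x₀ ∈ U := ⟨φ i x₀, ⟨by linarith, by linarith⟩, (φ i).left_inv hi⟩
  have hUs : U ⊆ (φ i).source := by
    rintro _ ⟨x, hx, rfl⟩; exact (φ i).map_target (hball hx)
  have hφU : ∀ x ∈ U, φ i x ∈ Ioo (φ i x₀ - δ) (φ i x₀ + δ) := by
    rintro _ ⟨x, hx, rfl⟩; rwa [(φ i).right_inv (hball hx)]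
  have hwU : 0 < w U := (hw0 ∅).trans_lt (hw' ∅ U (empty_subset _) ⟨U, hO, ⟨x₀, hx₀⟩, Subset.rfl,
    disjoint_empty _⟩)
  -- The chart coordinate varies by less than `2 * δ` on `U`; the factor makes the length at most `w
  -- U`.
  refine ⟨⟨U, fun x => w U / (2 * δ) * φ i x, σ i, hO,
    isPreconnected_Ioo.image _ ((φ i).continuousOn_symm.mono hball),
    ((φ i).continuousOn.mono hUs).const_mul _, fun x hx y hy hxy => ?_, fun x hx y hy => ?_,
    fun j => (hσ j i).mono fun x hx => ⟨hx.2, hUs hx.1⟩⟩, x₀, hx₀⟩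
  · exact (φ i).injOn (hUs hx) (hUs hy) (mul_left_cancel₀ (by positivity) hxy)
  · have h1 := hφU x hx
    have h2 := hφU y hy
    rw [← mul_sub, div_mul_eq_mul_div, div_le_iff₀ (by positivity)]
    exact mul_le_mul_of_nonneg_left (by linarith [h1.1, h1.2, h2.1, h2.2]) hwU.le

end SignedArc

/-- A connected second countable one-dimensional manifold with a system of signs becomes, after
removal of at most one point, an open interval on which the signs can be chosen coherently. -/
theorem exists_interval_chart {X ι : Type*} [TopologicalSpace X] [T2Space X]
    [SecondCountableTopology X] [PreconnectedSpace X] [Nonempty X]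
    (φ : ι → OpenPartialHomeomorph X ℝ) (hcov : ∀ x, ∃ i, x ∈ (φ i).source) (σ : ι → X → ℤˣ)
    (hσ : ∀ i j, ContinuousOn (fun x => σ i x * σ j x) ((φ i).source ∩ (φ j).source)) :
    ∃ (U : Set X) (h : X → ℝ) (o : X → ℤˣ), IsOpen U ∧ Uᶜ.Subsingleton ∧ ContinuousOn h U ∧
      InjOn h U ∧ (∀ x ∈ U, ∀ N ∈ 𝓝 x, h '' N ∈ 𝓝 (h x)) ∧ (∃ a b, a < b ∧ h '' U = Ioo a b) ∧
      ∀ i, ContinuousOn (fun x => σ i x * o x) (U ∩ (φ i).source) := by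
  obtain ⟨w, hw0, hw, hw'⟩ := exists_strictly_monotone_weight X
  obtain ⟨A₀, hA₀⟩ := SignedArc.exists_nonempty hcov hw0 hσ hw' (Classical.arbitrary X)
  obtain ⟨A, hA⟩ := exists_maximal_of_chains_bounded
    (r := fun A B : {A : SignedArc w φ σ // A.U.Nonempty} => A.1.Le B.1) (fun c hc => by
      rcases c.eq_empty_or_nonempty with rfl | hne
      · exact ⟨⟨A₀, hA₀⟩, fun A hA => absurd hA (notMem_empty _)⟩
      · obtain ⟨B, hB⟩ := SignedArc.chain_bound (c := Subtype.val '' c) hw (by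
          rintro _ ⟨A, hA, rfl⟩ _ ⟨B, hB, rfl⟩ hAB
          exact hc hA hB fun h => hAB (by rw [h])) (hne.image _)
        obtain ⟨A, hA⟩ := hne
        exact ⟨⟨B, A.2.mono (hB A.1 ⟨A, hA, rfl⟩).1⟩, fun D hD => hB D.1 ⟨D, hD, rfl⟩⟩)
    (fun h h' => h.trans h')
  have hmax : ∀ A', A.1.Le A' → A'.U ⊆ A.1.U := fun A' hA' =>
    (hA ⟨A', A.2.mono hA'.1⟩ hA').1
  refine ⟨A.1.U, A.1.h, A.1.o, A.1.isOpen, A.1.compl_subsingleton_of_maximal hcov hσ hw' hmax A.2,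
    A.1.continuousOn, A.1.injOn, fun x hx N hN => A.1.image_mem_nhds hcov hx hN, ?_, A.1.sign⟩
  obtain ⟨u, hu⟩ := A.2
  refine (A.1.isOpen_image hcov).exists_eq_Ioo (A.1.isPreconnected.image _ A.1.continuousOn)
    (A.2.image _) ⟨A.1.h u - w A.1.U, ?_⟩ ⟨A.1.h u + w A.1.U, ?_⟩
  · rintro _ ⟨v, hv, rfl⟩
    have := A.1.bound u hu v hv
    linarith
  · rintro _ ⟨v, hv, rfl⟩
    have := A.1.bound v hv u hu
    linarith

/-! ### Leaves, saturations and the boundary of the surface. -/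

namespace Foliation

variable {Z : Type*} [TopologicalSpace Z] (F : Foliation Z)

/-- The leaf through a point. -/
def leaf (z : Z) : Set Z := {w | F.leafSetoid w z}

lemma mem_leaf_self (z : Z) : z ∈ F.leaf z := F.leafSetoid.refl z

variable {F} in
lemma leaf_eq {z w : Z} (h : F.leafSetoid w z) : F.leaf w = F.leaf z := by
  ext x
  exact ⟨fun hx => F.leafSetoid.trans hx h, fun hx => F.leafSetoid.trans hx (F.leafSetoid.symm h)⟩

lemma leaf_mem_leaves (z : Z) : F.leaf z ∈ F.leaves := ⟨z, rfl⟩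

variable {F} in
lemma eq_leaf_of_mem {ω : Set Z} (hω : ω ∈ F.leaves) {z : Z} (hz : z ∈ ω) : ω = F.leaf z := by
  obtain ⟨w, rfl⟩ := hω
  exact (leaf_eq hz).symm

variable {F} in
lemma nonempty_of_mem_leaves {ω : Set Z} (hω : ω ∈ F.leaves) : ω.Nonempty := by
  obtain ⟨w, rfl⟩ := hω
  exact ⟨w, F.leafSetoid.refl w⟩

/-- Every leaf is the image of a closed embedding of the line. -/
def HasClosedLineLeaves : Prop :=
  ∀ z, ∃ γ : ℝ → Z, IsClosedEmbedding γ ∧ range γ = F.leaf z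

lemma hasClosedLineLeaves (hline : ∀ ω ∈ F.leaves, Nonempty (ω ≃ₜ ℝ))
    (hclosed : ∀ ω ∈ F.leaves, IsClosed ω) : F.HasClosedLineLeaves := by
  intro z
  obtain ⟨θ⟩ := hline _ (F.leaf_mem_leaves z)
  refine ⟨Subtype.val ∘ θ.symm, (hclosed _ (F.leaf_mem_leaves z)).isClosedEmbedding_subtypeVal.comp
    θ.symm.isClosedEmbedding, ?_⟩
  rw [range_comp, θ.symm.surjective.range_eq, image_univ, Subtype.range_coe]

variable {F} in
lemma HasClosedLineLeaves.isClosed_leaf (hF : F.HasClosedLineLeaves) (z : Z) :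
    IsClosed (F.leaf z) := by
  obtain ⟨γ, hγ, hr⟩ := hF z
  exact hr ▸ hγ.isClosed_range

lemma samePlaque_symm {a b : Z} (h : F.SamePlaque a b) : F.SamePlaque b a := by
  obtain ⟨φ, hφ, ha, hb, hab, hx⟩ := h
  exact ⟨φ, hφ, hb, ha, hab.symm, fun x hx' => hab ▸ hx x (by rwa [uIcc_comm])⟩

/-- The tube lemma thickens the horizontal segment from `a` to `b` inside the chart, and points near
`b` slide along the thickened segment to points near `a`. -/
lemma samePlaque_exists_near {a b : Z} (h : F.SamePlaque a b) {V : Set Z} (hV : IsOpen V)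
    (ha : a ∈ V) : ∀ᶠ w in 𝓝 b, ∃ v ∈ V, F.leafSetoid w v := by
  obtain ⟨φ, hφ, has, hbs, hab, hx⟩ := h
  obtain ⟨u, v, hu, hv, hsu, hbv, huv⟩ := generalized_tube_lemma (s := uIcc (φ a).1 (φ b).1)
    (t := {(φ b).2}) isCompact_uIcc isCompact_singleton φ.open_target (by
      rintro ⟨x, y⟩ ⟨hx1, hx2⟩
      have hy : y = (φ a).2 := (mem_singleton_iff.1 hx2).trans hab.symm
      exact hy ▸ hx x hx1)
  obtain ⟨δ, hδ, hball⟩ := Metric.isOpen_iff.1 hu _ (hsu right_mem_uIcc)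
  have hφb := φ.continuousAt hbs
  have h1 : ∀ᶠ w in 𝓝 b, (φ w).1 ∈ Metric.ball (φ b).1 δ :=
    hφb.fst.eventually_mem (Metric.ball_mem_nhds _ hδ)
  have h2 : ∀ᶠ w in 𝓝 b, (φ w).2 ∈ v := hφb.snd.eventually_mem (hv.mem_nhds (hbv rfl))
  have haeq : ((φ a).1, (φ b).2) = φ a := by rw [← hab]
  have h3 : ContinuousAt (fun w => φ.symm ((φ a).1, (φ w).2)) b := by
    refine ContinuousAt.comp (g := φ.symm) ?_ (continuousAt_const.prodMk hφb.snd)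
    rw [haeq]
    exact φ.continuousAt_symm (φ.map_source has)
  have h4 : ∀ᶠ w in 𝓝 b, φ.symm ((φ a).1, (φ w).2) ∈ V := h3.eventually_mem (by
    rw [haeq, φ.left_inv has]; exact hV.mem_nhds ha)
  filter_upwards [h1, h2, h4, φ.open_source.mem_nhds hbs] with w hw1 hw2 hw4 hw5
  have hseg : ∀ x ∈ uIcc (φ a).1 (φ w).1, (x, (φ w).2) ∈ φ.target := by
    intro x hx'
    refine huv ⟨?_, hw2⟩
    rcases uIcc_subset_uIcc_union_uIcc (b := (φ b).1) hx' with h | h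
    · exact hsu h
    · refine hball ?_
      rw [Metric.mem_ball, Real.dist_eq] at hw1 ⊢
      have h7 : |x - (φ b).1| ≤ |(φ w).1 - (φ b).1| := abs_sub_left_of_mem_uIcc h
      linarith
  have hva : φ (φ.symm ((φ a).1, (φ w).2)) = ((φ a).1, (φ w).2) :=
    φ.right_inv (hseg _ left_mem_uIcc)
  refine ⟨_, hw4, F.leafSetoid.symm (Relation.EqvGen.rel _ _ ⟨φ, hφ, φ.map_target (hseg _ left_mem_uIcc),
    hw5, ?_, ?_⟩)⟩
  · rw [hva]
  · rw [hva]; exact hseg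

/-- The saturation of an open set is open. -/
lemma isOpen_saturation {V : Set Z} (hV : IsOpen V) : IsOpen {w | ∃ v ∈ V, F.leafSetoid w v} := by
  rw [isOpen_iff_mem_nhds]
  rintro w ⟨v, hv, hwv⟩
  have key : ∀ a b : Z, Relation.EqvGen F.SamePlaque a b →
      (∀ O, IsOpen O → a ∈ O → ∀ᶠ w in 𝓝 b, ∃ v ∈ O, F.leafSetoid w v) ∧
      (∀ O, IsOpen O → b ∈ O → ∀ᶠ w in 𝓝 a, ∃ v ∈ O, F.leafSetoid w v) := by
    intro a b h
    induction h with
    | rel a b h =>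
      exact ⟨fun O hO ha => F.samePlaque_exists_near h hO ha,
        fun O hO hb => F.samePlaque_exists_near (F.samePlaque_symm h) hO hb⟩
    | refl a =>
      have : ∀ O, IsOpen O → a ∈ O → ∀ᶠ w in 𝓝 a, ∃ v ∈ O, F.leafSetoid w v := by
        intro O hO ha
        filter_upwards [hO.mem_nhds ha] with w hw using ⟨w, hw, F.leafSetoid.refl w⟩
      exact ⟨this, this⟩
    | symm a b h ih => exact ⟨ih.2, ih.1⟩
    | trans a b c h h' ih ih' =>
      have comb : ∀ a b c : Z, (∀ O, IsOpen O → a ∈ O → ∀ᶠ w in 𝓝 b, ∃ v ∈ O, F.leafSetoid w v) →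
          (∀ O, IsOpen O → b ∈ O → ∀ᶠ w in 𝓝 c, ∃ v ∈ O, F.leafSetoid w v) →
          (∀ O, IsOpen O → a ∈ O → ∀ᶠ w in 𝓝 c, ∃ v ∈ O, F.leafSetoid w v) := by
        intro a b c h h' O hO ha
        obtain ⟨O', hO'sub, hO', hbO'⟩ := mem_nhds_iff.1 (h O hO ha)
        filter_upwards [h' O' hO' hbO'] with w ⟨v, hv, hwv⟩
        obtain ⟨v', hv', hvv'⟩ := hO'sub hv
        exact ⟨v', hv', F.leafSetoid.trans hwv hvv'⟩
      exact ⟨comb a b c ih.1 ih'.1, comb c b a ih'.2 ih.2⟩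
  exact (key w v hwv).2 V hV hv

/-- Invariance of the boundary. If `z` had height `0` in `ψ` and positive height in `φ`, then the
`φ`-height along a transversal leaving `z` in `ψ` would be continuous and injective, hence monotone,
and would stay on one side of the height of `z`. But plaques of `φ` just above and just below `z`
both meet this transversal. -/
lemma mem_boundary_iff {φ : OpenPartialHomeomorph Z (ℝ × ℝ≥0)} (hφ : φ ∈ F.atlas) {z : Z}
    (hz : z ∈ φ.source) : z ∈ F.boundary ↔ (φ z).2 = 0 := by
  refine ⟨?_, fun h => ⟨φ, hφ, hz, h⟩⟩
  rintro ⟨ψ, hψ, hzψ, h0⟩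
  by_contra hpos
  obtain ⟨N₁, hN₁, hN₁s, hN₁c⟩ := F.compatible φ hφ ψ hψ z ⟨hz, hzψ⟩
  obtain ⟨N₂, hN₂, hN₂s, hN₂c⟩ := F.compatible ψ hψ φ hφ z ⟨hzψ, hz⟩
  have hN : N₁ ∩ N₂ ∈ 𝓝 z := inter_mem hN₁ hN₂
  -- a transversal starting at `z`
  let p : ℝ → ℝ × ℝ≥0 := fun y => ((ψ z).1, y.toNNReal)
  have hpc : Continuous p := continuous_const.prodMk continuous_real_toNNReal
  have hp0 : p 0 = ψ z := by simp [p, h0.symm]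
  have hT : ∀ᶠ y in 𝓝 (0 : ℝ), p y ∈ ψ.target ∧ ψ.symm (p y) ∈ N₁ ∩ N₂ := by
    have h1 : ContinuousAt (ψ.symm ∘ p) 0 := ContinuousAt.comp (g := ψ.symm) (by
      rw [hp0]; exact ψ.continuousAt_symm (ψ.map_source hzψ)) hpc.continuousAt
    refine (hpc.continuousAt.eventually_mem (ψ.open_target.mem_nhds ?_)).and (h1.eventually_mem ?_)
    · rw [hp0]; exact ψ.map_source hzψ
    · rw [Function.comp, hp0, ψ.left_inv hzψ]; exact hN
  obtain ⟨ε, hε, hball⟩ := Metric.eventually_nhds_iff_ball.1 hT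
  rw [Real.ball_eq_Ioo] at hball
  have hsub : Icc 0 (ε / 2) ⊆ Ioo (0 - ε) (0 + ε) := fun y hy =>
    ⟨by linarith [hy.1], by linarith [hy.2]⟩
  have hp2 : ∀ y ∈ Icc 0 (ε / 2), (ψ (ψ.symm (p y))).2 = y.toNNReal := fun y hy => by
    rw [ψ.right_inv (hball y (hsub hy)).1]
  let G : ℝ → ℝ≥0 := fun y => (φ (ψ.symm (p y))).2
  have hGc : ContinuousOn G (Icc 0 (ε / 2)) := by
    refine continuous_snd.comp_continuousOn (φ.continuousOn.comp (ψ.continuousOn_symm.comp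
      hpc.continuousOn fun y hy => (hball y (hsub hy)).1) fun y hy => ?_)
    exact (hN₁s (hball y (hsub hy)).2.1).1
  have hGi : InjOn G (Icc 0 (ε / 2)) := by
    intro y hy y' hy' h
    have := hN₁c _ (hball y (hsub hy)).2.1 _ (hball y' (hsub hy')).2.1 h
    rw [hp2 y hy, hp2 y' hy'] at this
    exact (Real.toNNReal_eq_toNNReal_iff hy.1 hy'.1).1 this
  have hG0 : G 0 = (φ z).2 := by simp only [G]; rw [hp0, ψ.left_inv hzψ]
  have hGval : ∀ w ∈ N₁ ∩ N₂, ((ψ w).2 : ℝ) ≤ ε / 2 → (φ w).2 = G (ψ w).2 := by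
    intro w hw hle
    have hy : ((ψ w).2 : ℝ) ∈ Icc 0 (ε / 2) := ⟨NNReal.coe_nonneg _, hle⟩
    refine hN₂c _ hw.2 _ (hball _ (hsub hy)).2.2 ?_
    rw [hp2 _ hy, Real.toNNReal_coe]
  -- points near `z` whose height in `φ` lies on a given side of that of `z`
  have hside : ∀ q : ℝ → ℝ≥0, ContinuousAt q 0 → q 0 = (φ z).2 →
      ∀ᶠ η in 𝓝 (0 : ℝ), ∃ y ∈ Icc 0 (ε / 2), q η = G y := by
    intro q hq hq0
    have hqz : ((φ z).1, q 0) = φ z := by rw [hq0]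
    have hc : ContinuousAt (fun η => φ.symm ((φ z).1, q η)) 0 :=
      ContinuousAt.comp (g := φ.symm) (by rw [hqz]; exact φ.continuousAt_symm (φ.map_source hz))
        (continuousAt_const.prodMk hq)
    have hval : φ.symm ((φ z).1, q 0) = z := by rw [hqz, φ.left_inv hz]
    have e1 : ∀ᶠ η in 𝓝 (0 : ℝ), φ.symm ((φ z).1, q η) ∈ N₁ ∩ N₂ :=
      hc.eventually_mem (by rw [hval]; exact hN)
    have e2 : ∀ᶠ η in 𝓝 (0 : ℝ), ((ψ (φ.symm ((φ z).1, q η))).2 : ℝ) < ε / 2 := by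
      have : ContinuousAt (fun η => ((ψ (φ.symm ((φ z).1, q η))).2 : ℝ)) 0 :=
        NNReal.continuous_coe.continuousAt.comp (ContinuousAt.snd (ContinuousAt.comp (g := ψ)
          (by rw [hval]; exact ψ.continuousAt hzψ) hc))
      refine this.eventually_lt_const ?_
      change ((ψ (φ.symm ((φ z).1, q 0))).2 : ℝ) < ε / 2
      rw [hval, h0]; simpa using hε
    have e3 : ∀ᶠ η in 𝓝 (0 : ℝ), ((φ z).1, q η) ∈ φ.target :=
      (continuousAt_const.prodMk hq).eventually_mem (φ.open_target.mem_nhds (by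
        rw [hqz]; exact φ.map_source hz))
    filter_upwards [e1, e2, e3] with η h1 h2 h3
    refine ⟨_, ⟨NNReal.coe_nonneg _, h2.le⟩, ?_⟩
    rw [← hGval _ h1 h2.le, φ.right_inv h3]
  have hposr : 0 < ((φ z).2 : ℝ) := by
    rw [NNReal.coe_pos]; exact pos_iff_ne_zero.2 hpos
  have h0mem : (0 : ℝ) ∈ Icc 0 (ε / 2) := ⟨le_rfl, by positivity⟩
  have e0 : ∀ᶠ η : ℝ in 𝓝[>] (0 : ℝ), η < ((φ z).2 : ℝ) ∧ 0 < η :=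
    (mem_of_superset (Ioo_mem_nhdsGT hposr) fun η hη => ⟨hη.2, hη.1⟩)
  rcases hGc.strictMonoOn_of_injOn_Icc' (by positivity) hGi with h | h
  · have e1 := hside (fun η => (((φ z).2 : ℝ) - η).toNNReal)
      (continuous_real_toNNReal.comp (continuous_const.sub continuous_id)).continuousAt (by simp)
    obtain ⟨η, ⟨y, hy, hqy⟩, hη, hη0⟩ := ((e1.filter_mono nhdsWithin_le_nhds).and e0).exists
    have h2 : G 0 ≤ G y := h.monotoneOn h0mem hy hy.1
    rw [hG0, ← hqy, ← NNReal.coe_le_coe, Real.coe_toNNReal _ (by linarith)] at h2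
    linarith
  · have e1 := hside (fun η => (((φ z).2 : ℝ) + η).toNNReal)
      (continuous_real_toNNReal.comp (continuous_const.add continuous_id)).continuousAt (by simp)
    obtain ⟨η, ⟨y, hy, hqy⟩, hη, hη0⟩ := ((e1.filter_mono nhdsWithin_le_nhds).and e0).exists
    have h2 : G y ≤ G 0 := h.antitoneOn h0mem hy hy.1
    rw [hG0, ← hqy, ← NNReal.coe_le_coe, Real.coe_toNNReal _ (by linarith)] at h2
    linarith

variable {F} in
lemma mem_boundary_congr {a b : Z} (h : F.leafSetoid a b) : a ∈ F.boundary ↔ b ∈ F.boundary := by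
  have key : ∀ a b : Z, Relation.EqvGen F.SamePlaque a b → (a ∈ F.boundary ↔ b ∈ F.boundary) := by
    intro a b h
    induction h with
    | rel a b h =>
      obtain ⟨φ, hφ, ha, hb, hab, -⟩ := h
      rw [F.mem_boundary_iff hφ ha, F.mem_boundary_iff hφ hb, hab]
    | refl a => rfl
    | symm a b h ih => exact ih.symm
    | trans a b c h h' ih ih' => exact ih.trans ih'
  exact key a b h

end Foliation

/-! ### Flow boxes. -/

namespace Foliation

variable {Z : Type*} [TopologicalSpace Z]

/-- A rectangle with horizontal plaques, embedded in a foliated surface. -/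
structure FlowBox (F : Foliation Z) (J : Set ℝ) where
  b : ℝ × ℝ → Z
  c : Z → ℝ × ℝ
  cont_b : ContinuousOn b (Ioo (-1) 1 ×ˢ J)
  left_inv : ∀ p ∈ Ioo (-1 : ℝ) 1 ×ˢ J, c (b p) = p
  cont_c : ContinuousOn c (b '' (Ioo (-1) 1 ×ˢ J))
  leaf : ∀ x ∈ Ioo (-1 : ℝ) 1, ∀ x' ∈ Ioo (-1 : ℝ) 1, ∀ y ∈ J, F.leafSetoid (b (x, y)) (b (x', y))

namespace FlowBox

variable {F : Foliation Z} {J : Set ℝ}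

def dom (B : F.FlowBox J) : Set Z := B.b '' (Ioo (-1) 1 ×ˢ J)

lemma injOn (B : F.FlowBox J) : InjOn B.b (Ioo (-1) 1 ×ˢ J) := fun p hp q hq h => by
  rw [← B.left_inv p hp, ← B.left_inv q hq, h]

lemma b_mem (B : F.FlowBox J) {p : ℝ × ℝ} (hp : p ∈ Ioo (-1 : ℝ) 1 ×ˢ J) : B.b p ∈ B.dom :=
  ⟨p, hp, rfl⟩

lemma c_mem (B : F.FlowBox J) {w : Z} (hw : w ∈ B.dom) : B.c w ∈ Ioo (-1 : ℝ) 1 ×ˢ J := by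
  obtain ⟨p, hp, rfl⟩ := hw
  rwa [B.left_inv p hp]

lemma b_c (B : F.FlowBox J) {w : Z} (hw : w ∈ B.dom) : B.b (B.c w) = w := by
  obtain ⟨p, hp, rfl⟩ := hw
  rw [B.left_inv p hp]

lemma image_mem_nhdsWithin (B : F.FlowBox J) {p : ℝ × ℝ} (hp : p ∈ Ioo (-1 : ℝ) 1 ×ˢ J)
    {N : Set (ℝ × ℝ)} (hN : N ∈ 𝓝[Ioo (-1) 1 ×ˢ J] p) : B.b '' N ∈ 𝓝[B.dom] (B.b p) := by
  have h := B.cont_c (B.b p) (B.b_mem hp)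
  rw [ContinuousWithinAt, B.left_inv p hp] at h
  have h' : Tendsto B.c (𝓝[B.dom] (B.b p)) (𝓝[Ioo (-1) 1 ×ˢ J] p) :=
    tendsto_nhdsWithin_iff.2 ⟨h, mem_of_superset self_mem_nhdsWithin fun w hw => B.c_mem hw⟩
  filter_upwards [h' hN, self_mem_nhdsWithin] with w hw hwd
  exact ⟨B.c w, hw, B.b_c hwd⟩

lemma isOpen_image_inter (B : F.FlowBox J) (hB : IsOpen B.dom) {O : Set (ℝ × ℝ)} (hO : IsOpen O) :
    IsOpen (B.b '' (Ioo (-1) 1 ×ˢ J ∩ O)) := by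
  convert B.cont_c.isOpen_inter_preimage hB hO using 1
  ext w
  constructor
  · rintro ⟨p, hp, rfl⟩
    exact ⟨B.b_mem hp.1, by rw [mem_preimage, B.left_inv p hp.1]; exact hp.2⟩
  · rintro ⟨hw, hw'⟩
    exact ⟨B.c w, ⟨B.c_mem hw, hw'⟩, B.b_c hw⟩

lemma isOpen_image (B : F.FlowBox J) (hB : IsOpen B.dom) {O : Set (ℝ × ℝ)} (hO : IsOpen O)
    (hOJ : O ⊆ Ioo (-1) 1 ×ˢ J) : IsOpen (B.b '' O) := by
  rw [← inter_eq_self_of_subset_right hOJ]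
  exact B.isOpen_image_inter hB hO

/-- Restriction of a flow box to a smaller rectangle, rescaled affinely. -/
noncomputable def rescale (B : F.FlowBox J) {J' : Set ℝ} (x₁ r y₁ k : ℝ) (hr : r ≠ 0) (hk : k ≠ 0)
    (hx : ∀ x ∈ Ioo (-1 : ℝ) 1, x₁ + r * x ∈ Ioo (-1 : ℝ) 1) (hy : ∀ y ∈ J', y₁ + k * y ∈ J) :
    F.FlowBox J' where
  b := fun p => B.b (x₁ + r * p.1, y₁ + k * p.2)
  c := fun w => (((B.c w).1 - x₁) / r, ((B.c w).2 - y₁) / k)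
  cont_b := B.cont_b.comp (by fun_prop) fun p hp => ⟨hx _ hp.1, hy _ hp.2⟩
  left_inv := fun p hp => by
    rw [B.left_inv _ ⟨hx _ hp.1, hy _ hp.2⟩]
    ext <;> field_simp <;> ring
  cont_c := by
    have h : ContinuousOn B.c ((fun p : ℝ × ℝ => B.b (x₁ + r * p.1, y₁ + k * p.2)) ''
        (Ioo (-1) 1 ×ˢ J')) := B.cont_c.mono (by
      rintro _ ⟨p, hp, rfl⟩
      exact ⟨_, ⟨hx _ hp.1, hy _ hp.2⟩, rfl⟩)
    exact (((continuous_fst.comp_continuousOn h).sub continuousOn_const).div_const _).prodMk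
      (((continuous_snd.comp_continuousOn h).sub continuousOn_const).div_const _)
  leaf := fun x hx' x' hx'' y hy' => B.leaf _ (hx x hx') _ (hx x' hx'') _ (hy y hy')

/-- The plaques of a leaf that is homeomorphic to the line are open in the leaf. -/
lemma exists_plaque_nhd (hF : F.HasClosedLineLeaves) (B : F.FlowBox J) {x y : ℝ}
    (hx : x ∈ Ioo (-1 : ℝ) 1) (hy : y ∈ J) :
    ∃ N ∈ 𝓝 (B.b (x, y)), ∀ w ∈ N, F.leafSetoid w (B.b (x, y)) →
      ∃ x' ∈ Ioo (-1 : ℝ) 1, w = B.b (x', y) := by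
  obtain ⟨γ, hγ, hr⟩ := hF (B.b (x, y))
  have hmem : ∀ x' ∈ Ioo (-1 : ℝ) 1, ∃ u, γ u = B.b (x', y) := fun x' hx' => by
    have : B.b (x', y) ∈ range γ := hr ▸ B.leaf x' hx' x hx y hy
    exact this
  choose! k hk using hmem
  have hkc : ContinuousOn k (Ioo (-1) 1) := by
    rw [hγ.isInducing.continuousOn_iff]
    refine ContinuousOn.congr (f := fun x' => B.b (x', y)) ?_ fun x' hx' => hk x' hx'
    exact B.cont_b.comp (by fun_prop) fun x' hx' => ⟨hx', hy⟩
  have hki : InjOn k (Ioo (-1) 1) := by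
    intro u hu v hv huv
    have : B.b (u, y) = B.b (v, y) := by rw [← hk u hu, ← hk v hv, huv]
    exact congrArg Prod.fst (B.injOn ⟨hu, hy⟩ ⟨hv, hy⟩ this)
  have h := image_mem_nhds_of_injOn_Ioo hkc hki hx (Ioo_mem_nhds hx.1 hx.2)
  -- Since `γ` is an embedding, a neighbourhood in the line is the trace of a neighbourhood in the
  -- surface: the leaf does not return close to the chosen point outside its plaque.
  rw [hγ.isInducing.nhds_eq_comap, hk x hx] at h
  obtain ⟨N, hN, hsub⟩ := mem_comap.1 h
  refine ⟨N, hN, fun w hw hwl => ?_⟩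
  have : w ∈ range γ := hr ▸ hwl
  obtain ⟨u, rfl⟩ := this
  obtain ⟨x', hx', rfl⟩ := hsub hw
  exact ⟨x', hx', hk x' hx'⟩

end FlowBox

variable (F : Foliation Z)

/-- `J` is the part of `(-1, 1)` on which the height `y₀ + δ * y` is nonnegative, so that one
construction serves interior points and boundary points. -/
lemma exists_flowBox_aux {φ : OpenPartialHomeomorph Z (ℝ × ℝ≥0)} (hφ : φ ∈ F.atlas)
    {N : Set Z} {x₀ y₀ δ : ℝ} (hδ : 0 < δ) {J : Set ℝ}
    (hJ : ∀ y, y ∈ J ↔ y ∈ Ioo (-1 : ℝ) 1 ∧ 0 ≤ y₀ + δ * y)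
    (hrect : ∀ x : ℝ, ∀ y : ℝ≥0, |x - x₀| < δ → |(y : ℝ) - y₀| < δ →
      (x, y) ∈ φ.target ∧ φ.symm (x, y) ∈ N) :
    ∃ B : F.FlowBox J, IsOpen B.dom ∧ B.dom ⊆ N ∧
      (∀ p, B.b p = φ.symm (x₀ + δ * p.1, (y₀ + δ * p.2).toNNReal)) ∧
      ∀ p ∈ Ioo (-1 : ℝ) 1 ×ˢ J, (B.b p ∈ F.boundary ↔ y₀ + δ * p.2 = 0) := by
  let g : ℝ × ℝ → ℝ × ℝ≥0 := fun p => (x₀ + δ * p.1, (y₀ + δ * p.2).toNNReal)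
  have hgc : Continuous g := by
    refine Continuous.prodMk (by fun_prop) (continuous_real_toNNReal.comp (by fun_prop))
  have habs : ∀ s ∈ Ioo (-1 : ℝ) 1, |δ * s| < δ := fun s hs => by
    rw [abs_mul, abs_of_pos hδ]
    have := abs_lt.2 hs
    nlinarith
  have hg : ∀ p ∈ Ioo (-1 : ℝ) 1 ×ˢ J, g p ∈ φ.target ∧ φ.symm (g p) ∈ N := by
    intro p hp
    obtain ⟨h1, h2⟩ := (hJ _).1 hp.2
    refine hrect _ _ (by simpa using habs _ hp.1) ?_
    rw [Real.coe_toNNReal _ h2]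
    simpa using habs _ h1
  let c : Z → ℝ × ℝ := fun w => (((φ w).1 - x₀) / δ, (((φ w).2 : ℝ) - y₀) / δ)
  have hcb : ∀ p ∈ Ioo (-1 : ℝ) 1 ×ˢ J, c (φ.symm (g p)) = p := by
    intro p hp
    simp only [c]
    rw [φ.right_inv (hg p hp).1]
    simp only [g]
    rw [Real.coe_toNNReal _ ((hJ _).1 hp.2).2]
    ext <;> field_simp <;> ring
  have hcc : ContinuousOn c φ.source := by
    have h := φ.continuousOn
    exact (((continuous_fst.comp_continuousOn h).sub continuousOn_const).div_const _).prodMk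
      (((NNReal.continuous_coe.comp_continuousOn (continuous_snd.comp_continuousOn h)).sub
        continuousOn_const).div_const _)
  have hsrc : (fun p => φ.symm (g p)) '' (Ioo (-1) 1 ×ˢ J) ⊆ φ.source := by
    rintro _ ⟨p, hp, rfl⟩; exact φ.map_target (hg p hp).1
  let B : F.FlowBox J :=
    { b := fun p => φ.symm (g p)
      c := c
      cont_b := φ.continuousOn_symm.comp hgc.continuousOn fun p hp => (hg p hp).1
      left_inv := hcb
      cont_c := hcc.mono hsrc
      leaf := by
        intro x hx x' hx' y hy
        refine Relation.EqvGen.rel _ _ ⟨φ, hφ, φ.map_target (hg (x, y) ⟨hx, hy⟩).1,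
          φ.map_target (hg (x', y) ⟨hx', hy⟩).1, ?_, ?_⟩
        · rw [φ.right_inv (hg (x, y) ⟨hx, hy⟩).1, φ.right_inv (hg (x', y) ⟨hx', hy⟩).1]
        · rw [φ.right_inv (hg (x, y) ⟨hx, hy⟩).1, φ.right_inv (hg (x', y) ⟨hx', hy⟩).1]
          intro u hu
          have hu' : (u - x₀) / δ ∈ Ioo (-1 : ℝ) 1 := by
            have : u ∈ Ioo (x₀ - δ) (x₀ + δ) := by
              refine (ordConnected_Ioo.uIcc_subset ?_ ?_) hu
              · exact ⟨by nlinarith [hx.1], by nlinarith [hx.2]⟩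
              · exact ⟨by nlinarith [hx'.1], by nlinarith [hx'.2]⟩
            constructor
            · rw [lt_div_iff₀ hδ]; linarith [this.1]
            · rw [div_lt_iff₀ hδ]; linarith [this.2]
          have := (hg ((u - x₀) / δ, y) ⟨hu', hy⟩).1
          simp only [g] at this
          rwa [mul_div_cancel₀ _ hδ.ne', add_sub_cancel] at this }
  have hdom : B.dom = φ.source ∩ c ⁻¹' (Ioo (-1) 1 ×ˢ Ioo (-1) 1) := by
    apply Subset.antisymm
    · rintro _ ⟨p, hp, rfl⟩
      refine ⟨hsrc ⟨p, hp, rfl⟩, ?_⟩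
      rw [mem_preimage]
      change c (φ.symm (g p)) ∈ _
      rw [hcb p hp]
      exact ⟨hp.1, ((hJ _).1 hp.2).1⟩
    · rintro w ⟨hw, hcw⟩
      have h2 : y₀ + δ * (c w).2 = (φ w).2 := by simp only [c]; field_simp; ring
      have h1 : x₀ + δ * (c w).1 = (φ w).1 := by simp only [c]; field_simp; ring
      refine ⟨c w, ⟨hcw.1, (hJ _).2 ⟨hcw.2, by rw [h2]; exact NNReal.coe_nonneg _⟩⟩, ?_⟩
      change φ.symm (g (c w)) = w
      simp only [g]
      rw [h1, h2, Real.toNNReal_coe]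
      exact φ.left_inv hw
  refine ⟨B, ?_, ?_, fun p => rfl, fun p hp => ?_⟩
  · rw [hdom]
    exact hcc.isOpen_inter_preimage φ.open_source (isOpen_Ioo.prod isOpen_Ioo)
  · rintro _ ⟨p, hp, rfl⟩
    exact (hg p hp).2
  · change φ.symm (g p) ∈ _ ↔ _
    rw [F.mem_boundary_iff hφ (φ.map_target (hg p hp).1), φ.right_inv (hg p hp).1]
    simp only [g]
    rw [← NNReal.coe_eq_zero, Real.coe_toNNReal _ ((hJ _).1 hp.2).2]

lemma exists_flowBox_interior {z : Z} (hz : z ∉ F.boundary) {N : Set Z} (hN : N ∈ 𝓝 z) :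
    ∃ B : F.FlowBox (Ioo (-1) 1), IsOpen B.dom ∧ B.dom ⊆ N ∧ B.b (0, 0) = z ∧
      ∀ p ∈ Ioo (-1 : ℝ) 1 ×ˢ Ioo (-1 : ℝ) 1, B.b p ∉ F.boundary := by
  obtain ⟨φ, hφ, hzφ⟩ := F.cover z
  obtain ⟨N', hN'N, hN', hzN'⟩ := mem_nhds_iff.1 hN
  have h0 : (φ z).2 ≠ 0 := fun h => hz ((F.mem_boundary_iff hφ hzφ).2 h)
  have hpos : 0 < ((φ z).2 : ℝ) := by rw [NNReal.coe_pos]; exact pos_iff_ne_zero.2 h0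
  have hT : IsOpen (φ.target ∩ φ.symm ⁻¹' N') :=
    φ.continuousOn_symm.isOpen_inter_preimage φ.open_target hN'
  obtain ⟨δ, hδ, hball⟩ := Metric.isOpen_iff.1 hT (φ z)
    ⟨φ.map_source hzφ, by rwa [mem_preimage, φ.left_inv hzφ]⟩
  -- The size is capped by the height of `z`, which keeps the box off the boundary.
  obtain ⟨B, hB, hBN, hb, hbd⟩ := F.exists_flowBox_aux hφ (N := N') (x₀ := (φ z).1) (y₀ := (φ z).2)
    (δ := min δ (φ z).2) (lt_min hδ hpos) (J := Ioo (-1) 1) (fun y => by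
      refine ⟨fun h => ⟨h, ?_⟩, fun h => h.1⟩
      nlinarith [h.1, h.2, min_le_right δ ((φ z).2 : ℝ), lt_min hδ hpos]) (fun x y hx hy => by
      refine hball ?_
      rw [Metric.mem_ball, Prod.dist_eq, max_lt_iff, Real.dist_eq, NNReal.dist_eq]
      exact ⟨hx.trans_le (min_le_left _ _), hy.trans_le (min_le_left _ _)⟩)
  refine ⟨B, hB, hBN.trans hN'N, ?_, fun p hp => ?_⟩
  · rw [hb]
    simp only [mul_zero, add_zero, Real.toNNReal_coe]
    exact φ.left_inv hzφ
  · rw [hbd p hp]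
    nlinarith [hp.2.1, hp.2.2, min_le_right δ ((φ z).2 : ℝ), lt_min hδ hpos]

lemma exists_flowBox_boundary {z : Z} (hz : z ∈ F.boundary) {N : Set Z} (hN : N ∈ 𝓝 z) :
    ∃ B : F.FlowBox (Ico 0 1), IsOpen B.dom ∧ B.dom ⊆ N ∧ B.b (0, 0) = z ∧
      ∀ p ∈ Ioo (-1 : ℝ) 1 ×ˢ Ico (0 : ℝ) 1, (B.b p ∈ F.boundary ↔ p.2 = 0) := by
  obtain ⟨φ, hφ, hzφ⟩ := F.cover z
  obtain ⟨N', hN'N, hN', hzN'⟩ := mem_nhds_iff.1 hN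
  have h0 : (φ z).2 = 0 := (F.mem_boundary_iff hφ hzφ).1 hz
  have hT : IsOpen (φ.target ∩ φ.symm ⁻¹' N') :=
    φ.continuousOn_symm.isOpen_inter_preimage φ.open_target hN'
  obtain ⟨δ, hδ, hball⟩ := Metric.isOpen_iff.1 hT (φ z)
    ⟨φ.map_source hzφ, by rwa [mem_preimage, φ.left_inv hzφ]⟩
  obtain ⟨B, hB, hBN, hb, hbd⟩ := F.exists_flowBox_aux hφ (N := N') (x₀ := (φ z).1) (y₀ := 0)
    (δ := δ) hδ (J := Ico 0 1) (fun y => by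
      refine ⟨fun h => ⟨⟨by linarith [h.1], h.2⟩, by nlinarith [h.1]⟩, fun h => ⟨?_, h.1.2⟩⟩
      have := h.2
      rw [zero_add] at this
      exact nonneg_of_mul_nonneg_right this hδ) (fun x y hx hy => by
      refine hball ?_
      rw [Metric.mem_ball, Prod.dist_eq, max_lt_iff, Real.dist_eq, NNReal.dist_eq, h0]
      exact ⟨hx, by simpa using hy⟩)
  refine ⟨B, hB, hBN.trans hN'N, ?_, fun p hp => ?_⟩
  · rw [hb]
    simp only [mul_zero, add_zero, Real.toNNReal_zero]
    rw [← h0]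
    exact φ.left_inv hzφ
  · rw [hbd p hp, zero_add, mul_eq_zero_iff_left hδ.ne']

end Foliation

/-! ### Half boxes on the two sides of a leaf. -/

namespace Foliation

variable {Z : Type*} [TopologicalSpace Z]

/-- A flow box on one side of a set `S`, whose bottom plaque is its intersection with `S`. -/
structure HalfBox (F : Foliation Z) (S : Set Z) extends FlowBox F (Ico 0 1) where
  mem_iff : ∀ p ∈ Ioo (-1 : ℝ) 1 ×ˢ Ico (0 : ℝ) 1, b p ∈ S ↔ p.2 = 0
  isOpen_interior : IsOpen (b '' (Ioo (-1) 1 ×ˢ Ioo 0 1))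
  -- The remaining fields say that the box is relatively closed in an open set `nhd`. Thus a
  -- connected set inside `nhd` that avoids the bottom plaque lies in the interior of the box or
  -- misses the box.
  nhd : Set Z
  isOpen_nhd : IsOpen nhd
  dom_subset : toFlowBox.dom ⊆ nhd
  closure_subset : nhd ∩ closure toFlowBox.dom ⊆ toFlowBox.dom

/-- The half boxes on both sides of a plaque contained in `S`.  They coincide if the plaque lies
in the boundary of the surface. -/
structure SidePair (F : Foliation Z) (S : Set Z) where
  B : Bool → F.HalfBox S
  base : ∀ x ∈ Ioo (-1 : ℝ) 1, (B true).b (x, 0) = (B false).b (x, 0)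
  isOpen : IsOpen ((B true).dom ∪ (B false).dom)
  sides : (B true = B false ∧ ∀ x ∈ Ioo (-1 : ℝ) 1, (B true).b (x, 0) ∈ F.boundary) ∨
    (Disjoint ((B true).b '' (Ioo (-1) 1 ×ˢ Ioo 0 1)) ((B false).b '' (Ioo (-1) 1 ×ˢ Ioo 0 1)) ∧
      ∀ x ∈ Ioo (-1 : ℝ) 1, (B true).b (x, 0) ∉ F.boundary)

lemma SidePair.base' {F : Foliation Z} {S : Set Z} (P : F.SidePair S) (e : Bool) {x : ℝ}
    (hx : x ∈ Ioo (-1 : ℝ) 1) : (P.B e).b (x, 0) = (P.B true).b (x, 0) := by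
  cases e
  · exact (P.base x hx).symm
  · rfl

lemma SidePair.image_mem_nhds {F : Foliation Z} {S : Set Z} (P : F.SidePair S) {x : ℝ}
    (hx : x ∈ Ioo (-1 : ℝ) 1) {N : Bool → Set (ℝ × ℝ)}
    (hN : ∀ e, N e ∈ 𝓝[Ioo (-1) 1 ×ˢ Ico 0 1] ((x, 0) : ℝ × ℝ)) :
    (P.B true).b '' N true ∪ (P.B false).b '' N false ∈ 𝓝 ((P.B true).b (x, 0)) := by
  have hp : ((x, 0) : ℝ × ℝ) ∈ Ioo (-1 : ℝ) 1 ×ˢ Ico (0 : ℝ) 1 := ⟨hx, le_rfl, one_pos⟩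
  have h1 := (P.B true).image_mem_nhdsWithin hp (hN true)
  have h2 := (P.B false).image_mem_nhdsWithin hp (hN false)
  rw [← P.base x hx] at h2
  rw [mem_nhdsWithin_iff_eventually] at h1 h2
  filter_upwards [h1, h2, P.isOpen.mem_nhds (Or.inl ((P.B true).b_mem hp))] with w hw1 hw2 hw3
  exact hw3.imp hw1 hw2

variable (F : Foliation Z) {𝓢 : Set (Set Z)}

/-- Only finitely many members of the family come near `z`, and those not containing `z` are closed
and can be removed from the neighbourhood. -/
lemma exists_nhd_forall_mem_sUnion (hF : F.HasClosedLineLeaves) (h𝓢 : 𝓢 ⊆ F.leaves)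
    (hfin : LocallyFinite (fun ω : 𝓢 => (ω : Set Z))) (z : Z) :
    ∃ N ∈ 𝓝 z, ∀ w ∈ N, w ∈ ⋃₀ 𝓢 → F.leafSetoid w z := by
  obtain ⟨N, hN, hNf⟩ := hfin z
  let T : Set 𝓢 := {ω : 𝓢 | ((ω : Set Z) ∩ N).Nonempty} ∩ {ω : 𝓢 | z ∉ (ω : Set Z)}
  have hT : T.Finite := hNf.subset inter_subset_left
  have hK : (⋂ ω ∈ T, (ω : Set Z)ᶜ) ∈ 𝓝 z := by
    rw [biInter_mem hT]
    rintro ω ⟨-, hω⟩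
    obtain ⟨w, hw⟩ := h𝓢 ω.2
    have : IsClosed (ω : Set Z) := by rw [hw]; exact hF.isClosed_leaf w
    exact this.isOpen_compl.mem_nhds hω
  refine ⟨N ∩ ⋂ ω ∈ T, (ω : Set Z)ᶜ, inter_mem hN hK, ?_⟩
  rintro w ⟨hwN, hwT⟩ ⟨ω, hω, hwω⟩
  by_cases hzω : z ∈ ω
  · have h1 := eq_leaf_of_mem (h𝓢 hω) hzω
    rw [h1] at hwω
    exact hwω
  · have := mem_iInter₂.1 hwT ⟨ω, hω⟩ ⟨⟨w, hwω, hwN⟩, hzω⟩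
    exact absurd hwω this

lemma isClosed_sUnion_leaves (hF : F.HasClosedLineLeaves) (h𝓢 : 𝓢 ⊆ F.leaves)
    (hfin : LocallyFinite (fun ω : 𝓢 => (ω : Set Z))) : IsClosed (⋃₀ 𝓢) := by
  rw [sUnion_eq_iUnion]
  refine hfin.isClosed_iUnion fun ω => ?_
  obtain ⟨w, hw⟩ := h𝓢 ω.2
  rw [hw]; exact hF.isClosed_leaf w

variable {F}

lemma mem_sUnion_congr (h𝓢 : 𝓢 ⊆ F.leaves) {w z : Z} (h : F.leafSetoid w z) :
    w ∈ ⋃₀ 𝓢 ↔ z ∈ ⋃₀ 𝓢 := by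
  have key : ∀ {w z : Z}, F.leafSetoid w z → w ∈ ⋃₀ 𝓢 → z ∈ ⋃₀ 𝓢 := by
    rintro w z h ⟨ω, hω, hw⟩
    refine ⟨ω, hω, ?_⟩
    rw [eq_leaf_of_mem (h𝓢 hω) hw]
    exact F.leafSetoid.symm h
  exact ⟨key h, key (F.leafSetoid.symm h)⟩

/-- A flow box can be shrunk so that it meets a locally finite union of leaves in its central
plaque. -/
lemma FlowBox.exists_adapted (hF : F.HasClosedLineLeaves) (h𝓢 : 𝓢 ⊆ F.leaves)
    {J : Set ℝ} (h0 : (0 : ℝ) ∈ J) (hJ : ∀ r ∈ Ioc (0 : ℝ) 1, ∀ y ∈ J, r * y ∈ J ∧ |y| < 1)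
    (B : F.FlowBox J) (hB : IsOpen B.dom) (hz : B.b (0, 0) ∈ ⋃₀ 𝓢)
    (hJ' : ∀ y, ∀ r ∈ Ioc (0 : ℝ) 1, y ∈ J → |y| < r → y / r ∈ J)
    (hBS : ∀ w ∈ B.dom, w ∈ ⋃₀ 𝓢 → F.leafSetoid w (B.b (0, 0))) :
    ∃ r ∈ Ioc (0 : ℝ) 1, ∃ B' : F.FlowBox J, IsOpen B'.dom ∧
      (∀ p, B'.b p = B.b (r * p.1, r * p.2)) ∧
      ∀ p ∈ Ioo (-1 : ℝ) 1 ×ˢ J, (B'.b p ∈ ⋃₀ 𝓢 ↔ p.2 = 0) := by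
  have h00 : ((0, 0) : ℝ × ℝ) ∈ Ioo (-1 : ℝ) 1 ×ˢ J := ⟨by simp, h0⟩
  -- Inside `N` the leaf through the centre consists of its central plaque only; shrinking by the
  -- factor `r` moves the box into `N`.
  obtain ⟨N, hN, hNl⟩ := B.exists_plaque_nhd hF h00.1 h00.2
  have hpre := B.cont_b _ h00 hN
  rw [mem_map, Metric.mem_nhdsWithin_iff] at hpre
  obtain ⟨δ, hδ, hball⟩ := hpre
  have hr : min δ 1 ∈ Ioc (0 : ℝ) 1 := ⟨lt_min hδ one_pos, min_le_right _ _⟩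
  set r := min δ 1 with hrdef
  have hrx : ∀ x ∈ Ioo (-1 : ℝ) 1, 0 + r * x ∈ Ioo (-1 : ℝ) 1 := fun x hx => by
    rw [zero_add]; constructor <;> nlinarith [hx.1, hx.2, hr.1, hr.2]
  refine ⟨r, hr, B.rescale 0 r 0 r hr.1.ne' hr.1.ne' hrx (fun y hy => by
    rw [zero_add]; exact (hJ r hr y hy).1), ?_, ?_, ?_⟩
  · have : (B.rescale 0 r 0 r hr.1.ne' hr.1.ne' hrx (fun y hy => by
        rw [zero_add]; exact (hJ r hr y hy).1)).dom =
        B.b '' (Ioo (-1) 1 ×ˢ J ∩ Ioo (-r) r ×ˢ Ioo (-r) r) := by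
      apply Subset.antisymm
      · rintro _ ⟨p, hp, rfl⟩
        refine ⟨(0 + r * p.1, 0 + r * p.2), ⟨⟨hrx _ hp.1, ?_⟩, ?_⟩, rfl⟩
        · simp only [zero_add]; exact (hJ r hr _ hp.2).1
        · have h3 := abs_lt.1 (hJ r hr _ hp.2).2
          simp only [zero_add]
          refine ⟨⟨?_, ?_⟩, ⟨?_, ?_⟩⟩ <;> simp only <;> nlinarith [hp.1.1, hp.1.2, hr.1]
      · rintro _ ⟨p, ⟨hp, hp'⟩, rfl⟩
        refine ⟨(p.1 / r, p.2 / r), ⟨⟨?_, ?_⟩, ?_⟩, ?_⟩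
        · rw [lt_div_iff₀ hr.1]; linarith [hp'.1.1]
        · rw [div_lt_iff₀ hr.1]; linarith [hp'.1.2]
        · exact hJ' _ r hr hp.2 (abs_lt.2 hp'.2)
        · change B.b (0 + r * (p.1 / r), 0 + r * (p.2 / r)) = B.b p
          rw [mul_div_cancel₀ _ hr.1.ne', mul_div_cancel₀ _ hr.1.ne', zero_add, zero_add]
    rw [this]
    exact B.isOpen_image_inter hB (isOpen_Ioo.prod isOpen_Ioo)
  · intro p
    change B.b (0 + r * p.1, 0 + r * p.2) = _
    rw [zero_add, zero_add]
  · intro p hp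
    change B.b (0 + r * p.1, 0 + r * p.2) ∈ _ ↔ _
    rw [zero_add, zero_add]
    have hq : ((r * p.1, r * p.2) : ℝ × ℝ) ∈ Ioo (-1 : ℝ) 1 ×ˢ J :=
      ⟨by simpa using hrx _ hp.1, (hJ r hr _ hp.2).1⟩
    constructor
    · intro h
      have h1 := hBS _ (B.b_mem hq) h
      have h2 : B.b (r * p.1, r * p.2) ∈ N := by
        refine hball ⟨?_, hq⟩
        rw [Metric.mem_ball, Prod.dist_eq, max_lt_iff, Real.dist_eq, Real.dist_eq, sub_zero, sub_zero,
          abs_mul, abs_mul, abs_of_pos hr.1]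
        have h3 := (hJ r hr _ hp.2).2
        have h4 := abs_lt.2 hp.1
        have h5 : r ≤ δ := min_le_left _ _
        constructor <;> nlinarith [hr.1]
      obtain ⟨x', hx', hb⟩ := hNl _ h2 h1
      have := congrArg Prod.snd (B.injOn hq ⟨hx', h0⟩ hb)
      simpa [hr.1.ne'] using this
    · intro h
      rw [h, mul_zero]
      exact (mem_sUnion_congr h𝓢 (B.leaf _ hq.1 0 (by simp) 0 h0)).2 hz

/-- At a boundary point a single box serves as both sides. At an interior point an adapted box is
divided by its central plaque, and the halves are its rescalings by `k = 1` and `k = -1`. -/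
lemma exists_sidePair (hF : F.HasClosedLineLeaves) (h𝓢 : 𝓢 ⊆ F.leaves)
    (hfin : LocallyFinite (fun ω : 𝓢 => (ω : Set Z))) {z : Z} (hz : z ∈ ⋃₀ 𝓢) :
    ∃ P : F.SidePair (⋃₀ 𝓢), (P.B true).b (0, 0) = z := by
  obtain ⟨N, hN, hNS⟩ := F.exists_nhd_forall_mem_sUnion hF h𝓢 hfin z
  by_cases hzb : z ∈ F.boundary
  · obtain ⟨B, hB, hBN, hB0, hBb⟩ := F.exists_flowBox_boundary hzb hN
    subst hB0
    obtain ⟨r, hr, B', hB', hb', hB'S⟩ := B.exists_adapted hF h𝓢 (J := Ico 0 1) (by simp)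
      (fun r hr y hy => ⟨⟨mul_nonneg hr.1.le hy.1, by nlinarith [hr.1, hr.2, hy.1, hy.2]⟩, by
        rw [abs_of_nonneg hy.1]; exact hy.2⟩) hB hz
      (fun y r hr hy hyr => ⟨div_nonneg hy.1 hr.1.le, by
        rw [div_lt_one hr.1]; exact (le_abs_self y).trans_lt hyr⟩)
      (fun w hw hwS => hNS w (hBN hw) hwS)
    let H : F.HalfBox (⋃₀ 𝓢) :=
      { B' with
        mem_iff := hB'S
        isOpen_interior := B'.isOpen_image hB' (isOpen_Ioo.prod isOpen_Ioo)
          (prod_mono_right Ioo_subset_Ico_self)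
        nhd := B'.dom
        isOpen_nhd := hB'
        dom_subset := Subset.rfl
        closure_subset := inter_subset_left }
    refine ⟨⟨fun _ => H, fun x _ => rfl, by simpa using hB', Or.inl ⟨rfl, fun x hx => ?_⟩⟩, ?_⟩
    · change B'.b (x, 0) ∈ _
      rw [hb', hBb ((r * ((x, (0 : ℝ)) : ℝ × ℝ).1, r * ((x, (0 : ℝ)) : ℝ × ℝ).2) : ℝ × ℝ) ⟨?_, ?_⟩]
      · simp
      · constructor <;> simp only <;> nlinarith [hx.1, hx.2, hr.1, hr.2]
      · simp
    · change B'.b (0, 0) = _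
      rw [hb']; simp
  · obtain ⟨B, hB, hBN, hB0, hBb⟩ := F.exists_flowBox_interior hzb hN
    subst hB0
    obtain ⟨r, hr, B', hB', hb', hB'S⟩ := B.exists_adapted hF h𝓢 (J := Ioo (-1) 1) (by simp)
      (fun r hr y hy => ⟨by constructor <;> nlinarith [hr.1, hr.2, hy.1, hy.2], abs_lt.2 hy⟩) hB hz
      (fun y r hr hy hyr => abs_lt.1 (by rw [abs_div, abs_of_pos hr.1, div_lt_one hr.1]; exact hyr))
      (fun w hw hwS => hNS w (hBN hw) hwS)
    have hxk : ∀ x ∈ Ioo (-1 : ℝ) 1, 0 + 1 * x ∈ Ioo (-1 : ℝ) 1 := fun x hx => by simpa using hx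
    have hyk : ∀ k : ℝ, |k| = 1 → ∀ y ∈ Ico (0 : ℝ) 1, 0 + k * y ∈ Ioo (-1 : ℝ) 1 :=
      fun k hk y hy => by
        rw [zero_add]
        exact abs_lt.1 (by rw [abs_mul, hk, one_mul, abs_of_nonneg hy.1]; exact hy.2)
    have hmem : ∀ k : ℝ, |k| = 1 → ∀ p ∈ Ioo (-1 : ℝ) 1 ×ˢ Ico (0 : ℝ) 1,
        ((p.1, k * p.2) : ℝ × ℝ) ∈ Ioo (-1 : ℝ) 1 ×ˢ Ioo (-1 : ℝ) 1 := fun k hk p hp =>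
      ⟨hp.1, by simpa using hyk k hk _ hp.2⟩
    -- the two halves
    have hhalf : ∀ k : ℝ, (hk : |k| = 1) → ∃ H : F.HalfBox (⋃₀ 𝓢), ∀ p, H.b p = B'.b (p.1, k * p.2) := by
      intro k hk
      have hk0 : k ≠ 0 := fun h => by simp [h] at hk
      have hkk : k * k = 1 := by rw [← abs_mul_abs_self, hk, one_mul]
      let R := B'.rescale 0 1 0 k one_ne_zero hk0 hxk (hyk k hk)
      have hR : ∀ p, R.b p = B'.b (p.1, k * p.2) := fun p => by
        change B'.b (0 + 1 * p.1, 0 + k * p.2) = _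
        rw [zero_add, zero_add, one_mul]
      have hRdom : R.dom ⊆ B'.dom := by
        rintro _ ⟨p, hp, rfl⟩
        rw [hR]
        exact B'.b_mem (hmem k hk p hp)
      have hmul : ∀ y, k * (k * y) = y := fun y => by rw [← mul_assoc, hkk, one_mul]
      have hRdom' : ∀ w ∈ B'.dom, 0 ≤ k * (B'.c w).2 → w ∈ R.dom := by
        intro w hw h0
        have hc := B'.c_mem hw
        refine ⟨((B'.c w).1, k * (B'.c w).2), ⟨hc.1, h0, ?_⟩, ?_⟩
        · refine (le_abs_self _).trans_lt ?_
          rw [abs_mul, hk, one_mul]; exact abs_lt.2 hc.2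
        · rw [hR]; simp only; rw [hmul]; exact B'.b_c hw
      refine ⟨{ R with
        mem_iff := fun p hp => ?_
        isOpen_interior := ?_
        nhd := B'.dom
        isOpen_nhd := hB'
        dom_subset := hRdom
        closure_subset := ?_ }, hR⟩
      · rw [hR, hB'S _ (hmem k hk p hp)]
        simp [hk0]
      · have : R.b '' (Ioo (-1) 1 ×ˢ Ioo 0 1) =
            B'.b '' (Ioo (-1) 1 ×ˢ (Ioo (-1 : ℝ) 1 ∩ {y | 0 < k * y})) := by
          apply Subset.antisymm
          · rintro _ ⟨p, hp, rfl⟩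
            rw [hR]
            refine ⟨(p.1, k * p.2), ⟨hp.1, (hmem k hk p ⟨hp.1, hp.2.1.le, hp.2.2⟩).2, ?_⟩, rfl⟩
            simp only [mem_ofPred_eq]; rw [hmul]; exact hp.2.1
          · rintro _ ⟨p, ⟨hp, hp2, hp3⟩, rfl⟩
            refine ⟨(p.1, k * p.2), ⟨hp, hp3, ?_⟩, ?_⟩
            · refine (le_abs_self _).trans_lt ?_
              rw [abs_mul, hk, one_mul]; exact abs_lt.2 hp2
            · rw [hR]; simp only; rw [hmul]
        rw [this]
        refine B'.isOpen_image hB' (isOpen_Ioo.prod ?_) (prod_mono_right fun y hy => hy.1)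
        exact isOpen_Ioo.inter (isOpen_lt continuous_const (by fun_prop))
      -- The half is given in the whole box by a weak inequality for a continuous function, so it is
      -- relatively closed.
      · rintro w ⟨hw, hwc⟩
        refine hRdom' w hw ?_
        have hcl : ContinuousWithinAt (fun w => k * (B'.c w).2) B'.dom w :=
          (continuousWithinAt_snd.comp (t := univ) (B'.cont_c w hw) (mapsTo_univ _ _)).const_mul k
        have hcl' := hcl.continuousAt (hB'.mem_nhds hw)
        by_contra hneg
        have hev := hcl'.eventually_lt_const (not_le.1 hneg)
        obtain ⟨v, hv1, hv2⟩ := mem_closure_iff_nhds.1 hwc _ hev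
        obtain ⟨p, hp, rfl⟩ := hv2
        have hv1' : k * (B'.c (R.b p)).2 < 0 := hv1
        rw [hR, B'.left_inv _ (hmem k hk p hp)] at hv1'
        simp only at hv1'
        rw [hmul] at hv1'
        exact absurd hp.2.1 (not_le.2 hv1')
    obtain ⟨H₁, hH₁⟩ := hhalf 1 (by simp)
    obtain ⟨H₂, hH₂⟩ := hhalf (-1) (by simp)
    refine ⟨⟨fun e => if e then H₁ else H₂, fun x hx => ?_, ?_, Or.inr ⟨?_, fun x hx => ?_⟩⟩, ?_⟩
    · simp [hH₁, hH₂]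
    · have : H₁.dom ∪ H₂.dom = B'.dom := by
        apply Subset.antisymm
        · rintro _ (⟨p, hp, rfl⟩ | ⟨p, hp, rfl⟩)
          · rw [hH₁]; exact B'.b_mem (hmem 1 (by simp) p hp)
          · rw [hH₂]; exact B'.b_mem (hmem (-1) (by simp) p hp)
        · rintro _ ⟨p, hp, rfl⟩
          rcases le_total 0 p.2 with h | h
          · exact Or.inl ⟨p, ⟨hp.1, h, hp.2.2⟩, by rw [hH₁]; simp⟩
          · exact Or.inr ⟨(p.1, -p.2), ⟨hp.1, by simpa using h, by linarith [hp.2.1]⟩, by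
              rw [hH₂]; simp⟩
      simpa [this] using hB'
    · rw [disjoint_left]
      simp only [if_true]
      rintro _ ⟨p, hp, rfl⟩ ⟨q, hq, h⟩
      simp only [Bool.false_eq_true, if_false] at h
      rw [hH₁, hH₂] at h
      have := congrArg Prod.snd (B'.injOn (hmem (-1) (by simp) q ⟨hq.1, hq.2.1.le, hq.2.2⟩)
        (hmem 1 (by simp) p ⟨hp.1, hp.2.1.le, hp.2.2⟩) h)
      simp only at this
      linarith [hp.2.1, hq.2.1]
    · simp only [if_true]
      rw [hH₁, hb']
      refine hBb _ ⟨?_, by simp⟩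
      constructor <;> simp only <;> nlinarith [hx.1, hx.2, hr.1, hr.2]
    · simp only [if_true]
      rw [hH₁, hb']; simp

end Foliation

/-! ### Boundary leaves, product neighbourhoods and leaf coordinates. -/

namespace Foliation

variable {Z : Type*} [TopologicalSpace Z] (F : Foliation Z)

lemma locallyFinite_coe_iff {𝓢 : Set (Set Z)} : LocallyFinite (fun ω : 𝓢 => (ω : Set Z)) ↔
    ∀ z, ∃ N ∈ 𝓝 z, {ω ∈ 𝓢 | (ω ∩ N).Nonempty}.Finite := by
  refine forall_congr' fun z => exists_congr fun N => and_congr_right fun _ => ?_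
  have : {ω ∈ 𝓢 | (ω ∩ N).Nonempty} = Subtype.val '' {ω : 𝓢 | ((ω : Set Z) ∩ N).Nonempty} := by
    ext ω
    constructor
    · rintro ⟨h1, h2⟩; exact ⟨⟨ω, h1⟩, h2, rfl⟩
    · rintro ⟨ω, h, rfl⟩; exact ⟨ω.2, h⟩
  rw [this, finite_image_iff Subtype.val_injective.injOn]

lemma locallyFinite_coe_union {𝓢 𝓣 : Set (Set Z)}
    (h : LocallyFinite (fun ω : 𝓢 => (ω : Set Z))) (h' : LocallyFinite (fun ω : 𝓣 => (ω : Set Z))) :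
    LocallyFinite (fun ω : (𝓢 ∪ 𝓣 : Set (Set Z)) => (ω : Set Z)) := by
  rw [locallyFinite_coe_iff] at *
  intro z
  obtain ⟨N, hN, hf⟩ := h z
  obtain ⟨N', hN', hf'⟩ := h' z
  refine ⟨N ∩ N', inter_mem hN hN', (hf.union hf').subset ?_⟩
  rintro ω ⟨hω | hω, hne⟩
  · exact Or.inl ⟨hω, hne.mono (inter_subset_inter_right _ inter_subset_left)⟩
  · exact Or.inr ⟨hω, hne.mono (inter_subset_inter_right _ inter_subset_right)⟩

/-- The leaves contained in the boundary of the surface. -/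
def boundaryLeaves : Set (Set Z) := {ω ∈ F.leaves | ω ⊆ F.boundary}

/-- A box at a boundary point meets the boundary in one plaque, and a box at an interior point
avoids it. -/
lemma locallyFinite_boundaryLeaves :
    LocallyFinite (fun ω : F.boundaryLeaves => (ω : Set Z)) := by
  rw [locallyFinite_coe_iff]
  intro z
  by_cases hz : z ∈ F.boundary
  · obtain ⟨B, hB, -, hB0, hBb⟩ := F.exists_flowBox_boundary hz univ_mem
    have h0 : ((0, 0) : ℝ × ℝ) ∈ Ioo (-1 : ℝ) 1 ×ˢ Ico (0 : ℝ) 1 := by simp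
    refine ⟨B.dom, hB.mem_nhds (hB0 ▸ B.b_mem h0), (finite_singleton (F.leaf z)).subset ?_⟩
    rintro ω ⟨⟨hω, hωb⟩, _, hw, p, hp, rfl⟩
    have h2 : p.2 = 0 := (hBb p hp).1 (hωb hw)
    rw [mem_singleton_iff, eq_leaf_of_mem hω hw]
    refine leaf_eq ?_
    have := B.leaf p.1 hp.1 0 h0.1 p.2 hp.2
    rw [h2, hB0] at this
    rwa [show p = (p.1, 0) from Prod.ext rfl h2]
  · obtain ⟨B, hB, -, hB0, hBb⟩ := F.exists_flowBox_interior hz univ_mem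
    refine ⟨B.dom, hB.mem_nhds (hB0 ▸ B.b_mem (by simp)), finite_empty.subset ?_⟩
    rintro ω ⟨⟨hω, hωb⟩, _, hw, p, hp, rfl⟩
    exact absurd (hωb hw) (hBb p hp)

/-- A saturated open set foliated as a product of a line and an interval. -/
structure ProductBox where
  e : ℝ × ℝ → Z
  g : Z → ℝ × ℝ
  isOpen_image : IsOpen (e '' (univ ×ˢ Ioo (-1) 1))
  cont_e : ContinuousOn e (univ ×ˢ Ioo (-1) 1)
  cont_g : ContinuousOn g (e '' (univ ×ˢ Ioo (-1) 1))
  left_inv : ∀ p ∈ (univ : Set ℝ) ×ˢ Ioo (-1 : ℝ) 1, g (e p) = p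
  leaf_iff : ∀ p ∈ (univ : Set ℝ) ×ˢ Ioo (-1 : ℝ) 1, ∀ w, F.leafSetoid w (e p) ↔
    ∃ x, w = e (x, p.2)
  -- This is where regularity speaks of the closure of the neighbourhood. It yields the Hausdorff
  -- property of the leaf space, and keeps limits of convergent levels inside a piece.
  isClosed : ∀ ρ < 1, IsClosed (e '' (univ ×ˢ Icc (-ρ) ρ))

lemma exists_productBox {z : Z} (hz : z ∉ F.boundary) (hreg : F.IsRegularLeaf (F.leaf z)) :
    ∃ B : F.ProductBox, ∃ x, B.e (x, 0) = z := by
  classical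
  rcases hreg with ⟨-, U, hU, hzU, hsat, h, hleaf, hmem, hzero⟩ | ⟨hb, -⟩
  swap
  · exact absurd (hb (F.mem_leaf_self z)) hz
  have hIcc : ∀ s ∈ Icc (-1 : ℝ) 1, ((projIcc (-1 : ℝ) 1 (by norm_num) s : Icc (-1 : ℝ) 1) : ℝ) = s :=
    fun s hs => by rw [projIcc_of_mem _ hs]
  -- Projecting heights to `[-1, 1]` defines the inverse of `h` on the whole plane; only its values
  -- on the strip matter.
  let e' : ℝ × ℝ → closure U := fun p => h.symm (p.1, projIcc (-1) 1 (by norm_num) p.2)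
  have he' : Continuous e' := h.symm.continuous.comp
    (continuous_fst.prodMk (continuous_projIcc.comp continuous_snd))
  have hhe : ∀ p, h (e' p) = (p.1, projIcc (-1) 1 (by norm_num) p.2) := fun p =>
    h.apply_symm_apply _
  have heh : ∀ w : closure U, e' ((h w).1, (h w).2) = w := fun w => by
    simp only [e']
    rw [projIcc_val]
    exact h.symm_apply_apply w
  let g : Z → ℝ × ℝ := fun w => if hw : w ∈ closure U then ((h ⟨w, hw⟩).1, (h ⟨w, hw⟩).2) else 0
  have hgc : ContinuousOn g (closure U) := by
    rw [continuousOn_iff_continuous_domRestrict]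
    have : (closure U).domRestrict g = fun w => ((h w).1, ((h w).2 : ℝ)) := by
      ext w <;> simp [g]
    rw [this]
    exact (continuous_fst.comp h.continuous).prodMk
      (continuous_subtype_val.comp (continuous_snd.comp h.continuous))
  have hUI : ∀ p : ℝ × ℝ, p.2 ∈ Icc (-1 : ℝ) 1 → ((e' p : Z) ∈ U ↔ p.2 ∈ Ioo (-1 : ℝ) 1) :=
    fun p hp => by rw [hmem, hhe, hIcc _ hp]
  have himg : (fun p => (e' p : Z)) '' (univ ×ˢ Ioo (-1) 1) = U := by
    apply Subset.antisymm
    · rintro _ ⟨p, hp, rfl⟩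
      exact (hUI p (Ioo_subset_Icc_self hp.2)).2 hp.2
    · intro w hw
      refine ⟨((h ⟨w, subset_closure hw⟩).1, ((h ⟨w, subset_closure hw⟩).2 : ℝ)),
        ⟨mem_univ _, (hmem ⟨w, subset_closure hw⟩).1 hw⟩, ?_⟩
      exact congrArg Subtype.val (heh ⟨w, subset_closure hw⟩)
  refine ⟨⟨fun p => e' p, g, ?_, ?_, ?_, ?_, ?_, ?_⟩, ?_⟩
  · rw [himg]; exact hU
  · exact (continuous_subtype_val.comp he').continuousOn
  · rw [himg]; exact hgc.mono subset_closure
  · intro p hp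
    simp only [g]
    rw [dif_pos (e' p).2, Subtype.coe_eta, hhe, hIcc _ (Ioo_subset_Icc_self hp.2)]
  · intro p hp w
    have hpU : (e' p : Z) ∈ U := (hUI p (Ioo_subset_Icc_self hp.2)).2 hp.2
    constructor
    · intro hw
      have hwU : w ∈ U := hsat _ (F.leaf_mem_leaves (e' p)) ⟨_, F.mem_leaf_self _, hpU⟩ hw
      have h1 := (hleaf ⟨w, subset_closure hwU⟩ (e' p)).1 hw
      refine ⟨(h ⟨w, subset_closure hwU⟩).1, ?_⟩
      have h2 := congrArg Subtype.val (heh ⟨w, subset_closure hwU⟩)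
      have h3 : ((h ⟨w, subset_closure hwU⟩).2 : ℝ) = p.2 := by
        rw [h1, hhe]; exact hIcc _ (Ioo_subset_Icc_self hp.2)
      rw [h3] at h2
      exact h2.symm
    · rintro ⟨x, rfl⟩
      rw [hleaf, hhe, hhe]
  · intro ρ hρ
    have : (fun p => (e' p : Z)) '' (univ ×ˢ Icc (-ρ) ρ) =
        Subtype.val '' {w : closure U | ((h w).2 : ℝ) ∈ Icc (-ρ) ρ} := by
      apply Subset.antisymm
      · rintro _ ⟨p, hp, rfl⟩
        refine ⟨e' p, ?_, rfl⟩
        rw [mem_ofPred_eq, hhe, hIcc _ ⟨by linarith [hp.2.1], by linarith [hp.2.2]⟩]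
        exact hp.2
      · rintro _ ⟨w, hw, rfl⟩
        exact ⟨((h w).1, ((h w).2 : ℝ)), ⟨mem_univ _, hw⟩, congrArg Subtype.val (heh w)⟩
    rw [this]
    refine isClosed_closure.isClosedEmbedding_subtypeVal.isClosedMap _ ?_
    exact isClosed_Icc.preimage (continuous_subtype_val.comp (continuous_snd.comp h.continuous))
  · have hzc : z ∈ closure U := subset_closure (hzU (F.mem_leaf_self z))
    refine ⟨(h ⟨z, hzc⟩).1, ?_⟩
    have h1 : ((h ⟨z, hzc⟩).2 : ℝ) = 0 := (hzero ⟨z, hzc⟩).1 (F.mem_leaf_self z)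
    have h2 := congrArg Subtype.val (heh ⟨z, hzc⟩)
    rw [h1] at h2
    exact h2

namespace ProductBox

variable {F} (B : F.ProductBox)

def dom : Set Z := B.e '' (univ ×ˢ Ioo (-1) 1)

lemma e_mem {x s : ℝ} (hs : s ∈ Ioo (-1 : ℝ) 1) : B.e (x, s) ∈ B.dom := ⟨_, ⟨mem_univ _, hs⟩, rfl⟩

lemma g_e {x s : ℝ} (hs : s ∈ Ioo (-1 : ℝ) 1) : B.g (B.e (x, s)) = (x, s) :=
  B.left_inv _ ⟨mem_univ _, hs⟩

lemma g_mem {w : Z} (hw : w ∈ B.dom) : (B.g w).2 ∈ Ioo (-1 : ℝ) 1 := by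
  obtain ⟨p, hp, rfl⟩ := hw
  rw [B.left_inv p hp]; exact hp.2

lemma e_g {w : Z} (hw : w ∈ B.dom) : B.e (B.g w) = w := by
  obtain ⟨p, hp, rfl⟩ := hw
  rw [B.left_inv p hp]

lemma mem_dom_of_rel {w z : Z} (h : F.leafSetoid w z) (hz : z ∈ B.dom) : w ∈ B.dom := by
  obtain ⟨p, hp, rfl⟩ := hz
  obtain ⟨x, rfl⟩ := (B.leaf_iff p hp w).1 h
  exact B.e_mem hp.2

lemma rel_iff {w z : Z} (hw : w ∈ B.dom) (hz : z ∈ B.dom) :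
    F.leafSetoid w z ↔ (B.g w).2 = (B.g z).2 := by
  obtain ⟨p, hp, rfl⟩ := hz
  rw [B.leaf_iff p hp, B.left_inv p hp]
  constructor
  · rintro ⟨x, rfl⟩
    rw [B.g_e hp.2]
  · intro h
    refine ⟨(B.g w).1, ?_⟩
    rw [← h]; exact (B.e_g hw).symm

lemma rel_e {s : ℝ} (hs : s ∈ Ioo (-1 : ℝ) 1) (x x' : ℝ) :
    F.leafSetoid (B.e (x, s)) (B.e (x', s)) := by
  rw [B.rel_iff (B.e_mem hs) (B.e_mem hs), B.g_e hs, B.g_e hs]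

lemma continuous_e {s : ℝ} (hs : s ∈ Ioo (-1 : ℝ) 1) : Continuous fun x => B.e (x, s) := by
  rw [← continuousOn_univ]
  exact B.cont_e.comp (by fun_prop) fun x _ => ⟨mem_univ _, hs⟩

lemma continuousOn_e (x : ℝ) : ContinuousOn (fun s => B.e (x, s)) (Ioo (-1) 1) :=
  B.cont_e.comp (by fun_prop) fun _ hs => ⟨mem_univ _, hs⟩

lemma isOpen_dom : IsOpen B.dom := B.isOpen_image

lemma continuousOn_g : ContinuousOn B.g B.dom := B.cont_g

end ProductBox

/-- A function that parametrizes every leaf. -/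
def IsLeafCoordinate (Θ : Z → ℝ) : Prop :=
  ∀ z, ∃ γ : ℝ → Z, IsClosedEmbedding γ ∧ range γ = F.leaf z ∧ ∀ u, Θ (γ u) = u

variable {F}

/-- One parametrization is chosen per leaf, through a representative point. Nothing is claimed
transversally: a leaf coordinate need not be continuous from leaf to leaf. -/
lemma HasClosedLineLeaves.exists_isLeafCoordinate (hF : F.HasClosedLineLeaves) :
    ∃ Θ : Z → ℝ, F.IsLeafCoordinate Θ := by
  choose γ hγ hr using hF
  let out : Z → Z := fun z => (Quotient.mk F.leafSetoid z).out
  have hout : ∀ z, F.leafSetoid (out z) z := fun z => Quotient.mk_out (s := F.leafSetoid) z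
  have hmem : ∀ z, ∃ u, γ (out z) u = z := fun z => by
    have : z ∈ range (γ (out z)) := by
      rw [hr]; exact F.leafSetoid.symm (hout z)
    exact this
  choose Θ hΘ using hmem
  refine ⟨Θ, fun z => ⟨γ (out z), hγ _, by rw [hr, leaf_eq (hout z)], fun u => ?_⟩⟩
  have h1 : F.leafSetoid (γ (out z) u) z := by
    have : γ (out z) u ∈ F.leaf (out z) := hr (out z) ▸ mem_range_self u
    exact F.leafSetoid.trans this (hout z)
  have h2 : out (γ (out z) u) = out z := by
    simp only [out]
    rw [Quotient.sound (s := F.leafSetoid) h1]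
  have h3 := hΘ (γ (out z) u)
  rw [h2] at h3
  exact (hγ _).injective h3

lemma IsLeafCoordinate.injOn {Θ : Z → ℝ} (hΘ : F.IsLeafCoordinate Θ) {z w : Z}
    (h : F.leafSetoid w z) (he : Θ w = Θ z) : w = z := by
  obtain ⟨γ, hγ, hr, hu⟩ := hΘ z
  have h1 : w ∈ range γ := hr ▸ h
  have h2 : z ∈ range γ := hr ▸ F.mem_leaf_self z
  obtain ⟨u, rfl⟩ := h1
  obtain ⟨v, rfl⟩ := h2
  rw [hu, hu] at he
  rw [he]

/-- Within a single leaf continuity can be tested after composition with the embedding `γ`, which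
`Θ` inverts. -/
lemma IsLeafCoordinate.continuousOn_comp {Θ : Z → ℝ} (hΘ : F.IsLeafCoordinate Θ) {z : Z}
    {α : Type*} [TopologicalSpace α] {f : α → Z} {s : Set α} (hf : ContinuousOn f s)
    (hfz : ∀ x ∈ s, F.leafSetoid (f x) z) : ContinuousOn (fun x => Θ (f x)) s := by
  obtain ⟨γ, hγ, hr, hu⟩ := hΘ z
  have h1 : ∀ x ∈ s, γ (Θ (f x)) = f x := fun x hx => by
    have : f x ∈ range γ := hr ▸ hfz x hx
    obtain ⟨u, hux⟩ := this
    rw [← hux, hu]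
  rw [hγ.isInducing.continuousOn_iff]
  exact hf.congr h1

/-- The direction, with respect to a leaf coordinate, of the lines of a product box. -/
lemma ProductBox.strictMono_or_strictAnti {Θ : Z → ℝ} (hΘ : F.IsLeafCoordinate Θ)
    (B : F.ProductBox) {s : ℝ} (hs : s ∈ Ioo (-1 : ℝ) 1) :
    StrictMono (fun x => Θ (B.e (x, s))) ∨ StrictAnti (fun x => Θ (B.e (x, s))) := by
  refine Continuous.strictMono_of_inj ?_ ?_
  · rw [← continuousOn_univ]
    exact hΘ.continuousOn_comp (z := B.e (0, s)) (B.continuous_e hs).continuousOn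
      fun x _ => B.rel_e hs x 0
  · intro x y hxy
    have := hΘ.injOn (B.rel_e hs x y) hxy
    have h2 := congrArg B.g this
    rw [B.g_e hs, B.g_e hs] at h2
    exact congrArg Prod.fst h2

end Foliation

/-! ### The leaf space as a one-dimensional manifold with signs. -/

namespace Foliation

variable {Z : Type*} [TopologicalSpace Z] {F : Foliation Z}

lemma isOpenMap_mk (F : Foliation Z) : IsOpenMap (Quotient.mk F.leafSetoid) := by
  intro V hV
  change IsOpen ((Quotient.mk F.leafSetoid) ⁻¹' (Quotient.mk F.leafSetoid '' V))
  convert F.isOpen_saturation hV using 1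
  ext w
  simp only [mem_preimage, mem_image]
  exact exists_congr fun v => and_congr_right fun _ =>
    ⟨fun h => F.leafSetoid.symm (Quotient.exact h), fun h => Quotient.sound (F.leafSetoid.symm h)⟩

lemma nhds_mk (F : Foliation Z) (z : Z) :
    𝓝 (Quotient.mk F.leafSetoid z) = map (Quotient.mk F.leafSetoid) (𝓝 z) :=
  le_antisymm (F.isOpenMap_mk.nhds_le z) (continuous_quotient_mk'.tendsto z)

namespace ProductBox

/-- A product box gives a chart of the leaf space. -/
noncomputable def chart (B : F.ProductBox) : OpenPartialHomeomorph (Quotient F.leafSetoid) ℝ where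
  toFun := Quotient.lift (fun z => open scoped Classical in if z ∈ B.dom then (B.g z).2 else 0) (by
    intro z w h
    have h' : F.leafSetoid z w := h
    by_cases hw : w ∈ B.dom
    · have hz := B.mem_dom_of_rel h' hw
      simp only [if_pos hw, if_pos hz]
      exact (B.rel_iff hz hw).1 h'
    · have hz : z ∉ B.dom := fun hz => hw (B.mem_dom_of_rel (F.leafSetoid.symm h') hz)
      simp only [if_neg hw, if_neg hz])
  invFun := fun s => Quotient.mk F.leafSetoid (B.e (0, s))
  source := Quotient.mk F.leafSetoid '' B.dom
  target := Ioo (-1) 1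
  map_source' := by
    rintro _ ⟨z, hz, rfl⟩
    simp only [Quotient.lift_mk, if_pos hz]
    exact B.g_mem hz
  map_target' := fun s hs => ⟨_, B.e_mem hs, rfl⟩
  left_inv' := by
    rintro _ ⟨z, hz, rfl⟩
    simp only [Quotient.lift_mk, if_pos hz]
    refine Quotient.sound ?_
    change F.leafSetoid _ _
    rw [B.rel_iff (B.e_mem (B.g_mem hz)) hz, B.g_e (B.g_mem hz)]
  right_inv' := fun s hs => by
    simp only [Quotient.lift_mk, if_pos (B.e_mem hs), B.g_e hs]
  open_source := F.isOpenMap_mk _ B.isOpen_dom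
  open_target := isOpen_Ioo
  continuousOn_toFun := by
    rintro _ ⟨z, hz, rfl⟩
    refine ContinuousAt.continuousWithinAt ?_
    rw [ContinuousAt, nhds_mk, tendsto_map'_iff]
    simp only [Quotient.lift_mk, if_pos hz]
    have h := (continuous_snd.comp_continuousOn B.continuousOn_g).continuousAt
      (B.isOpen_dom.mem_nhds hz)
    refine (show Tendsto (fun z => (B.g z).2) (𝓝 z) (𝓝 (B.g z).2) from h).congr' ?_
    filter_upwards [B.isOpen_dom.mem_nhds hz] with w hw
    simp only [Function.comp, Quotient.lift_mk, if_pos hw]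
  continuousOn_invFun := continuous_quotient_mk'.comp_continuousOn (B.continuousOn_e 0)

lemma chart_mk (B : F.ProductBox) {z : Z} (hz : z ∈ B.dom) :
    B.chart (Quotient.mk F.leafSetoid z) = (B.g z).2 := by
  classical
  have h : B.chart (Quotient.mk F.leafSetoid z) = if z ∈ B.dom then (B.g z).2 else 0 := by
    simp only [chart]
    congr
  rw [h, if_pos hz]

lemma mk_mem_chart_source (B : F.ProductBox) {z : Z} :
    Quotient.mk F.leafSetoid z ∈ B.chart.source ↔ z ∈ B.dom := by
  constructor
  · rintro ⟨w, hw, h⟩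
    exact B.mem_dom_of_rel (F.leafSetoid.symm (Quotient.exact h)) hw
  · exact fun h => ⟨z, h, rfl⟩

open scoped Classical in
/-- The sign of a product box on a leaf, with respect to a leaf coordinate. -/
noncomputable def sign (Θ : Z → ℝ) (B : F.ProductBox) (m : Quotient F.leafSetoid) : ℤˣ :=
  if Θ (B.e (0, B.chart m)) < Θ (B.e (1, B.chart m)) then 1 else -1

lemma lt_iff_of_sign_eq_one {Θ : Z → ℝ} (hΘ : F.IsLeafCoordinate Θ) (B : F.ProductBox)
    {z w : Z} (hz : z ∈ B.dom) (hw : F.leafSetoid w z)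
    (hs : B.sign Θ (Quotient.mk F.leafSetoid z) = 1) :
    Θ w < Θ z ↔ (B.g w).1 < (B.g z).1 := by
  have hw' := B.mem_dom_of_rel hw hz
  have hgz := B.g_mem hz
  have hlt : Θ (B.e (0, (B.g z).2)) < Θ (B.e (1, (B.g z).2)) := by
    by_contra h
    simp only [sign, B.chart_mk hz, if_neg h] at hs
    exact absurd hs (by decide)
  have hew : B.e ((B.g w).1, (B.g z).2) = w := by
    rw [← (B.rel_iff hw' hz).1 hw]; exact B.e_g hw'
  have hez : B.e ((B.g z).1, (B.g z).2) = z := B.e_g hz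
  rcases B.strictMono_or_strictAnti hΘ hgz with h | h
  · rw [← h.lt_iff_lt (a := (B.g w).1), hew, hez]
  · exact absurd (h zero_lt_one) (not_lt.2 hlt.le)

lemma lt_iff_of_sign_eq_neg_one {Θ : Z → ℝ} (hΘ : F.IsLeafCoordinate Θ) (B : F.ProductBox)
    {z w : Z} (hz : z ∈ B.dom) (hw : F.leafSetoid w z)
    (hs : B.sign Θ (Quotient.mk F.leafSetoid z) = -1) :
    Θ w < Θ z ↔ (B.g z).1 < (B.g w).1 := by
  have hw' := B.mem_dom_of_rel hw hz
  have hgz := B.g_mem hz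
  have hlt : ¬ Θ (B.e (0, (B.g z).2)) < Θ (B.e (1, (B.g z).2)) := by
    intro h
    simp only [sign, B.chart_mk hz, if_pos h] at hs
    exact absurd hs (by decide)
  have hew : B.e ((B.g w).1, (B.g z).2) = w := by
    rw [← (B.rel_iff hw' hz).1 hw]; exact B.e_g hw'
  have hez : B.e ((B.g z).1, (B.g z).2) = z := B.e_g hz
  rcases B.strictMono_or_strictAnti hΘ hgz with h | h
  · exact absurd (h zero_lt_one) hlt
  · have := h.lt_iff_gt (a := (B.g w).1) (b := (B.g z).1)
    simp only [hew, hez] at this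
    exact this

/-- The product compares the directions of the two boxes directly, so the arbitrary leaf coordinate
cancels. This is what makes products of signs locally constant although the signs themselves are
not. -/
lemma sign_eq_sign_mul {Θ : Z → ℝ} (hΘ : F.IsLeafCoordinate Θ) (B B' : F.ProductBox) {s : ℝ}
    (hs : s ∈ Ioo (-1 : ℝ) 1) (hB' : B.e (0, s) ∈ B'.dom) :
    B.sign Θ (Quotient.mk F.leafSetoid (B.e (0, s))) *
      B'.sign Θ (Quotient.mk F.leafSetoid (B.e (0, s))) =
    if (B'.g (B.e (0, s))).1 < (B'.g (B.e (1, s))).1 then 1 else -1 := by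
  have hrel : F.leafSetoid (B.e (0, s)) (B.e (1, s)) := B.rel_e hs 0 1
  have h1 : B.e (1, s) ∈ B'.dom := B'.mem_dom_of_rel (F.leafSetoid.symm hrel) hB'
  have hq : Quotient.mk F.leafSetoid (B.e (0, s)) = Quotient.mk F.leafSetoid (B.e (1, s)) :=
    Quotient.sound hrel
  rw [hq]
  have hg0 : (B.g (B.e (0, s))).1 < (B.g (B.e (1, s))).1 := by
    rw [B.g_e hs, B.g_e hs]; exact zero_lt_one
  have hne : (B'.g (B.e (0, s))).1 ≠ (B'.g (B.e (1, s))).1 := by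
    intro h
    have h2 := (B'.rel_iff hB' h1).1 hrel
    have h3 : B'.g (B.e (0, s)) = B'.g (B.e (1, s)) := Prod.ext h h2
    have h4 : B.e (0, s) = B.e (1, s) := by rw [← B'.e_g hB', h3, B'.e_g h1]
    rw [h4] at hg0
    exact lt_irrefl _ hg0
  rcases Int.units_eq_one_or (B.sign Θ (Quotient.mk F.leafSetoid (B.e (1, s)))) with h | h <;>
  rcases Int.units_eq_one_or (B'.sign Θ (Quotient.mk F.leafSetoid (B.e (1, s)))) with h' | h'
  · have e := (B.lt_iff_of_sign_eq_one hΘ (B.e_mem hs) hrel h).2 hg0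
    rw [if_pos ((B'.lt_iff_of_sign_eq_one hΘ h1 hrel h').1 e), h, h']; rfl
  · have e := (B.lt_iff_of_sign_eq_one hΘ (B.e_mem hs) hrel h).2 hg0
    rw [if_neg ((B'.lt_iff_of_sign_eq_neg_one hΘ h1 hrel h').1 e).not_gt, h, h']; rfl
  · have e : ¬ Θ (B.e (0, s)) < Θ (B.e (1, s)) := fun e =>
      ((B.lt_iff_of_sign_eq_neg_one hΘ (B.e_mem hs) hrel h).1 e).not_gt hg0
    rw [if_neg fun h2 => e ((B'.lt_iff_of_sign_eq_one hΘ h1 hrel h').2 h2), h, h']; rfl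
  · have e : ¬ Θ (B.e (0, s)) < Θ (B.e (1, s)) := fun e =>
      ((B.lt_iff_of_sign_eq_neg_one hΘ (B.e_mem hs) hrel h).1 e).not_gt hg0
    rw [if_pos (lt_of_not_ge fun h2 => e ((B'.lt_iff_of_sign_eq_neg_one hΘ h1 hrel h').2
      (lt_of_le_of_ne h2 hne.symm))), h, h']; rfl

/-- By `sign_eq_sign_mul` the product is the sign of a difference of coordinates that is continuous
in the level and never zero. -/
lemma continuousOn_sign_mul {Θ : Z → ℝ} (hΘ : F.IsLeafCoordinate Θ) (B B' : F.ProductBox) :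
    ContinuousOn (fun m => B.sign Θ m * B'.sign Θ m) (B.chart.source ∩ B'.chart.source) := by
  rintro m ⟨hm, hm'⟩
  refine ContinuousAt.continuousWithinAt ?_
  set s₀ := B.chart m with hs₀
  have hs : s₀ ∈ Ioo (-1 : ℝ) 1 := B.chart.map_source hm
  have hmq : Quotient.mk F.leafSetoid (B.e (0, s₀)) = m := B.chart.left_inv hm
  have hd : B.e (0, s₀) ∈ B'.dom := by rwa [← B'.mk_mem_chart_source, hmq]
  have hd1 : B.e (1, s₀) ∈ B'.dom := B'.mem_dom_of_rel (B.rel_e hs 1 0) hd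
  -- the difference of coordinates in `B'` is continuous and does not vanish
  let k : ℝ → ℝ := fun s => (B'.g (B.e (1, s))).1 - (B'.g (B.e (0, s))).1
  have hIoo : Ioo (-1 : ℝ) 1 ∈ 𝓝 s₀ := Ioo_mem_nhds hs.1 hs.2
  have hca : ∀ x, B.e (x, s₀) ∈ B'.dom → ContinuousAt (fun s => (B'.g (B.e (x, s))).1) s₀ := by
    intro x hx
    refine ContinuousAt.fst (ContinuousAt.comp (g := B'.g) (f := fun s => B.e (x, s)) ?_
      ((B.continuousOn_e x).continuousAt hIoo))
    exact B'.continuousOn_g.continuousAt (B'.isOpen_dom.mem_nhds hx)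
  have hk : ContinuousAt k s₀ := (hca 1 hd1).sub (hca 0 hd)
  have hdom : ∀ᶠ s in 𝓝 s₀, B.e (0, s) ∈ B'.dom :=
    ((B.continuousOn_e 0).continuousAt hIoo).eventually_mem (B'.isOpen_dom.mem_nhds hd)
  have hne : k s₀ ≠ 0 := by
    intro h
    have h1 : (B'.g (B.e (1, s₀))).1 = (B'.g (B.e (0, s₀))).1 := sub_eq_zero.1 h
    have h2 := (B'.rel_iff hd1 hd).1 (B.rel_e hs 1 0)
    have h3 : B.e (1, s₀) = B.e (0, s₀) := by rw [← B'.e_g hd1, Prod.ext h1 h2, B'.e_g hd]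
    have h4 := congrArg B.g h3
    rw [B.g_e hs, B.g_e hs] at h4
    exact one_ne_zero (congrArg Prod.fst h4)
  have hev : ∀ᶠ s in 𝓝 s₀, (0 < k s ↔ 0 < k s₀) := by
    rcases hne.lt_or_gt with h | h
    · filter_upwards [hk.eventually_lt_const h] with s hs1
      exact ⟨fun h' => absurd h' hs1.not_gt, fun h' => absurd h' h.not_gt⟩
    · filter_upwards [hk.eventually_const_lt h] with s hs1
      exact ⟨fun _ => h, fun _ => hs1⟩
  have hcm : ContinuousAt B.chart m := B.chart.continuousAt hm
  have hall := hcm.eventually (((hev.and hdom).and hIoo))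
  refine ContinuousAt.congr (f := fun _ => B.sign Θ m * B'.sign Θ m) continuousAt_const ?_
  filter_upwards [hall, B.chart.open_source.mem_nhds hm] with n ⟨⟨hn1, hn2⟩, hn3⟩ hn4
  have hnq : Quotient.mk F.leafSetoid (B.e (0, B.chart n)) = n := B.chart.left_inv hn4
  have e1 := B.sign_eq_sign_mul hΘ B' hs hd
  have e2 := B.sign_eq_sign_mul hΘ B' hn3 hn2
  rw [hmq] at e1
  rw [hnq] at e2
  rw [e1, e2]
  have : ((B'.g (B.e (0, s₀))).1 < (B'.g (B.e (1, s₀))).1) ↔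
      ((B'.g (B.e (0, B.chart n))).1 < (B'.g (B.e (1, B.chart n))).1) := by
    have := hn1
    simp only [k, sub_pos] at this
    exact this.symm
  simp only [this]

end ProductBox

end Foliation

/-! ### Cutting the surface into coherently oriented pieces. -/

/-- The form of `exists_interval_chart` needed for a component of an open part of a leaf space:
separation is asked only inside `C`, since singular leaves may spoil it elsewhere, and the interval
is normalized to `(-1, 1)`. -/
theorem exists_interval_chart_of_isOpen {M ι : Type*} [TopologicalSpace M]
    [SecondCountableTopology M] {C : Set M} (hC : IsOpen C) (hpre : IsPreconnected C)
    (hne : C.Nonempty)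
    (hsep : ∀ x ∈ C, ∀ y ∈ C, x ≠ y → ∃ u v, IsOpen u ∧ IsOpen v ∧ x ∈ u ∧ y ∈ v ∧ Disjoint u v)
    (φ : ι → OpenPartialHomeomorph M ℝ) (hcov : ∀ x ∈ C, ∃ i, x ∈ (φ i).source) (σ : ι → M → ℤˣ)
    (hσ : ∀ i j, ContinuousOn (fun x => σ i x * σ j x) ((φ i).source ∩ (φ j).source)) :
    ∃ (U : Set M) (h : M → ℝ) (o : M → ℤˣ), IsOpen U ∧ U ⊆ C ∧ (C \ U).Subsingleton ∧
      ContinuousOn h U ∧ InjOn h U ∧ (∀ x ∈ U, ∀ N ∈ 𝓝 x, h '' N ∈ 𝓝 (h x)) ∧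
      h '' U = Ioo (-1) 1 ∧ ∀ i, ContinuousOn (fun x => σ i x * o x) (U ∩ (φ i).source) := by
  classical
  let O : TopologicalSpace.Opens M := ⟨C, hC⟩
  have hO : Nonempty O := ⟨⟨hne.some, hne.some_mem⟩⟩
  have : PreconnectedSpace O := Subtype.preconnectedSpace hpre
  have : T2Space O := ⟨fun x y hxy => by
    obtain ⟨u, v, hu, hv, hxu, hyv, hd⟩ := hsep x x.2 y y.2 fun h => hxy (Subtype.ext h)
    exact ⟨Subtype.val ⁻¹' u, Subtype.val ⁻¹' v, hu.preimage continuous_subtype_val,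
      hv.preimage continuous_subtype_val, hxu, hyv, hd.preimage _⟩⟩
  have hsrc : ∀ i, ((φ i).subtypeRestr hO).source = Subtype.val ⁻¹' (φ i).source :=
    fun i => OpenPartialHomeomorph.subtypeRestr_source _ _
  obtain ⟨U, h, o, hU, hUs, hh, hinj, hopen, ⟨a, b, hab, him⟩, ho⟩ :=
    exists_interval_chart (X := O) (fun i => (φ i).subtypeRestr hO)
      (fun x => by
        obtain ⟨i, hi⟩ := hcov x x.2
        exact ⟨i, by rw [hsrc]; exact hi⟩)
      (fun i x => σ i x) (fun i j => by
        simp only [hsrc]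
        exact (hσ i j).comp continuous_subtype_val.continuousOn fun x hx => hx)
  have emb : IsOpenEmbedding (Subtype.val : O → M) := hC.isOpenEmbedding_subtypeVal
  let L : ℝ → ℝ := fun s => (2 * s - a - b) / (b - a)
  have hba : 0 < b - a := sub_pos.2 hab
  have hL : Continuous L := by fun_prop
  let Le : ℝ ≃ₜ ℝ :=
    { toFun := L, invFun := fun s => ((b - a) * s + a + b) / 2,
      left_inv := fun s => by simp only [L]; field_simp; ring
      right_inv := fun s => by simp only [L]; field_simp; ring
      continuous_toFun := hL
      continuous_invFun := by fun_prop }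
  let r : M → O := fun m => if hm : m ∈ C then ⟨m, hm⟩ else hO.some
  have hr : ∀ x : O, r x = x := fun x => dif_pos x.2
  have hrU : MapsTo r (Subtype.val '' U) U := by
    rintro _ ⟨x, hx, rfl⟩; rwa [hr]
  have hrc : ContinuousOn r (Subtype.val '' U) := by
    rintro _ ⟨x, hx, rfl⟩
    have : ContinuousAt r x := by
      rw [emb.continuousAt_iff.symm]
      have : r ∘ Subtype.val = (id : O → O) := funext hr
      rw [this]; exact continuousAt_id
    exact this.continuousWithinAt
  refine ⟨Subtype.val '' U, fun m => L (h (r m)), fun m => o (r m), emb.isOpenMap _ hU, ?_, ?_,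
    hL.comp_continuousOn (hh.comp hrc hrU), ?_, ?_, ?_, ?_⟩
  · rintro _ ⟨x, hx, rfl⟩; exact x.2
  · rintro x ⟨hx, hxU⟩ y ⟨hy, hyU⟩
    have := hUs (x := ⟨x, hx⟩) (fun h => hxU ⟨⟨x, hx⟩, h, rfl⟩) (y := ⟨y, hy⟩)
      (fun h => hyU ⟨⟨y, hy⟩, h, rfl⟩)
    exact congrArg Subtype.val this
  · rintro _ ⟨x, hx, rfl⟩ _ ⟨y, hy, rfl⟩ hxy
    have := Le.injective hxy
    rw [hr, hr] at this
    rw [hinj hx hy this]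
  · rintro _ ⟨x, hx, rfl⟩ N hN
    have h1 : Subtype.val ⁻¹' N ∈ 𝓝 x := continuous_subtype_val.continuousAt hN
    have h2 := Le.isOpenMap.image_mem_nhds (hopen x hx _ h1)
    change L (h (r x)) |> fun v => _ ∈ 𝓝 v
    simp only [hr]
    refine mem_of_superset h2 ?_
    rintro _ ⟨_, ⟨y, hy, rfl⟩, rfl⟩
    exact ⟨y, hy, by simp only [hr]; rfl⟩
  · have : (fun m => L (h (r m))) '' (Subtype.val '' U) = L '' (h '' U) := by
      simp only [image_image, hr]
    rw [this, him]
    ext s; constructor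
    · rintro ⟨x, hx, rfl⟩
      simp only [L, mem_Ioo, lt_div_iff₀ hba, div_lt_iff₀ hba]
      constructor <;> linarith [hx.1, hx.2]
    · intro hs
      refine ⟨Le.symm s, ?_, Le.apply_symm_apply s⟩
      change ((b - a) * s + a + b) / 2 ∈ _
      constructor <;> nlinarith [hs.1, hs.2]
  · intro i
    have := (ho i).comp (f := r) (s := Subtype.val '' U ∩ (φ i).source)
      (hrc.mono inter_subset_left) (by
        rintro _ ⟨⟨x, hx, rfl⟩, hs⟩
        rw [hr, hsrc]; exact ⟨hx, hs⟩)
    refine this.congr ?_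
    rintro _ ⟨⟨x, hx, rfl⟩, hs⟩
    simp only [Function.comp, hr]

namespace Foliation

variable {Z : Type*} [TopologicalSpace Z] {F : Foliation Z}

/-- A saturated open set whose leaf space is an interval, coherently oriented. -/
structure Piece (F : Foliation Z) where
  W : Set Z
  t : Z → ℝ
  Θ : Z → ℝ
  isOpen_W : IsOpen W
  cont_t : ContinuousOn t W
  image_t : t '' W = Ioo (-1) 1
  leaf_iff : ∀ z ∈ W, ∀ w, F.leafSetoid w z ↔ w ∈ W ∧ t w = t z
  open_t : ∀ z ∈ W, ∀ N ∈ 𝓝 z, t '' N ∈ 𝓝 (t z)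
  isClosed_slab : ∀ s ∈ Ioo (-1 : ℝ) 1, ∃ ε > 0, IsClosed (W ∩ t ⁻¹' Icc (s - ε) (s + ε))
  param : ∀ z ∈ W, ∃ γ : ℝ → Z, IsClosedEmbedding γ ∧ range γ = F.leaf z ∧ ∀ u, Θ (γ u) = u
  -- `Θ` is continuous along each leaf only; what survives a change of leaf is the order it defines.
  order_open : ∀ z ∈ W, ∀ w ∈ W, t z = t w → Θ z < Θ w →
    ∀ᶠ p in 𝓝 (z, w), p.1 ∈ W → p.2 ∈ W → t p.1 = t p.2 → Θ p.1 < Θ p.2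

lemma mk_eq_mk_iff {w z : Z} :
    Quotient.mk F.leafSetoid w = Quotient.mk F.leafSetoid z ↔ F.leafSetoid w z :=
  ⟨fun h => Quotient.exact h, fun h => Quotient.sound h⟩

/-- The leaf coordinate twisted by `o` increases with the box coordinate up to the sign `B.sign Θ *
o`, which is locally constant by the choice of `o`. -/
lemma ProductBox.oriented_lt_iff {Θ : Z → ℝ} (hΘ : F.IsLeafCoordinate Θ) (B : F.ProductBox)
    {o : Quotient F.leafSetoid → ℤˣ} {z w : Z} (hz : z ∈ B.dom) (hw : F.leafSetoid w z) :
    let m := Quotient.mk F.leafSetoid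
    (((o (m w) : ℤ) : ℝ) * Θ w < ((o (m z) : ℤ) : ℝ) * Θ z ↔
      (((B.sign Θ (m z) * o (m z) : ℤˣ) : ℤ) : ℝ) * (B.g w).1 <
        (((B.sign Θ (m z) * o (m z) : ℤˣ) : ℤ) : ℝ) * (B.g z).1) := by
  intro m
  have hm : m w = m z := mk_eq_mk_iff.2 hw
  have hw' := B.mem_dom_of_rel hw hz
  have hs : B.sign Θ (m w) = B.sign Θ (m z) := by rw [hm]
  have hzw := F.leafSetoid.symm hw
  rw [hm]
  rcases Int.units_eq_one_or (B.sign Θ (m z)) with h | h <;>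
    rcases Int.units_eq_one_or (o (m z)) with h' | h' <;>
    rw [h, h']
  · simpa using B.lt_iff_of_sign_eq_one hΘ hz hw h
  · simpa using B.lt_iff_of_sign_eq_one hΘ hw' hzw (hs.trans h)
  · simpa using B.lt_iff_of_sign_eq_neg_one hΘ hz hw h
  · simpa using B.lt_iff_of_sign_eq_neg_one hΘ hw' hzw (hs.trans h)

/-- The levels are `h` of the leaf and the coordinate is `Θ` twisted by `o`. Product boxes supply
the local properties: closed slabs, and openness of the order, where the box coordinate times a
locally constant sign decides. -/
lemma exists_piece {Θ : Z → ℝ} (hΘ : F.IsLeafCoordinate Θ) {U : Set (Quotient F.leafSetoid)}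
    {h : Quotient F.leafSetoid → ℝ} {o : Quotient F.leafSetoid → ℤˣ} (hU : IsOpen U)
    (hbox : ∀ z, Quotient.mk F.leafSetoid z ∈ U → ∃ B : F.ProductBox, ∃ x, B.e (x, 0) = z)
    (hh : ContinuousOn h U) (hinj : InjOn h U) (hopen : ∀ x ∈ U, ∀ N ∈ 𝓝 x, h '' N ∈ 𝓝 (h x))
    (him : h '' U = Ioo (-1) 1)
    (ho : ∀ B : F.ProductBox, ContinuousOn (fun m => B.sign Θ m * o m) (U ∩ B.chart.source)) :
    ∃ P : F.Piece, P.W = Quotient.mk F.leafSetoid ⁻¹' U := by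
  let m := Quotient.mk F.leafSetoid
  have hm : Continuous m := continuous_quot_mk
  have hms : Function.Surjective m := Quotient.mk_surjective
  have h0 : (0 : ℝ) ∈ Ioo (-1 : ℝ) 1 := by simp
  have hW : IsOpen (m ⁻¹' U) := hU.preimage hm
  have ht : ContinuousOn (h ∘ m) (m ⁻¹' U) := hh.comp hm.continuousOn fun _ hx => hx
  refine ⟨⟨m ⁻¹' U, h ∘ m, fun z => ((o (m z) : ℤ) : ℝ) * Θ z, hW, ht, ?_, ?_, ?_, ?_, ?_, ?_⟩, rfl⟩
  · rw [image_comp, image_preimage_eq U hms, him]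
  · intro z hz w
    constructor
    · intro hw
      have := mk_eq_mk_iff.2 hw
      refine ⟨?_, congrArg h this⟩
      change m w ∈ U
      rw [show m w = m z from this]; exact hz
    · rintro ⟨hw, he⟩
      exact mk_eq_mk_iff.1 (hinj hw hz he)
  · intro z hz N hN
    rw [image_comp]
    exact hopen (m z) hz _ (F.isOpenMap_mk.image_mem_nhds hN)
  · intro s hs
    rw [← him] at hs
    obtain ⟨x, hx, rfl⟩ := hs
    obtain ⟨z, rfl⟩ := hms x
    obtain ⟨B, x, hB⟩ := hbox z hx
    have hzB : z ∈ B.dom := hB ▸ B.e_mem h0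
    have hc : ContinuousAt (fun s => m (B.e (x, s))) 0 :=
      hm.continuousAt.comp ((B.continuousOn_e x).continuousAt (Ioo_mem_nhds h0.1 h0.2))
    have hU' : ∀ᶠ s in 𝓝 (0 : ℝ), m (B.e (x, s)) ∈ U :=
      hc.eventually_mem (hU.mem_nhds (by rw [hB]; exact hx))
    obtain ⟨r, hr, hrU⟩ := Metric.eventually_nhds_iff.1 hU'
    let ρ := min (r / 2) (1 / 2)
    have hρ : 0 < ρ := by positivity
    have hρ1 : ρ < 1 := (min_le_right _ _).trans_lt (by norm_num)
    have hρr : ρ < r := (min_le_left _ _).trans_lt (by linarith)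
    have hsub : ∀ s ∈ Icc (-ρ) ρ, s ∈ Ioo (-1 : ℝ) 1 ∧ m (B.e (x, s)) ∈ U := fun s hs =>
      ⟨⟨by linarith [hs.1], by linarith [hs.2]⟩, hrU (by
        rw [Real.dist_0_eq_abs]; exact (abs_le.2 hs).trans_lt hρr)⟩
    have hlev : ∀ s ∈ Icc (-ρ) ρ, ∀ x', m (B.e (x', s)) = m (B.e (x, s)) := fun s hs x' =>
      mk_eq_mk_iff.2 (B.rel_e (hsub s hs).1 x' x)
    have hN : h '' (m '' (B.e '' (univ ×ˢ Ioo (-ρ) ρ))) ∈ 𝓝 (h (m z)) := by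
      refine hopen _ hx _ (F.isOpenMap_mk.image_mem_nhds ?_)
      have : B.dom ∩ (fun w => (B.g w).2) ⁻¹' Ioo (-ρ) ρ ∈ 𝓝 z := by
        refine inter_mem (B.isOpen_dom.mem_nhds hzB) ?_
        refine (continuous_snd.continuousAt.comp
          (B.continuousOn_g.continuousAt (B.isOpen_dom.mem_nhds hzB))) ?_
        have : (B.g z).2 = 0 := by rw [← hB, B.g_e h0]
        refine Ioo_mem_nhds ?_ ?_ <;> simp [this, hρ]
      refine mem_of_superset this ?_
      rintro w ⟨hw, hw2⟩
      exact ⟨B.g w, ⟨mem_univ _, hw2⟩, B.e_g hw⟩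
    obtain ⟨ε, hε, hεN⟩ := Metric.mem_nhds_iff.1 hN
    refine ⟨ε / 2, by positivity, ?_⟩
    have hcl := B.isClosed ρ hρ1
    -- For small `ε` the slab of the piece lies in a closed slab of the product box, since `h` is
    -- injective and the box already realizes all levels near that of `z`.
    have heq : m ⁻¹' U ∩ (h ∘ m) ⁻¹' Icc (h (m z) - ε / 2) (h (m z) + ε / 2) =
        B.e '' (univ ×ˢ Icc (-ρ) ρ) ∩ (h ∘ m) ⁻¹' Icc (h (m z) - ε / 2) (h (m z) + ε / 2) := by
      ext w
      refine and_congr_left fun hw => ?_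
      constructor
      · intro hwU
        have hw' : h (m w) ∈ Metric.ball (h (m z)) ε := by
          rw [Metric.mem_ball, Real.dist_eq, abs_lt]
          have h1 := hw.1; have h2 := hw.2
          simp only [Function.comp] at h1 h2
          constructor <;> linarith
        obtain ⟨_, ⟨_, ⟨⟨x', s⟩, hs, rfl⟩, rfl⟩, he⟩ := hεN hw'
        have hs' : s ∈ Icc (-ρ) ρ := Ioo_subset_Icc_self hs.2
        have h1 : m (B.e (x', s)) ∈ U := by rw [hlev s hs']; exact (hsub s hs').2
        have h2 := mk_eq_mk_iff.1 (hinj hwU h1 he.symm)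
        obtain ⟨x'', hx''⟩ := (B.leaf_iff (x', s) ⟨mem_univ _, (hsub s hs').1⟩ w).1 h2
        exact ⟨(x'', s), ⟨mem_univ _, hs'⟩, hx''.symm⟩
      · rintro ⟨⟨x', s⟩, hs, rfl⟩
        change m _ ∈ U
        rw [hlev s hs.2]; exact (hsub s hs.2).2
    rw [heq]
    refine (ht.mono ?_).preimage_isClosed_of_isClosed hcl isClosed_Icc
    rintro _ ⟨⟨x', s⟩, hs, rfl⟩
    change m _ ∈ U
    rw [hlev s hs.2]; exact (hsub s hs.2).2
  · intro z hz
    obtain ⟨γ, hγ, hr, hu⟩ := hΘ z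
    have hmz : ∀ u, m (γ u) = m z := fun u => mk_eq_mk_iff.2 (hr ▸ mem_range_self u : γ u ∈ F.leaf z)
    rcases Int.units_eq_one_or (o (m z)) with h' | h'
    · exact ⟨γ, hγ, hr, fun u => by simp [hmz, h', hu]⟩
    · refine ⟨γ ∘ (Homeomorph.neg ℝ), hγ.comp (Homeomorph.neg ℝ).isClosedEmbedding, ?_, fun u => ?_⟩
      · rw [range_comp, (Homeomorph.neg ℝ).surjective.range_eq, image_univ, hr]
      · simp [hmz, h', hu]
  · intro z hz w hw he hlt
    have hzw : m z = m w := hinj hz hw he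
    obtain ⟨B, x, hB⟩ := hbox w hw
    have hwB : w ∈ B.dom := hB ▸ B.e_mem h0
    have hzB := B.mem_dom_of_rel (mk_eq_mk_iff.1 hzw) hwB
    have hO : U ∩ B.chart.source ∈ 𝓝 (m w) :=
      (hU.inter B.chart.open_source).mem_nhds ⟨hw, B.mk_mem_chart_source.2 hwB⟩
    have h1 : ∀ᶠ n in 𝓝 (m w), B.sign Θ n * o n = B.sign Θ (m w) * o (m w) := by
      have := ((ho B).continuousAt hO).tendsto
      exact this.eventually_mem (isOpen_discrete {B.sign Θ (m w) * o (m w)} |>.mem_nhds rfl)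
    have h2 := hm.continuousAt.eventually h1
    replace hlt := (B.oriented_lt_iff (o := o) hΘ hwB (mk_eq_mk_iff.1 hzw)).1 hlt
    have hg : ∀ v ∈ B.dom, ContinuousAt (fun v => (B.g v).1) v := fun v hv =>
      continuous_fst.continuousAt.comp (B.continuousOn_g.continuousAt (B.isOpen_dom.mem_nhds hv))
    set c : ℝ := (((B.sign Θ (m w) * o (m w) : ℤˣ) : ℤ) : ℝ)
    have h3 : ∀ᶠ p in 𝓝 (z, w), c * (B.g p.1).1 < c * (B.g p.2).1 :=
      ((hg z hzB).comp' (continuous_fst.continuousAt (x := (z, w))) |>.const_mul c).eventually_lt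
        ((hg w hwB).comp' (continuous_snd.continuousAt (x := (z, w))) |>.const_mul c) hlt
    have h4 : ∀ᶠ p : Z × Z in 𝓝 (z, w), p.2 ∈ B.dom ∧
        B.sign Θ (m p.2) * o (m p.2) = B.sign Θ (m w) * o (m w) :=
      (continuous_snd.continuousAt (x := (z, w))).eventually
        ((B.isOpen_dom.eventually_mem hwB).and h2)
    filter_upwards [h3, h4] with p hp ⟨hp2, hps⟩ hp1W hp2W hpt
    have hrel := mk_eq_mk_iff.1 (hinj hp1W hp2W hpt)
    refine (B.oriented_lt_iff (o := o) hΘ hp2 hrel).2 ?_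
    rw [show Quotient.mk F.leafSetoid = m from rfl, hps]
    exact hp

lemma isOpen_connectedComponentIn_of_charts {X : Type*} [TopologicalSpace X] {M : Set X}
    (hM : IsOpen M) (hφ : ∀ x ∈ M, ∃ φ : OpenPartialHomeomorph X ℝ, x ∈ φ.source) (x : X) :
    IsOpen (connectedComponentIn M x) := by
  rw [isOpen_iff_mem_nhds]
  intro y hy
  have hyM := connectedComponentIn_subset M x hy
  obtain ⟨φ, hφy⟩ := hφ y hyM
  have h1 : φ '' (φ.source ∩ M) ∈ 𝓝 (φ y) :=
    (φ.isOpen_image_source_inter hM).mem_nhds ⟨y, ⟨hφy, hyM⟩, rfl⟩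
  obtain ⟨ε, hε, hball⟩ := Metric.mem_nhds_iff.1 h1
  have hsub : Metric.ball (φ y) ε ⊆ φ.target := by
    intro s hs
    obtain ⟨w, hw, rfl⟩ := hball hs
    exact φ.map_source hw.1
  have hopen : IsOpen (φ.symm '' Metric.ball (φ y) ε) :=
    φ.symm.isOpen_image_of_subset_source Metric.isOpen_ball hsub
  have hpre : IsPreconnected (φ.symm '' Metric.ball (φ y) ε) :=
    ((convex_ball (φ y) ε).isPreconnected).image _ (φ.continuousOn_symm.mono hsub)
  have hmem : y ∈ φ.symm '' Metric.ball (φ y) ε :=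
    ⟨φ y, Metric.mem_ball_self hε, φ.left_inv hφy⟩
  refine mem_of_superset (hopen.mem_nhds hmem) ?_
  rw [connectedComponentIn_eq hy]
  refine hpre.subset_connectedComponentIn hmem ?_
  rintro _ ⟨s, hs, rfl⟩
  obtain ⟨w, hw, rfl⟩ := hball hs
  rw [φ.left_inv hw.1]; exact hw.2

/-- Distinct leaves of which one has a product neighbourhood are separated in the leaf space. -/
lemma ProductBox.exists_separation (B : F.ProductBox) {x : ℝ} {w : Z}
    (hw : ¬ F.leafSetoid w (B.e (x, 0))) :
    ∃ u v : Set (Quotient F.leafSetoid), IsOpen u ∧ IsOpen v ∧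
      Quotient.mk F.leafSetoid (B.e (x, 0)) ∈ u ∧ Quotient.mk F.leafSetoid w ∈ v ∧
      Disjoint u v := by
  have h0 : (0 : ℝ) ∈ Ioo (-1 : ℝ) 1 := by simp
  obtain ⟨ρ, hρ, hρ1, hρw⟩ : ∃ ρ > 0, ρ < 1 ∧ w ∉ B.e '' (univ ×ˢ Icc (-ρ) ρ) := by
    by_cases hd : w ∈ B.dom
    · have hne : (B.g w).2 ≠ 0 := by
        intro h
        rw [B.rel_iff hd (B.e_mem h0), B.g_e h0] at hw
        exact hw h
      have hg := B.g_mem hd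
      have habs : |(B.g w).2| < 1 := abs_lt.2 hg
      have hpos : 0 < |(B.g w).2| := abs_pos.2 hne
      refine ⟨|(B.g w).2| / 2, by positivity, by linarith, ?_⟩
      rintro ⟨⟨x', s⟩, ⟨-, hs⟩, rfl⟩
      have hs1 := abs_le.2 hs
      have hs' : s ∈ Ioo (-1 : ℝ) 1 := ⟨by linarith [hs.1], by linarith [hs.2]⟩
      rw [B.g_e hs'] at hs1 hpos
      simp only at hs1 hpos
      linarith
    · refine ⟨1 / 2, by norm_num, by norm_num, ?_⟩
      rintro ⟨⟨x', s⟩, ⟨-, hs⟩, rfl⟩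
      exact hd (B.e_mem ⟨by linarith [hs.1], by linarith [hs.2]⟩)
  have hIcc : ∀ s ∈ Icc (-ρ) ρ, s ∈ Ioo (-1 : ℝ) 1 := fun s hs =>
    ⟨by linarith [hs.1], by linarith [hs.2]⟩
  have hu : IsOpen (B.e '' (univ ×ˢ Ioo (-ρ) ρ)) := by
    have := (continuous_snd.comp_continuousOn B.continuousOn_g).isOpen_inter_preimage
      B.isOpen_dom (isOpen_Ioo (a := -ρ) (b := ρ))
    convert this using 1
    ext v
    constructor
    · rintro ⟨⟨x', s⟩, ⟨-, hs⟩, rfl⟩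
      have hs' := hIcc s (Ioo_subset_Icc_self hs)
      exact ⟨B.e_mem hs', by simp only [mem_preimage, Function.comp, B.g_e hs']; exact hs⟩
    · rintro ⟨hv, hs⟩
      exact ⟨B.g v, ⟨mem_univ _, hs⟩, B.e_g hv⟩
  refine ⟨_, _, F.isOpenMap_mk _ hu, F.isOpenMap_mk _ (B.isClosed ρ hρ1).isOpen_compl,
    ⟨_, ⟨(x, 0), ⟨mem_univ _, by simp [hρ]⟩, rfl⟩, rfl⟩, ⟨w, hρw, rfl⟩, ?_⟩
  rw [Set.disjoint_left]
  rintro _ ⟨_, ⟨⟨x', s⟩, ⟨-, hs⟩, rfl⟩, rfl⟩ ⟨v, hv, he⟩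
  have hs' := Ioo_subset_Icc_self hs
  obtain ⟨x'', hx''⟩ := (B.leaf_iff (x', s) ⟨mem_univ _, hIcc s hs'⟩ v).1 (mk_eq_mk_iff.1 he)
  exact hv ⟨(x'', s), ⟨mem_univ _, hs'⟩, hx''.symm⟩

end Foliation

namespace Foliation

variable {Z : Type*} [TopologicalSpace Z] {F : Foliation Z}

lemma HalfBox.isPreconnected_interior {S : Set Z} (B : F.HalfBox S) :
    IsPreconnected (B.b '' (Ioo (-1) 1 ×ˢ Ioo 0 1)) := by
  refine (isPreconnected_Ioo.prod isPreconnected_Ioo).image _ (B.cont_b.mono ?_)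
  exact prod_mono_right Ioo_subset_Ico_self

/-- A surface foliated by closed lines is cut by a locally finite family of leaves into countably
many pieces. -/
theorem exists_decomposition [T2Space Z] [SecondCountableTopology Z] (hF : F.HasClosedLineLeaves)
    (hfin : LocallyFinite (fun ω : F.singularLeaves => (ω : Set Z))) :
    ∃ 𝓢 : Set (Set Z), 𝓢 ⊆ F.leaves ∧ LocallyFinite (fun ω : 𝓢 => (ω : Set Z)) ∧
      F.boundary ⊆ ⋃₀ 𝓢 ∧ ∃ (Λ : Type) (_ : Countable Λ) (P : Λ → F.Piece),
        (∀ k l, k ≠ l → Disjoint (P k).W (P l).W) ∧ ⋃ l, (P l).W = (⋃₀ 𝓢)ᶜ := by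
  classical
  obtain ⟨Θ, hΘ⟩ := hF.exists_isLeafCoordinate
  -- Leaves outside this family are regular and lie inside the surface, so they have two-sided
  -- product boxes.
  set 𝓢' : Set (Set Z) := F.singularLeaves ∪ F.boundaryLeaves with h𝓢'
  have h𝓢l : 𝓢' ⊆ F.leaves := union_subset (fun _ h => h.1) (fun _ h => h.1)
  have hfin' : LocallyFinite (fun ω : 𝓢' => (ω : Set Z)) :=
    locallyFinite_coe_union hfin F.locallyFinite_boundaryLeaves
  have hcl : IsClosed (⋃₀ 𝓢') := F.isClosed_sUnion_leaves hF h𝓢l hfin'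
  have hbd' : F.boundary ⊆ ⋃₀ 𝓢' := fun z hz =>
    ⟨F.leaf z, Or.inr ⟨F.leaf_mem_leaves z, fun w hw => (F.mem_boundary_congr hw).2 hz⟩,
      F.mem_leaf_self z⟩
  let m := Quotient.mk F.leafSetoid
  have hm : Continuous m := continuous_quot_mk
  have hms : Function.Surjective m := Quotient.mk_surjective
  -- An open quotient of a second countable space is second countable.
  have hsc : SecondCountableTopology (Quotient F.leafSetoid) :=
    (isQuotientMap_quot_mk (r := F.leafSetoid)).secondCountableTopology F.isOpenMap_mk
  set M : Set (Quotient F.leafSetoid) := m '' (⋃₀ 𝓢')ᶜ with hMdef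
  have hM : IsOpen M := F.isOpenMap_mk _ hcl.isOpen_compl
  have hmM : ∀ z, m z ∈ M ↔ z ∉ ⋃₀ 𝓢' := by
    intro z
    constructor
    · rintro ⟨w, hw, he⟩ hz
      exact hw ((mem_sUnion_congr h𝓢l (mk_eq_mk_iff.1 he)).2 hz)
    · intro hz; exact ⟨z, hz, rfl⟩
  have hbox : ∀ z, z ∉ ⋃₀ 𝓢' → ∃ B : F.ProductBox, ∃ x, B.e (x, 0) = z := by
    intro z hz
    refine F.exists_productBox (fun h => hz (hbd' h)) ?_
    by_contra hs
    exact hz ⟨F.leaf z, Or.inl ⟨F.leaf_mem_leaves z, hs⟩, F.mem_leaf_self z⟩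
  have hdom : ∀ z, z ∉ ⋃₀ 𝓢' → ∃ B : F.ProductBox, z ∈ B.dom := by
    intro z hz
    obtain ⟨B, x, rfl⟩ := hbox z hz
    exact ⟨B, B.e_mem (by simp)⟩
  have hchart : ∀ x ∈ M, ∃ B : F.ProductBox, x ∈ B.chart.source := by
    rintro _ ⟨z, hz, rfl⟩
    obtain ⟨B, hB⟩ := hdom z hz
    exact ⟨B, B.mk_mem_chart_source.2 hB⟩
  let cc := connectedComponentIn M
  have hcc : ∀ x, IsOpen (cc x) := fun x => isOpen_connectedComponentIn_of_charts hM
    (fun x hx => by obtain ⟨B, hB⟩ := hchart x hx; exact ⟨B.chart, hB⟩) x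
  let 𝒞 : Set (Set (Quotient F.leafSetoid)) := cc '' M
  have hdisj : ∀ c ∈ 𝒞, ∀ d ∈ 𝒞, ∀ x, x ∈ c → x ∈ d → c = d := by
    rintro _ ⟨x, hx, rfl⟩ _ ⟨y, hy, rfl⟩ w hw hw'
    exact (connectedComponentIn_eq hw).trans (connectedComponentIn_eq hw').symm
  have hcount : 𝒞.Countable := by
    refine Set.PairwiseDisjoint.countable_of_isOpen (s := id) ?_ ?_ ?_
    · intro c hc d hd hcd
      exact Set.disjoint_left.2 fun x hx hx' => hcd (hdisj c hc d hd x hx hx')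
    · rintro _ ⟨x, hx, rfl⟩; exact hcc x
    · rintro _ ⟨x, hx, rfl⟩; exact ⟨x, mem_connectedComponentIn hx⟩
  have hCM : ∀ c ∈ 𝒞, c ⊆ M := by
    rintro _ ⟨x, hx, rfl⟩; exact connectedComponentIn_subset M x
  choose U h o hU hUC hsub hh hinj hopen him ho using fun c : 𝒞 =>
    exists_interval_chart_of_isOpen (C := (c : Set (Quotient F.leafSetoid)))
      (by obtain ⟨_, x, hx, rfl⟩ := c; exact hcc x)
      (by obtain ⟨_, x, hx, rfl⟩ := c; exact isPreconnected_connectedComponentIn)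
      (by obtain ⟨_, x, hx, rfl⟩ := c; exact ⟨x, mem_connectedComponentIn hx⟩)
      (by
        intro x hx y hy hxy
        obtain ⟨z, hz, rfl⟩ := hCM c c.2 hx
        obtain ⟨w, rfl⟩ := hms y
        obtain ⟨B, x, rfl⟩ := hbox z hz
        exact B.exists_separation fun hr => hxy (mk_eq_mk_iff.2 hr).symm)
      (fun B : F.ProductBox => B.chart) (fun x hx => hchart x (hCM c c.2 hx))
      (fun B => B.sign Θ) (fun B B' => B.continuousOn_sign_mul hΘ B')
  have hUM : ∀ c, U c ⊆ M := fun c => (hUC c).trans (hCM c c.2)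
  choose P hP using fun c : 𝒞 => exists_piece hΘ (hU c)
    (fun z hz => hbox z ((hmM z).1 (hUM c hz))) (hh c) (hinj c) (hopen c) (him c) (ho c)
  -- The additional cuts: the leaf, at most one for each component of `M`, that has to be removed to
  -- open a circle or to orient the leaves.
  set 𝓣 : Set (Set Z) := {ω ∈ F.leaves | ∃ c : 𝒞, ∃ z ∈ ω, m z ∈ (c : Set _) \ U c} with h𝓣
  have h𝓣one : ∀ c : 𝒞, {ω ∈ 𝓣 | ∃ z ∈ ω, m z ∈ (c : Set _)}.Subsingleton := by
    have key : ∀ c : 𝒞, ∀ ω ∈ {ω ∈ 𝓣 | ∃ z ∈ ω, m z ∈ (c : Set _)}, ∃ z, ω = F.leaf z ∧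
        m z ∈ (c : Set _) \ U c := by
      rintro c ω ⟨⟨hω, d, z, hzω, hz⟩, w, hw, hwc⟩
      have hwz : m w = m z := mk_eq_mk_iff.2 (by
        rw [eq_leaf_of_mem hω hzω] at hw; exact hw)
      have : d = c := Subtype.ext (hdisj d d.2 c c.2 (m z) hz.1 (hwz ▸ hwc))
      subst this
      exact ⟨z, eq_leaf_of_mem hω hzω, hz⟩
    intro c ω hω ω' hω'
    obtain ⟨z, rfl, hz⟩ := key c ω hω
    obtain ⟨z', rfl, hz'⟩ := key c ω' hω'
    exact leaf_eq (mk_eq_mk_iff.1 (hsub c hz hz'))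
  have hcut : ∀ ω ∈ 𝓣, ∀ w ∈ ω, w ∉ ⋃₀ 𝓢' := by
    rintro ω ⟨hω, c, z, hzω, hz⟩ w hw
    rw [eq_leaf_of_mem hω hzω] at hw
    rw [← hmM, show m w = m z from mk_eq_mk_iff.2 hw]
    exact hCM c c.2 hz.1
  -- A connected set off `𝓢'` maps into a single component of `M`, so it meets at most one
  -- additional cut.
  have hfinT : ∀ A : Set Z, IsPreconnected A → A ⊆ (⋃₀ 𝓢')ᶜ →
      {ω ∈ 𝓣 | (ω ∩ A).Nonempty}.Finite := by
    intro A hA hAS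
    rcases A.eq_empty_or_nonempty with rfl | ⟨a, ha⟩
    · simp
    have haM : m a ∈ M := (hmM a).2 (hAS ha)
    refine (h𝓣one ⟨cc (m a), m a, haM, rfl⟩).finite.subset ?_
    rintro ω ⟨hω, w, hwω, hwA⟩
    refine ⟨hω, w, hwω, ?_⟩
    exact (hA.image m hm.continuousOn).subset_connectedComponentIn (mem_image_of_mem m ha)
      (by rintro _ ⟨v, hv, rfl⟩; exact (hmM v).2 (hAS hv)) (mem_image_of_mem m hwA)
  have hfinTl : LocallyFinite (fun ω : 𝓣 => (ω : Set Z)) := by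
    rw [locallyFinite_coe_iff]
    intro z
    by_cases hz : z ∈ ⋃₀ 𝓢'
    -- Additional cuts do not accumulate at a leaf of `𝓢'`, because each of the two half boxes has a
    -- connected interior off `𝓢'`.
    · obtain ⟨Q, hQ⟩ := exists_sidePair hF h𝓢l hfin' hz
      have hI : ∀ e, (Q.B e).b '' (Ioo (-1) 1 ×ˢ Ioo 0 1) ⊆ (⋃₀ 𝓢')ᶜ := by
        rintro e _ ⟨p, hp, rfl⟩ hpS
        exact hp.2.1.ne' (((Q.B e).mem_iff p ⟨hp.1, Ioo_subset_Ico_self hp.2⟩).1 hpS)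
      refine ⟨_, Q.isOpen.mem_nhds (hQ ▸ Or.inl ((Q.B true).b_mem (by simp))),
        ((hfinT _ (Q.B true).isPreconnected_interior (hI true)).union
          (hfinT _ (Q.B false).isPreconnected_interior (hI false))).subset ?_⟩
      have hcase : ∀ e, ∀ ω ∈ 𝓣, ∀ w ∈ ω, w ∈ (Q.B e).dom →
          w ∈ (Q.B e).b '' (Ioo (-1) 1 ×ˢ Ioo 0 1) := by
        rintro e ω hω _ hw ⟨p, hp, rfl⟩
        refine ⟨p, ⟨hp.1, lt_of_le_of_ne hp.2.1 fun h0 => ?_, hp.2.2⟩, rfl⟩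
        exact hcut ω hω _ hw (((Q.B e).mem_iff p hp).2 h0.symm)
      rintro ω ⟨hω, w, hwω, hw | hw⟩
      · exact Or.inl ⟨hω, w, hwω, hcase true ω hω w hwω hw⟩
      · exact Or.inr ⟨hω, w, hwω, hcase false ω hω w hwω hw⟩
    · refine ⟨m ⁻¹' cc (m z), hm.continuousAt ((hcc (m z)).mem_nhds
        (mem_connectedComponentIn ((hmM z).2 hz))),
        (h𝓣one ⟨cc (m z), m z, (hmM z).2 hz, rfl⟩).finite.subset ?_⟩
      rintro ω ⟨hω, w, hwω, hw⟩
      exact ⟨hω, w, hwω, hw⟩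
  have hW : ∀ c d : 𝒞, c ≠ d → Disjoint (P c).W (P d).W := by
    intro c d hcd
    rw [hP, hP]
    refine Set.disjoint_left.2 fun z hz hz' => hcd (Subtype.ext ?_)
    exact hdisj c c.2 d d.2 (m z) (hUC c hz) (hUC d hz')
  have := hcount.to_subtype
  -- Numbering the components by natural numbers puts the index set in `Type`.
  obtain ⟨f, hf⟩ := exists_injective_nat 𝒞
  let eq := Equiv.ofInjective f hf
  refine ⟨𝓢' ∪ 𝓣, union_subset h𝓢l fun _ h => h.1, locallyFinite_coe_union hfin' hfinTl,
    hbd'.trans (sUnion_subset_sUnion subset_union_left), range f, inferInstance,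
    fun l => P (eq.symm l), fun k l hkl => hW _ _ (eq.symm.injective.ne hkl), ?_⟩
  have : ⋃ l, (P (eq.symm l)).W = ⋃ c, (P c).W := eq.symm.surjective.iUnion_comp fun c => (P c).W
  rw [this]
  ext z
  rw [mem_iUnion, mem_compl_iff, sUnion_union, mem_union, not_or]
  constructor
  · rintro ⟨c, hc⟩
    rw [hP] at hc
    refine ⟨(hmM z).1 (hUM c hc), ?_⟩
    rintro ⟨ω, ⟨hω, d, w, hwω, hw⟩, hzω⟩
    have hzw : m z = m w := mk_eq_mk_iff.2 (by
      rw [eq_leaf_of_mem hω hwω] at hzω; exact hzω)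
    have hcd : c = d := Subtype.ext (hdisj c c.2 d d.2 (m z) (hUC c hc) (hzw ▸ hw.1))
    subst hcd
    refine hw.2 ?_
    rw [← hzw]; exact hc
  · rintro ⟨h1, h2⟩
    let c : 𝒞 := ⟨cc (m z), m z, (hmM z).2 h1, rfl⟩
    refine ⟨c, ?_⟩
    rw [hP]
    by_contra hc
    exact h2 ⟨F.leaf z, ⟨F.leaf_mem_leaves z, c, z, F.mem_leaf_self z,
      mem_connectedComponentIn ((hmM z).2 h1), hc⟩, F.mem_leaf_self z⟩

end Foliation

/-! ### Bump functions and suprema along initial segments of leaves. -/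

namespace Foliation

variable {Z : Type*} [TopologicalSpace Z]

lemma locallyCompactSpace (F : Foliation Z) : LocallyCompactSpace Z := by
  choose φ hφ hz using F.cover
  let : ChartedSpace (ℝ × ℝ≥0) Z := ⟨F.atlas, φ, hz, hφ⟩
  exact ChartedSpace.locallyCompactSpace (ℝ × ℝ≥0) Z

/-- Countably many compactly supported functions, fine enough to separate points from closed
sets. -/
lemma exists_bump_family [T2Space Z] [SecondCountableTopology Z] [LocallyCompactSpace Z] :
    ∃ u : ℕ × ℕ → Z → ℝ, (∀ i, Continuous (u i)) ∧ (∀ i z, 0 ≤ u i z ∧ u i z ≤ 1) ∧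
      (∀ i, ∃ K, IsCompact K ∧ ∀ z ∉ K, u i z = 0) ∧
      ∀ z, ∀ N ∈ 𝓝 z, ∃ i, 0 < u i z ∧ ∃ K ⊆ N, IsCompact K ∧ ∀ w ∉ K, u i w = 0 := by
  classical
  rcases isEmpty_or_nonempty Z with hZ | hZ
  · exact ⟨fun _ _ => 0, fun _ => continuous_const, fun _ _ => by simp,
      fun _ => ⟨∅, isCompact_empty, fun _ _ => rfl⟩, fun z => hZ.elim z⟩
  let := TopologicalSpace.metrizableSpaceMetric Z
  let q := TopologicalSpace.denseSeq Z
  let r : ℕ → ℝ := fun n => 1 / (n + 1)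
  have hr : ∀ n, 0 < r n := fun n => by positivity
  have hr1 : ∀ n, r n ≤ 1 := fun n => by
    simp only [r]; rw [div_le_one (by positivity)]; linarith [(Nat.cast_nonneg n : (0 : ℝ) ≤ n)]
  -- Cones over balls with centres in a dense sequence and radii `1 / (n + 1)`, replaced by zero
  -- when the closed ball is not compact.
  let u : ℕ × ℕ → Z → ℝ := fun i w =>
    if IsCompact (Metric.closedBall (q i.1) (r i.2)) then max 0 (r i.2 - dist w (q i.1)) else 0
  have hu0 : ∀ i, ∀ w ∉ Metric.closedBall (q i.1) (r i.2), u i w = 0 := by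
    intro i w hw
    rw [Metric.mem_closedBall, not_le] at hw
    simp only [u]
    split_ifs
    · exact max_eq_left (by linarith)
    · rfl
  refine ⟨u, fun i => ?_, fun i z => ?_, fun i => ?_, fun z N hN => ?_⟩
  · by_cases h : IsCompact (Metric.closedBall (q i.1) (r i.2))
    · simp only [u, if_pos h]; fun_prop
    · simp only [u, if_neg h]; fun_prop
  · simp only [u]
    split_ifs
    · exact ⟨le_max_left _ _, max_le zero_le_one
        (by linarith [hr1 i.2, dist_nonneg (x := z) (y := q i.1)])⟩
    · simp
  · by_cases h : IsCompact (Metric.closedBall (q i.1) (r i.2))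
    · exact ⟨_, h, hu0 i⟩
    · exact ⟨∅, isCompact_empty, fun z _ => by simp only [u, if_neg h]⟩
  · obtain ⟨K, hK, hKc, hKN⟩ := exists_mem_nhds_isCompact_mapsTo (f := id) continuous_id hN
    obtain ⟨ε, hε, hball⟩ := Metric.mem_nhds_iff.1 hK
    obtain ⟨n, hn⟩ := exists_nat_one_div_lt (show (0 : ℝ) < ε / 2 by positivity)
    obtain ⟨k, hk⟩ := (TopologicalSpace.denseRange_denseSeq Z).exists_dist_lt z (hr n)
    have hsub : Metric.closedBall (q k) (r n) ⊆ K := by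
      intro w hw
      refine hball ?_
      rw [Metric.mem_closedBall] at hw
      rw [Metric.mem_ball]
      have := dist_triangle w (q k) z
      rw [dist_comm (q k) z] at this
      have hrn : r n < ε / 2 := hn
      have hk' : dist z (q k) < r n := hk
      linarith
    have hc : IsCompact (Metric.closedBall (q k) (r n)) :=
      hKc.of_isClosed_subset Metric.isClosed_closedBall hsub
    refine ⟨(k, n), ?_, _, fun w hw => hKN (hsub hw), hc, hu0 (k, n)⟩
    simp only [u, if_pos hc]
    exact lt_max_of_lt_right (sub_pos.2 hk)

variable {F : Foliation Z}

namespace Piece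

/-- The piece with all leaves reversed. -/
def rev (P : F.Piece) : F.Piece :=
  { P with
    Θ := fun z => -P.Θ z
    param := fun z hz => by
      obtain ⟨γ, hγ, hr, hu⟩ := P.param z hz
      refine ⟨γ ∘ (Homeomorph.neg ℝ), hγ.comp (Homeomorph.neg ℝ).isClosedEmbedding, ?_, fun u => ?_⟩
      · rw [range_comp, (Homeomorph.neg ℝ).surjective.range_eq, image_univ, hr]
      · simp [hu]
    order_open := fun z hz w hw he hlt => by
      have h := P.order_open w hw z hz he.symm (neg_lt_neg_iff.1 hlt)
      have hc : Tendsto Prod.swap (𝓝 (z, w)) (𝓝 (w, z)) := continuous_swap.tendsto _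
      filter_upwards [hc h] with p hp h1 h2 h12
      exact neg_lt_neg_iff.2 (hp h2 h1 h12.symm) }

variable (P : F.Piece)

lemma exists_param {w : Z} (hw : w ∈ P.W) : ∃ γ : ℝ → Z, IsClosedEmbedding γ ∧
    (∀ u, γ u ∈ P.W ∧ P.t (γ u) = P.t w ∧ P.Θ (γ u) = u) ∧
    ∀ w' ∈ P.W, P.t w' = P.t w → γ (P.Θ w') = w' := by
  obtain ⟨γ, hγ, hr, hu⟩ := P.param w hw
  have hmem : ∀ u, F.leafSetoid (γ u) w := fun u => (hr ▸ mem_range_self u : γ u ∈ F.leaf w)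
  refine ⟨γ, hγ, fun u => ⟨((P.leaf_iff w hw _).1 (hmem u)).1, ((P.leaf_iff w hw _).1 (hmem u)).2,
    hu u⟩, fun w' hw' he => ?_⟩
  have : w' ∈ range γ := hr ▸ (P.leaf_iff w hw w').2 ⟨hw', he⟩
  obtain ⟨u, rfl⟩ := this
  rw [hu]

lemma eq_of_eq {w w' : Z} (hw : w ∈ P.W) (hw' : w' ∈ P.W) (ht : P.t w' = P.t w)
    (hΘ : P.Θ w' = P.Θ w) : w' = w := by
  obtain ⟨γ, -, -, h⟩ := P.exists_param hw
  rw [← h w' hw' ht, hΘ, h w hw rfl]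

lemma t_mem {w : Z} (hw : w ∈ P.W) : P.t w ∈ Ioo (-1 : ℝ) 1 := P.image_t ▸ mem_image_of_mem _ hw

lemma continuousAt_t {w : Z} (hw : w ∈ P.W) : ContinuousAt P.t w :=
  P.cont_t.continuousAt (P.isOpen_W.mem_nhds hw)

/-- The points of the leaf of `w` that precede `w`. -/
def below (w : Z) : Set Z := {w' ∈ P.W | P.t w' = P.t w ∧ P.Θ w' ≤ P.Θ w}

/-- The supremum of `φ` over the initial segments of the leaves. -/
noncomputable def runSup (φ : Z → ℝ) (w : Z) : ℝ := sSup (φ '' P.below w)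

lemma isClosed_below {w : Z} (hw : w ∈ P.W) : IsClosed (P.below w) := by
  obtain ⟨γ, hγ, h1, h2⟩ := P.exists_param hw
  have : P.below w = γ '' Iic (P.Θ w) := by
    ext w'
    constructor
    · rintro ⟨hw', ht, hΘ⟩; exact ⟨_, hΘ, h2 w' hw' ht⟩
    · rintro ⟨u, hu, rfl⟩
      exact ⟨(h1 u).1, (h1 u).2.1, by rw [(h1 u).2.2]; exact hu⟩
  rw [this]
  exact hγ.isClosedMap _ isClosed_Iic

variable {P} {φ : Z → ℝ}

lemma self_mem_below {w : Z} (hw : w ∈ P.W) : w ∈ P.below w := ⟨hw, rfl, le_rfl⟩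

lemma le_runSup (hφ : ∀ w ∈ P.W, 0 ≤ φ w ∧ φ w ≤ 1) {w w' : Z} (h : w' ∈ P.below w) :
    φ w' ≤ P.runSup φ w :=
  le_csSup ⟨1, by rintro _ ⟨v, hv, rfl⟩; exact (hφ v hv.1).2⟩ ⟨w', h, rfl⟩

lemma runSup_le {w : Z} (hw : w ∈ P.W) {a : ℝ} (h : ∀ w' ∈ P.below w, φ w' ≤ a) :
    P.runSup φ w ≤ a :=
  csSup_le ⟨_, w, self_mem_below hw, rfl⟩ (by rintro _ ⟨v, hv, rfl⟩; exact h v hv)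

lemma exists_of_lt_runSup {w : Z} (hw : w ∈ P.W) {a : ℝ} (h : a < P.runSup φ w) :
    ∃ w' ∈ P.below w, a < φ w' := by
  by_contra! hc
  exact absurd (runSup_le hw hc) (not_le.2 h)

lemma runSup_mem (hφ : ∀ w ∈ P.W, 0 ≤ φ w ∧ φ w ≤ 1) {w : Z} (hw : w ∈ P.W) :
    0 ≤ P.runSup φ w ∧ P.runSup φ w ≤ 1 :=
  ⟨(hφ w hw).1.trans (le_runSup hφ (self_mem_below hw)), runSup_le hw fun v hv => (hφ v hv.1).2⟩

lemma runSup_mono (hφ : ∀ w ∈ P.W, 0 ≤ φ w ∧ φ w ≤ 1) {w w' : Z} (hw : w ∈ P.W)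
    (ht : P.t w = P.t w') (hΘ : P.Θ w ≤ P.Θ w') : P.runSup φ w ≤ P.runSup φ w' :=
  runSup_le hw fun _ hv => le_runSup hφ ⟨hv.1, hv.2.1.trans ht, hv.2.2.trans hΘ⟩

/-- Lower semicontinuity: a point where `φ` is nearly the supremum has companions on all nearby
leaves, still preceding the moving point because the order is open. Upper semicontinuity: points
with a large value of `φ` stay in a compact set, and in a closed slab of levels they cannot escape
from the piece. -/
lemma continuousOn_runSup (hφ : ∀ w ∈ P.W, 0 ≤ φ w ∧ φ w ≤ 1) (hc : ContinuousOn φ P.W)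
    (hK : ∀ a > 0, ∃ K, IsCompact K ∧ ∀ w ∈ P.W, a ≤ φ w → w ∈ K) :
    ContinuousOn (P.runSup φ) P.W := by
  have hca : ∀ w ∈ P.W, ContinuousAt φ w := fun w hw => hc.continuousAt (P.isOpen_W.mem_nhds hw)
  intro w hw
  refine ContinuousAt.continuousWithinAt ?_
  have hWw := P.isOpen_W.mem_nhds hw
  refine tendsto_order.2 ⟨fun a ha => ?_, fun b hb => ?_⟩
  · obtain ⟨w', hw', ha'⟩ := exists_of_lt_runSup hw ha
    rcases hw'.2.2.eq_or_lt with h | h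
    · have : w' = w := P.eq_of_eq hw hw'.1 hw'.2.1 h
      subst this
      filter_upwards [(hca w' hw).eventually_const_lt ha', hWw] with v hv hvW
      exact hv.trans_le (le_runSup hφ (self_mem_below hvW))
    · have h1 := P.order_open w' hw'.1 w hw hw'.2.1 h
      rw [nhds_prod_eq, eventually_prod_iff] at h1
      obtain ⟨p, hp, q, hq, hpq⟩ := h1
      have h2 : P.t '' {v | p v ∧ v ∈ P.W ∧ a < φ v} ∈ 𝓝 (P.t w') :=
        P.open_t w' hw'.1 _ (hp.and ((P.isOpen_W.eventually_mem hw'.1).and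
          ((hca w' hw'.1).eventually_const_lt ha')))
      rw [hw'.2.1] at h2
      filter_upwards [P.continuousAt_t hw h2, hq, hWw] with v ⟨v', ⟨hp', hv'W, hv'φ⟩, hv't⟩ hqv hvW
      exact hv'φ.trans_le (le_runSup hφ ⟨hv'W, hv't, (hpq hp' hqv hv'W hvW hv't).le⟩)
  · obtain ⟨a, ha, hab⟩ := exists_between hb
    have ha0 : 0 < a := (runSup_mem hφ hw).1.trans_lt ha
    obtain ⟨K, hKc, hKφ⟩ := hK a ha0
    obtain ⟨ε, hε, hcl⟩ := P.isClosed_slab _ (P.t_mem hw)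
    have hA : IsCompact (K ∩ (P.W ∩ P.t ⁻¹' Icc (P.t w - ε) (P.t w + ε))) := hKc.inter_right hcl
    -- A point `v'` of the compact set precedes `w` or equals it, follows it, or has another level.
    -- In the last two cases it does not precede points near `w`, and in the first `φ` is below `a`.
    have key := hA.eventually_forall_of_forall_eventually (x₀ := w)
      (P := fun v v' => v ∈ P.W → v' ∈ P.below v → φ v' < a) (by
        rintro v' ⟨-, hv'W, -⟩
        have hfst : Tendsto Prod.fst (𝓝 (w, v')) (𝓝 w) := continuous_fst.tendsto (w, v')
        have hsnd : Tendsto Prod.snd (𝓝 (w, v')) (𝓝 v') := continuous_snd.tendsto (w, v')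
        by_cases ht : P.t v' = P.t w
        · rcases le_or_gt (P.Θ v') (P.Θ w) with h | h
          · have h1 : φ v' < a := (le_runSup hφ ⟨hv'W, ht, h⟩).trans_lt ha
            filter_upwards [hsnd.eventually ((hca v' hv'W).eventually_lt_const h1)] with p hp _ _
            exact hp
          · filter_upwards [P.order_open w hw v' hv'W ht.symm h] with p hp h1 h2
            exact absurd h2.2.2 (not_le.2 (hp h1 h2.1 h2.2.1.symm))
        · have h1 : Tendsto (fun p : Z × Z => P.t p.2 - P.t p.1) (𝓝 (w, v'))
              (𝓝 (P.t v' - P.t w)) :=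
            ((P.continuousAt_t hv'W).tendsto.comp hsnd).sub ((P.continuousAt_t hw).tendsto.comp hfst)
          filter_upwards [h1.eventually_ne (sub_ne_zero.2 ht)] with p hp _ h2
          exact absurd (sub_eq_zero.2 h2.2.1) hp)
    have hm : Icc (P.t w - ε) (P.t w + ε) ∈ 𝓝 (P.t w) := Icc_mem_nhds (by linarith) (by linarith)
    filter_upwards [key, hWw, P.continuousAt_t hw hm] with v hv hvW hvt
    refine lt_of_le_of_lt (runSup_le hvW fun v' hv' => ?_) hab
    by_contra! hlt
    have ht' : P.t v' ∈ Icc (P.t w - ε) (P.t w + ε) := by rw [hv'.2.1]; exact hvt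
    exact absurd (hv v' ⟨hKφ v' hv'.1 hlt.le, hv'.1, ht'⟩ hvW hv') (not_lt.2 hlt.le)

end Piece

end Foliation

/-! ### End boxes of a piece. -/

namespace Foliation

variable {Z : Type*} [TopologicalSpace Z] {F : Foliation Z}

/-- On a connected set, two functions with distinct values on the same leaves of a piece are
ordered in the same way everywhere. -/
lemma Piece.lt_or_gt_of_isPreconnected (P : F.Piece) {α : Type*} [TopologicalSpace α] {C : Set α}
    (hC : IsPreconnected C) {f g : α → Z} (hf : ContinuousOn f C) (hg : ContinuousOn g C)
    (hfW : ∀ x ∈ C, f x ∈ P.W) (hgW : ∀ x ∈ C, g x ∈ P.W) (ht : ∀ x ∈ C, P.t (f x) = P.t (g x))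
    (hne : ∀ x ∈ C, f x ≠ g x) :
    (∀ x ∈ C, P.Θ (f x) < P.Θ (g x)) ∨ (∀ x ∈ C, P.Θ (g x) < P.Θ (f x)) := by
  have hnΘ : ∀ x ∈ C, P.Θ (f x) ≠ P.Θ (g x) := fun x hx h =>
    hne x hx (P.eq_of_eq (hgW x hx) (hfW x hx) (ht x hx) h)
  have key : ∀ {f g : α → Z}, ContinuousOn f C → ContinuousOn g C → (∀ x ∈ C, f x ∈ P.W) →
      (∀ x ∈ C, g x ∈ P.W) → (∀ x ∈ C, P.t (f x) = P.t (g x)) →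
      ∀ x ∈ C, P.Θ (f x) < P.Θ (g x) → ∀ᶠ y in 𝓝[C] x, P.Θ (f y) < P.Θ (g y) := by
    intro f g hf hg hfW hgW ht x hx h
    have h1 := P.order_open _ (hfW x hx) _ (hgW x hx) (ht x hx) h
    have h2 : Tendsto (fun y => (f y, g y)) (𝓝[C] x) (𝓝 (f x, g x)) :=
      ContinuousWithinAt.prodMk (hf x hx) (hg x hx)
    filter_upwards [h2 h1, self_mem_nhdsWithin] with y hy hyC
    exact hy (hfW y hyC) (hgW y hyC) (ht y hyC)
  have hloc : ∀ {x y : α}, x ∈ C → y ∈ C →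
      (P.Θ (f x) < P.Θ (g x) ↔ P.Θ (f y) < P.Θ (g y)) := by
    intro x y hx hy
    refine hC.induction₂' (fun x y => P.Θ (f x) < P.Θ (g x) ↔ P.Θ (f y) < P.Θ (g y)) ?_
      (fun x y z _ _ _ h h' => h.trans h') hx hy
    intro x hx
    rcases (hnΘ x hx).lt_or_gt with h | h
    · filter_upwards [key hf hg hfW hgW ht x hx h] with y hy
      exact ⟨⟨fun _ => hy, fun _ => h⟩, ⟨fun _ => h, fun _ => hy⟩⟩
    · filter_upwards [key hg hf hgW hfW (fun x hx => (ht x hx).symm) x hx h] with y hy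
      exact ⟨⟨fun h' => absurd h' h.not_gt, fun h' => absurd h' hy.not_gt⟩,
        ⟨fun h' => absurd h' hy.not_gt, fun h' => absurd h' h.not_gt⟩⟩
  rcases C.eq_empty_or_nonempty with rfl | ⟨a, ha⟩
  · exact Or.inl fun x hx => hx.elim
  rcases (hnΘ a ha).lt_or_gt with h | h
  · exact Or.inl fun x hx => (hloc ha hx).1 h
  · exact Or.inr fun x hx => (hnΘ x hx).lt_or_gt.resolve_left fun h' =>
      absurd ((hloc ha hx).2 h') h.not_gt

/-- A half box at the end of a piece. -/
structure Piece.EndBox (P : F.Piece) (S : Set Z) extends HalfBox F S where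
  -- `σ` is the end of `(-1, 1)` to which the levels tend at the base, and `e` tells whether the
  -- order of the leaves increases or decreases along the plaques.
  σ : ℝ
  e : ℝ
  σ_eq : σ = 1 ∨ σ = -1
  e_eq : e = 1 ∨ e = -1
  mem_W : ∀ p ∈ Ioo (-1 : ℝ) 1 ×ˢ Ioo (0 : ℝ) 1, b p ∈ P.W
  base_notMem : ∀ x ∈ Ioo (-1 : ℝ) 1, b (x, 0) ∉ P.W
  t_eq : ∀ p ∈ Ioo (-1 : ℝ) 1 ×ˢ Ioo (0 : ℝ) 1, P.t (b p) = P.t (b (0, p.2))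
  injOn_level : InjOn (fun y => P.t (b (0, y))) (Ioo 0 1)
  tendsto_level : Tendsto (fun y => P.t (b (0, y))) (𝓝[>] 0) (𝓝 σ)
  orient : ∀ y ∈ Ioo (0 : ℝ) 1, StrictMonoOn (fun x => e * P.Θ (b (x, y))) (Ioo (-1) 1)

lemma HalfBox.isOpen_image_interior {S : Set Z} (B : F.HalfBox S) {O : Set (ℝ × ℝ)}
    (hO : IsOpen O) (hOs : O ⊆ Ioo (-1) 1 ×ˢ Ioo 0 1) : IsOpen (B.b '' O) := by
  have hsub : (Ioo (-1) 1 ×ˢ Ioo 0 1 : Set (ℝ × ℝ)) ⊆ Ioo (-1) 1 ×ˢ Ico 0 1 :=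
    prod_mono_right Ioo_subset_Ico_self
  have h := (B.cont_c.mono (image_mono hsub)).isOpen_inter_preimage B.isOpen_interior hO
  convert h using 1
  ext w
  constructor
  · rintro ⟨p, hp, rfl⟩
    exact ⟨⟨p, hOs hp, rfl⟩, by rw [mem_preimage, B.left_inv p (hsub (hOs hp))]; exact hp⟩
  · rintro ⟨⟨p, hp, rfl⟩, hO⟩
    rw [mem_preimage, B.left_inv p (hsub hp)] at hO
    exact ⟨p, hO, rfl⟩

/-- The level along a transversal of the box is an open function, so it is injective and monotone
and has a limit at the base. The limit is not inside `(-1, 1)`: a slab around it is closed, and the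
base would belong to the piece. -/
lemma HalfBox.exists_endBox {P : F.Piece} {S : Set Z} (B : F.HalfBox S) (hS : Disjoint P.W S)
    (hW : ∀ p ∈ Ioo (-1 : ℝ) 1 ×ˢ Ioo (0 : ℝ) 1, B.b p ∈ P.W) :
    ∃ E : P.EndBox S, E.toHalfBox = B := by
  have hsub : (Ioo (-1) 1 ×ˢ Ioo 0 1 : Set (ℝ × ℝ)) ⊆ Ioo (-1) 1 ×ˢ Ico 0 1 :=
    prod_mono_right Ioo_subset_Ico_self
  have h0 : (0 : ℝ) ∈ Ioo (-1 : ℝ) 1 := by simp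
  have hbase : ∀ x ∈ Ioo (-1 : ℝ) 1, B.b (x, 0) ∉ P.W := fun x hx h =>
    Set.disjoint_left.1 hS h ((B.mem_iff (x, 0) ⟨hx, by simp⟩).2 rfl)
  have hteq : ∀ p ∈ Ioo (-1 : ℝ) 1 ×ˢ Ioo (0 : ℝ) 1, P.t (B.b p) = P.t (B.b (0, p.2)) := by
    intro p hp
    exact ((P.leaf_iff _ (hW (0, p.2) ⟨h0, hp.2⟩) _).1
      (B.leaf p.1 hp.1 0 h0 p.2 (Ioo_subset_Ico_self hp.2))).2
  set g : ℝ → ℝ := fun y => P.t (B.b (0, y)) with hg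
  have hgc : ContinuousOn g (Ioo 0 1) := by
    refine P.cont_t.comp ((B.cont_b.mono hsub).comp (by fun_prop) fun y hy => ⟨h0, hy⟩)
      fun y hy => hW (0, y) ⟨h0, hy⟩
  have hgm : ∀ y ∈ Ioo (0 : ℝ) 1, g y ∈ Ioo (-1 : ℝ) 1 := fun y hy => P.t_mem (hW (0, y) ⟨h0, hy⟩)
  have hginj : InjOn g (Ioo 0 1) := by
    refine injOn_Ioo_of_not_isLocalExtr hgc fun y hy => not_isLocalExtr_of_image_mem_nhds ?_
    intro N hN
    obtain ⟨O, hON, hO, hyO⟩ := mem_nhds_iff.1 hN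
    have h1 : B.b '' (Ioo (-1) 1 ×ˢ (O ∩ Ioo 0 1)) ∈ 𝓝 (B.b (0, y)) :=
      (B.isOpen_image_interior (isOpen_Ioo.prod (hO.inter isOpen_Ioo))
        (prod_mono_right inter_subset_right)).mem_nhds ⟨_, ⟨h0, hyO, hy⟩, rfl⟩
    refine mem_of_superset (P.open_t _ (hW (0, y) ⟨h0, hy⟩) _ h1) ?_
    rintro _ ⟨_, ⟨p, hp, rfl⟩, rfl⟩
    exact ⟨p.2, hON hp.2.1, (hteq p ⟨hp.1, hp.2.2⟩).symm⟩
  have hlim : ∃ σ : ℝ, (σ = 1 ∨ σ = -1) ∧ Tendsto g (𝓝[>] 0) (𝓝 σ) := by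
    have hne : (Ioo (0 : ℝ) 1).Nonempty := nonempty_Ioo.2 one_pos
    obtain ⟨σ, hσ⟩ : ∃ σ, Tendsto g (𝓝[>] 0) (𝓝 σ) := by
      rcases hgc.strictMonoOn_of_injOn_Ioo one_pos hginj with h | h
      · exact ⟨_, h.monotoneOn.tendsto_nhdsWithin_Ioo_right hne
          ⟨-1, by rintro _ ⟨y, hy, rfl⟩; exact (hgm y hy).1.le⟩⟩
      · exact ⟨_, h.antitoneOn.tendsto_nhdsWithin_Ioo_right hne
          ⟨1, by rintro _ ⟨y, hy, rfl⟩; exact (hgm y hy).2.le⟩⟩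
    refine ⟨σ, ?_, hσ⟩
    have hev : ∀ᶠ y in 𝓝[>] (0 : ℝ), y ∈ Ioo (0 : ℝ) 1 := Ioo_mem_nhdsGT one_pos
    have h1 : σ ≤ 1 := le_of_tendsto hσ (hev.mono fun y hy => (hgm y hy).2.le)
    have h2 : -1 ≤ σ := ge_of_tendsto hσ (hev.mono fun y hy => (hgm y hy).1.le)
    by_contra! hne
    have hσm : σ ∈ Ioo (-1 : ℝ) 1 := ⟨lt_of_le_of_ne h2 (Ne.symm hne.2), lt_of_le_of_ne h1 hne.1⟩
    obtain ⟨ε, hε, hcl⟩ := P.isClosed_slab σ hσm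
    have hb : Tendsto (fun y => B.b (0, y)) (𝓝[>] 0) (𝓝 (B.b (0, 0))) := by
      have := (B.cont_b (0, 0) ⟨h0, by simp⟩).tendsto
      refine this.comp (tendsto_nhdsWithin_iff.2 ⟨?_, ?_⟩)
      · exact ((by fun_prop : Continuous fun y : ℝ => ((0 : ℝ), y)).tendsto 0).mono_left
          nhdsWithin_le_nhds
      · exact hev.mono fun y hy => ⟨h0, Ioo_subset_Ico_self hy⟩
    have hIcc : Icc (σ - ε) (σ + ε) ∈ 𝓝 σ := Icc_mem_nhds (by linarith) (by linarith)
    refine hbase 0 h0 (hcl.mem_of_tendsto hb ?_).1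
    filter_upwards [hev, hσ hIcc] with y hy hy2
    exact ⟨hW (0, y) ⟨h0, hy⟩, hy2⟩
  obtain ⟨σ, hσ, hσt⟩ := hlim
  obtain ⟨e, he, hor⟩ : ∃ e : ℝ, (e = 1 ∨ e = -1) ∧
      ∀ y ∈ Ioo (0 : ℝ) 1, StrictMonoOn (fun x => e * P.Θ (B.b (x, y))) (Ioo (-1) 1) := by
    -- Pairs of distinct points on a common plaque, listed in increasing order, form a convex set;
    -- so the order of their images is the same throughout the box.
    let C : Set (ℝ × ℝ × ℝ) := (Ioo (-1) 1 ×ˢ Ioo (-1) 1 ×ˢ Ioo 0 1) ∩ {q | q.1 < q.2.1}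
    have hC : IsPreconnected C := by
      refine Convex.isPreconnected (Convex.inter ?_ ?_)
      · exact (convex_Ioo _ _).prod ((convex_Ioo _ _).prod (convex_Ioo _ _))
      · intro a ha b hb r s hr hs hrs
        simp only [mem_ofPred_eq, Prod.fst_add, Prod.snd_add, Prod.smul_fst, Prod.smul_snd,
          smul_eq_mul] at *
        rcases hr.eq_or_lt with rfl | hr
        · have : s = 1 := by linarith
          subst this; linarith
        · nlinarith
    have hbc := B.cont_b.mono hsub
    have := P.lt_or_gt_of_isPreconnected hC (f := fun q => B.b (q.1, q.2.2))
      (g := fun q => B.b (q.2.1, q.2.2))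
      (hbc.comp (by fun_prop) fun q hq => ⟨hq.1.1, hq.1.2.2⟩)
      (hbc.comp (by fun_prop) fun q hq => ⟨hq.1.2.1, hq.1.2.2⟩)
      (fun q hq => hW (q.1, q.2.2) ⟨hq.1.1, hq.1.2.2⟩)
      (fun q hq => hW (q.2.1, q.2.2) ⟨hq.1.2.1, hq.1.2.2⟩)
      (fun q hq => (hteq (q.1, q.2.2) ⟨hq.1.1, hq.1.2.2⟩).trans
        (hteq (q.2.1, q.2.2) ⟨hq.1.2.1, hq.1.2.2⟩).symm)
      (fun q hq h => by
        have := B.injOn (hsub (a := (q.1, q.2.2)) ⟨hq.1.1, hq.1.2.2⟩)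
          (hsub (a := (q.2.1, q.2.2)) ⟨hq.1.2.1, hq.1.2.2⟩) h
        exact absurd (congrArg Prod.fst this) (ne_of_lt hq.2))
    rcases this with h | h
    · refine ⟨1, Or.inl rfl, fun y hy x hx x' hx' hlt => ?_⟩
      have := h (x, x', y) ⟨⟨hx, hx', hy⟩, hlt⟩
      simpa using this
    · refine ⟨-1, Or.inr rfl, fun y hy x hx x' hx' hlt => ?_⟩
      have := h (x, x', y) ⟨⟨hx, hx', hy⟩, hlt⟩
      simpa using this
  exact ⟨{ B with
    σ := σ, e := e, σ_eq := hσ, e_eq := he, mem_W := hW, base_notMem := hbase, t_eq := hteq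
    injOn_level := hginj, tendsto_level := hσt, orient := hor }, rfl⟩

end Foliation

/-- The germs at `(x, 0)` of the upper half plane, within a fixed rectangle. -/
def endFilter (x : ℝ) : Filter (ℝ × ℝ) := 𝓝[Ioo (-1) 1 ×ˢ Ioo 0 1] (x, 0)

lemma hasBasis_endFilter {x : ℝ} (hx : x ∈ Ioo (-1 : ℝ) 1) {Q : ℝ × ℝ → Prop}
    (h : ∀ᶠ p in endFilter x, Q p) :
    ∃ δ > 0, (Ioo (x - δ) (x + δ) ×ˢ Ioo 0 δ ⊆ Ioo (-1) 1 ×ˢ Ioo 0 1) ∧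
      ∀ p ∈ Ioo (x - δ) (x + δ) ×ˢ Ioo 0 δ, Q p := by
  rw [endFilter, eventually_nhdsWithin_iff, Metric.eventually_nhds_iff] at h
  obtain ⟨ε, hε, h⟩ := h
  have h3 : 0 < min (min ε 1) (min (x + 1) (1 - x)) :=
    lt_min (lt_min hε one_pos) (lt_min (by linarith [hx.1]) (by linarith [hx.2]))
  have h4 := min_le_left (min ε 1) (min (x + 1) (1 - x))
  have h5 := min_le_right (min ε 1) (min (x + 1) (1 - x))
  have h6 := min_le_left ε 1
  have h7 := min_le_right ε 1
  have h8 := min_le_left (x + 1) (1 - x)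
  have h9 := min_le_right (x + 1) (1 - x)
  set δ := min (min ε 1) (min (x + 1) (1 - x))
  have hsub : (Ioo (x - δ) (x + δ) ×ˢ Ioo 0 δ : Set (ℝ × ℝ)) ⊆ Ioo (-1) 1 ×ˢ Ioo 0 1 := by
    rintro p ⟨hp1, hp2⟩
    exact ⟨⟨by linarith [hp1.1], by linarith [hp1.2]⟩, hp2.1, by linarith [hp2.2]⟩
  refine ⟨δ, h3, hsub, fun p hp => h ?_ (hsub hp)⟩
  rw [Prod.dist_eq, max_lt_iff, Real.dist_eq, Real.dist_eq, abs_lt, abs_lt]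
  obtain ⟨hp1, hp2⟩ := hp
  refine ⟨⟨by linarith [hp1.1], by linarith [hp1.2]⟩, ?_, ?_⟩
  · change -ε < p.2 - 0; linarith [hp2.1]
  · change p.2 - 0 < ε; linarith [hp2.2]

lemma rect_mem_endFilter {x δ : ℝ} (hδ : 0 < δ) :
    Ioo (x - δ) (x + δ) ×ˢ Ioo 0 δ ∈ endFilter x := by
  have h1 : Ioo (x - δ) (x + δ) ×ˢ Ioo (-δ) δ ∈ 𝓝 ((x, 0) : ℝ × ℝ) :=
    prod_mem_nhds (Ioo_mem_nhds (by linarith) (by linarith)) (Ioo_mem_nhds (by linarith) hδ)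
  rw [endFilter]
  filter_upwards [mem_nhdsWithin_of_mem_nhds h1, self_mem_nhdsWithin] with p hp hp2
  exact ⟨hp.1, hp2.2.1, hp.2.2⟩

lemma endFilter_neBot {x : ℝ} (hx : x ∈ Ioo (-1 : ℝ) 1) : (endFilter x).NeBot := by
  refine ⟨fun h => ?_⟩
  have : ∀ᶠ p in endFilter x, False := by rw [h]; exact eventually_bot
  obtain ⟨δ, hδ, -, h⟩ := hasBasis_endFilter hx this
  exact h (x, δ / 2) ⟨⟨by simp [hδ], by simp [hδ]⟩, by simp [hδ], by simp only; linarith⟩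

namespace Foliation

variable {Z : Type*} [TopologicalSpace Z] {F : Foliation Z}

namespace Piece

variable {P : F.Piece} {S : Set Z}

namespace EndBox

variable (E : P.EndBox S)

lemma tendsto_b {x : ℝ} (hx : x ∈ Ioo (-1 : ℝ) 1) :
    Tendsto E.b (endFilter x) (𝓝 (E.b (x, 0))) :=
  (E.cont_b (x, 0) ⟨hx, by simp⟩).tendsto.mono_left
    (nhdsWithin_mono _ (prod_mono_right Ioo_subset_Ico_self))

lemma eventually_mem_interior (x : ℝ) :
    ∀ᶠ p in endFilter x, p ∈ Ioo (-1 : ℝ) 1 ×ˢ Ioo (0 : ℝ) 1 := self_mem_nhdsWithin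

lemma tendsto_t (x : ℝ) : Tendsto (fun p => P.t (E.b p)) (endFilter x) (𝓝 E.σ) := by
  have h : Tendsto Prod.snd (endFilter x) (𝓝[>] (0 : ℝ)) := by
    refine tendsto_nhdsWithin_iff.2 ⟨(continuous_snd.tendsto (x, (0 : ℝ))).mono_left
      nhdsWithin_le_nhds, ?_⟩
    filter_upwards [eventually_mem_interior x] with p hp
    exact hp.2.1
  refine (E.tendsto_level.comp h).congr' ?_
  filter_upwards [eventually_mem_interior x] with p hp
  exact (E.t_eq p hp).symm

lemma eventually_t_notMem (x : ℝ) {K : Set ℝ} (hK : IsCompact K) (hK1 : K ⊆ Ioo (-1) 1) :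
    ∀ᶠ p in endFilter x, P.t (E.b p) ∉ K := by
  refine E.tendsto_t x (hK.isClosed.isOpen_compl.mem_nhds fun h => ?_)
  have := hK1 h
  rcases E.σ_eq with h' | h' <;> rw [h'] at this
  · exact lt_irrefl _ this.2
  · exact lt_irrefl _ this.1

lemma abs_e_mul (x : ℝ) : |E.e * x| = |x| := by
  rcases E.e_eq with h | h <;> simp [h]

lemma e_mul_e (x : ℝ) : E.e * (E.e * x) = x := by
  rcases E.e_eq with h | h <;> simp [h]

lemma e_mul_mem {x a : ℝ} : E.e * x ∈ Ioo (-a) a ↔ x ∈ Ioo (-a) a := by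
  rw [mem_Ioo, mem_Ioo, ← abs_lt, ← abs_lt, abs_e_mul]

/-- Leaves of the piece meet an end box in at most one plaque. -/
lemma snd_eq {p p' : ℝ × ℝ} (hp : p ∈ Ioo (-1 : ℝ) 1 ×ˢ Ioo (0 : ℝ) 1)
    (hp' : p' ∈ Ioo (-1 : ℝ) 1 ×ˢ Ioo (0 : ℝ) 1) (h : P.t (E.b p) = P.t (E.b p')) :
    p.2 = p'.2 := by
  rw [E.t_eq p hp, E.t_eq p' hp'] at h
  exact E.injOn_level hp.2 hp'.2 h

lemma Θ_le_iff {x x' y : ℝ} (hx : x ∈ Ioo (-1 : ℝ) 1) (hx' : x' ∈ Ioo (-1 : ℝ) 1)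
    (hy : y ∈ Ioo (0 : ℝ) 1) : E.e * x ≤ E.e * x' ↔ P.Θ (E.b (x, y)) ≤ P.Θ (E.b (x', y)) := by
  have h := (E.orient y hy).le_iff_le hx hx'
  have h2 := (E.orient y hy).le_iff_le hx' hx
  rcases E.e_eq with h' | h' <;> rw [h'] at h h2 ⊢
  · simpa using h.symm
  · simpa using h2.symm

/-- Zero up to `-1/2`, of slope `1` up to its maximum `1` at `1/2`, then down to zero at `3/4`. Its
running maximum is therefore affine on `(-1/2, 1/2)`. -/
noncomputable def bumpX (u : ℝ) : ℝ := max 0 (min (u + 1 / 2) (3 - 4 * u))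

/-- Equal to `1` up to `1/4` and falling to zero at `1/2`, so that near the base only the horizontal
factor of a product matters. -/
noncomputable def bumpY (y : ℝ) : ℝ := max 0 (min 1 (2 - 4 * y))

lemma bumpX_mem (u : ℝ) : 0 ≤ bumpX u ∧ bumpX u ≤ 1 := by
  refine ⟨le_max_left _ _, max_le zero_le_one ?_⟩
  rcases le_total u (1 / 2) with h | h
  · exact (min_le_left _ _).trans (by linarith)
  · exact (min_le_right _ _).trans (by linarith)

lemma bumpY_mem (u : ℝ) : 0 ≤ bumpY u ∧ bumpY u ≤ 1 :=
  ⟨le_max_left _ _, max_le zero_le_one (min_le_left _ _)⟩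

lemma continuous_bumpX : Continuous bumpX := by unfold bumpX; fun_prop

lemma continuous_bumpY : Continuous bumpY := by unfold bumpY; fun_prop

lemma bumpY_eq_one {y : ℝ} (hy : y ≤ 1 / 4) : bumpY y = 1 := by
  rw [bumpY, min_eq_left (by linarith), max_eq_right zero_le_one]

lemma bumpX_of_le {u : ℝ} (hu : u ≤ 1 / 2) : bumpX u = max 0 (u + 1 / 2) := by
  rw [bumpX, min_eq_left (by linarith)]

lemma bumpX_le {u v : ℝ} (h : u ≤ v) : bumpX u ≤ bumpX (min v (1 / 2)) := by
  rw [bumpX_of_le (min_le_right v _)]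
  rcases le_total u (1 / 2) with hu | hu
  · rw [bumpX_of_le hu]
    exact max_le_max le_rfl (add_le_add_left (le_min h hu) _)
  · rw [min_eq_right (hu.trans h)]
    exact (bumpX_mem u).2.trans (by norm_num)

lemma bumpX_ne_zero {u : ℝ} (h : bumpX u ≠ 0) : u ∈ Ioo (-(3 / 4) : ℝ) (3 / 4) := by
  have : 0 < bumpX u := lt_of_le_of_ne (bumpX_mem u).1 h.symm
  have h2 := (lt_max_iff.1 this).resolve_left (lt_irrefl _)
  have h3 := lt_min_iff.1 h2
  constructor <;> linarith [h3.1, h3.2]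

lemma bumpY_ne_zero {y : ℝ} (h : bumpY y ≠ 0) : y < 1 / 2 := by
  have : 0 < bumpY y := lt_of_le_of_ne (bumpY_mem y).1 h.symm
  have h2 := (lt_max_iff.1 this).resolve_left (lt_irrefl _)
  linarith [(lt_min_iff.1 h2).2]

open scoped Classical in
/-- A bump function on an end box, equal to the leafwise coordinate near the central part. -/
noncomputable def tent (w : Z) : ℝ :=
  if w ∈ E.b '' (Ioo (-1) 1 ×ˢ Ioo 0 1) then bumpX (E.e * (E.c w).1) * bumpY (E.c w).2 else 0

lemma interior_subset : (Ioo (-1) 1 ×ˢ Ioo 0 1 : Set (ℝ × ℝ)) ⊆ Ioo (-1) 1 ×ˢ Ico 0 1 :=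
  prod_mono_right Ioo_subset_Ico_self

lemma tent_b {p : ℝ × ℝ} (hp : p ∈ Ioo (-1 : ℝ) 1 ×ˢ Ioo (0 : ℝ) 1) :
    E.tent (E.b p) = bumpX (E.e * p.1) * bumpY p.2 := by
  rw [tent, if_pos ⟨p, hp, rfl⟩, E.left_inv p (interior_subset hp)]

lemma tent_mem (w : Z) : 0 ≤ E.tent w ∧ E.tent w ≤ 1 := by
  rw [tent]
  split_ifs
  · exact ⟨mul_nonneg (bumpX_mem _).1 (bumpY_mem _).1,
      mul_le_one₀ (bumpX_mem _).2 (bumpY_mem _).1 (bumpY_mem _).2⟩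
  · simp

/-- A compact set containing the support of the bump function. -/
def core : Set Z := E.b '' (Icc (-(3 / 4)) (3 / 4) ×ˢ Icc 0 (1 / 2))

lemma isCompact_core : IsCompact E.core :=
  (isCompact_Icc.prod isCompact_Icc).image_of_continuousOn (E.cont_b.mono (by
    rintro p ⟨h1, h2⟩
    exact ⟨⟨by linarith [h1.1], by linarith [h1.2]⟩, h2.1, by linarith [h2.2]⟩))

lemma exists_of_tent_ne_zero {w : Z} (h : E.tent w ≠ 0) :
    ∃ p : ℝ × ℝ, p.1 ∈ Ioo (-(3 / 4) : ℝ) (3 / 4) ∧ p.2 ∈ Ioo (0 : ℝ) (1 / 2) ∧ w = E.b p := by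
  by_cases hw : w ∈ E.b '' (Ioo (-1) 1 ×ˢ Ioo 0 1)
  · obtain ⟨p, hp, rfl⟩ := hw
    rw [E.tent_b hp] at h
    exact ⟨p, E.e_mul_mem.1 (bumpX_ne_zero (left_ne_zero_of_mul h)),
      ⟨hp.2.1, bumpY_ne_zero (right_ne_zero_of_mul h)⟩, rfl⟩
  · rw [tent, if_neg hw] at h; exact absurd rfl h

lemma mem_core_of_tent_ne_zero {w : Z} (h : E.tent w ≠ 0) : w ∈ E.core := by
  obtain ⟨p, h1, h2, rfl⟩ := E.exists_of_tent_ne_zero h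
  exact ⟨p, ⟨Ioo_subset_Icc_self h1, Ioo_subset_Icc_self h2⟩, rfl⟩

lemma mem_interior_of_mem_core {w : Z} (hw : w ∈ P.W) (h : w ∈ E.core) :
    w ∈ E.b '' (Ioo (-1) 1 ×ˢ Ioo 0 1) := by
  obtain ⟨p, ⟨h1, h2⟩, rfl⟩ := h
  have h1' : p.1 ∈ Ioo (-1 : ℝ) 1 := ⟨by linarith [h1.1], by linarith [h1.2]⟩
  refine ⟨p, ⟨h1', lt_of_le_of_ne h2.1 fun h0 => ?_, by linarith [h2.2]⟩, rfl⟩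
  exact E.base_notMem p.1 h1' (by rwa [show (p.1, (0 : ℝ)) = p from Prod.ext rfl h0])

lemma continuousOn_tent [T2Space Z] : ContinuousOn E.tent P.W := by
  intro w hw
  refine ContinuousAt.continuousWithinAt ?_
  by_cases hc : w ∈ E.core
  · have hI := E.mem_interior_of_mem_core hw hc
    have hcc : ContinuousAt E.c w :=
      (E.cont_c.mono (image_mono interior_subset)).continuousAt (E.isOpen_interior.mem_nhds hI)
    have h : ContinuousAt (fun w => bumpX (E.e * (E.c w).1) * bumpY (E.c w).2) w :=
      (continuous_bumpX.continuousAt.comp (continuousAt_const.mul hcc.fst)).mul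
        (continuous_bumpY.continuousAt.comp hcc.snd)
    refine h.congr ?_
    filter_upwards [E.isOpen_interior.mem_nhds hI] with v hv
    rw [tent, if_pos hv]
  · have h : ContinuousAt (fun _ : Z => (0 : ℝ)) w := continuousAt_const
    refine h.congr ?_
    filter_upwards [E.isCompact_core.isClosed.isOpen_compl.mem_nhds hc] with v hv
    by_contra h0
    exact hv (E.mem_core_of_tent_ne_zero (Ne.symm h0))

lemma continuousOn_runSup_tent [T2Space Z] : ContinuousOn (P.runSup E.tent) P.W :=
  continuousOn_runSup (fun w _ => E.tent_mem w) E.continuousOn_tent fun _ ha =>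
    ⟨E.core, E.isCompact_core, fun _ _ h => E.mem_core_of_tent_ne_zero (ha.trans_le h).ne'⟩

/-- A leaf of the piece crosses the box in one plaque only, so the supremum is the running maximum
of the profile `bumpX` on this plaque. -/
lemma runSup_tent_b {p : ℝ × ℝ} (hp : p ∈ Ioo (-1 : ℝ) 1 ×ˢ Ioo (0 : ℝ) 1) (hy : p.2 ≤ 1 / 4) :
    P.runSup E.tent (E.b p) = bumpX (min (E.e * p.1) (1 / 2)) := by
  have hφ : ∀ w ∈ P.W, 0 ≤ E.tent w ∧ E.tent w ≤ 1 := fun w _ => E.tent_mem w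
  apply le_antisymm
  · refine runSup_le (E.mem_W p hp) fun w' hw' => ?_
    by_cases h0 : E.tent w' = 0
    · rw [h0]; exact (bumpX_mem _).1
    obtain ⟨q, hq1, hq2, rfl⟩ := E.exists_of_tent_ne_zero h0
    have hq : q ∈ Ioo (-1 : ℝ) 1 ×ˢ Ioo (0 : ℝ) 1 :=
      ⟨⟨by linarith [hq1.1], by linarith [hq1.2]⟩, hq2.1, by linarith [hq2.2]⟩
    have hqp := E.snd_eq hq hp hw'.2.1
    rw [E.tent_b hq]
    have h1 : E.e * q.1 ≤ E.e * p.1 := by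
      rw [E.Θ_le_iff hq.1 hp.1 hq.2]
      have := hw'.2.2
      rwa [← Prod.mk.eta (p := q), ← Prod.mk.eta (p := p), ← hqp] at this
    calc _ ≤ bumpX (E.e * q.1) * 1 := mul_le_mul_of_nonneg_left (bumpY_mem _).2 (bumpX_mem _).1
      _ ≤ _ := by rw [mul_one]; exact bumpX_le h1
  · have hep : E.e * p.1 ∈ Ioo (-1 : ℝ) 1 := E.e_mul_mem.2 hp.1
    have hm : min (E.e * p.1) (1 / 2) ∈ Ioo (-1 : ℝ) 1 :=
      ⟨lt_min hep.1 (by norm_num), (min_le_left _ _).trans_lt hep.2⟩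
    have hx : E.e * min (E.e * p.1) (1 / 2) ∈ Ioo (-1 : ℝ) 1 := E.e_mul_mem.2 hm
    have hq : (E.e * min (E.e * p.1) (1 / 2), p.2) ∈ Ioo (-1 : ℝ) 1 ×ˢ Ioo (0 : ℝ) 1 := ⟨hx, hp.2⟩
    have h1 : E.tent (E.b (E.e * min (E.e * p.1) (1 / 2), p.2)) =
        bumpX (min (E.e * p.1) (1 / 2)) := by
      rw [E.tent_b hq, bumpY_eq_one hy, mul_one, E.e_mul_e]
    rw [← h1]
    refine le_runSup hφ ⟨E.mem_W _ hq, (E.t_eq _ hq).trans (E.t_eq p hp).symm, ?_⟩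
    have := (E.Θ_le_iff hx hp.1 hp.2).1 (by rw [E.e_mul_e]; exact min_le_left _ _)
    exact this

/-- A leaf at a level below the transition zone crosses the core in a full plaque, and the point
either precedes all of it or follows all of it, which gives `0` or `1`. A leaf at a level beyond
that zone misses the support. On connected sets off the core and this zone the function is thus
constant. -/
lemma runSup_tent_of_notMem_core {w : Z} (hw : w ∈ P.W) (hc : w ∉ E.core)
    (ht : P.t w ∉ (fun y => P.t (E.b (0, y))) '' Icc (1 / 4) (1 / 2)) :
    P.runSup E.tent w = 0 ∨ P.runSup E.tent w = 1 := by
  have hφ : ∀ w ∈ P.W, 0 ≤ E.tent w ∧ E.tent w ≤ 1 := fun w _ => E.tent_mem w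
  have hzero : (∀ w' ∈ P.below w, E.tent w' = 0) → P.runSup E.tent w = 0 := fun h =>
    le_antisymm (runSup_le hw fun w' hw' => (h w' hw').le) (runSup_mem hφ hw).1
  by_cases hy : ∃ y ∈ Ioo (0 : ℝ) (1 / 4), P.t w = P.t (E.b (0, y))
  · obtain ⟨y, hy, hty⟩ := hy
    have hI : ∀ u ∈ Icc (-(3 / 4) : ℝ) (3 / 4), (u, y) ∈ Ioo (-1 : ℝ) 1 ×ˢ Ioo (0 : ℝ) 1 :=
      fun u hu => ⟨⟨by linarith [hu.1], by linarith [hu.2]⟩, hy.1, by linarith [hy.2]⟩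
    have hte : ∀ u ∈ Icc (-(3 / 4) : ℝ) (3 / 4), P.t w = P.t (E.b (u, y)) := fun u hu =>
      hty.trans (E.t_eq (u, y) (hI u hu)).symm
    rcases P.lt_or_gt_of_isPreconnected (isPreconnected_Icc (a := (-(3 / 4) : ℝ)) (b := 3 / 4))
      (f := fun _ => w) (g := fun u => E.b (u, y)) continuousOn_const
      (E.cont_b.comp (by fun_prop) fun u hu => interior_subset (hI u hu)) (fun _ _ => hw)
      (fun u hu => E.mem_W _ (hI u hu)) hte
      (fun u hu h => hc ⟨(u, y), ⟨hu, hy.1.le, by linarith [hy.2]⟩, h.symm⟩) with h | h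
    · refine Or.inl (hzero fun w' hw' => ?_)
      by_contra h0
      obtain ⟨q, hq1, hq2, rfl⟩ := E.exists_of_tent_ne_zero h0
      have hq : q ∈ Ioo (-1 : ℝ) 1 ×ˢ Ioo (0 : ℝ) 1 :=
        ⟨⟨by linarith [hq1.1], by linarith [hq1.2]⟩, hq2.1, by linarith [hq2.2]⟩
      have hq1' := Ioo_subset_Icc_self hq1
      have : q.2 = y := E.snd_eq hq (hI q.1 hq1') (hw'.2.1.trans (hte q.1 hq1'))
      have h2 := h q.1 hq1'
      rw [← this, Prod.mk.eta] at h2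
      exact absurd hw'.2.2 (not_le.2 h2)
    · refine Or.inr (le_antisymm (runSup_mem hφ hw).2 ?_)
      have he : E.e * (1 / 2) ∈ Icc (-(3 / 4) : ℝ) (3 / 4) :=
        Ioo_subset_Icc_self (E.e_mul_mem.2 (by constructor <;> norm_num))
      have h1 : E.tent (E.b (E.e * (1 / 2), y)) = 1 := by
        rw [E.tent_b (hI _ he), bumpY_eq_one hy.2.le, E.e_mul_e, bumpX_of_le le_rfl]
        norm_num
      rw [← h1]
      exact le_runSup hφ ⟨E.mem_W _ (hI _ he), (hte _ he).symm, (h _ he).le⟩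
  · refine Or.inl (hzero fun w' hw' => ?_)
    by_contra h0
    obtain ⟨q, hq1, hq2, rfl⟩ := E.exists_of_tent_ne_zero h0
    have hq : q ∈ Ioo (-1 : ℝ) 1 ×ˢ Ioo (0 : ℝ) 1 :=
      ⟨⟨by linarith [hq1.1], by linarith [hq1.2]⟩, hq2.1, by linarith [hq2.2]⟩
    have hte : P.t w = P.t (E.b (0, q.2)) := hw'.2.1.symm.trans (E.t_eq q hq)
    rcases lt_or_ge q.2 (1 / 4) with h | h
    · exact hy ⟨q.2, ⟨hq2.1, h⟩, hte⟩
    · exact ht ⟨q.2, ⟨h, hq2.2.le⟩, hte.symm⟩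

/-- A connected set near a point of an end box lies inside the end box or is disjoint from it. -/
lemma subset_interior_or_disjoint {A : Set Z} (hA : IsPreconnected A) (hAW : A ⊆ P.W)
    (hn : A ⊆ E.nhd) :
    A ⊆ E.b '' (Ioo (-1) 1 ×ˢ Ioo 0 1) ∨ Disjoint A E.dom := by
  have hd : ∀ w ∈ P.W, w ∈ E.dom → w ∈ E.b '' (Ioo (-1) 1 ×ˢ Ioo 0 1) := by
    rintro _ hw ⟨p, hp, rfl⟩
    refine ⟨p, ⟨hp.1, lt_of_le_of_ne hp.2.1 fun h0 => ?_, hp.2.2⟩, rfl⟩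
    exact E.base_notMem p.1 hp.1 (by rwa [show (p.1, (0 : ℝ)) = p from Prod.ext rfl h0])
  have := isPreconnected_iff_subset_of_disjoint.1 hA _ (E.nhd ∩ (closure E.dom)ᶜ)
    E.isOpen_interior (E.isOpen_nhd.inter isClosed_closure.isOpen_compl) (by
      intro w hw
      by_cases h : w ∈ E.dom
      · exact Or.inl (hd w (hAW hw) h)
      · exact Or.inr ⟨hn hw, fun h' => h (E.closure_subset ⟨hn hw, h'⟩)⟩) (by
      rw [eq_empty_iff_forall_notMem]
      rintro _ ⟨-, ⟨p, hp, rfl⟩, -, h⟩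
      exact h (subset_closure ⟨p, interior_subset hp, rfl⟩))
  refine this.imp_right fun h => Set.disjoint_left.2 fun w hw hwd => (h hw).2 (subset_closure hwd)

lemma core_subset_dom : E.core ⊆ E.dom := by
  rintro _ ⟨p, ⟨h1, h2⟩, rfl⟩
  exact ⟨p, ⟨⟨by linarith [h1.1], by linarith [h1.2]⟩, h2.1, by linarith [h2.2]⟩, rfl⟩

/-- The germ of an end box at a boundary point either avoids the core of another one or is
contained in it. -/
lemma core_dichotomy [T2Space Z] (E' : P.EndBox S) {x : ℝ} (hx : x ∈ Ioo (-1 : ℝ) 1) :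
    (∀ᶠ p in endFilter x, E'.b p ∉ E.core) ∨
      (E'.b (x, 0) ∈ E.dom ∧ ∀ᶠ p in endFilter x, E'.b p ∈ E.b '' (Ioo (-1) 1 ×ˢ Ioo 0 1)) := by
  by_cases hz : E'.b (x, 0) ∈ E.dom
  · obtain ⟨δ, hδ, hsub, hn⟩ := hasBasis_endFilter hx
      ((E'.tendsto_b hx).eventually (E.isOpen_nhd.eventually_mem (E.dom_subset hz)))
    have hpre : IsPreconnected (E'.b '' (Ioo (x - δ) (x + δ) ×ˢ Ioo 0 δ)) :=
      (isPreconnected_Ioo.prod isPreconnected_Ioo).image _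
        (E'.cont_b.mono (hsub.trans interior_subset))
    rcases E.subset_interior_or_disjoint hpre
      (by rintro _ ⟨p, hp, rfl⟩; exact E'.mem_W p (hsub hp))
      (by rintro _ ⟨p, hp, rfl⟩; exact hn p hp) with h | h
    · refine Or.inr ⟨hz, ?_⟩
      filter_upwards [rect_mem_endFilter hδ] with p hp
      exact h ⟨p, hp, rfl⟩
    · refine Or.inl ?_
      filter_upwards [rect_mem_endFilter hδ] with p hp hpc
      exact Set.disjoint_left.1 h ⟨p, hp, rfl⟩ (E.core_subset_dom hpc)
  · refine Or.inl ((E'.tendsto_b hx).eventually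
      (E.isCompact_core.isClosed.isOpen_compl.eventually_mem fun h => hz (E.core_subset_dom h)))

/-- The common point is outside the piece, so it lies on the bottom plaque of `E`; continuity of
`E.c` then carries the germ of `E'` to a germ of `E`. -/
lemma tendsto_c (E' : P.EndBox S) {x : ℝ} (hx : x ∈ Ioo (-1 : ℝ) 1) (hz : E'.b (x, 0) ∈ E.dom)
    (h : ∀ᶠ p in endFilter x, E'.b p ∈ E.b '' (Ioo (-1) 1 ×ˢ Ioo 0 1)) :
    ∃ x' ∈ Ioo (-1 : ℝ) 1, E.b (x', 0) = E'.b (x, 0) ∧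
      Tendsto (fun p => E.c (E'.b p)) (endFilter x) (endFilter x') := by
  obtain ⟨q, hq, hqz⟩ := id hz
  have h0 : q.2 = 0 := by
    by_contra hne
    refine E'.base_notMem x hx ?_
    rw [← hqz]
    exact E.mem_W q ⟨hq.1, lt_of_le_of_ne hq.2.1 (Ne.symm hne), hq.2.2⟩
  have hq0 : q = (q.1, 0) := Prod.ext rfl h0
  refine ⟨q.1, hq.1, by rw [← hq0]; exact hqz, tendsto_nhdsWithin_iff.2 ⟨?_, ?_⟩⟩
  · have h1 : Tendsto E'.b (endFilter x) (𝓝[E.dom] (E'.b (x, 0))) :=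
      tendsto_nhdsWithin_iff.2 ⟨E'.tendsto_b hx, h.mono fun p hp => image_mono interior_subset hp⟩
    have h2 := (E.cont_c _ hz).tendsto.comp h1
    rw [← hqz, E.left_inv q hq] at h2
    rwa [← hq0]
  · filter_upwards [h] with p ⟨r, hr, hrp⟩
    rw [← hrp, E.left_inv r (interior_subset hr)]; exact hr

end EndBox

end Piece

end Foliation

lemma tendsto_prodMk_endFilter {x : ℝ} (hx : x ∈ Ioo (-1 : ℝ) 1) :
    Tendsto (fun y : ℝ => (x, y)) (𝓝[>] 0) (endFilter x) := by
  refine tendsto_nhdsWithin_iff.2 ⟨?_, ?_⟩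
  · exact ((by fun_prop : Continuous fun y : ℝ => (x, y)).tendsto 0).mono_left nhdsWithin_le_nhds
  · filter_upwards [Ioo_mem_nhdsGT one_pos] with y hy
    exact ⟨hx, hy⟩

lemma tendsto_fst_endFilter (x : ℝ) : Tendsto Prod.fst (endFilter x) (𝓝 x) :=
  (continuous_fst.tendsto (x, (0 : ℝ))).mono_left nhdsWithin_le_nhds

lemma tendsto_snd_endFilter (x : ℝ) : Tendsto Prod.snd (endFilter x) (𝓝 (0 : ℝ)) :=
  (continuous_snd.tendsto (x, (0 : ℝ))).mono_left nhdsWithin_le_nhds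

/-! ### The coordinate along the leaves of a piece. -/

namespace Foliation

variable {Z : Type*} [TopologicalSpace Z] {F : Foliation Z}

namespace Piece

/-- A continuous function on a piece, monotone along the leaves, with limits at the germs of
end boxes. -/
structure Admissible (P : F.Piece) (S : Set Z) (m : Z → ℝ) : Prop where
  cont : ContinuousOn m P.W
  mono : ∀ w ∈ P.W, ∀ w' ∈ P.W, P.t w = P.t w' → P.Θ w ≤ P.Θ w' → m w ≤ m w'
  lim : ∀ E : P.EndBox S, ∀ x ∈ Ioo (-1 : ℝ) 1,
    ∃ L, Tendsto (fun p => m (E.b p)) (endFilter x) (𝓝 L)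

variable {P : F.Piece} {S : Set Z} {m m' : Z → ℝ}

lemma Admissible.add (h : P.Admissible S m) (h' : P.Admissible S m') :
    P.Admissible S (fun w => m w + m' w) where
  cont := h.cont.add h'.cont
  mono w hw w' hw' ht hΘ := add_le_add (h.mono w hw w' hw' ht hΘ) (h'.mono w hw w' hw' ht hΘ)
  lim E x hx := by
    obtain ⟨L, hL⟩ := h.lim E x hx
    obtain ⟨L', hL'⟩ := h'.lim E x hx
    exact ⟨L + L', hL.add hL'⟩

/-- Continuity follows from uniform convergence, and the limits at end boxes from dominated
convergence. -/
lemma Admissible.tsum {ι : Type*} {m : ι → Z → ℝ} (h : ∀ i, P.Admissible S (m i))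
    (hm : ∀ i, ∀ w ∈ P.W, 0 ≤ m i w ∧ m i w ≤ 1) {ε : ι → ℝ} (hε : Summable ε)
    (hε0 : ∀ i, 0 ≤ ε i) : P.Admissible S (fun w => ∑' i, ε i * m i w) := by
  have hb : ∀ i, ∀ w ∈ P.W, ‖ε i * m i w‖ ≤ ε i := fun i w hw => by
    rw [Real.norm_of_nonneg (mul_nonneg (hε0 i) (hm i w hw).1)]
    exact mul_le_of_le_one_right (hε0 i) (hm i w hw).2
  refine ⟨continuousOn_tsum (fun i => continuousOn_const.mul (h i).cont) hε hb, ?_, ?_⟩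
  · intro w hw w' hw' ht hΘ
    exact Summable.tsum_le_tsum
      (fun i => mul_le_mul_of_nonneg_left ((h i).mono w hw w' hw' ht hΘ) (hε0 i))
      (Summable.of_norm_bounded hε fun i => hb i w hw)
      (Summable.of_norm_bounded hε fun i => hb i w' hw')
  · intro E x hx
    choose L hL using fun i => (h i).lim E x hx
    refine ⟨_, tendsto_tsum_of_dominated_convergence hε (fun i => (hL i).const_mul (ε i)) ?_⟩
    filter_upwards [EndBox.eventually_mem_interior x] with p hp i
    exact hb i _ (E.mem_W p hp)

lemma Admissible.lim_mono (h : P.Admissible S m) (E : P.EndBox S) {x x' : ℝ}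
    (hx : x ∈ Ioo (-1 : ℝ) 1) (hx' : x' ∈ Ioo (-1 : ℝ) 1) (hle : E.e * x ≤ E.e * x') {L L' : ℝ}
    (hL : Tendsto (fun p => m (E.b p)) (endFilter x) (𝓝 L))
    (hL' : Tendsto (fun p => m (E.b p)) (endFilter x') (𝓝 L')) : L ≤ L' := by
  refine le_of_tendsto_of_tendsto (hL.comp (tendsto_prodMk_endFilter hx))
    (hL'.comp (tendsto_prodMk_endFilter hx')) ?_
  filter_upwards [Ioo_mem_nhdsGT one_pos] with y hy
  exact h.mono _ (E.mem_W (x, y) ⟨hx, hy⟩) _ (E.mem_W (x', y) ⟨hx', hy⟩)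
    ((E.t_eq (x, y) ⟨hx, hy⟩).trans (E.t_eq (x', y) ⟨hx', hy⟩).symm)
    ((E.Θ_le_iff hx hx' hy).1 hle)

/-- By `core_dichotomy` the germ of another end box either avoids the core, where the function is
`0` or `1` and constant by connectedness, or lies inside the box, where there is an explicit
formula. -/
lemma EndBox.admissible_runSup_tent [T2Space Z] (E : P.EndBox S) :
    P.Admissible S (P.runSup E.tent) where
  cont := E.continuousOn_runSup_tent
  mono w hw w' _ ht hΘ := runSup_mono (fun w _ => E.tent_mem w) hw ht hΘ
  lim E' x hx := by
    rcases E.core_dichotomy E' hx with h | ⟨hz, h⟩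
    · have hsubI : Icc (1 / 4 : ℝ) (1 / 2) ⊆ Ioo 0 1 := fun y hy =>
        ⟨by linarith [hy.1], by linarith [hy.2]⟩
      have h0 : (0 : ℝ) ∈ Ioo (-1 : ℝ) 1 := by simp
      have hK : IsCompact ((fun y => P.t (E.b (0, y))) '' Icc (1 / 4) (1 / 2)) := by
        refine isCompact_Icc.image_of_continuousOn (P.cont_t.comp (E.cont_b.comp (by fun_prop)
          fun y hy => interior_subset ⟨h0, hsubI hy⟩) fun y hy => E.mem_W (0, y) ⟨h0, hsubI hy⟩)
      have hK1 : (fun y => P.t (E.b (0, y))) '' Icc (1 / 4) (1 / 2) ⊆ Ioo (-1) 1 := by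
        rintro _ ⟨y, hy, rfl⟩
        exact P.t_mem (E.mem_W (0, y) ⟨h0, hsubI hy⟩)
      obtain ⟨δ, hδ, hsub, hQ⟩ := hasBasis_endFilter hx (h.and (E'.eventually_t_notMem x hK hK1))
      have hc : ContinuousOn (fun p => P.runSup E.tent (E'.b p))
          (Ioo (x - δ) (x + δ) ×ˢ Ioo 0 δ) :=
        E.continuousOn_runSup_tent.comp (E'.cont_b.mono (hsub.trans interior_subset))
          fun p hp => E'.mem_W p (hsub hp)
      obtain ⟨L, -, hL⟩ := (isPreconnected_Ioo.prod isPreconnected_Ioo).eqOn_const_of_mapsTo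
        (T := ({0, 1} : Set ℝ)) (Set.toFinite _).isDiscrete hc
        (fun p hp => E.runSup_tent_of_notMem_core (E'.mem_W p (hsub hp)) (hQ p hp).1 (hQ p hp).2)
        ⟨0, by simp⟩
      refine ⟨L, tendsto_const_nhds.congr' ?_⟩
      filter_upwards [rect_mem_endFilter hδ] with p hp
      exact (hL hp).symm
    · obtain ⟨x', hx', -, hc⟩ := E.tendsto_c E' hx hz h
      have h1 : Tendsto (fun p : ℝ × ℝ => bumpX (min (E.e * p.1) (1 / 2))) (endFilter x')
          (𝓝 (bumpX (min (E.e * x') (1 / 2)))) := by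
        have : Continuous fun u : ℝ => bumpX (min (E.e * u) (1 / 2)) :=
          continuous_bumpX.comp (by fun_prop)
        exact (this.tendsto x').comp (tendsto_fst_endFilter x')
      refine ⟨_, (h1.comp hc).congr' ?_⟩
      have hs := (tendsto_snd_endFilter x').comp hc
      filter_upwards [h, hs.eventually_lt_const (by norm_num : (0 : ℝ) < 1 / 4)] with p ⟨q, hq, hqp⟩ hp
      have hcq : E.c (E'.b p) = q := by rw [← hqp, E.left_inv q (interior_subset hq)]
      simp only [Function.comp, hcq] at hp ⊢
      rw [← hqp, E.runSup_tent_b hq hp.le]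

/-- On the central half of the base the limit is affine with slope `E.e`. This term makes the final
coordinate injective on the base. -/
lemma EndBox.tendsto_runSup_tent (E : P.EndBox S) {x : ℝ} (hx : x ∈ Ioo (-(1 / 2) : ℝ) (1 / 2)) :
    Tendsto (fun p => P.runSup E.tent (E.b p)) (endFilter x) (𝓝 (E.e * x + 1 / 2)) := by
  have he := E.e_mul_mem.2 hx
  have h1 : Tendsto (fun p : ℝ × ℝ => bumpX (min (E.e * p.1) (1 / 2))) (endFilter x)
      (𝓝 (bumpX (min (E.e * x) (1 / 2)))) := by
    have : Continuous fun u : ℝ => bumpX (min (E.e * u) (1 / 2)) :=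
      continuous_bumpX.comp (by fun_prop)
    exact (this.tendsto x).comp (tendsto_fst_endFilter x)
  have h2 : bumpX (min (E.e * x) (1 / 2)) = E.e * x + 1 / 2 := by
    rw [min_eq_left he.2.le, bumpX_of_le he.2.le, max_eq_right (by linarith [he.1])]
  rw [h2] at h1
  refine h1.congr' ?_
  filter_upwards [eventually_mem_interior x,
    (tendsto_snd_endFilter x).eventually_lt_const (by norm_num : (0 : ℝ) < 1 / 4)] with p hp hp2
  rw [E.runSup_tent_b hp hp2.le]

/-- Running suprema of functions compactly supported in the piece are admissible. -/
lemma admissible_runSup {φ : Z → ℝ} (hc : Continuous φ) (hφ : ∀ w, 0 ≤ φ w ∧ φ w ≤ 1)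
    {K : Set Z} (hK : IsCompact K) (hKW : K ⊆ P.W) (hKφ : ∀ w ∉ K, φ w = 0) :
    P.Admissible S (P.runSup φ) where
  cont := continuousOn_runSup (fun w _ => hφ w) hc.continuousOn fun a ha => ⟨K, hK, fun w _ h => by
    by_contra hw
    rw [hKφ w hw] at h
    exact absurd ha (not_lt.2 h)⟩
  mono w hw w' _ ht hΘ := runSup_mono (fun w _ => hφ w) hw ht hΘ
  lim E x hx := by
    -- The levels of `K` form a compact subset of `(-1, 1)`, so leaves close to the base of an end
    -- box do not meet `K`.
    refine ⟨0, tendsto_const_nhds.congr' ?_⟩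
    filter_upwards [E.eventually_t_notMem x (hK.image_of_continuousOn (P.cont_t.mono hKW))
      (by rintro _ ⟨w, hw, rfl⟩; exact P.t_mem (hKW hw)), EndBox.eventually_mem_interior x]
      with p hp hpI
    refine (le_antisymm (runSup_le (E.mem_W p hpI) fun w hw => ?_)
      (runSup_mem (fun w _ => hφ w) (E.mem_W p hpI)).1).symm
    rw [hKφ w fun h => hp ⟨w, h, hw.2.1⟩]

/-- A function that is large near the initial ends of the leaves and vanishes near the end
boxes. -/
noncomputable def depth (P : F.Piece) (φ : Z → ℝ) (w : Z) : ℝ :=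
  max 0 ((P.runSup φ w)⁻¹ - (1 - P.t w ^ 2)⁻¹)

variable {φ : Z → ℝ}

lemma one_sub_sq_pos {w : Z} (hw : w ∈ P.W) : 0 < 1 - P.t w ^ 2 := by
  have := P.t_mem hw
  nlinarith [this.1, this.2]

lemma runSup_pos (hφ : ∀ w, 0 < φ w ∧ φ w ≤ 1) {w : Z} (hw : w ∈ P.W) : 0 < P.runSup φ w :=
  (hφ w).1.trans_le (le_runSup (fun w _ => ⟨(hφ w).1.le, (hφ w).2⟩) (self_mem_below hw))

lemma continuousOn_depth (hc : Continuous φ) (hφ : ∀ w, 0 < φ w ∧ φ w ≤ 1)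
    (hK : ∀ a > 0, ∃ K, IsCompact K ∧ ∀ w, a ≤ φ w → w ∈ K) :
    ContinuousOn (P.depth φ) P.W := by
  have h1 : ContinuousOn (P.runSup φ) P.W :=
    continuousOn_runSup (fun w _ => ⟨(hφ w).1.le, (hφ w).2⟩) hc.continuousOn fun a ha => by
      obtain ⟨K, hK, h⟩ := hK a ha
      exact ⟨K, hK, fun w _ => h w⟩
  exact continuousOn_const.sup ((h1.inv₀ fun w hw => (runSup_pos hφ hw).ne').sub
    ((continuousOn_const.sub (P.cont_t.pow 2)).inv₀ fun w hw => (one_sub_sq_pos hw).ne'))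

lemma depth_anti (hφ : ∀ w, 0 < φ w ∧ φ w ≤ 1) {w w' : Z} (hw : w ∈ P.W)
    (ht : P.t w = P.t w') (hΘ : P.Θ w ≤ P.Θ w') : P.depth φ w' ≤ P.depth φ w := by
  unfold depth
  rw [← ht]
  exact max_le_max le_rfl (sub_le_sub_right (inv_anti₀ (runSup_pos hφ hw)
    (runSup_mono (fun w _ => ⟨(hφ w).1.le, (hφ w).2⟩) hw ht hΘ)) _)

/-- A leaf is properly embedded: far towards its beginning it has left the compact set where `φ` is
not small, so the supremum over the initial segment is small there. -/
lemma exists_lt_depth (hφ : ∀ w, 0 < φ w ∧ φ w ≤ 1)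
    (hK : ∀ a > 0, ∃ K, IsCompact K ∧ ∀ w, a ≤ φ w → w ∈ K) [T2Space Z] {w : Z} (hw : w ∈ P.W)
    (a : ℝ) : ∃ w' ∈ P.below w, a < P.depth φ w' := by
  obtain ⟨γ, hγ, h1, -⟩ := P.exists_param hw
  set k := (1 - P.t w ^ 2)⁻¹ with hk
  have hk0 : 0 < k := inv_pos.2 (one_sub_sq_pos hw)
  -- A running supremum below this bound has an inverse of at least `|a| + 1 + k`, which exceeds `a`
  -- after subtraction of `k`.
  have hc0 : 0 < (|a| + 1 + k)⁻¹ := by positivity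
  obtain ⟨K, hKc, hKφ⟩ := hK _ hc0
  obtain ⟨u₀, hu₀⟩ := (hγ.isCompact_preimage hKc).bddBelow
  set u := min u₀ (P.Θ w) - 1
  have hu1 : u < u₀ := (sub_one_lt _).trans_le (min_le_left _ _)
  have hu2 : u < P.Θ w := (sub_one_lt _).trans_le (min_le_right _ _)
  refine ⟨γ u, ⟨(h1 u).1, (h1 u).2.1, by rw [(h1 u).2.2]; exact hu2.le⟩, ?_⟩
  have hle : P.runSup φ (γ u) ≤ (|a| + 1 + k)⁻¹ := by
    refine runSup_le (h1 u).1 fun v hv => ?_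
    by_contra! hlt
    have hvw : P.t v = P.t w := hv.2.1.trans (h1 u).2.1
    have hvγ : γ (P.Θ v) = v := P.eq_of_eq hv.1 (h1 _).1 ((h1 _).2.1.trans hvw.symm) (h1 _).2.2
    have : u₀ ≤ P.Θ v := hu₀ (show P.Θ v ∈ γ ⁻¹' K by
      rw [mem_preimage, hvγ]; exact hKφ v hlt.le)
    have h3 := hv.2.2
    rw [(h1 u).2.2] at h3
    linarith
  have h4 := inv_anti₀ (runSup_pos hφ (h1 u).1) hle
  rw [inv_inv] at h4
  refine lt_max_of_lt_right ?_
  rw [(h1 u).2.1, ← hk]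
  linarith [le_abs_self a]

/-- Near the base `φ` is bounded away from zero, whereas `1 - t ^ 2` tends to zero. The subtracted
term then wins, and the maximum with `0` cuts the depth off. -/
lemma eventually_depth_eq_zero (hc : Continuous φ) (hφ : ∀ w, 0 < φ w ∧ φ w ≤ 1)
    (E : P.EndBox S) {x : ℝ} (hx : x ∈ Ioo (-1 : ℝ) 1) :
    ∀ᶠ p in endFilter x, P.depth φ (E.b p) = 0 := by
  have h1 : Tendsto (fun p => φ (E.b p)) (endFilter x) (𝓝 (φ (E.b (x, 0)))) :=
    (hc.tendsto _).comp (E.tendsto_b hx)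
  have h2 : Tendsto (fun p => 1 - P.t (E.b p) ^ 2) (endFilter x) (𝓝 0) := by
    have := (tendsto_const_nhds (x := (1 : ℝ))).sub ((E.tendsto_t x).pow 2)
    have h0 : 1 - E.σ ^ 2 = 0 := by rcases E.σ_eq with h | h <;> rw [h] <;> norm_num
    rwa [h0] at this
  filter_upwards [h2.eventually_lt h1 (hφ _).1, EndBox.eventually_mem_interior x] with p hp hpI
  have hW := E.mem_W p hpI
  refine max_eq_left (sub_nonpos.2 (inv_anti₀ (one_sub_sq_pos hW) (hp.le.trans ?_)))
  exact le_runSup (fun w _ => ⟨(hφ w).1.le, (hφ w).2⟩) (self_mem_below hW)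

/-- An end box of the reversed piece. -/
def EndBox.rev (E : P.EndBox S) : P.rev.EndBox S :=
  { E with
    e := -E.e
    e_eq := by rcases E.e_eq with h | h <;> simp [h]
    orient := fun y hy x hx x' hx' h => by
      have := E.orient y hy hx hx' h
      simpa [Piece.rev] using this }

/-- The first depth is large near the final ends of the leaves, the second near the initial ends.
Their difference is unbounded on every leaf in both directions, without affecting the limits at the
end boxes. -/
lemma admissible_depth [T2Space Z] (hc : Continuous φ) (hφ : ∀ w, 0 < φ w ∧ φ w ≤ 1)
    (hK : ∀ a > 0, ∃ K, IsCompact K ∧ ∀ w, a ≤ φ w → w ∈ K) :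
    P.Admissible S (fun w => P.rev.depth φ w - P.depth φ w) where
  cont := (continuousOn_depth (P := P.rev) hc hφ hK).sub (continuousOn_depth hc hφ hK)
  mono w hw w' hw' ht hΘ := sub_le_sub
    (depth_anti (P := P.rev) hφ hw' ht.symm (neg_le_neg hΘ)) (depth_anti hφ hw ht hΘ)
  lim E x hx := by
    refine ⟨0, tendsto_const_nhds.congr' ?_⟩
    filter_upwards [eventually_depth_eq_zero hc hφ E hx,
      eventually_depth_eq_zero hc hφ E.rev hx] with p hp hp'
    rw [hp]
    change 0 = P.rev.depth φ (E.rev.b p) - 0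
    rw [hp', sub_zero]

/-- A weighted sum of all bumps. If finitely many weights exhaust the total `c` up to less than `a`,
a point outside the supports of the corresponding bumps has value below `a`; so superlevel sets lie
in finite unions of compact sets. -/
lemma exists_proper_function [T2Space Z] [SecondCountableTopology Z] [LocallyCompactSpace Z] :
    ∃ φ : Z → ℝ, Continuous φ ∧ (∀ w, 0 < φ w ∧ φ w ≤ 1) ∧
      ∀ a > 0, ∃ K, IsCompact K ∧ ∀ w, a ≤ φ w → w ∈ K := by
  obtain ⟨u, hu, hu1, huK, hN⟩ := exists_bump_family (Z := Z)
  obtain ⟨ε, hε, c, hs, hc⟩ := posSumOfEncodable one_pos (ℕ × ℕ)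
  have hb : ∀ i w, ‖ε i * u i w‖ ≤ ε i := fun i w => by
    rw [Real.norm_of_nonneg (mul_nonneg (hε i).le (hu1 i w).1)]
    exact mul_le_of_le_one_right (hε i).le (hu1 i w).2
  have hsum : ∀ w, Summable fun i => ε i * u i w := fun w =>
    Summable.of_norm_bounded hs.summable fun i => hb i w
  have h0 : ∀ i w, 0 ≤ ε i * u i w := fun i w => mul_nonneg (hε i).le (hu1 i w).1
  refine ⟨fun w => ∑' i, ε i * u i w,
    continuous_tsum (fun i => continuous_const.mul (hu i)) hs.summable hb, fun w => ⟨?_, ?_⟩, ?_⟩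
  · obtain ⟨i, hi, -⟩ := hN w univ univ_mem
    exact (hsum w).tsum_pos (h0 · w) i (mul_pos (hε i) hi)
  · refine le_trans (Summable.tsum_le_tsum (fun i => (le_abs_self _).trans (hb i w)) (hsum w)
      hs.summable) ?_
    rw [hs.tsum_eq]; exact hc
  · intro a ha
    have h1 : ∀ᶠ s : Finset (ℕ × ℕ) in atTop, c - a < ∑ i ∈ s, ε i :=
      hs.eventually_const_lt (by linarith)
    obtain ⟨s, hsa⟩ := h1.exists
    choose K hK hKu using huK
    refine ⟨⋃ i ∈ s, K i, s.finite_toSet.isCompact_biUnion fun i _ => hK i, fun w hw => ?_⟩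
    by_contra hwn
    simp only [mem_iUnion, not_exists] at hwn
    have h2 : ∑ i ∈ s, (ε i - ε i * u i w) ≤ ∑' i, (ε i - ε i * u i w) :=
      (hs.summable.sub (hsum w)).sum_le_tsum s fun i _ =>
        sub_nonneg.2 (mul_le_of_le_one_right (hε i).le (hu1 i w).2)
    rw [hs.summable.tsum_sub (hsum w), hs.tsum_eq, Finset.sum_congr rfl fun i hi => by
      rw [hKu i w (hwn i hi), mul_zero, sub_zero]] at h2
    linarith

/-- A coordinate along the leaves of a piece that extends to countably many end boxes. -/
theorem exists_strip_coordinate [T2Space Z] [SecondCountableTopology Z] (P : F.Piece) {S : Set Z}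
    {ι : Type*} [Countable ι] (E : ι → P.EndBox S) :
    ∃ f : Z → ℝ, P.Admissible S f ∧
      (∀ w ∈ P.W, ∀ w' ∈ P.W, P.t w = P.t w' → P.Θ w < P.Θ w' → f w < f w') ∧
      (∀ w ∈ P.W, ∀ a, ∃ w' ∈ P.W, P.t w' = P.t w ∧ a < f w') ∧
      (∀ w ∈ P.W, ∀ a, ∃ w' ∈ P.W, P.t w' = P.t w ∧ f w' < a) ∧
      ∀ i, ∀ x ∈ Ioo (-(1 / 2) : ℝ) (1 / 2), ∀ x' ∈ Ioo (-(1 / 2) : ℝ) (1 / 2),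
        (E i).e * x < (E i).e * x' → ∀ L L',
        Tendsto (fun p => f ((E i).b p)) (endFilter x) (𝓝 L) →
        Tendsto (fun p => f ((E i).b p)) (endFilter x') (𝓝 L') → L < L' := by
  classical
  have := F.locallyCompactSpace
  obtain ⟨u, hu, hu1, huK, hN⟩ := exists_bump_family (Z := Z)
  obtain ⟨φ, hφc, hφ, hφK⟩ := exists_proper_function (Z := Z)
  -- Only bumps with compact support inside the piece are kept, as their running suprema vanish near
  -- all end boxes.
  let v : ℕ × ℕ → Z → ℝ := fun i =>
    if ∃ K ⊆ P.W, IsCompact K ∧ ∀ w ∉ K, u i w = 0 then u i else fun _ => 0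
  have hv1 : ∀ i z, 0 ≤ v i z ∧ v i z ≤ 1 := by
    intro i z
    simp only [v]
    split_ifs
    · exact hu1 i z
    · simp
  have hvc : ∀ i, Continuous (v i) := by
    intro i
    simp only [v]
    split_ifs
    · exact hu i
    · exact continuous_const
  have hvK : ∀ i, ∃ K ⊆ P.W, IsCompact K ∧ ∀ w ∉ K, v i w = 0 := by
    intro i
    by_cases h : ∃ K ⊆ P.W, IsCompact K ∧ ∀ w ∉ K, u i w = 0
    · simp only [v, if_pos h]; exact h
    · exact ⟨∅, empty_subset _, isCompact_empty, fun w _ => by simp only [v, if_neg h]⟩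
  let m : (ℕ × ℕ) ⊕ ι → Z → ℝ :=
    Sum.elim (fun i => P.runSup (v i)) (fun i => P.runSup (E i).tent)
  have hm : ∀ i, P.Admissible S (m i) := by
    rintro (i | i)
    · obtain ⟨K, hKW, hK, h⟩ := hvK i
      exact admissible_runSup (hvc i) (hv1 i) hK hKW h
    · exact (E i).admissible_runSup_tent
  have hm1 : ∀ i, ∀ w ∈ P.W, 0 ≤ m i w ∧ m i w ≤ 1 := by
    rintro (i | i) w hw
    · exact runSup_mem (fun w _ => hv1 i w) hw
    · exact runSup_mem (fun w _ => (E i).tent_mem w) hw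
  have := Encodable.ofCountable ((ℕ × ℕ) ⊕ ι)
  obtain ⟨ε, hε, c, hs, hc⟩ := posSumOfEncodable one_pos ((ℕ × ℕ) ⊕ ι)
  let f₁ : Z → ℝ := fun w => ∑' i, ε i * m i w
  let f₂ : Z → ℝ := fun w => P.rev.depth φ w - P.depth φ w
  have hf₁ : P.Admissible S f₁ := Admissible.tsum hm hm1 hs.summable fun i => (hε i).le
  have hf₂ : P.Admissible S f₂ := admissible_depth hφc hφ hφK
  have hsum : ∀ w ∈ P.W, Summable fun i => ε i * m i w := fun w hw =>
    Summable.of_norm_bounded hs.summable fun i => by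
      rw [Real.norm_of_nonneg (mul_nonneg (hε i).le (hm1 i w hw).1)]
      exact mul_le_of_le_one_right (hε i).le (hm1 i w hw).2
  have hf₁1 : ∀ w ∈ P.W, 0 ≤ f₁ w ∧ f₁ w ≤ c := fun w hw =>
    ⟨tsum_nonneg fun i => mul_nonneg (hε i).le (hm1 i w hw).1, by
      rw [← hs.tsum_eq]
      exact (hsum w hw).tsum_le_tsum
        (fun i => mul_le_of_le_one_right (hε i).le (hm1 i w hw).2) hs.summable⟩
  -- Isolating the term `j`: the rest is still monotone along leaves, so strictness of one term
  -- gives strictness of the sum.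
  have hsplit : ∀ j, ∃ g : Z → ℝ, P.Admissible S g ∧
      ∀ w ∈ P.W, f₁ w + f₂ w = g w + ε j * m j w := by
    intro j
    have h1 : Summable (fun i => if i = j then 0 else ε i) := by
      refine Summable.of_nonneg_of_le (fun i => ?_) (fun i => ?_) hs.summable
      · split_ifs; exacts [le_rfl, (hε i).le]
      · split_ifs; exacts [(hε i).le, le_rfl]
    refine ⟨_, (Admissible.tsum hm hm1 h1 fun i => by split_ifs; exacts [le_rfl, (hε i).le]).add
      hf₂, fun w hw => ?_⟩
    have : f₁ w = ε j * m j w + ∑' i, if i = j then 0 else ε i * m i w :=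
      (hsum w hw).tsum_eq_add_tsum_ite j
    rw [this]
    simp only [ite_mul, zero_mul]
    ring
  refine ⟨fun w => f₁ w + f₂ w, hf₁.add hf₂, ?_, ?_, ?_, ?_⟩
  · intro w hw w' hw' ht hlt
    -- A bump at `w'` supported in the piece and off the closed set `P.below w` has running supremum
    -- `0` at `w` and a positive one at `w'`.
    have hnot : w' ∉ P.below w := fun h => absurd h.2.2 (not_le.2 hlt)
    obtain ⟨i, hi, K, hKN, hK, hKu⟩ := hN w' (P.W ∩ (P.below w)ᶜ)
      (inter_mem (P.isOpen_W.mem_nhds hw') ((P.isClosed_below hw).isOpen_compl.mem_nhds hnot))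
    have hvu : v i = u i := if_pos ⟨K, hKN.trans inter_subset_left, hK, hKu⟩
    obtain ⟨g, hg, hfg⟩ := hsplit (Sum.inl i)
    have h1 : m (Sum.inl i) w ≤ 0 := runSup_le hw fun w'' hw'' => by
      rw [hvu, hKu w'' fun h => (hKN h).2 hw'']
    have h2 : 0 < m (Sum.inl i) w' :=
      hi.trans_le (by
        rw [← hvu]; exact le_runSup (fun w _ => hv1 i w) (self_mem_below hw'))
    have h3 := hg.mono w hw w' hw' ht hlt.le
    change f₁ w + f₂ w < f₁ w' + f₂ w'
    rw [hfg w hw, hfg w' hw']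
    nlinarith [hε (Sum.inl i)]
  · intro w hw a
    obtain ⟨w', hw', ha⟩ := exists_lt_depth (P := P.rev) hφ hφK hw (a + P.depth φ w)
    refine ⟨w', hw'.1, hw'.2.1, ?_⟩
    have h1 := depth_anti (P := P) hφ hw hw'.2.1.symm (neg_le_neg_iff.1 hw'.2.2)
    have h2 := (hf₁1 w' hw'.1).1
    change a < f₁ w' + (P.rev.depth φ w' - P.depth φ w')
    linarith
  · intro w hw a
    obtain ⟨w', hw', ha⟩ := exists_lt_depth (P := P) hφ hφK hw (c - a + P.rev.depth φ w)
    refine ⟨w', hw'.1, hw'.2.1, ?_⟩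
    have h1 := depth_anti (P := P.rev) hφ hw hw'.2.1.symm (neg_le_neg hw'.2.2)
    have h2 := (hf₁1 w' hw'.1).2
    change f₁ w' + (P.rev.depth φ w' - P.depth φ w') < a
    linarith
  -- Strictness comes from the bump of the box `i` itself, whose limit is affine in `x`; the
  -- remaining terms have monotone limits.
  · intro i x hx x' hx' hlt L L' hL hL'
    obtain ⟨g, hg, hfg⟩ := hsplit (Sum.inr i)
    have hsub : Ioo (-(1 / 2) : ℝ) (1 / 2) ⊆ Ioo (-1) 1 := Ioo_subset_Ioo (by norm_num) (by norm_num)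
    have hgl : ∀ x ∈ Ioo (-(1 / 2) : ℝ) (1 / 2), ∀ L,
        Tendsto (fun p => f₁ ((E i).b p) + f₂ ((E i).b p)) (endFilter x) (𝓝 L) →
        Tendsto (fun p => g ((E i).b p)) (endFilter x)
          (𝓝 (L - ε (Sum.inr i) * ((E i).e * x + 1 / 2))) := by
      intro x hx L hL
      refine (hL.sub (((E i).tendsto_runSup_tent hx).const_mul (ε (Sum.inr i)))).congr' ?_
      filter_upwards [EndBox.eventually_mem_interior x] with p hp
      rw [hfg _ ((E i).mem_W p hp)]
      exact add_sub_cancel_right _ _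
    have := hg.lim_mono (E i) (hsub hx) (hsub hx') hlt.le (hgl x hx L hL) (hgl x' hx' L' hL')
    nlinarith [hε (Sum.inr i)]

end Piece

end Foliation

/-! ### Charts from pieces onto strips. -/

/-- With `g` the level along a transversal of an end box, this says that every leaf of level close
to `σ` passes through the box. The image is an interval with `σ` as one end. -/
lemma eventually_mem_image_of_tendsto {g : ℝ → ℝ} {σ η : ℝ} (hη : 0 < η)
    (hg : ContinuousOn g (Ioo 0 η)) (hσ : σ = 1 ∨ σ = -1) (hlim : Tendsto g (𝓝[>] 0) (𝓝 σ))
    (hm : ∀ y ∈ Ioo 0 η, g y ∈ Ioo (-1 : ℝ) 1) :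
    ∀ᶠ s in 𝓝 σ, s ∈ Ioo (-1 : ℝ) 1 → s ∈ g '' Ioo 0 η := by
  have hy : η / 2 ∈ Ioo 0 η := ⟨by linarith, by linarith⟩
  have hoc : OrdConnected (g '' Ioo 0 η) := (isPreconnected_Ioo.image g hg).ordConnected
  have hev : ∀ᶠ y in 𝓝[>] (0 : ℝ), y ∈ Ioo 0 η := Ioo_mem_nhdsGT hη
  have h1 := hm _ hy
  rcases hσ with rfl | rfl
  · filter_upwards [Ioi_mem_nhds h1.2] with s hs hs1
    obtain ⟨y, hy1, hy2⟩ := ((hlim.eventually_const_lt hs1.2).and hev).exists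
    exact hoc.out ⟨_, hy, rfl⟩ ⟨_, hy2, rfl⟩ ⟨le_of_lt hs, hy1.le⟩
  · filter_upwards [Iio_mem_nhds h1.1] with s hs hs1
    obtain ⟨y, hy1, hy2⟩ := ((hlim.eventually_lt_const hs1.1).and hev).exists
    exact hoc.out ⟨_, hy2, rfl⟩ ⟨_, hy, rfl⟩ ⟨hy1.le, le_of_lt hs⟩

namespace Foliation

variable {Z : Type*} [TopologicalSpace Z] {F : Foliation Z}

/-- A homeomorphism between a piece and an open strip, extended to a family of end boxes. -/
structure StripChart (P : F.Piece) {S : Set Z} {ι : Type*} (E : ι → P.EndBox S) where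
  G : Z → ℝ × ℝ
  g : ℝ × ℝ → Z
  H : ι → ℝ × ℝ → ℝ × ℝ
  snd_G : ∀ w ∈ P.W, (G w).2 = P.t w
  g_mem : ∀ p ∈ (univ ×ˢ Ioo (-1) 1 : Set (ℝ × ℝ)), g p ∈ P.W
  g_G : ∀ w ∈ P.W, g (G w) = w
  G_g : ∀ p ∈ (univ ×ˢ Ioo (-1) 1 : Set (ℝ × ℝ)), G (g p) = p
  cont_G : ContinuousOn G P.W
  cont_g : ContinuousOn g (univ ×ˢ Ioo (-1) 1)
  cont_H : ∀ i, ContinuousOn (H i) (Ioo (-1) 1 ×ˢ Ico 0 1)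
  H_eq : ∀ i, ∀ p ∈ Ioo (-1 : ℝ) 1 ×ˢ Ioo (0 : ℝ) 1, H i p = G ((E i).b p)
  snd_H : ∀ i, ∀ x ∈ Ioo (-1 : ℝ) 1, (H i (x, 0)).2 = (E i).σ
  injOn_H : ∀ i, InjOn (fun x => (H i (x, 0)).1) (Ioo (-(1 / 2)) (1 / 2))
  image_H : ∀ i, ∀ x ∈ Ioo (-(1 / 2) : ℝ) (1 / 2), ∀ N ∈ endFilter x,
    H i '' N ∈ 𝓝[univ ×ˢ Ioo (-1) 1] (H i (x, 0))

/-- The chart is `(f, t)`. It is injective because `f` is strictly increasing on leaves, and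
surjective because `f` is unbounded on each leaf in both directions. Its extension to the bases of
the end boxes is by limits. -/
theorem Piece.exists_stripChart [T2Space Z] [SecondCountableTopology Z] (P : F.Piece)
    (hb : Disjoint P.W F.boundary) {S : Set Z} {ι : Type*} [Countable ι] (E : ι → P.EndBox S) :
    Nonempty (StripChart P E) := by
  classical
  obtain ⟨f, hf, hmono, htop, hbot, hend⟩ := P.exists_strip_coordinate E
  set A : Set (ℝ × ℝ) := univ ×ˢ Ioo (-1) 1 with hA
  let G : Z → ℝ × ℝ := fun w => (f w, P.t w)
  have hGc : ContinuousOn G P.W := hf.cont.prodMk P.cont_t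
  have hGA : ∀ w ∈ P.W, G w ∈ A := fun w hw => ⟨mem_univ _, P.t_mem hw⟩
  have hGinj : InjOn G P.W := by
    intro w hw w' hw' h
    have h1 : f w = f w' := congrArg Prod.fst h
    have h2 : P.t w = P.t w' := congrArg Prod.snd h
    rcases lt_trichotomy (P.Θ w) (P.Θ w') with h3 | h3 | h3
    · exact absurd h1 (hmono w hw w' hw' h2 h3).ne
    · exact P.eq_of_eq hw' hw h2 h3
    · exact absurd h1 (hmono w' hw' w hw h2.symm h3).ne'
  have hGsurj : SurjOn G P.W A := by
    rintro ⟨a, s⟩ ⟨-, hs⟩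
    change s ∈ _ at hs
    rw [← P.image_t] at hs
    obtain ⟨w, hw, rfl⟩ := hs
    obtain ⟨γ, hγ, h1, h2⟩ := P.exists_param hw
    have hc : Continuous fun u => f (γ u) :=
      hf.cont.comp_continuous hγ.continuous fun u => (h1 u).1
    obtain ⟨w₁, hw₁, ht₁, ha₁⟩ := hbot w hw a
    obtain ⟨w₂, hw₂, ht₂, ha₂⟩ := htop w hw a
    obtain ⟨u, hu⟩ := mem_range_of_exists_le_of_exists_ge (c := a) hc
      ⟨P.Θ w₁, by rw [h2 w₁ hw₁ ht₁]; exact ha₁.le⟩ ⟨P.Θ w₂, by rw [h2 w₂ hw₂ ht₂]; exact ha₂.le⟩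
    exact ⟨γ u, (h1 u).1, Prod.ext hu (h1 u).2.1⟩
  have hne : P.W.Nonempty := by
    obtain ⟨w, hw, -⟩ := hGsurj (show ((0, 0) : ℝ × ℝ) ∈ A from ⟨mem_univ _, by simp⟩)
    exact ⟨w, hw⟩
  have : Nonempty Z := ⟨hne.some⟩
  let g := Function.invFunOn G P.W
  have hgW : ∀ p ∈ A, g p ∈ P.W := fun p hp => Function.invFunOn_mem (hGsurj hp)
  have hGg : ∀ p ∈ A, G (g p) = p := fun p hp => Function.invFunOn_eq (hGsurj hp)
  have hgG : ∀ w ∈ P.W, g (G w) = w := fun w hw =>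
    hGinj (hgW _ (hGA w hw)) hw (hGg _ (hGA w hw))
  -- In a flow box the level depends on the height only. Openness of `t` provides the right height,
  -- and the fibrewise intermediate value theorem a point of that plaque with the right value of
  -- `f`.
  have hGopen : ∀ w ∈ P.W, ∀ N ∈ 𝓝 w, G '' (N ∩ P.W) ∈ 𝓝 (G w) := by
    intro w hw N hN
    obtain ⟨B, hB, hBN, hB0, -⟩ := F.exists_flowBox_interior (Set.disjoint_left.1 hb hw)
      (inter_mem hN (P.isOpen_W.mem_nhds hw))
    have h0 : (0 : ℝ) ∈ Ioo (-1 : ℝ) 1 := by simp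
    have hte : ∀ p ∈ Ioo (-1 : ℝ) 1 ×ˢ Ioo (-1 : ℝ) 1, P.t (B.b p) = P.t (B.b (0, p.2)) :=
      fun p hp => ((P.leaf_iff _ (hBN (B.b_mem (p := (0, p.2)) ⟨h0, hp.2⟩)).2 _).1
        (B.leaf p.1 hp.1 0 h0 p.2 hp.2)).2
    have hfb : ContinuousOn (fun p => f (B.b p)) (Ioo (-1) 1 ×ˢ Ioo (-1) 1) :=
      hf.cont.comp B.cont_b fun p hp => (hBN (B.b_mem hp)).2
    have hsl : ContinuousOn (fun x => f (B.b (x, 0))) (Ioo (-1) 1) :=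
      hfb.comp (f := fun x : ℝ => (x, (0 : ℝ))) (by fun_prop) fun x hx => ⟨hx, h0⟩
    have hinj : InjOn (fun x => f (B.b (x, 0))) (Ioo (-1) 1) := by
      intro x hx x' hx' h
      have : G (B.b (x, 0)) = G (B.b (x', 0)) :=
        Prod.ext h ((hte (x, 0) ⟨hx, h0⟩).trans (hte (x', 0) ⟨hx', h0⟩).symm)
      have := hGinj (hBN (B.b_mem (p := (x, 0)) ⟨hx, h0⟩)).2
        (hBN (B.b_mem (p := (x', 0)) ⟨hx', h0⟩)).2 this
      exact congrArg Prod.fst (B.injOn (x₁ := (x, 0)) ⟨hx, h0⟩ (x₂ := (x', 0)) ⟨hx', h0⟩ this)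
    have hl : (0 - 1 / 2 : ℝ) ∈ Ioo (-1 : ℝ) 1 := by constructor <;> norm_num
    have hr : (0 + 1 / 2 : ℝ) ∈ Ioo (-1 : ℝ) 1 := by constructor <;> norm_num
    have hev := eventually_exists_fiber_eq (J := Ioo (-1 : ℝ) 1) (X := fun x y => f (B.b (x, y)))
      (x₀ := 0) (δ := 1 / 2) (s₀ := 0) (by norm_num)
      (fun s hs => hfb.comp (by fun_prop) fun x hx =>
        ⟨⟨by linarith [hx.1], by linarith [hx.2]⟩, hs⟩)
      ((hfb.comp (f := fun y : ℝ => ((0 - 1 / 2 : ℝ), y)) (by fun_prop) fun y hy => ⟨hl, hy⟩) 0 h0)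
      ((hfb.comp (f := fun y : ℝ => ((0 + 1 / 2 : ℝ), y)) (by fun_prop) fun y hy => ⟨hr, hy⟩) 0 h0)
      (by
        rcases hsl.strictMonoOn_of_injOn_Ioo (by norm_num) hinj with h | h
        · exact Or.inl ⟨h hl h0 (by norm_num), h h0 hr (by norm_num)⟩
        · exact Or.inr ⟨h h0 hr (by norm_num), h hl h0 (by norm_num)⟩)
    obtain ⟨U, hU, V, hV, hUV⟩ := Filter.mem_prod_iff.1 hev
    have hV' : (Ioo (-1) 1 ×ˢ (V ∩ Ioo (-1) 1) : Set (ℝ × ℝ)) ∈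
        𝓝[Ioo (-1) 1 ×ˢ Ioo (-1) 1] ((0, 0) : ℝ × ℝ) := by
      rw [nhdsWithin_prod_eq]
      exact prod_mem_prod self_mem_nhdsWithin (inter_mem hV self_mem_nhdsWithin)
    have h1 := B.image_mem_nhdsWithin (p := (0, 0)) ⟨h0, h0⟩ hV'
    rw [hB.nhdsWithin_eq (B.b_mem (p := (0, 0)) ⟨h0, h0⟩), hB0] at h1
    have h2 := P.open_t w hw _ h1
    rw [hB0] at hU
    refine mem_of_superset (prod_mem_nhds hU h2) ?_
    rintro ⟨a, s⟩ ⟨ha, _, ⟨p, hp, rfl⟩, hs⟩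
    obtain ⟨x, hx, hxa⟩ := hUV (show (a, p.2) ∈ U ×ˢ V from ⟨ha, hp.2.1⟩)
    have hxp : (x, p.2) ∈ Ioo (-1 : ℝ) 1 ×ˢ Ioo (-1 : ℝ) 1 :=
      ⟨⟨by linarith [hx.1], by linarith [hx.2]⟩, hp.2.2⟩
    refine ⟨B.b (x, p.2), hBN (B.b_mem hxp), Prod.ext hxa ?_⟩
    exact (hte _ hxp).trans ((hte p ⟨hp.1, hp.2.2⟩).symm.trans hs)
  have hgc : ContinuousOn g A := by
    intro p hp
    have : ContinuousAt g p := by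
      intro N hN
      have h1 := hGopen (g p) (hgW p hp) N hN
      rw [hGg p hp] at h1
      refine mem_map.2 (mem_of_superset h1 ?_)
      rintro _ ⟨w, ⟨hwN, hwW⟩, rfl⟩
      rw [mem_preimage, hgG w hwW]; exact hwN
    exact this.continuousWithinAt
  set I : Set (ℝ × ℝ) := Ioo (-1) 1 ×ˢ Ioo 0 1 with hI
  let H : ι → ℝ × ℝ → ℝ × ℝ := fun i => extendFrom I fun p => G ((E i).b p)
  have hcl : Ioo (-1) 1 ×ˢ Ico 0 1 ⊆ closure I := by
    rw [hI, closure_prod_eq, closure_Ioo (by norm_num), closure_Ioo (by norm_num)]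
    exact prod_mono Ioo_subset_Icc_self Ico_subset_Icc_self
  have hbc : ∀ i, ContinuousOn (fun p => G ((E i).b p)) I := fun i =>
    hGc.comp ((E i).cont_b.mono Piece.EndBox.interior_subset) fun p hp => (E i).mem_W p hp
  have hlim0 : ∀ i, ∀ x ∈ Ioo (-1 : ℝ) 1, ∃ L,
      Tendsto (fun p => G ((E i).b p)) (endFilter x) (𝓝 (L, (E i).σ)) := by
    intro i x hx
    obtain ⟨L, hL⟩ := hf.lim (E i) x hx
    exact ⟨L, hL.prodMk_nhds ((E i).tendsto_t x)⟩
  have hlim : ∀ i, ∀ p ∈ Ioo (-1 : ℝ) 1 ×ˢ Ico (0 : ℝ) 1,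
      ∃ L, Tendsto (fun p => G ((E i).b p)) (𝓝[I] p) (𝓝 L) := by
    rintro i ⟨x, y⟩ ⟨hx, hy⟩
    rcases hy.1.eq_or_lt with h | h
    · change 0 = y at h
      subst h
      obtain ⟨L, hL⟩ := hlim0 i x hx
      exact ⟨_, hL⟩
    · exact ⟨_, hbc i (x, y) ⟨hx, h, hy.2⟩⟩
  have hHc : ∀ i, ContinuousOn (H i) (Ioo (-1) 1 ×ˢ Ico 0 1) := fun i =>
    continuousOn_extendFrom hcl (hlim i)
  have hHeq : ∀ i, ∀ p ∈ I, H i p = G ((E i).b p) := fun i p hp =>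
    extendFrom_extends (hbc i) p hp
  have hH0 : ∀ i, ∀ x ∈ Ioo (-1 : ℝ) 1,
      Tendsto (fun p => G ((E i).b p)) (endFilter x) (𝓝 (H i (x, 0))) := by
    intro i x hx
    exact tendsto_extendFrom (hlim i (x, 0) ⟨hx, by simp⟩)
  have hHσ : ∀ i, ∀ x ∈ Ioo (-1 : ℝ) 1, (H i (x, 0)).2 = (E i).σ := by
    intro i x hx
    obtain ⟨L, hL⟩ := hlim0 i x hx
    have := endFilter_neBot hx
    rw [tendsto_nhds_unique (hH0 i x hx) hL]
  have hhalf : Ioo (-(1 / 2) : ℝ) (1 / 2) ⊆ Ioo (-1) 1 :=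
    Ioo_subset_Ioo (by norm_num) (by norm_num)
  have hmonoH : ∀ i, ∀ x ∈ Ioo (-(1 / 2) : ℝ) (1 / 2), ∀ x' ∈ Ioo (-(1 / 2) : ℝ) (1 / 2),
      (E i).e * x < (E i).e * x' → (H i (x, 0)).1 < (H i (x', 0)).1 := by
    intro i x hx x' hx' h
    exact hend i x hx x' hx' h _ _ ((continuous_fst.tendsto _).comp (hH0 i x (hhalf hx)))
      ((continuous_fst.tendsto _).comp (hH0 i x' (hhalf hx')))
  have hmono3 : ∀ i, ∀ x₁ ∈ Ioo (-(1 / 2) : ℝ) (1 / 2), ∀ x₂ ∈ Ioo (-(1 / 2) : ℝ) (1 / 2),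
      x₁ < x₂ → (E i).e = 1 ∧ (H i (x₁, 0)).1 < (H i (x₂, 0)).1 ∨
        (E i).e = -1 ∧ (H i (x₂, 0)).1 < (H i (x₁, 0)).1 := by
    intro i x₁ h₁ x₂ h₂ hlt
    rcases (E i).e_eq with h | h
    · exact Or.inl ⟨h, hmonoH i x₁ h₁ x₂ h₂ (by rw [h]; linarith)⟩
    · exact Or.inr ⟨h, hmonoH i x₂ h₂ x₁ h₁ (by rw [h]; linarith)⟩
  refine ⟨⟨G, g, H, fun _ _ => rfl, hgW, hgG, hGg, hGc, hgc, hHc, hHeq, hHσ, ?_, ?_⟩⟩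
  · intro i x hx x' hx' h
    by_contra hne
    rcases lt_or_gt_of_ne hne with h1 | h1
    · rcases hmono3 i x hx x' hx' h1 with ⟨-, h2⟩ | ⟨-, h2⟩
      · exact h2.ne h
      · exact h2.ne' h
    · rcases hmono3 i x' hx' x hx h1 with ⟨-, h2⟩ | ⟨-, h2⟩
      · exact h2.ne' h
      · exact h2.ne h
  -- The same argument at the base: levels close to `σ` are levels of plaques of the box, and strict
  -- monotonicity of the limit at height `0` starts the fibrewise intermediate value theorem.
  · intro i x hx N hN
    have hx1 := hhalf hx
    obtain ⟨δ₀, hδ₀, hsub₀, hN₀⟩ := hasBasis_endFilter hx1 hN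
    obtain ⟨δ, hδ, hδδ, hδx⟩ : ∃ δ > 0, δ < δ₀ ∧ ∀ x' ∈ Icc (x - δ) (x + δ),
        x' ∈ Ioo (-(1 / 2) : ℝ) (1 / 2) := by
      have h := Ioo_mem_nhds hx.1 hx.2
      obtain ⟨r, hr, hball⟩ := Metric.mem_nhds_iff.1 h
      refine ⟨min (r / 2) (δ₀ / 2), by positivity, (min_le_right _ _).trans_lt (by linarith),
        fun x' hx' => hball ?_⟩
      rw [Metric.mem_ball, Real.dist_eq, abs_lt]
      have := min_le_left (r / 2) (δ₀ / 2)
      constructor <;> linarith [hx'.1, hx'.2]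
    have hl := hδx (x - δ) ⟨le_rfl, by linarith⟩
    have hr := hδx (x + δ) ⟨by linarith, le_rfl⟩
    have h0 : (0 : ℝ) ∈ Ico (0 : ℝ) 1 := by simp
    have hH1 : ContinuousOn (fun p => (H i p).1) (Ioo (-1) 1 ×ˢ Ico 0 1) :=
      continuous_fst.comp_continuousOn (hHc i)
    have hev := eventually_exists_fiber_eq (J := Ico (0 : ℝ) 1) (X := fun x y => (H i (x, y)).1)
      (x₀ := x) (δ := δ) (s₀ := 0) hδ
      (fun s hs => hH1.comp (by fun_prop) fun x' hx' => ⟨hhalf (hδx x' hx'), hs⟩)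
      ((hH1.comp (f := fun y : ℝ => (x - δ, y)) (by fun_prop) fun y hy => ⟨hhalf hl, hy⟩) 0 h0)
      ((hH1.comp (f := fun y : ℝ => (x + δ, y)) (by fun_prop) fun y hy => ⟨hhalf hr, hy⟩) 0 h0)
      (by
        rcases hmono3 i _ hl x hx (by linarith) with ⟨h1, h2⟩ | ⟨h1, h2⟩ <;>
        rcases hmono3 i x hx _ hr (by linarith) with ⟨h3, h4⟩ | ⟨h3, h4⟩
        · exact Or.inl ⟨h2, h4⟩
        · exfalso; linarith
        · exfalso; linarith
        · exact Or.inr ⟨h4, h2⟩)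
    obtain ⟨U, hU, V, hV, hUV⟩ := Filter.mem_prod_iff.1 hev
    obtain ⟨η₀, hη₀, hηV⟩ := Metric.mem_nhdsWithin_iff.1 hV
    set η := min η₀ (min δ₀ 1) with hηdef
    have hη : 0 < η := lt_min hη₀ (lt_min hδ₀ one_pos)
    have hη1 : η ≤ η₀ := min_le_left _ _
    have hη2 : η ≤ δ₀ := (min_le_right _ _).trans (min_le_left _ _)
    have hη3 : η ≤ 1 := (min_le_right _ _).trans (min_le_right _ _)
    have hz0 : (0 : ℝ) ∈ Ioo (-1 : ℝ) 1 := by simp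
    have hlev := eventually_mem_image_of_tendsto (g := fun y => P.t ((E i).b (0, y))) hη
      (P.cont_t.comp ((E i).cont_b.comp (by fun_prop) fun y hy =>
        ⟨hz0, hy.1.le, hy.2.trans_le hη3⟩) fun y hy =>
        (E i).mem_W (0, y) ⟨hz0, hy.1, hy.2.trans_le hη3⟩) (E i).σ_eq (E i).tendsto_level
      (fun y hy => P.t_mem ((E i).mem_W (0, y) ⟨hz0, hy.1, hy.2.trans_le hη3⟩))
    rw [← hHσ i x hx1] at hlev
    have h3 : ∀ᶠ p in 𝓝 (H i (x, 0)), p.1 ∈ U ∧ (p.2 ∈ Ioo (-1 : ℝ) 1 →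
        p.2 ∈ (fun y => P.t ((E i).b (0, y))) '' Ioo 0 η) :=
      ((continuous_fst.tendsto _).eventually hU).and ((continuous_snd.tendsto _).eventually hlev)
    filter_upwards [mem_nhdsWithin_of_mem_nhds h3, self_mem_nhdsWithin] with p hp hpA
    obtain ⟨y, hy, hyp⟩ := hp.2 hpA.2
    have hyV : y ∈ V := hηV ⟨by
      rw [Metric.mem_ball, Real.dist_0_eq_abs, abs_of_pos hy.1]; exact hy.2.trans_le hη1,
      hy.1.le, hy.2.trans_le hη3⟩
    obtain ⟨x', hx', hxp⟩ := hUV (show (p.1, y) ∈ U ×ˢ V from ⟨hp.1, hyV⟩)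
    have hmem : (x', y) ∈ Ioo (x - δ₀) (x + δ₀) ×ˢ Ioo 0 δ₀ :=
      ⟨⟨by linarith [hx'.1], by linarith [hx'.2]⟩, hy.1, hy.2.trans_le hη2⟩
    refine ⟨(x', y), hN₀ _ hmem, Prod.ext hxp ?_⟩
    rw [hHeq i _ (hsub₀ hmem)]
    exact ((E i).t_eq _ (hsub₀ hmem)).trans hyp

end Foliation

/-! ### Cuttings: pieces, side pairs and strip charts together. -/

namespace Foliation

universe u

variable {Z : Type u} [TopologicalSpace Z] {F : Foliation Z}

/-- A decomposition of a foliated surface into pieces along a locally finite family of leaves,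
with a countable family of end boxes covering these leaves from both sides. -/
structure Cutting (F : Foliation Z) where
  𝓢 : Set (Set Z)
  subset_leaves : 𝓢 ⊆ F.leaves
  locallyFinite : LocallyFinite (fun ω : 𝓢 => (ω : Set Z))
  boundary_subset : F.boundary ⊆ ⋃₀ 𝓢
  Λ : Type
  countable : Countable Λ
  P : Λ → F.Piece
  disjoint : ∀ k l, k ≠ l → Disjoint (P k).W (P l).W
  iUnion_W : ⋃ l, (P l).W = (⋃₀ 𝓢)ᶜ
  J : Type u
  Q : J → F.SidePair (⋃₀ 𝓢)
  cover : ∀ z ∈ ⋃₀ 𝓢, ∃ j, ∃ x ∈ Ioo (-(1 / 2) : ℝ) (1 / 2), ((Q j).B true).b (x, 0) = z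
  piece : J × Bool → Λ
  E : ∀ l, {i // piece i = l} → (P l).EndBox (⋃₀ 𝓢)
  E_eq : ∀ l i, (E l i).toHalfBox = (Q i.1.1).B i.1.2
  chart : ∀ l, StripChart (P l) (E l)

/-- A Lindelöf argument. The cover uses the central halves of the boxes, because the strip
coordinate is known to be injective only there. -/
lemma exists_countable_sidePairs [T2Space Z] [SecondCountableTopology Z]
    (hF : F.HasClosedLineLeaves) {𝓢 : Set (Set Z)} (h𝓢 : 𝓢 ⊆ F.leaves)
    (hfin : LocallyFinite (fun ω : 𝓢 => (ω : Set Z))) :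
    ∃ (J : Type u) (_ : Countable J) (Q : J → F.SidePair (⋃₀ 𝓢)),
      ∀ z ∈ ⋃₀ 𝓢, ∃ j, ∃ x ∈ Ioo (-(1 / 2) : ℝ) (1 / 2), ((Q j).B true).b (x, 0) = z := by
  classical
  choose Q hQ using fun z : (⋃₀ 𝓢 : Set Z) => exists_sidePair hF h𝓢 hfin z.2
  let R : Set (ℝ × ℝ) := Ioo (-(1 / 2)) (1 / 2) ×ˢ Ico 0 1
  have hR : R ∈ 𝓝[Ioo (-1) 1 ×ˢ Ico 0 1] ((0, 0) : ℝ × ℝ) := by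
    rw [nhdsWithin_prod_eq]
    exact prod_mem_prod (mem_nhdsWithin_of_mem_nhds (Ioo_mem_nhds (by norm_num) (by norm_num)))
      self_mem_nhdsWithin
  let V : Z → Set Z := fun z => if h : z ∈ ⋃₀ 𝓢 then
    ((Q ⟨z, h⟩).B true).b '' R ∪ ((Q ⟨z, h⟩).B false).b '' R else univ
  obtain ⟨T, hTS, hTc, hT⟩ := TopologicalSpace.countable_cover_nhdsWithin (s := ⋃₀ 𝓢) (f := V) (by
    intro z hz
    refine mem_nhdsWithin_of_mem_nhds ?_
    simp only [V, dif_pos hz]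
    have := (Q ⟨z, hz⟩).image_mem_nhds (x := 0) (by simp) (N := fun _ => R) fun _ => hR
    rwa [hQ] at this)
  refine ⟨T, hTc.to_subtype, fun z => Q ⟨z, hTS z.2⟩, fun z hz => ?_⟩
  obtain ⟨y, hy, hzy⟩ := mem_iUnion₂.1 (hT hz)
  refine ⟨⟨y, hy⟩, ?_⟩
  simp only [V, dif_pos (hTS hy)] at hzy
  have key : ∀ e, z ∈ ((Q ⟨y, hTS hy⟩).B e).b '' R →
      ∃ x ∈ Ioo (-(1 / 2) : ℝ) (1 / 2), ((Q ⟨y, hTS hy⟩).B true).b (x, 0) = z := by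
    rintro e ⟨p, hp, rfl⟩
    have hp1 : p.1 ∈ Ioo (-1 : ℝ) 1 := ⟨by linarith [hp.1.1], by linarith [hp.1.2]⟩
    have h0 := (((Q ⟨y, hTS hy⟩).B e).mem_iff p ⟨hp1, hp.2⟩).1 hz
    refine ⟨p.1, hp.1, ?_⟩
    rw [← (Q ⟨y, hTS hy⟩).base' e hp1]
    congr 1
    exact Prod.ext rfl h0.symm
  exact hzy.elim (key true) (key false)

/-- The interior of a half box is connected and avoids the cutting leaves, so it lies in a single
piece and the half box is an end box of that piece. -/
theorem exists_cutting [T2Space Z] [SecondCountableTopology Z] (hF : F.HasClosedLineLeaves)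
    (hfin : LocallyFinite (fun ω : F.singularLeaves => (ω : Set Z))) : Nonempty (Cutting F) := by
  obtain ⟨𝓢, h𝓢, h𝓢f, hbd, Λ, hΛ, P, hdisj, hunion⟩ := exists_decomposition hF hfin
  obtain ⟨J, hJ, Q, hcover⟩ := exists_countable_sidePairs hF h𝓢 h𝓢f
  have hWS : ∀ l, Disjoint (P l).W (⋃₀ 𝓢) := fun l => by
    rw [← subset_compl_iff_disjoint_right, ← hunion]; exact subset_iUnion (fun l => (P l).W) l
  have hl : ∀ i : J × Bool, ∃ l, ∀ p ∈ Ioo (-1 : ℝ) 1 ×ˢ Ioo (0 : ℝ) 1,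
      ((Q i.1).B i.2).b p ∈ (P l).W := by
    intro i
    set B := (Q i.1).B i.2
    have hU : B.b '' (Ioo (-1) 1 ×ˢ Ioo 0 1) ⊆ ⋃ l, (P l).W := by
      rintro _ ⟨p, hp, rfl⟩
      rw [hunion]
      intro h
      exact hp.2.1.ne' ((B.mem_iff p ⟨hp.1, Ioo_subset_Ico_self hp.2⟩).1 h)
    have hp₀ : ((0, 1 / 2) : ℝ × ℝ) ∈ Ioo (-1 : ℝ) 1 ×ˢ Ioo (0 : ℝ) 1 := by
      constructor <;> constructor <;> norm_num
    obtain ⟨l, hl⟩ := mem_iUnion.1 (hU ⟨_, hp₀, rfl⟩)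
    have hne : (B.b '' (Ioo (-1) 1 ×ˢ Ioo 0 1) ∩ (P l).W).Nonempty :=
      ⟨B.b (0, 1 / 2), mem_image_of_mem _ hp₀, hl⟩
    have hsub := B.isPreconnected_interior.subset_left_of_subset_union (u := (P l).W)
      (v := ⋃ k ∈ {k | k ≠ l}, (P k).W) (P l).isOpen_W
      (isOpen_biUnion fun k _ => (P k).isOpen_W)
      (disjoint_iUnion₂_right.2 fun k hk => hdisj l k (Ne.symm hk))
      (fun w hw => by
        obtain ⟨k, hk⟩ := mem_iUnion.1 (hU hw)
        by_cases h : k = l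
        · exact Or.inl (h ▸ hk)
        · exact Or.inr (mem_biUnion (show k ∈ {k | k ≠ l} from h) hk)) hne
    exact ⟨l, fun p hp => hsub ⟨p, hp, rfl⟩⟩
  choose piece hpiece using hl
  choose E hE using fun l (i : {i // piece i = l}) =>
    ((Q i.1.1).B i.1.2).exists_endBox (hWS l) (fun p hp => by
      have := hpiece i.1 p hp
      rwa [i.2] at this)
  have hchart : ∀ l, Nonempty (StripChart (P l) (E l)) := fun l =>
    (P l).exists_stripChart ((hWS l).mono_right hbd) (E l)
  exact ⟨⟨𝓢, h𝓢, h𝓢f, hbd, Λ, hΛ, P, hdisj, hunion, J, Q, hcover, piece, E, hE,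
    fun l => (hchart l).some⟩⟩

end Foliation

/-! ### The strip of a piece and its map to the surface. -/

namespace Foliation

namespace StripChart

variable {Z : Type*} [TopologicalSpace Z] {F : Foliation Z} {P : F.Piece} {S : Set Z} {ι : Type*}
  {E : ι → P.EndBox S} (C : StripChart P E)

lemma half_subset : Ioo (-(1 / 2) : ℝ) (1 / 2) ⊆ Ioo (-1) 1 :=
  Ioo_subset_Ioo (by norm_num) (by norm_num)

lemma zero_mem {x : ℝ} (hx : x ∈ Ioo (-(1 / 2) : ℝ) (1 / 2)) :
    (x, (0 : ℝ)) ∈ Ioo (-1 : ℝ) 1 ×ˢ Ico (0 : ℝ) 1 := ⟨half_subset hx, by simp⟩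

lemma continuousOn_fst_H (i : ι) :
    ContinuousOn (fun x => (C.H i (x, 0)).1) (Ioo (-(1 / 2)) (1 / 2)) :=
  continuous_fst.comp_continuousOn ((C.cont_H i).comp (by fun_prop) fun _ hx => zero_mem hx)

lemma image_fst_H_mem_nhds (i : ι) {x : ℝ} (hx : x ∈ Ioo (-(1 / 2) : ℝ) (1 / 2)) {N : Set ℝ}
    (hN : N ∈ 𝓝 x) : (fun x => (C.H i (x, 0)).1) '' N ∈ 𝓝 (C.H i (x, 0)).1 :=
  image_mem_nhds_of_injOn_Ioo (C.continuousOn_fst_H i) (C.injOn_H i) hx hN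

/-- The part of an end of the strip that is filled in by end boxes. -/
def endSet (s : ℝ) : Set ℝ :=
  {r | ∃ i, ∃ x ∈ Ioo (-(1 / 2) : ℝ) (1 / 2), C.H i (x, 0) = (r, s)}

lemma isOpen_endSet (s : ℝ) : IsOpen (C.endSet s) := by
  rw [isOpen_iff_mem_nhds]
  rintro r ⟨i, x, hx, h⟩
  have hr : (C.H i (x, 0)).1 = r := by rw [h]
  have hs : (E i).σ = s := by rw [← C.snd_H i x (half_subset hx), h]
  have := C.image_fst_H_mem_nhds i hx (Ioo_mem_nhds hx.1 hx.2)
  rw [hr] at this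
  refine mem_of_superset this ?_
  rintro _ ⟨x', hx', rfl⟩
  exact ⟨i, x', hx', Prod.ext rfl ((C.snd_H i x' (half_subset hx')).trans hs)⟩

/-- The strip obtained by adding to an open strip the boundary plaques of the end boxes. -/
def strip : Strip where
  u := -1
  v := 1
  u_lt_v := by norm_num
  carrier := univ ×ˢ Ioo (-1) 1 ∪ {p | ∃ i, ∃ x ∈ Ioo (-(1 / 2) : ℝ) (1 / 2), p = C.H i (x, 0)}
  contains_open := subset_union_left
  subset_closed := by
    rintro p (hp | ⟨i, x, hx, rfl⟩)
    · exact ⟨hp.1, Ioo_subset_Icc_self hp.2⟩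
    · refine ⟨mem_univ _, ?_⟩
      rw [C.snd_H i x (half_subset hx)]
      rcases (E i).σ_eq with h | h <;> rw [h] <;> simp
  rel_open := by
    refine ⟨({p | p.2 < 1} ∪ Prod.fst ⁻¹' C.endSet 1) ∩
      ({p | -1 < p.2} ∪ Prod.fst ⁻¹' C.endSet (-1)),
      ((isOpen_lt continuous_snd continuous_const).union
        ((C.isOpen_endSet 1).preimage continuous_fst)).inter
      ((isOpen_lt continuous_const continuous_snd).union
        ((C.isOpen_endSet (-1)).preimage continuous_fst)), ?_⟩
    ext p
    constructor
    · rintro (hp | ⟨i, x, hx, rfl⟩)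
      · exact ⟨⟨Or.inl hp.2.2, Or.inl hp.2.1⟩, hp.1, Ioo_subset_Icc_self hp.2⟩
      · have hσ := C.snd_H i x (half_subset hx)
        rcases (E i).σ_eq with h | h <;> rw [h] at hσ
        · refine ⟨⟨Or.inr ⟨i, x, hx, Prod.ext rfl hσ⟩, Or.inl ?_⟩, mem_univ _, ?_⟩
          · change -1 < (C.H i (x, 0)).2; rw [hσ]; norm_num
          · rw [hσ]; norm_num
        · refine ⟨⟨Or.inl ?_, Or.inr ⟨i, x, hx, Prod.ext rfl hσ⟩⟩, mem_univ _, ?_⟩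
          · change (C.H i (x, 0)).2 < 1; rw [hσ]; norm_num
          · rw [hσ]; norm_num
    · rintro ⟨⟨h1, h2⟩, -, h3⟩
      rcases h3.1.eq_or_lt with h | h
      · rcases h2 with h2 | ⟨i, x, hx, hr⟩
        · exact absurd h h2.ne
        · exact Or.inr ⟨i, x, hx, by rw [hr]; exact Prod.ext rfl h.symm⟩
      · rcases h3.2.eq_or_lt with h' | h'
        · rcases h1 with h1 | ⟨i, x, hx, hr⟩
          · exact absurd h' h1.ne
          · exact Or.inr ⟨i, x, hx, by rw [hr]; exact Prod.ext rfl h'⟩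
        · exact Or.inl ⟨mem_univ _, h, h'⟩

lemma mem_boundary_iff {p : ℝ × ℝ} : p ∈ C.strip.boundary ↔
    ∃ i, ∃ x ∈ Ioo (-(1 / 2) : ℝ) (1 / 2), p = C.H i (x, 0) := by
  constructor
  · rintro ⟨hp | hp, h⟩
    · exfalso
      rcases h with h | h
      · exact hp.2.1.ne' h
      · exact hp.2.2.ne h
    · exact hp
  · rintro ⟨i, x, hx, rfl⟩
    refine ⟨Or.inr ⟨i, x, hx, rfl⟩, ?_⟩
    rw [C.snd_H i x (half_subset hx)]
    exact (E i).σ_eq.symm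

lemma mem_boundary_or (p : ℝ × ℝ) (hp : p ∈ C.strip.carrier) :
    p ∈ (univ ×ˢ Ioo (-1) 1 : Set (ℝ × ℝ)) ∨ p ∈ C.strip.boundary :=
  hp.imp_right fun h => C.mem_boundary_iff.2 h

/-- The two boundary lines have distance `2`, so near a boundary point only its own line counts, and
there the first coordinate of `H i` is open. -/
lemma image_mem_nhdsWithin_boundary (i : ι) {x : ℝ} (hx : x ∈ Ioo (-(1 / 2) : ℝ) (1 / 2)) :
    (fun x' => C.H i (x', 0)) '' Ioo (-(1 / 2)) (1 / 2) ∈ 𝓝[C.strip.boundary] (C.H i (x, 0)) := by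
  have h1 := C.image_fst_H_mem_nhds i hx (Ioo_mem_nhds hx.1 hx.2)
  have hσ := C.snd_H i x (half_subset hx)
  have h2 : ∀ᶠ p in 𝓝 (C.H i (x, 0)), p.1 ∈ (fun x => (C.H i (x, 0)).1) ''
      Ioo (-(1 / 2)) (1 / 2) ∧ |p.2 - (E i).σ| < 1 := by
    refine ((continuous_fst.tendsto _).eventually h1).and ?_
    have : Tendsto (fun p : ℝ × ℝ => |p.2 - (E i).σ|) (𝓝 (C.H i (x, 0))) (𝓝 0) := by
      have h : Continuous fun p : ℝ × ℝ => |p.2 - (E i).σ| := by fun_prop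
      have := h.tendsto (C.H i (x, 0))
      simpa [hσ] using this
    exact this.eventually_lt_const one_pos
  filter_upwards [mem_nhdsWithin_of_mem_nhds h2, self_mem_nhdsWithin] with p ⟨⟨x', hx', hp1⟩, hp2⟩ hpb
  refine ⟨x', hx', Prod.ext hp1 ?_⟩
  rw [C.snd_H i x' (half_subset hx')]
  have hp2' := abs_lt.1 hp2
  have hb : p.2 = -1 ∨ p.2 = 1 := hpb.2
  rcases hb with h | h <;> rcases (E i).σ_eq with h' | h' <;> rw [h, h'] at hp2' ⊢ <;> exfalso <;>
    linarith [hp2'.1, hp2'.2]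

lemma H_mem_of_pos {i : ι} {p : ℝ × ℝ} (hp : p ∈ Ioo (-1 : ℝ) 1 ×ˢ Ioo (0 : ℝ) 1) :
    C.H i p ∈ (univ ×ˢ Ioo (-1) 1 : Set (ℝ × ℝ)) := by
  have hW := (E i).mem_W p hp
  rw [C.H_eq i p hp]
  refine ⟨mem_univ _, ?_⟩
  rw [C.snd_G _ hW]; exact P.t_mem hW

lemma H_mem {i : ι} {p : ℝ × ℝ} (hp : p ∈ Ioo (-(1 / 2) : ℝ) (1 / 2) ×ˢ Ico (0 : ℝ) 1) :
    C.H i p ∈ C.strip.carrier := by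
  rcases hp.2.1.eq_or_lt with h | h
  · exact Or.inr ⟨i, p.1, hp.1, by rw [show p = (p.1, 0) from Prod.ext rfl h.symm]⟩
  · exact Or.inl (C.H_mem_of_pos ⟨half_subset hp.1, h, hp.2.2⟩)

/-- The inverse of the chart, extended to the boundary of the strip. -/
noncomputable def q : ℝ × ℝ → Z := extendFrom (univ ×ˢ Ioo (-1) 1) C.g

/-- By `image_H` the points of the open strip near `H i (x, 0)` come from points of the end box near
`(x, 0)`. -/
lemma tendsto_g (i : ι) {x : ℝ} (hx : x ∈ Ioo (-(1 / 2) : ℝ) (1 / 2)) :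
    Tendsto C.g (𝓝[univ ×ˢ Ioo (-1) 1] (C.H i (x, 0))) (𝓝 ((E i).b (x, 0))) := by
  intro N hN
  have h1 : ∀ᶠ p in endFilter x, (E i).b p ∈ N ∧ p ∈ Ioo (-1 : ℝ) 1 ×ˢ Ioo (0 : ℝ) 1 :=
    ((E i).tendsto_b (half_subset hx)).eventually hN |>.and (Piece.EndBox.eventually_mem_interior x)
  refine mem_map.2 (mem_of_superset (C.image_H i x hx _ h1) ?_)
  rintro _ ⟨p, ⟨hpN, hp⟩, rfl⟩
  rw [mem_preimage, C.H_eq i p hp, C.g_G _ ((E i).mem_W p hp)]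
  exact hpN

lemma carrier_subset_closure : C.strip.carrier ⊆ closure (univ ×ˢ Ioo (-1) 1) := by
  rw [closure_prod_eq, closure_univ, closure_Ioo (by norm_num)]
  exact C.strip.subset_closed

lemma tendsto_q : ∀ p ∈ C.strip.carrier, ∃ z,
    Tendsto C.g (𝓝[univ ×ˢ Ioo (-1) 1] p) (𝓝 z) := by
  rintro p (hp | ⟨i, x, hx, rfl⟩)
  · exact ⟨_, C.cont_g p hp⟩
  · exact ⟨_, C.tendsto_g i hx⟩

lemma tendsto_G (i : ι) {x : ℝ} (hx : x ∈ Ioo (-1 : ℝ) 1) :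
    Tendsto (fun p => C.G ((E i).b p)) (endFilter x) (𝓝 (C.H i (x, 0))) := by
  have h := (C.cont_H i (x, 0) ⟨hx, by simp⟩).tendsto.mono_left
    (nhdsWithin_mono (x, (0 : ℝ)) Piece.EndBox.interior_subset)
  refine Tendsto.congr' ?_ h
  filter_upwards [self_mem_nhdsWithin] with p hp
  exact C.H_eq i p hp

/-- Both boundary points are limits of the chart along one and the same germ of the piece. -/
lemma H_eq_H {i i' : ι} {x x' : ℝ} (hx : x ∈ Ioo (-(1 / 2) : ℝ) (1 / 2))
    (hx' : x' ∈ Ioo (-(1 / 2) : ℝ) (1 / 2)) (h : (E i').b (x', 0) = (E i).b (x, 0))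
    (hev : ∀ᶠ p in endFilter x', (E i').b p ∈ (E i).b '' (Ioo (-1) 1 ×ˢ Ioo 0 1)) :
    C.H i' (x', 0) = C.H i (x, 0) := by
  obtain ⟨y, hy, hyx, hc⟩ := (E i).tendsto_c (E i') (half_subset hx')
    (h ▸ (E i).b_mem (zero_mem hx)) hev
  have hyx' : y = x :=
    congrArg Prod.fst ((E i).injOn ⟨hy, by simp⟩ (zero_mem hx) (hyx.trans h))
  subst hyx'
  have := endFilter_neBot (half_subset hx')
  refine tendsto_nhds_unique (C.tendsto_G i' (half_subset hx'))
    (((C.tendsto_G i (half_subset hx)).comp hc).congr' ?_)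
  filter_upwards [hev] with p ⟨r, hr, hrp⟩
  simp only [Function.comp]
  rw [← hrp, (E i).left_inv r (Piece.EndBox.interior_subset hr)]

/-- The interior of each box fills the open strip near its boundary points; at a common boundary
point two disjoint interiors would have to overlap. -/
lemma H_ne_H {i i' : ι} {x x' : ℝ} (hx : x ∈ Ioo (-(1 / 2) : ℝ) (1 / 2))
    (hx' : x' ∈ Ioo (-(1 / 2) : ℝ) (1 / 2))
    (hd : Disjoint ((E i).b '' (Ioo (-1) 1 ×ˢ Ioo 0 1)) ((E i').b '' (Ioo (-1) 1 ×ˢ Ioo 0 1))) :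
    C.H i (x, 0) ≠ C.H i' (x', 0) := by
  intro h
  have h1 := C.image_H i x hx _ (Piece.EndBox.eventually_mem_interior x)
  have h2 := C.image_H i' x' hx' _ (Piece.EndBox.eventually_mem_interior x')
  rw [← h] at h2
  have : (𝓝[univ ×ˢ Ioo (-1) 1] (C.H i (x, 0))).NeBot :=
    mem_closure_iff_nhdsWithin_neBot.1 (C.carrier_subset_closure (C.H_mem ⟨hx, by simp⟩))
  obtain ⟨_, ⟨p, hp, rfl⟩, p', hp', hpp⟩ := Filter.nonempty_of_mem (Filter.inter_mem h1 h2)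
  have hp1 : p ∈ Ioo (-1 : ℝ) 1 ×ˢ Ioo (0 : ℝ) 1 := hp
  have hp1' : p' ∈ Ioo (-1 : ℝ) 1 ×ˢ Ioo (0 : ℝ) 1 := hp'
  rw [C.H_eq _ _ hp1, C.H_eq _ _ hp1'] at hpp
  have : (E i).b p = (E i').b p' := by
    rw [← C.g_G _ ((E i).mem_W p hp1), ← C.g_G _ ((E i').mem_W p' hp1'), hpp]
  exact Set.disjoint_left.1 hd ⟨p, hp1, rfl⟩ ⟨p', hp1', this.symm⟩

variable [T2Space Z]

lemma continuousOn_q : ContinuousOn C.q C.strip.carrier := by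
  -- Extension by limits is continuous into a regular space, and a locally compact Hausdorff space
  -- is regular.
  have := F.locallyCompactSpace
  exact continuousOn_extendFrom C.carrier_subset_closure C.tendsto_q

lemma q_of_mem {p : ℝ × ℝ} (hp : p ∈ (univ ×ˢ Ioo (-1) 1 : Set (ℝ × ℝ))) : C.q p = C.g p :=
  extendFrom_extends C.cont_g p hp

lemma q_H {i : ι} {p : ℝ × ℝ} (hp : p ∈ Ioo (-(1 / 2) : ℝ) (1 / 2) ×ˢ Ico (0 : ℝ) 1) :
    C.q (C.H i p) = (E i).b p := by
  rcases hp.2.1.eq_or_lt with h | h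
  · have hp' : p = (p.1, 0) := Prod.ext rfl h.symm
    rw [hp']
    refine extendFrom_eq (C.carrier_subset_closure (C.H_mem (hp' ▸ hp))) (C.tendsto_g i hp.1)
  · have hpI : p ∈ Ioo (-1 : ℝ) 1 ×ˢ Ioo (0 : ℝ) 1 := ⟨half_subset hp.1, h, hp.2.2⟩
    rw [C.q_of_mem (C.H_mem_of_pos hpI), C.H_eq i p hpI, C.g_G _ ((E i).mem_W p hpI)]

lemma q_mem_W {p : ℝ × ℝ} (hp : p ∈ (univ ×ˢ Ioo (-1) 1 : Set (ℝ × ℝ))) : C.q p ∈ P.W := by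
  rw [C.q_of_mem hp]; exact C.g_mem p hp

end StripChart

end Foliation

/-! ### The quotient map from the disjoint union of the strips. -/

namespace Foliation

universe u

variable {Z : Type u} [TopologicalSpace Z] {F : Foliation Z}

namespace Cutting

variable (c : Cutting F)

/-- The strips of the atlas defined by a cutting. -/
def strips (l : c.Λ) : Strip := (c.chart l).strip

/-- The map from the disjoint union of the strips to the surface. -/
noncomputable def q (s : Strip.DisjUnion c.strips) : Z := (c.chart s.1).q s.2

/-- The end boxes of a cutting. -/
def b (i : c.J × Bool) : ℝ × ℝ → Z := ((c.Q i.1).B i.2).b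

lemma E_b (l : c.Λ) (i : {i // c.piece i = l}) : (c.E l i).b = c.b i.1 := by
  rw [c.E_eq]; rfl

/-- The points of the strips given by the end boxes. -/
def pt (i : c.J × Bool) (p : (Ioo (-(1 / 2)) (1 / 2) ×ˢ Ico 0 1 : Set (ℝ × ℝ))) :
    Strip.DisjUnion c.strips :=
  ⟨c.piece i, (c.chart _).H ⟨i, rfl⟩ p, (c.chart _).H_mem p.2⟩

/-- The boundary points of the strips given by the end boxes. -/
def bp (i : c.J × Bool) (x : Ioo (-(1 / 2) : ℝ) (1 / 2)) : Strip.DisjUnion c.strips :=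
  c.pt i ⟨(x, 0), x.2, by simp⟩

lemma bp_eq_mk : ∀ (l : c.Λ) (i : {i // c.piece i = l}) (x : Ioo (-(1 / 2) : ℝ) (1 / 2)),
    c.bp i.1 x = ⟨l, (c.chart l).H i (x, 0), (c.chart l).H_mem ⟨x.2, by simp⟩⟩ := by
  rintro _ ⟨i, rfl⟩ x; rfl

lemma continuous_pt (i : c.J × Bool) : Continuous (c.pt i) := by
  refine continuous_sigmaMk.comp (Continuous.subtype_mk ?_ _)
  exact ((c.chart _).cont_H ⟨i, rfl⟩).comp_continuous continuous_subtype_val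
    fun p => ⟨StripChart.half_subset p.2.1, p.2.2⟩

lemma continuous_bp (i : c.J × Bool) : Continuous (c.bp i) :=
  (c.continuous_pt i).comp (by fun_prop)

lemma b_mem_iff (i : c.J × Bool) {p : ℝ × ℝ} (hp : p ∈ Ioo (-1 : ℝ) 1 ×ˢ Ico (0 : ℝ) 1) :
    c.b i p ∈ ⋃₀ c.𝓢 ↔ p.2 = 0 := ((c.Q i.1).B i.2).mem_iff p hp

lemma b_zero_mem (i : c.J × Bool) {x : ℝ} (hx : x ∈ Ioo (-(1 / 2) : ℝ) (1 / 2)) :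
    c.b i (x, 0) ∈ ⋃₀ c.𝓢 := (c.b_mem_iff i (StripChart.zero_mem hx)).2 rfl

lemma b_mem_W (i : c.J × Bool) {p : ℝ × ℝ} (hp : p ∈ Ioo (-1 : ℝ) 1 ×ˢ Ioo (0 : ℝ) 1) :
    c.b i p ∈ (c.P (c.piece i)).W := by
  rw [← c.E_b _ ⟨i, rfl⟩]; exact (c.E _ ⟨i, rfl⟩).mem_W p hp

lemma notMem_of_mem_W {l : c.Λ} {z : Z} (hz : z ∈ (c.P l).W) : z ∉ ⋃₀ c.𝓢 := by
  have : z ∈ (⋃₀ c.𝓢)ᶜ := by rw [← c.iUnion_W]; exact mem_iUnion.2 ⟨l, hz⟩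
  exact this

lemma eq_of_mem_W {k l : c.Λ} {z : Z} (hk : z ∈ (c.P k).W) (hl : z ∈ (c.P l).W) : k = l := by
  by_contra h
  exact Set.disjoint_left.1 (c.disjoint k l h) hk hl

lemma mem_or (z : Z) : z ∈ ⋃₀ c.𝓢 ∨ ∃ l, z ∈ (c.P l).W := by
  by_cases hz : z ∈ ⋃₀ c.𝓢
  · exact Or.inl hz
  · have : z ∈ (⋃₀ c.𝓢)ᶜ := hz
    rw [← c.iUnion_W] at this
    exact Or.inr (mem_iUnion.1 this)

lemma mem_open_or (s : Strip.DisjUnion c.strips) :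
    (s.2 : ℝ × ℝ) ∈ (univ ×ˢ Ioo (-1) 1 : Set (ℝ × ℝ)) ∨ ∃ i x, s = c.bp i x := by
  obtain ⟨l, p, hp⟩ := s
  refine ((c.chart l).mem_boundary_or p hp).imp_right fun h => ?_
  obtain ⟨i, x, hx, rfl⟩ := (c.chart l).mem_boundary_iff.1 h
  exact ⟨i.1, ⟨x, hx⟩, (c.bp_eq_mk l i ⟨x, hx⟩).symm⟩

lemma bp_eq_bp {i i' : c.J × Bool} {x x' : Ioo (-(1 / 2) : ℝ) (1 / 2)}
    (h : c.b i' (x', 0) = c.b i (x, 0))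
    (hev : ∀ᶠ p in endFilter x', c.b i' p ∈ c.b i '' (Ioo (-1) 1 ×ˢ Ioo 0 1)) :
    c.bp i' x' = c.bp i x := by
  have := endFilter_neBot (StripChart.half_subset x'.2)
  obtain ⟨p, ⟨r, hr, hrp⟩, hp⟩ := (hev.and (Piece.EndBox.eventually_mem_interior (x' : ℝ))).exists
  have hl : c.piece i' = c.piece i := c.eq_of_mem_W (c.b_mem_W i' hp) (hrp ▸ c.b_mem_W i hr)
  have hH := (c.chart (c.piece i)).H_eq_H (i := ⟨i, rfl⟩) (i' := ⟨i', hl⟩) x.2 x'.2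
    (by rw [E_b, E_b]; exact h) (by simpa only [E_b] using hev)
  rw [c.bp_eq_mk (c.piece i) ⟨i', hl⟩, c.bp_eq_mk (c.piece i) ⟨i, rfl⟩]
  simp only [hH]

/-- The points of the strips over a given point of the cutting leaves. -/
lemma bp_eq_or {i : c.J × Bool} {j : c.J} {x x' : Ioo (-(1 / 2) : ℝ) (1 / 2)}
    (h : c.b i (x', 0) = c.b (j, true) (x, 0)) :
    c.bp i x' = c.bp (j, true) x ∨
      c.bp i x' = c.bp (j, false) x ∧ c.b (j, true) (x, 0) ∉ F.boundary := by
  have hx := StripChart.half_subset x.2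
  have hx' := StripChart.half_subset x'.2
  have hz : c.b i (x', 0) ∈ ((c.Q j).B true).dom ∪ ((c.Q j).B false).dom :=
    h ▸ Or.inl (((c.Q j).B true).b_mem (StripChart.zero_mem x.2))
  have ht : Tendsto (c.b i) (endFilter x') (𝓝 (c.b i (x', 0))) := by
    rw [← c.E_b _ ⟨i, rfl⟩]; exact (c.E _ ⟨i, rfl⟩).tendsto_b hx'
  obtain ⟨δ, hδ, hsub, hQ⟩ := hasBasis_endFilter hx' (ht ((c.Q j).isOpen.mem_nhds hz))
  -- A small connected germ of the box `i`, close to the plaque of `c.Q j` but off the cutting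
  -- leaves: it must lie on one of the two sides.
  set A := c.b i '' (Ioo ((x' : ℝ) - δ) (x' + δ) ×ˢ Ioo 0 δ)
  have hA : IsPreconnected A := (isPreconnected_Ioo.prod isPreconnected_Ioo).image _
    (((c.Q i.1).B i.2).cont_b.mono (hsub.trans Piece.EndBox.interior_subset))
  have hcase : ∀ e, ∀ w ∈ A, w ∈ ((c.Q j).B e).dom →
      w ∈ ((c.Q j).B e).b '' (Ioo (-1) 1 ×ˢ Ioo 0 1) := by
    rintro e w ⟨p, hp, hpw⟩ ⟨r, hr, rfl⟩
    refine ⟨r, ⟨hr.1, lt_of_le_of_ne hr.2.1 fun h0 => ?_, hr.2.2⟩, rfl⟩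
    have h1 := (((c.Q j).B e).mem_iff r hr).2 h0.symm
    rw [← hpw, c.b_mem_iff i (Piece.EndBox.interior_subset (hsub hp))] at h1
    exact (hsub hp).2.1.ne' h1
  have hAU : A ⊆ ((c.Q j).B true).b '' (Ioo (-1) 1 ×ˢ Ioo 0 1) ∪
      ((c.Q j).B false).b '' (Ioo (-1) 1 ×ˢ Ioo 0 1) := by
    intro w hw
    obtain ⟨p, hp, rfl⟩ := id hw
    exact (hQ p hp).imp (hcase true _ hw) (hcase false _ hw)
  have hev : ∀ e, A ⊆ ((c.Q j).B e).b '' (Ioo (-1) 1 ×ˢ Ioo 0 1) →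
      c.bp i x' = c.bp (j, e) x := by
    intro e he
    refine c.bp_eq_bp (h.trans ((c.Q j).base' e hx).symm) ?_
    filter_upwards [rect_mem_endFilter hδ] with p hp
    exact he ⟨p, hp, rfl⟩
  rcases (c.Q j).sides with ⟨heq, -⟩ | ⟨hd, hb⟩
  · rw [← heq, union_self] at hAU
    exact Or.inl (hev true hAU)
  · rcases isPreconnected_iff_subset_of_disjoint.1 hA _ _ ((c.Q j).B true).isOpen_interior
      ((c.Q j).B false).isOpen_interior hAU (by rw [hd.inter_eq, inter_empty]) with h1 | h1
    · exact Or.inl (hev true h1)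
    · exact Or.inr ⟨hev false h1, hb x hx⟩

/-- The two sides of a cutting leaf may belong to the same piece, even to the same end of its strip;
the boundary points still differ by `H_ne_H`. -/
lemma bp_true_ne_bp_false {j : c.J} {x : Ioo (-(1 / 2) : ℝ) (1 / 2)}
    (hb : c.b (j, true) (x, 0) ∉ F.boundary) : c.bp (j, true) x ≠ c.bp (j, false) x := by
  intro h
  have hx := StripChart.half_subset x.2
  have hl : c.piece (j, true) = c.piece (j, false) := congrArg Sigma.fst h
  rcases (c.Q j).sides with ⟨-, hb'⟩ | ⟨hd, -⟩
  · exact hb (hb' x hx)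
  rw [c.bp_eq_mk _ ⟨(j, true), hl⟩, c.bp_eq_mk _ ⟨(j, false), rfl⟩] at h
  refine (c.chart (c.piece (j, false))).H_ne_H (i := ⟨(j, true), hl⟩) (i' := ⟨(j, false), rfl⟩)
    x.2 x.2 (by rw [E_b, E_b]; exact hd) ?_
  exact congrArg Subtype.val (eq_of_heq (Sigma.mk.inj h).2)

variable [T2Space Z]

lemma continuous_q : Continuous c.q := by
  refine continuous_sigma fun l => ?_
  exact (c.chart l).continuousOn_q.domRestrict

lemma q_pt (i : c.J × Bool) (p) : c.q (c.pt i p) = c.b i p := by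
  rw [← c.E_b _ ⟨i, rfl⟩]
  exact (c.chart _).q_H p.2

lemma q_bp (i : c.J × Bool) (x) : c.q (c.bp i x) = c.b i (x, 0) := c.q_pt i _

lemma q_mem_W {s : Strip.DisjUnion c.strips}
    (hs : (s.2 : ℝ × ℝ) ∈ (univ ×ˢ Ioo (-1) 1 : Set (ℝ × ℝ))) : c.q s ∈ (c.P s.1).W :=
  (c.chart s.1).q_mem_W hs

lemma exists_bp {s : Strip.DisjUnion c.strips} (hs : c.q s ∈ ⋃₀ c.𝓢) : ∃ i x, s = c.bp i x :=
  (c.mem_open_or s).resolve_left fun h => c.notMem_of_mem_W (c.q_mem_W h) hs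

lemma mem_open_of_q_mem_W {s : Strip.DisjUnion c.strips} {l : c.Λ} (hs : c.q s ∈ (c.P l).W) :
    (s.2 : ℝ × ℝ) ∈ (univ ×ˢ Ioo (-1) 1 : Set (ℝ × ℝ)) := by
  refine (c.mem_open_or s).resolve_right ?_
  rintro ⟨i, x, rfl⟩
  rw [q_bp] at hs
  exact c.notMem_of_mem_W hs (c.b_zero_mem i x.2)

lemma eq_of_q_eq_of_mem_W {s s' : Strip.DisjUnion c.strips} {l : c.Λ} (hs : c.q s ∈ (c.P l).W)
    (h : c.q s = c.q s') : s = s' := by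
  have h1 := c.mem_open_of_q_mem_W hs
  have h2 := c.mem_open_of_q_mem_W (h ▸ hs)
  have hl := c.eq_of_mem_W (c.q_mem_W h1) (h ▸ c.q_mem_W h2)
  obtain ⟨l, p, hp⟩ := s
  obtain ⟨l', p', hp'⟩ := s'
  change l = l' at hl
  subst hl
  change p ∈ _ at h1
  change p' ∈ _ at h2
  change (c.chart l).q p = (c.chart l).q p' at h
  rw [(c.chart l).q_of_mem h1, (c.chart l).q_of_mem h2] at h
  have : p = p' := by rw [← (c.chart l).G_g p h1, h, (c.chart l).G_g p' h2]
  subst this; rfl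

/-- The point of a strip over a point of a piece. -/
lemma exists_q_eq_of_mem_W {l : c.Λ} {z : Z} (hz : z ∈ (c.P l).W) :
    (c.chart l).G z ∈ (univ ×ˢ Ioo (-1) 1 : Set (ℝ × ℝ)) ∧ (c.chart l).q ((c.chart l).G z) = z := by
  have h : (c.chart l).G z ∈ (univ ×ˢ Ioo (-1) 1 : Set (ℝ × ℝ)) :=
    ⟨mem_univ _, by rw [(c.chart l).snd_G z hz]; exact (c.P l).t_mem hz⟩
  exact ⟨h, by rw [(c.chart l).q_of_mem h, (c.chart l).g_G z hz]⟩

lemma surjective_q : Function.Surjective c.q := by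
  intro z
  rcases c.mem_or z with hz | ⟨l, hz⟩
  · obtain ⟨j, x, hx, rfl⟩ := c.cover z hz
    exact ⟨c.bp (j, true) ⟨x, hx⟩, c.q_bp _ _⟩
  · obtain ⟨h1, h2⟩ := c.exists_q_eq_of_mem_W hz
    exact ⟨⟨l, (c.chart l).G z, Or.inl h1⟩, h2⟩

/-- A set with open preimage is a neighbourhood of each of its points: inside a piece through the
chart, and on a cutting leaf because the two half boxes together form a neighbourhood. -/
lemma isQuotientMap_q : IsQuotientMap c.q := by
  refine (isQuotientMap_iff _).2 ⟨isCoinducing_iff.2 fun N =>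
    ⟨fun h => ?_, fun h => h.preimage c.continuous_q⟩, c.surjective_q⟩
  rw [isOpen_iff_mem_nhds]
  intro z hz
  rcases c.mem_or z with hzS | ⟨l, hzl⟩
  · obtain ⟨j, x, hx, rfl⟩ := c.cover z hzS
    have key : ∀ e, {p | p ∈ (Ioo (-(1 / 2)) (1 / 2) ×ˢ Ico 0 1 : Set (ℝ × ℝ)) ∧ c.b (j, e) p ∈ N} ∈
        𝓝[Ioo (-1) 1 ×ˢ Ico 0 1] ((x, 0) : ℝ × ℝ) := by
      intro e
      obtain ⟨O, hO, hON⟩ := isOpen_induced_iff.1 (h.preimage (c.continuous_pt (j, e)))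
      have hmem : ∀ p (hp : p ∈ (Ioo (-(1 / 2)) (1 / 2) ×ˢ Ico 0 1 : Set (ℝ × ℝ))),
          p ∈ O ↔ c.b (j, e) p ∈ N := by
        intro p hp
        have : (⟨p, hp⟩ : (Ioo (-(1 / 2)) (1 / 2) ×ˢ Ico 0 1 : Set (ℝ × ℝ))) ∈ Subtype.val ⁻¹' O ↔
            c.q (c.pt (j, e) ⟨p, hp⟩) ∈ N := by rw [hON]; rfl
        rw [q_pt] at this
        exact this
      have hxO : ((x, 0) : ℝ × ℝ) ∈ O := by
        rw [hmem _ ⟨hx, by simp⟩]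
        have := (c.Q j).base' e (StripChart.half_subset hx)
        change ((c.Q j).B e).b (x, 0) ∈ N
        rw [this]; exact hz
      have h1 : (Prod.fst ⁻¹' Ioo (-(1 / 2)) (1 / 2) : Set (ℝ × ℝ)) ∈ 𝓝 ((x, 0) : ℝ × ℝ) :=
        continuous_fst.continuousAt (Ioo_mem_nhds hx.1 hx.2)
      filter_upwards [mem_nhdsWithin_of_mem_nhds (hO.mem_nhds hxO),
        mem_nhdsWithin_of_mem_nhds h1, self_mem_nhdsWithin] with p hp1 hp2 hp3
      have hp : p ∈ (Ioo (-(1 / 2)) (1 / 2) ×ˢ Ico 0 1 : Set (ℝ × ℝ)) := ⟨hp2, hp3.2⟩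
      exact ⟨hp, (hmem p hp).1 hp1⟩
    refine mem_of_superset ((c.Q j).image_mem_nhds (StripChart.half_subset hx) key) ?_
    rintro _ (⟨p, hp, rfl⟩ | ⟨p, hp, rfl⟩)
    · exact hp.2
    · exact hp.2
  · obtain ⟨O, hO, hON⟩ := isOpen_induced_iff.1 (isOpen_sigma_iff.1 h l)
    have hmem : ∀ p (hp : p ∈ (c.strips l).carrier), p ∈ O ↔ (c.chart l).q p ∈ N := by
      intro p hp
      have : (⟨p, hp⟩ : (c.strips l).carrier) ∈ Subtype.val ⁻¹' O ↔ (c.chart l).q p ∈ N := by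
        rw [hON]; rfl
      exact this
    have hopen := (c.chart l).cont_G.isOpen_inter_preimage (c.P l).isOpen_W hO
    refine mem_of_superset (hopen.mem_nhds ⟨hzl, ?_⟩) ?_
    · obtain ⟨h1, h2⟩ := c.exists_q_eq_of_mem_W hzl
      rw [mem_preimage, hmem _ (Or.inl h1), h2]; exact hz
    · rintro w ⟨hw, hwO⟩
      obtain ⟨h1, h2⟩ := c.exists_q_eq_of_mem_W hw
      rw [mem_preimage, hmem _ (Or.inl h1), h2] at hwO
      exact hwO

end Cutting

end Foliation

/-! ### Boundary intervals and the leaves they cover. -/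

lemma Strip.mem_inSum {Λ : Type} {S : Λ → Strip} {l : Λ} {A : Set (ℝ × ℝ)}
    {s : Strip.DisjUnion S} : s ∈ Strip.inSum S l A ↔ s.1 = l ∧ (s.2 : ℝ × ℝ) ∈ A := by
  constructor
  · rintro ⟨y, hy, rfl⟩
    exact ⟨rfl, hy⟩
  · obtain ⟨k, p⟩ := s
    rintro ⟨rfl, h⟩
    exact ⟨p, h, rfl⟩

lemma Strip.boundary_subset (S : Strip) : S.boundary ⊆ S.carrier := fun _ h => h.1

namespace Foliation

namespace StripChart

variable {Z : Type*} [TopologicalSpace Z] {F : Foliation Z} {P : F.Piece} {S : Set Z} {ι : Type*}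
  {E : ι → P.EndBox S} (C : StripChart P E)

lemma H_mem_boundary (i : ι) {x : ℝ} (hx : x ∈ Ioo (-(1 / 2) : ℝ) (1 / 2)) :
    C.H i (x, 0) ∈ C.strip.boundary := C.mem_boundary_iff.2 ⟨i, x, hx, rfl⟩

lemma H_mem_component (i : ι) {x x' : ℝ} (hx : x ∈ Ioo (-(1 / 2) : ℝ) (1 / 2))
    (hx' : x' ∈ Ioo (-(1 / 2) : ℝ) (1 / 2)) :
    C.H i (x', 0) ∈ connectedComponentIn C.strip.boundary (C.H i (x, 0)) := by
  have hc : IsPreconnected ((fun x => C.H i (x, 0)) '' Ioo (-(1 / 2)) (1 / 2)) :=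
    isPreconnected_Ioo.image _ ((C.cont_H i).comp (by fun_prop) fun _ hx => zero_mem hx)
  refine hc.subset_connectedComponentIn ⟨x, hx, rfl⟩ ?_ ⟨x', hx', rfl⟩
  rintro _ ⟨y, hy, rfl⟩
  exact C.H_mem_boundary i hy

/-- The height is locally constant on the boundary, so a boundary interval is horizontal. -/
lemma snd_eq_of_mem_component {p p' : ℝ × ℝ}
    (hp' : p' ∈ connectedComponentIn C.strip.boundary p) : p'.2 = p.2 := by
  have hp : p ∈ C.strip.boundary := connectedComponentIn_nonempty_iff.1 ⟨p', hp'⟩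
  refine isPreconnected_connectedComponentIn.induction₂ (fun a b => a.2 = b.2) (fun a ha => ?_)
    (fun a b d _ _ _ => Eq.trans) (fun a b _ _ => Eq.symm) hp'
    (mem_connectedComponentIn hp)
  obtain ⟨i, x, hx, rfl⟩ := C.mem_boundary_iff.1 (connectedComponentIn_subset _ _ ha)
  filter_upwards [nhdsWithin_mono _ (connectedComponentIn_subset _ _)
    (C.image_mem_nhdsWithin_boundary i hx)] with b hb
  obtain ⟨y, hy, rfl⟩ := hb
  exact (C.snd_H i x (half_subset hx)).trans (C.snd_H i y (half_subset hy)).symm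

lemma _root_.Foliation.HalfBox.image_mem_nhds_of_isLeafCoordinate {B : F.HalfBox S} {Θ : Z → ℝ}
    (hΘ : F.IsLeafCoordinate Θ) {x : ℝ} (hx : x ∈ Ioo (-1 : ℝ) 1) {N : Set ℝ} (hN : N ∈ 𝓝 x) :
    (fun x => Θ (B.b (x, 0))) '' N ∈ 𝓝 (Θ (B.b (x, 0))) := by
  refine image_mem_nhds_of_injOn_Ioo (f := fun x => Θ (B.b (x, 0))) ?_ ?_ hx hN
  · refine hΘ.continuousOn_comp (z := B.b (0, 0))
      (B.cont_b.comp (f := fun x : ℝ => (x, (0 : ℝ))) (by fun_prop) fun y hy => ⟨hy, by simp⟩) ?_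
    exact fun y hy => B.leaf _ hy _ (by simp) _ (by simp)
  · intro y hy y' hy' h
    exact congrArg Prod.fst (B.injOn ⟨hy, by simp⟩ ⟨hy', by simp⟩
      (hΘ.injOn (B.leaf _ hy _ hy' _ (by simp)) h))

variable [T2Space Z]

lemma rel_of_mem_component {p p' : ℝ × ℝ}
    (hp' : p' ∈ connectedComponentIn C.strip.boundary p) : F.leafSetoid (C.q p') (C.q p) := by
  have hp : p ∈ C.strip.boundary := connectedComponentIn_nonempty_iff.1 ⟨p', hp'⟩
  refine isPreconnected_connectedComponentIn.induction₂ (fun a b => F.leafSetoid (C.q a) (C.q b))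
    (fun a ha => ?_) (fun a b d _ _ _ h h' => F.leafSetoid.trans h h')
    (fun a b _ _ h => F.leafSetoid.symm h) hp' (mem_connectedComponentIn hp)
  obtain ⟨i, x, hx, rfl⟩ := C.mem_boundary_iff.1 (connectedComponentIn_subset _ _ ha)
  filter_upwards [nhdsWithin_mono _ (connectedComponentIn_subset _ _)
    (C.image_mem_nhdsWithin_boundary i hx)] with b hb
  obtain ⟨y, hy, rfl⟩ := hb
  rw [C.q_H ⟨hx, by simp⟩, C.q_H ⟨hy, by simp⟩]
  exact (E i).leaf _ (half_subset hx) _ (half_subset hy) _ (by simp)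

/-- Along the interval `q` runs through plaques of one leaf, so the leaf coordinate of `q` is an
open function near each point. It has no local extremum and hence, by Rolle's argument, no repeated
value. -/
lemma injOn_q_component {Θ : Z → ℝ} (hΘ : F.IsLeafCoordinate Θ) (p : ℝ × ℝ) :
    InjOn C.q (connectedComponentIn C.strip.boundary p) := by
  set A := connectedComponentIn C.strip.boundary p
  have hAI : ∀ r r', (r, p.2) ∈ A → (r', p.2) ∈ A → ∀ u ∈ Icc r r', (u, p.2) ∈ A := by
    intro r r' hr hr' u hu
    obtain ⟨a, ha, rfl⟩ := ((isPreconnected_connectedComponentIn (x := p) (F := C.strip.boundary)).image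
      Prod.fst continuous_fst.continuousOn).ordConnected.out ⟨_, hr, rfl⟩ ⟨_, hr', rfl⟩ hu
    rwa [← C.snd_eq_of_mem_component ha]
  have hcont : ContinuousOn (fun a => Θ (C.q a)) A :=
    hΘ.continuousOn_comp (C.continuousOn_q.mono
      ((connectedComponentIn_subset _ _).trans C.strip.boundary_subset))
      fun a ha => C.rel_of_mem_component ha
  have key : ∀ r r', (r, p.2) ∈ A → (r', p.2) ∈ A → r < r' →
      Θ (C.q (r, p.2)) ≠ Θ (C.q (r', p.2)) := by
    intro r r' hr hr' hlt heq
    obtain ⟨u, hu, he⟩ := exists_isLocalExtr_Ioo (f := fun r => Θ (C.q (r, p.2))) hlt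
      (hcont.comp (f := fun r => (r, p.2)) (by fun_prop) fun u hu => hAI r r' hr hr' u hu) heq
    obtain ⟨i, x, hx, hux⟩ := C.mem_boundary_iff.1
      (connectedComponentIn_subset _ _ (hAI r r' hr hr' u (Ioo_subset_Icc_self hu)))
    have hσ : ∀ y ∈ Ioo (-(1 / 2) : ℝ) (1 / 2), C.H i (y, 0) = ((C.H i (y, 0)).1, p.2) := by
      intro y hy
      refine Prod.ext rfl ?_
      rw [C.snd_H i y (half_subset hy), ← C.snd_H i x (half_subset hx), ← hux]
    have hu' : u = (C.H i (x, 0)).1 := by rw [← hux]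
    have hcx : ContinuousAt (fun x => (C.H i (x, 0)).1) x :=
      (C.continuousOn_fst_H i).continuousAt (Ioo_mem_nhds hx.1 hx.2)
    rw [hu'] at he
    have hext : ∀ᶠ y in 𝓝 x, Θ (C.q ((C.H i (y, 0)).1, p.2)) = Θ ((E i).b (y, 0)) := by
      filter_upwards [Ioo_mem_nhds hx.1 hx.2] with y hy
      rw [← hσ y hy, C.q_H ⟨hy, by simp⟩]
    refine not_isLocalExtr_of_image_mem_nhds (f := fun y => Θ ((E i).b (y, 0))) (x := x)
      (fun N hN => (E i).toHalfBox.image_mem_nhds_of_isLeafCoordinate hΘ (half_subset hx) hN) ?_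
    refine he.elim (fun h => Or.inl ?_) (fun h => Or.inr ?_)
    · have := hcx.eventually h
      filter_upwards [this, hext] with y h1 h2
      change Θ ((E i).b (x, 0)) ≤ Θ ((E i).b (y, 0))
      rw [← h2, ← hext.self_of_nhds]; exact h1
    · have := hcx.eventually h
      filter_upwards [this, hext] with y h1 h2
      change Θ ((E i).b (y, 0)) ≤ Θ ((E i).b (x, 0))
      rw [← h2, ← hext.self_of_nhds]; exact h1
  intro a ha a' ha' h
  have h1 : a = (a.1, p.2) := Prod.ext rfl (C.snd_eq_of_mem_component (p := p) ha)
  have h2 : a' = (a'.1, p.2) := Prod.ext rfl (C.snd_eq_of_mem_component (p := p) ha')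
  rw [h1] at ha h
  rw [h2] at ha' h
  rcases lt_trichotomy a.1 a'.1 with hlt | heq | hlt
  · exact absurd (congrArg Θ h) (key _ _ ha ha' hlt)
  · rw [h1, h2, heq]
  · exact absurd (congrArg Θ h).symm (key _ _ ha' ha hlt)

end StripChart

end Foliation

namespace Foliation

universe u

variable {Z : Type u} [TopologicalSpace Z] {F : Foliation Z}

/-- The central part of a plaque of a leaf homeomorphic to the line is open in the leaf. -/
lemma FlowBox.exists_half_plaque_nhd {J : Set ℝ} (hF : F.HasClosedLineLeaves) (B : F.FlowBox J)
    {x y : ℝ} (hx : x ∈ Ioo (-(1 / 2) : ℝ) (1 / 2)) (hy : y ∈ J) :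
    ∃ N ∈ 𝓝 (B.b (x, y)), ∀ w ∈ N, F.leafSetoid w (B.b (x, y)) →
      ∃ x' ∈ Ioo (-(1 / 2) : ℝ) (1 / 2), w = B.b (x', y) := by
  have hp : (x, y) ∈ Ioo (-1 : ℝ) 1 ×ˢ J := ⟨StripChart.half_subset hx, hy⟩
  obtain ⟨N, hN, h⟩ := B.exists_plaque_nhd hF hp.1 hy
  have hc := B.cont_c _ (B.b_mem hp)
  rw [ContinuousWithinAt, B.left_inv _ hp] at hc
  have h1 : ∀ᶠ w in 𝓝[B.dom] (B.b (x, y)), (B.c w).1 ∈ Ioo (-(1 / 2) : ℝ) (1 / 2) :=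
    hc.eventually (continuous_fst.continuousAt (Ioo_mem_nhds hx.1 hx.2))
  rw [eventually_nhdsWithin_iff] at h1
  refine ⟨_, inter_mem hN h1, fun w hw hwl => ?_⟩
  obtain ⟨x', hx', rfl⟩ := h w hw.1 hwl
  have h2 : (B.c (B.b (x', y))).1 ∈ Ioo (-(1 / 2) : ℝ) (1 / 2) := hw.2 (B.b_mem ⟨hx', hy⟩)
  rw [B.left_inv _ ⟨hx', hy⟩] at h2
  exact ⟨x', h2, rfl⟩

namespace Cutting

variable (c : Cutting F)

/-- The boundary interval of the strips through a given point. -/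
def edge (s : Strip.DisjUnion c.strips) : Set (Strip.DisjUnion c.strips) :=
  Strip.inSum c.strips s.1 (connectedComponentIn (c.strips s.1).boundary s.2)

lemma bp_mem_boundary (i : c.J × Bool) (x) :
    ((c.bp i x).2 : ℝ × ℝ) ∈ (c.strips (c.bp i x).1).boundary :=
  (c.chart (c.piece i)).H_mem_boundary ⟨i, rfl⟩ x.2

variable {c}

lemma mem_edge {s s' : Strip.DisjUnion c.strips} : s' ∈ c.edge s ↔
    s'.1 = s.1 ∧ (s'.2 : ℝ × ℝ) ∈ connectedComponentIn (c.strips s.1).boundary s.2 :=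
  Strip.mem_inSum

lemma edge_eq {s s' : Strip.DisjUnion c.strips} (h : s' ∈ c.edge s) : c.edge s' = c.edge s := by
  obtain ⟨l, p⟩ := s
  obtain ⟨l', p'⟩ := s'
  obtain ⟨h1, h2⟩ := mem_edge.1 h
  change l' = l at h1
  subst h1
  change Strip.inSum _ _ _ = Strip.inSum _ _ _
  exact congrArg _ (connectedComponentIn_eq h2).symm

variable (c)

lemma bp_mem_edge_bp (i : c.J × Bool) (x x') : c.bp i x' ∈ c.edge (c.bp i x) :=
  mem_edge.2 ⟨rfl, (c.chart (c.piece i)).H_mem_component ⟨i, rfl⟩ x.2 x'.2⟩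

lemma bp_mem_edge_iff {s : Strip.DisjUnion c.strips} (i : c.J × Bool) (x x') :
    c.bp i x' ∈ c.edge s ↔ c.bp i x ∈ c.edge s := by
  have key : ∀ x x', c.bp i x ∈ c.edge s → c.bp i x' ∈ c.edge s := fun x x' h =>
    edge_eq h ▸ c.bp_mem_edge_bp i x x'
  exact ⟨key _ _, key _ _⟩

lemma edge_bp_mem (i : c.J × Bool) (x) :
    c.edge (c.bp i x) ∈ Strip.sumBoundaryIntervals c.strips :=
  ⟨_, _, ⟨_, c.bp_mem_boundary i x, rfl⟩, rfl⟩

variable {c}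

lemma exists_bp_of_mem_boundary {l : c.Λ} {p : ℝ × ℝ} (hp : p ∈ (c.strips l).boundary) :
    ∃ i x, (⟨l, p, hp.1⟩ : Strip.DisjUnion c.strips) = c.bp i x := by
  obtain ⟨i, x, hx, rfl⟩ := (c.chart l).mem_boundary_iff.1 hp
  exact ⟨i.1, ⟨x, hx⟩, (c.bp_eq_mk l i ⟨x, hx⟩).symm⟩

lemma exists_bp_of_mem_edge {s s' : Strip.DisjUnion c.strips} (h : s' ∈ c.edge s) :
    ∃ i x, s' = c.bp i x := by
  obtain ⟨l, p⟩ := s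
  obtain ⟨l', p', hp'⟩ := s'
  obtain ⟨h1, h2⟩ := mem_edge.1 h
  change l' = l at h1
  subst h1
  exact exists_bp_of_mem_boundary (connectedComponentIn_subset _ _ h2)

lemma exists_eq_edge_bp {A : Set (Strip.DisjUnion c.strips)}
    (hA : A ∈ Strip.sumBoundaryIntervals c.strips) : ∃ i x, A = c.edge (c.bp i x) := by
  obtain ⟨l, _, ⟨p, hp, rfl⟩, rfl⟩ := hA
  obtain ⟨i, x, h⟩ := exists_bp_of_mem_boundary hp
  exact ⟨i, x, by rw [← h]; rfl⟩

variable [T2Space Z]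

lemma rel_of_mem_edge {s s' : Strip.DisjUnion c.strips} (h : s' ∈ c.edge s) :
    F.leafSetoid (c.q s') (c.q s) := by
  obtain ⟨l, p⟩ := s
  obtain ⟨l', p', hp'⟩ := s'
  obtain ⟨h1, h2⟩ := mem_edge.1 h
  change l' = l at h1
  subst h1
  exact (c.chart l').rel_of_mem_component h2

lemma injOn_q_edge {Θ : Z → ℝ} (hΘ : F.IsLeafCoordinate Θ) (s : Strip.DisjUnion c.strips) :
    InjOn c.q (c.edge s) := by
  obtain ⟨l, p⟩ := s
  rintro ⟨k, a, ha⟩ h ⟨k', a', ha'⟩ h' heq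
  obtain ⟨h1, h2⟩ := mem_edge.1 h
  obtain ⟨h1', h2'⟩ := mem_edge.1 h'
  change k = l at h1
  change k' = l at h1'
  subst h1
  subst h1'
  have := (c.chart k').injOn_q_component hΘ p h2 h2' heq
  change a = a' at this
  subst this
  rfl

/-- By `bp_eq_or` the only strip points over a base point of a side pair are those given by its two
sides. -/
lemma mem_image_edge_iff (s : Strip.DisjUnion c.strips) (j : c.J)
    (x : Ioo (-(1 / 2) : ℝ) (1 / 2)) :
    c.b (j, true) (x, 0) ∈ c.q '' c.edge s ↔ ∃ e, c.bp (j, e) x ∈ c.edge s := by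
  constructor
  · rintro ⟨s', hs', h⟩
    obtain ⟨i, x', rfl⟩ := exists_bp_of_mem_edge hs'
    rw [q_bp] at h
    rcases c.bp_eq_or h with h1 | ⟨h1, -⟩
    · exact ⟨true, h1 ▸ hs'⟩
    · exact ⟨false, h1 ▸ hs'⟩
  · rintro ⟨e, h⟩
    refine ⟨_, h, ?_⟩
    rw [q_bp]
    exact (c.Q j).base' e (StripChart.half_subset x.2)

/-- The points of the leaf covered by the interval form an open and closed subset: over the central
part of a plaque, covering is decided by the two sides of a side pair and does not depend on the
point. As the leaf is a line, everything is covered. -/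
lemma image_edge (hF : F.HasClosedLineLeaves) (i : c.J × Bool) (x) :
    c.q '' c.edge (c.bp i x) = F.leaf (c.b i (x, 0)) := by
  set X := c.edge (c.bp i x)
  apply Subset.antisymm
  · rintro _ ⟨s, hs, rfl⟩
    have := rel_of_mem_edge hs
    rwa [q_bp] at this
  obtain ⟨γ, hγ, hr⟩ := hF (c.b i (x, 0))
  have hγl : ∀ u, F.leafSetoid (γ u) (c.b i (x, 0)) := fun u => by
    have : γ u ∈ F.leaf (c.b i (x, 0)) := hr ▸ mem_range_self u
    exact this
  have hloc : ∀ u, ∀ᶠ v in 𝓝 u, (γ u ∈ c.q '' X ↔ γ v ∈ c.q '' X) := by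
    intro u
    have hu : γ u ∈ ⋃₀ c.𝓢 := (mem_sUnion_congr c.subset_leaves (hγl u)).2 (c.b_zero_mem i x.2)
    obtain ⟨j, y, hy, hz⟩ := c.cover _ hu
    obtain ⟨N, hN, hNl⟩ := ((c.Q j).B true).exists_half_plaque_nhd hF hy (y := 0) (by simp)
    rw [hz] at hN hNl
    filter_upwards [hγ.continuous.continuousAt hN] with v hv
    obtain ⟨y', hy', hz'⟩ := hNl _ hv (F.leafSetoid.trans (hγl v) (F.leafSetoid.symm (hγl u)))
    rw [← hz, hz']
    refine (mem_image_edge_iff _ j ⟨y, hy⟩).trans (Iff.trans ?_ (mem_image_edge_iff _ j ⟨y', hy'⟩).symm)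
    exact exists_congr fun e => c.bp_mem_edge_iff (j, e) _ _
  have hall := fun u v => isPreconnected_univ.induction₂
    (fun u v => γ u ∈ c.q '' X ↔ γ v ∈ c.q '' X) (fun u _ => by rw [nhdsWithin_univ]; exact hloc u)
    (fun _ _ _ _ _ _ => Iff.trans) (fun _ _ _ _ => Iff.symm) (mem_univ u) (mem_univ v)
  have h0 : c.b i (x, 0) ∈ range γ := hr ▸ F.mem_leaf_self _
  obtain ⟨u₀, hu₀⟩ := h0
  intro w hw
  rw [← hr] at hw
  obtain ⟨u, rfl⟩ := hw
  refine (hall u₀ u).1 ⟨_, c.bp_mem_edge_bp i x x, ?_⟩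
  rw [q_bp, hu₀]

/-- The leaf coordinate of `q` maps the interval homeomorphically onto the real line, and `q` is
this map followed by the closed embedding `γ` of the leaf. -/
lemma isClosedEmbedding_edge (hF : F.HasClosedLineLeaves) (i : c.J × Bool) (x) :
    IsClosedEmbedding ((c.edge (c.bp i x)).domRestrict c.q) := by
  obtain ⟨Θ, hΘ⟩ := hF.exists_isLeafCoordinate
  set X := c.edge (c.bp i x)
  obtain ⟨γ, hγ, hr, hu⟩ := hΘ (c.b i (x, 0))
  have himg := image_edge hF i x
  have hγΘ : ∀ s : X, γ (Θ (c.q s)) = c.q s := fun s => by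
    have : c.q s ∈ range γ := by rw [hr, ← himg]; exact mem_image_of_mem _ s.2
    obtain ⟨u, h⟩ := this
    rw [← h, hu]
  let θ : X → ℝ := fun s => Θ (c.q s)
  have hcont : Continuous θ := by
    rw [hγ.isInducing.continuous_iff]
    exact (c.continuous_q.comp continuous_subtype_val).congr fun s => (hγΘ s).symm
  have hinj : Function.Injective θ := fun s s' h => Subtype.ext
    (injOn_q_edge hΘ _ s.2 s'.2 (by rw [← hγΘ s, ← hγΘ s']; exact congrArg γ h))
  have hopen : IsOpenMap θ := by
    rw [isOpenMap_iff_nhds_le]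
    rintro ⟨s, hs⟩ N hN
    obtain ⟨i', x', rfl⟩ := exists_bp_of_mem_edge hs
    let β : Ioo (-(1 / 2) : ℝ) (1 / 2) → X := fun y =>
      ⟨c.bp i' y, (c.bp_mem_edge_iff i' x' y).2 hs⟩
    have hβ : Continuous β := (c.continuous_bp i').subtype_mk _
    have h1 : β ⁻¹' (θ ⁻¹' N) ∈ 𝓝 x' := hβ.continuousAt hN
    have h2 := (isOpen_Ioo.isOpenEmbedding_subtypeVal).image_mem_nhds.2 h1
    have h3 := ((c.Q i'.1).B i'.2).image_mem_nhds_of_isLeafCoordinate hΘ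
      (StripChart.half_subset x'.2) h2
    have h4 : ∀ y, θ (β y) = Θ (c.b i' (y, 0)) := fun y => by
      simp only [θ, β]; rw [q_bp]
    have h5 : θ ⟨c.bp i' x', hs⟩ = Θ (c.b i' (x', 0)) := h4 x'
    rw [h5]
    refine mem_of_superset h3 ?_
    rintro _ ⟨_, ⟨y, hy, rfl⟩, rfl⟩
    have : θ (β y) ∈ N := hy
    rw [h4] at this
    exact this
  have hsurj : range θ = univ := by
    refine eq_univ_of_forall fun u => ?_
    have : γ u ∈ c.q '' X := by rw [himg, ← hr]; exact mem_range_self u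
    obtain ⟨s, hs, h⟩ := this
    exact ⟨⟨s, hs⟩, by simp only [θ]; rw [h, hu]⟩
  have hθ : IsClosedEmbedding θ :=
    ⟨(IsOpenEmbedding.of_continuous_injective_isOpenMap hcont hinj hopen).isEmbedding,
      by rw [hsurj]; exact isClosed_univ⟩
  have : X.domRestrict c.q = γ ∘ θ := funext fun s => (hγΘ s).symm
  rw [this]
  exact hγ.comp hθ

end Cutting

end Foliation

/-! ### Verification of the striped atlas. -/

namespace Foliation

universe u

variable {Z : Type u} [TopologicalSpace Z] [T2Space Z] {F : Foliation Z}

namespace Cutting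

variable {c : Cutting F}

lemma image_line (l : c.Λ) {t : ℝ} (ht : t ∈ Ioo (-1 : ℝ) 1) :
    c.q '' Strip.inSum c.strips l (univ ×ˢ {t}) = {w | w ∈ (c.P l).W ∧ (c.P l).t w = t} := by
  apply Subset.antisymm
  · rintro _ ⟨⟨k, p, hp⟩, hs, rfl⟩
    obtain ⟨h1, -, h2⟩ := Strip.mem_inSum.1 hs
    change k = l at h1
    subst h1
    have h2' : p.2 = t := h2
    have hpA : p ∈ (univ ×ˢ Ioo (-1) 1 : Set (ℝ × ℝ)) := ⟨mem_univ _, h2'.symm ▸ ht⟩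
    refine ⟨(c.chart k).q_mem_W hpA, ?_⟩
    change (c.P k).t ((c.chart k).q p) = t
    rw [← h2', ← (c.chart k).snd_G _ ((c.chart k).q_mem_W hpA)]
    rw [(c.chart k).q_of_mem hpA, (c.chart k).G_g p hpA]
  · rintro w ⟨hw, hwt⟩
    obtain ⟨h1, h2⟩ := c.exists_q_eq_of_mem_W hw
    exact ⟨⟨l, _, Or.inl h1⟩, Strip.mem_inSum.2 ⟨rfl, mem_univ _,
      ((c.chart l).snd_G w hw).trans hwt⟩, h2⟩

lemma image_line_eq_leaf {l : c.Λ} {z : Z} (hz : z ∈ (c.P l).W) :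
    c.q '' Strip.inSum c.strips l (univ ×ˢ {(c.P l).t z}) = F.leaf z := by
  rw [image_line l ((c.P l).t_mem hz)]
  ext w
  exact ((c.P l).leaf_iff z hz w).symm

lemma leaves_eq (hF : F.HasClosedLineLeaves) :
    F.leaves = (fun A => c.q '' A) '' Strip.sumLeaves c.strips := by
  apply Subset.antisymm
  · rintro _ ⟨z, rfl⟩
    change F.leaf z ∈ _
    rcases c.mem_or z with hz | ⟨l, hz⟩
    · obtain ⟨j, x, hx, rfl⟩ := c.cover z hz
      obtain ⟨l, I, hI, h⟩ := c.edge_bp_mem (j, true) ⟨x, hx⟩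
      exact ⟨_, ⟨l, I, Or.inr hI, h⟩, image_edge hF (j, true) ⟨x, hx⟩⟩
    · exact ⟨_, ⟨l, _, Or.inl ⟨_, (c.P l).t_mem hz, rfl⟩, rfl⟩, image_line_eq_leaf hz⟩
  · rintro _ ⟨_, ⟨l, L, ⟨t, ht, rfl⟩ | hL, rfl⟩, rfl⟩
    · have ht' : t ∈ (c.P l).t '' (c.P l).W := by rw [(c.P l).image_t]; exact ht
      obtain ⟨z, hz, rfl⟩ := ht'
      change c.q '' _ ∈ _
      rw [image_line_eq_leaf hz]
      exact F.leaf_mem_leaves z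
    · obtain ⟨i, x, h⟩ := exists_eq_edge_bp (A := Strip.inSum c.strips l L) ⟨l, L, hL, rfl⟩
      simp only [h, image_edge hF]
      exact F.leaf_mem_leaves _

/-- The two points of the strips over a point of a cutting leaf inside the surface. -/
lemma eq_or_eq_of_q_eq {s s₁ s₂ : Strip.DisjUnion c.strips} (hs : c.q s ∈ ⋃₀ c.𝓢)
    (h₁ : c.q s₁ = c.q s) (h₂ : c.q s₂ = c.q s) (h₁₂ : s₁ ≠ s₂) : s = s₁ ∨ s = s₂ := by
  obtain ⟨j, x, hx, hz⟩ := c.cover _ hs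
  have key : ∀ s', c.q s' = c.q s → s' = c.bp (j, true) ⟨x, hx⟩ ∨ s' = c.bp (j, false) ⟨x, hx⟩ := by
    intro s' h
    obtain ⟨i, x', rfl⟩ := c.exists_bp (h ▸ hs)
    rw [q_bp] at h
    exact (c.bp_eq_or (j := j) (x := ⟨x, hx⟩) (h.trans hz.symm)).imp_right And.left
  rcases key s rfl with h | h <;> rcases key s₁ h₁ with h' | h' <;>
    rcases key s₂ h₂ with h'' | h'' <;> simp_all

/-- Over a point of the boundary of the surface there is only one point of the strips. -/
lemma eq_of_q_eq_of_mem_boundary {s s' : Strip.DisjUnion c.strips} (hs : c.q s ∈ F.boundary)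
    (h : c.q s' = c.q s) : s = s' := by
  have hs𝓢 := c.boundary_subset hs
  obtain ⟨j, x, hx, hz⟩ := c.cover _ hs𝓢
  have key : ∀ s', c.q s' = c.q s → s' = c.bp (j, true) ⟨x, hx⟩ := by
    intro s' h
    obtain ⟨i, x', rfl⟩ := c.exists_bp (h ▸ hs𝓢)
    rw [q_bp] at h
    refine (c.bp_eq_or (j := j) (x := ⟨x, hx⟩) (h.trans hz.symm)).resolve_right fun h' => ?_
    exact h'.2 (by rw [← hz] at hs; exact hs)
  rw [key s rfl, key s' h]

lemma image_edge_false (hF : F.HasClosedLineLeaves) (j : c.J) (x) :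
    c.q '' c.edge (c.bp (j, false) x) = F.leaf (c.b (j, true) (x, 0)) := by
  rw [image_edge hF]
  exact congrArg F.leaf ((c.Q j).base' false (StripChart.half_subset x.2))

lemma edge_true_ne_edge_false (hF : F.HasClosedLineLeaves) {j : c.J}
    {x : Ioo (-(1 / 2) : ℝ) (1 / 2)} (hb : c.b (j, true) (x, 0) ∉ F.boundary) :
    c.edge (c.bp (j, true) x) ≠ c.edge (c.bp (j, false) x) := by
  intro h
  obtain ⟨Θ, hΘ⟩ := hF.exists_isLeafCoordinate
  refine c.bp_true_ne_bp_false hb (injOn_q_edge hΘ (c.bp (j, false) x)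
    (h ▸ c.bp_mem_edge_bp _ x x) (c.bp_mem_edge_bp _ x x) ?_)
  rw [q_bp, q_bp]
  exact ((c.Q j).base' false (StripChart.half_subset x.2)).symm

/-- For each cutting leaf inside the surface, the intervals on its two sides in one chosen box are
glued. Over a point of such a leaf there are just two strip points, one in each of these intervals,
while over a boundary point there is a single one; this gives injectivity off the glued intervals.
-/
theorem isStripedAtlas_q [SecondCountableTopology Z] (hF : F.HasClosedLineLeaves)
    (c : Cutting F) : IsStripedAtlas c.strips c.q := by
  refine ⟨c.isQuotientMap_q, ?_⟩
  let I : Set c.𝓢 := {ω | Disjoint (ω : Set Z) F.boundary}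
  have := F.locallyCompactSpace
  have hcount : Countable c.𝓢 := countable_univ_iff.1
    (c.locallyFinite.countable_univ fun ω => nonempty_of_mem_leaves (c.subset_leaves ω.2))
  -- A locally finite family of nonempty sets in this space is countable, so the gluings can be
  -- numbered.
  obtain ⟨f, hf⟩ := exists_injective_nat I
  let e := Equiv.ofInjective f hf
  have hex : ∀ ω : I, ∃ (j : c.J) (x : Ioo (-(1 / 2) : ℝ) (1 / 2)),
      F.leaf (c.b (j, true) (x, 0)) = (ω.1 : Set Z) ∧ c.b (j, true) (x, 0) ∉ F.boundary := by
    rintro ⟨⟨ω, hω⟩, hωb⟩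
    obtain ⟨z, hz⟩ := nonempty_of_mem_leaves (c.subset_leaves hω)
    obtain ⟨j, x, hx, rfl⟩ := c.cover z ⟨ω, hω, hz⟩
    exact ⟨j, ⟨x, hx⟩, (eq_leaf_of_mem (c.subset_leaves hω) hz).symm,
      Set.disjoint_left.1 hωb hz⟩
  choose j x hleaf hb using hex
  let X : I → Set (Strip.DisjUnion c.strips) := fun ω => c.edge (c.bp (j ω, true) (x ω))
  let Y : I → Set (Strip.DisjUnion c.strips) := fun ω => c.edge (c.bp (j ω, false) (x ω))
  have hX : ∀ ω, c.q '' X ω = ω.1 := fun ω => (image_edge hF _ _).trans (hleaf ω)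
  have hY : ∀ ω, c.q '' Y ω = ω.1 := fun ω => (image_edge_false hF _ _).trans (hleaf ω)
  have hXi : Function.Injective X := fun ω ω' h =>
    Subtype.ext (Subtype.ext (by rw [← hX, ← hX, h]))
  have hYi : Function.Injective Y := fun ω ω' h =>
    Subtype.ext (Subtype.ext (by rw [← hY, ← hY, h]))
  have hXY : ∀ ω ω', X ω ≠ Y ω' := by
    intro ω ω' h
    have h1 : ω = ω' := Subtype.ext (Subtype.ext (by rw [← hX, ← hY, h]))
    subst h1
    exact edge_true_ne_edge_false hF (hb ω) h
  refine ⟨range f, fun γ => X (e.symm γ), fun γ => Y (e.symm γ), fun γ => c.edge_bp_mem _ _,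
    fun γ => c.edge_bp_mem _ _, hXi.comp e.symm.injective, hYi.comp e.symm.injective, ?_, ?_,
    fun γ => (hX _).trans (hY _).symm, fun γ => isClosedEmbedding_edge hF _ _,
    fun γ => isClosedEmbedding_edge hF _ _⟩
  · rw [Set.disjoint_left]
    rintro _ ⟨γ, rfl⟩ ⟨γ', h⟩
    exact hXY _ _ h.symm
  · intro s hs s' hs' h
    rcases c.mem_or (c.q s) with hq | ⟨l, hq⟩
    swap
    · exact c.eq_of_q_eq_of_mem_W hq h
    by_cases hqb : c.q s ∈ F.boundary
    · exact eq_of_q_eq_of_mem_boundary hqb h.symm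
    exfalso
    obtain ⟨ω, hω, hqω⟩ := id hq
    have hωI : (⟨ω, hω⟩ : c.𝓢) ∈ I := by
      refine Set.disjoint_left.2 fun w hw hwb => hqb ?_
      have hw' : w ∈ F.leaf (c.q s) := eq_leaf_of_mem (c.subset_leaves hω) hqω ▸ hw
      exact (mem_boundary_congr hw').1 hwb
    have hqX : c.q s ∈ c.q '' X ⟨_, hωI⟩ := by rw [hX]; exact hqω
    have hqY : c.q s ∈ c.q '' Y ⟨_, hωI⟩ := by rw [hY]; exact hqω
    obtain ⟨s₁, hs₁, hq₁⟩ := hqX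
    obtain ⟨s₂, hs₂, hq₂⟩ := hqY
    refine hs ?_
    rcases eq_or_eq_of_q_eq hq hq₁ hq₂ (fun h => hXY ⟨_, hωI⟩ ⟨_, hωI⟩
      ((edge_eq hs₁).symm.trans ((congrArg c.edge h).trans (edge_eq hs₂)))) with rfl | rfl
    · refine Or.inl (mem_iUnion.2 ⟨e ⟨_, hωI⟩, ?_⟩)
      rw [Equiv.symm_apply_apply]; exact hs₁
    · refine Or.inr (mem_iUnion.2 ⟨e ⟨_, hωI⟩, ?_⟩)
      rw [Equiv.symm_apply_apply]; exact hs₂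

end Cutting

theorem admitsStripedAtlas_of_locallyFinite [SecondCountableTopology Z]
    (hF : F.HasClosedLineLeaves)
    (hfin : LocallyFinite (fun ω : F.singularLeaves => (ω : Set Z))) : F.AdmitsStripedAtlas := by
  obtain ⟨c⟩ := exists_cutting hF hfin
  exact ⟨c.Λ, c.countable, c.strips, c.q, c.isStripedAtlas_q hF, c.leaves_eq hF⟩

end Foliation

/-! ### From a striped atlas to local finiteness. -/

namespace Foliation

variable {Z : Type*} [TopologicalSpace Z] {F : Foliation Z}

/-- A continuous injective map of an open strip that sends lines onto leaves is open, as seen in a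
flow box. -/
lemma FlowBox.exists_nhd_forall_eq (hF : F.HasClosedLineLeaves) {f : ℝ × ℝ → Z} {u v : ℝ}
    (hc : ContinuousOn f (univ ×ˢ Ioo u v)) (hi : InjOn f (univ ×ˢ Ioo u v))
    (hl : ∀ t ∈ Ioo u v, f '' (univ ×ˢ {t}) ∈ F.leaves) {p : ℝ × ℝ}
    (hp : p ∈ (univ : Set ℝ) ×ˢ Ioo u v) {J : Set ℝ} (B : F.FlowBox J) (hB : IsOpen B.dom)
    (hpB : f p ∈ B.dom) {N : Set (ℝ × ℝ)} (hN : N ∈ 𝓝 p) :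
    ∃ M ∈ 𝓝 (B.c (f p)), ∀ r ∈ M, ∃ p' ∈ N, f p' ∈ B.dom ∧ B.c (f p') = r := by
  have hopen : IsOpen (univ ×ˢ Ioo u v : Set (ℝ × ℝ)) := isOpen_univ.prod isOpen_Ioo
  have hN' : N ∩ (univ ×ˢ Ioo u v ∩ f ⁻¹' B.dom) ∈ 𝓝 p :=
    inter_mem hN ((hc.isOpen_inter_preimage hopen hB).mem_nhds ⟨hp, hpB⟩)
  obtain ⟨δ, hδ, hball⟩ := Metric.mem_nhds_iff.1 hN'
  obtain ⟨x₀, t₀⟩ := p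
  have hsub : ∀ x ∈ Ioo (x₀ - δ) (x₀ + δ), ∀ t ∈ Ioo (t₀ - δ) (t₀ + δ),
      (x, t) ∈ N ∩ (univ ×ˢ Ioo u v ∩ f ⁻¹' B.dom) := by
    intro x hx t ht
    refine hball ?_
    rw [Metric.mem_ball, Prod.dist_eq, max_lt_iff, Real.dist_eq, Real.dist_eq, abs_lt, abs_lt]
    exact ⟨⟨by linarith [hx.1], by linarith [hx.2]⟩, by linarith [ht.1], by linarith [ht.2]⟩
  have hx₀ : x₀ ∈ Ioo (x₀ - δ) (x₀ + δ) := ⟨by linarith, by linarith⟩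
  have ht₀ : t₀ ∈ Ioo (t₀ - δ) (t₀ + δ) := ⟨by linarith, by linarith⟩
  have hcc : ContinuousOn (fun p => B.c (f p)) (Ioo (x₀ - δ) (x₀ + δ) ×ˢ Ioo (t₀ - δ) (t₀ + δ)) :=
    B.cont_c.comp (hc.mono fun p hp => (hsub _ hp.1 _ hp.2).2.1) fun p hp => (hsub _ hp.1 _ hp.2).2.2
  have hrel : ∀ t ∈ Ioo u v, ∀ x x', F.leafSetoid (f (x, t)) (f (x', t)) := by
    intro t ht x x'
    have h1 := eq_leaf_of_mem (hl t ht) (mem_image_of_mem f (show (x', t) ∈ univ ×ˢ {t} by simp))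
    have h2 : f (x, t) ∈ F.leaf (f (x', t)) :=
      h1 ▸ mem_image_of_mem f (show (x, t) ∈ univ ×ˢ {t} by simp)
    exact h2
  let Y : ℝ → ℝ := fun t => (B.c (f (x₀, t))).2
  -- A plaque is open in its leaf, so the height in the box is locally constant along a line.
  have hY : ∀ t ∈ Ioo (t₀ - δ) (t₀ + δ), ∀ x ∈ Ioo (x₀ - δ) (x₀ + δ), (B.c (f (x, t))).2 = Y t := by
    intro t ht x hx
    refine isPreconnected_Ioo.induction₂ (fun x x' => (B.c (f (x, t))).2 = (B.c (f (x', t))).2)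
      (fun a ha => ?_) (fun _ _ _ _ _ _ => Eq.trans) (fun _ _ _ _ => Eq.symm) hx hx₀
    have hm := (hsub a ha t ht).2
    have hd := B.c_mem hm.2
    obtain ⟨M, hM, hMl⟩ := B.exists_plaque_nhd hF hd.1 hd.2
    have hca : ContinuousAt (fun a => f (a, t)) a :=
      (hc.continuousAt (hopen.mem_nhds hm.1)).comp (f := fun a : ℝ => (a, t)) (by fun_prop)
    rw [Prod.mk.eta, B.b_c hm.2] at hM hMl
    filter_upwards [mem_nhdsWithin_of_mem_nhds (hca hM)] with a' ha'
    obtain ⟨x', hx', h⟩ := hMl _ ha' (hrel t hm.1.2 _ _)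
    change f (a', t) = _ at h
    rw [h, B.left_inv (x', (B.c (f (a, t))).2) ⟨hx', hd.2⟩]
  have hYc : ContinuousOn Y (Ioo (t₀ - δ) (t₀ + δ)) :=
    continuous_snd.comp_continuousOn (hcc.comp (f := fun t => (x₀, t)) (by fun_prop)
      fun t ht => ⟨hx₀, ht⟩)
  -- Equal heights mean equal leaves, and by injectivity of `f` distinct lines have distinct leaves
  -- as images.
  have hYi : InjOn Y (Ioo (t₀ - δ) (t₀ + δ)) := by
    intro t ht t' ht' h
    have hm := (hsub x₀ hx₀ t ht).2
    have hm' := (hsub x₀ hx₀ t' ht').2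
    have hd := B.c_mem hm.2
    have hd' := B.c_mem hm'.2
    have h1 := B.leaf _ hd'.1 _ hd.1 _ hd.2
    have h2 : (B.c (f (x₀, t))).2 = (B.c (f (x₀, t'))).2 := h
    have h3 : ((B.c (f (x₀, t'))).1, (B.c (f (x₀, t))).2) = B.c (f (x₀, t')) := Prod.ext rfl h2
    rw [h3, Prod.mk.eta, B.b_c hm.2, B.b_c hm'.2] at h1
    have h4 := eq_leaf_of_mem (hl t hm.1.2)
      (mem_image_of_mem f (show (x₀, t) ∈ univ ×ˢ {t} by simp))
    have h5 : f (x₀, t') ∈ f '' (univ ×ˢ {t}) := h4 ▸ h1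
    obtain ⟨⟨x, s⟩, ⟨-, hs⟩, hx⟩ := h5
    change s = t at hs
    subst hs
    exact congrArg Prod.snd (hi (show (x, s) ∈ univ ×ˢ Ioo u v from ⟨mem_univ _, hm.1.2⟩)
      hm'.1 hx)
  have hXi : InjOn (fun x => (B.c (f (x, t₀))).1) (Ioo (x₀ - δ) (x₀ + δ)) := by
    intro x hx x' hx' h
    have h1 : B.c (f (x, t₀)) = B.c (f (x', t₀)) :=
      Prod.ext h ((hY _ ht₀ _ hx).trans (hY _ ht₀ _ hx').symm)
    have hm := (hsub x hx t₀ ht₀).2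
    have hm' := (hsub x' hx' t₀ ht₀).2
    have h2 : f (x, t₀) = f (x', t₀) := by rw [← B.b_c hm.2, h1, B.b_c hm'.2]
    exact congrArg Prod.fst (hi hm.1 hm'.1 h2)
  have hXc : ∀ t ∈ Ioo (t₀ - δ) (t₀ + δ),
      ContinuousOn (fun x => (B.c (f (x, t))).1) (Ioo (x₀ - δ) (x₀ + δ)) := fun t ht =>
    continuous_fst.comp_continuousOn (hcc.comp (f := fun x => (x, t)) (by fun_prop)
      fun x hx => ⟨hx, ht⟩)
  have hXw : ∀ x ∈ Ioo (x₀ - δ) (x₀ + δ), ContinuousWithinAt (fun t => (B.c (f (x, t))).1)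
      (Ioo (t₀ - δ) (t₀ + δ)) t₀ := fun x hx =>
    continuous_fst.comp_continuousOn (hcc.comp (f := fun t => (x, t)) (by fun_prop)
      fun t ht => ⟨hx, ht⟩) t₀ ht₀
  have hl₀ : x₀ - δ / 2 ∈ Ioo (x₀ - δ) (x₀ + δ) := ⟨by linarith, by linarith⟩
  have hr₀ : x₀ + δ / 2 ∈ Ioo (x₀ - δ) (x₀ + δ) := ⟨by linarith, by linarith⟩
  -- The height is handled by one-dimensional invariance of domain for `Y`, the horizontal
  -- coordinate by the fibrewise intermediate value theorem.
  have hfib := eventually_exists_fiber_eq (X := fun x t => (B.c (f (x, t))).1) (x₀ := x₀)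
    (half_pos hδ) (J := Ioo (t₀ - δ) (t₀ + δ)) (s₀ := t₀)
    (fun t ht => (hXc t ht).mono (Icc_subset_Ioo hl₀.1 hr₀.2)) (hXw _ hl₀) (hXw _ hr₀) (by
      rcases (hXc t₀ ht₀).strictMonoOn_of_injOn_Ioo (by linarith) hXi with h | h
      · exact Or.inl ⟨h hl₀ hx₀ (by linarith), h hx₀ hr₀ (by linarith)⟩
      · exact Or.inr ⟨h hx₀ hr₀ (by linarith), h hl₀ hx₀ (by linarith)⟩)
  rw [nhdsWithin_eq_nhds.2 (Ioo_mem_nhds ht₀.1 ht₀.2)] at hfib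
  obtain ⟨A, hA, T, hT, hAT⟩ := mem_prod_iff.1 hfib
  have hYn := image_mem_nhds_of_injOn_Ioo hYc hYi ht₀ (inter_mem hT (Ioo_mem_nhds ht₀.1 ht₀.2))
  refine ⟨A ×ˢ (Y '' (T ∩ Ioo (t₀ - δ) (t₀ + δ))), prod_mem_nhds hA hYn, ?_⟩
  rintro ⟨a, _⟩ ⟨ha, t, ⟨htT, ht⟩, rfl⟩
  obtain ⟨x, hx, hxa⟩ := hAT (show (a, t) ∈ A ×ˢ T from ⟨ha, htT⟩)
  have hx' : x ∈ Ioo (x₀ - δ) (x₀ + δ) := ⟨by linarith [hx.1], by linarith [hx.2]⟩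
  exact ⟨(x, t), (hsub x hx' t ht).1, (hsub x hx' t ht).2.2, Prod.ext hxa (hY t ht x hx')⟩

/-- At a boundary point the image would fill a neighbourhood of the origin in the box coordinates,
including negative heights. -/
lemma notMem_boundary_of_image_line
    (hF : F.HasClosedLineLeaves) {f : ℝ × ℝ → Z} {u v : ℝ}
    (hc : ContinuousOn f (univ ×ˢ Ioo u v)) (hi : InjOn f (univ ×ˢ Ioo u v))
    (hl : ∀ t ∈ Ioo u v, f '' (univ ×ˢ {t}) ∈ F.leaves) {p : ℝ × ℝ}
    (hp : p ∈ (univ : Set ℝ) ×ˢ Ioo u v) : f p ∉ F.boundary := by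
  intro hb
  obtain ⟨B, hB, -, hB0, hBb⟩ := F.exists_flowBox_boundary hb univ_mem
  have h0 : ((0, 0) : ℝ × ℝ) ∈ Ioo (-1 : ℝ) 1 ×ˢ Ico (0 : ℝ) 1 := by simp
  obtain ⟨M, hM, h⟩ := B.exists_nhd_forall_eq hF hc hi hl hp hB (hB0 ▸ B.b_mem h0) univ_mem
  rw [← hB0, B.left_inv _ h0] at hM
  obtain ⟨δ, hδ, hball⟩ := Metric.mem_nhds_iff.1 hM
  obtain ⟨p', -, hp', hr⟩ := h (0, -(δ / 2)) (hball (by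
    rw [Metric.mem_ball, Prod.dist_eq, max_lt_iff, Real.dist_eq, Real.dist_eq, abs_lt, abs_lt]
    refine ⟨⟨?_, ?_⟩, ?_, ?_⟩ <;> simp only <;> linarith))
  have := (B.c_mem hp').2.1
  rw [hr] at this
  simp only at this
  linarith

lemma image_mem_nhds_of_image_line
    (hF : F.HasClosedLineLeaves) {f : ℝ × ℝ → Z} {u v : ℝ}
    (hc : ContinuousOn f (univ ×ˢ Ioo u v)) (hi : InjOn f (univ ×ˢ Ioo u v))
    (hl : ∀ t ∈ Ioo u v, f '' (univ ×ˢ {t}) ∈ F.leaves) {p : ℝ × ℝ}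
    (hp : p ∈ (univ : Set ℝ) ×ˢ Ioo u v)
    {N : Set (ℝ × ℝ)} (hN : N ∈ 𝓝 p) : f '' N ∈ 𝓝 (f p) := by
  obtain ⟨B, hB, -, hB0, -⟩ := F.exists_flowBox_interior
    (notMem_boundary_of_image_line hF hc hi hl hp) univ_mem
  have hd : f p ∈ B.dom := hB0 ▸ B.b_mem (by simp)
  obtain ⟨M, hM, h⟩ := B.exists_nhd_forall_eq hF hc hi hl hp hB hd hN
  filter_upwards [(B.cont_c.continuousAt (hB.mem_nhds hd)) hM, hB.mem_nhds hd] with w hw hwd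
  obtain ⟨p', hp', hpd, hr⟩ := h _ hw
  exact ⟨p', hp', by rw [← B.b_c hpd, hr, B.b_c hwd]⟩

end Foliation

namespace Strip

variable {Λ : Type} {S : Λ → Strip}

lemma mem_carrier_of_mem_Ioo (T : Strip) {p : ℝ × ℝ} (hp : p.2 ∈ Ioo T.u T.v) : p ∈ T.carrier :=
  T.contains_open ⟨mem_univ _, hp⟩

variable (S) in
/-- The union of the interiors of the strips. -/
def sumInterior : Set (DisjUnion S) := {s | (s.2 : ℝ × ℝ).2 ∈ Ioo (S s.1).u (S s.1).v}

lemma isOpen_sumInterior : IsOpen (sumInterior S) := by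
  rw [isOpen_sigma_iff]
  intro l
  have h : Continuous fun p : (S l).carrier => (p : ℝ × ℝ).2 :=
    continuous_snd.comp continuous_subtype_val
  exact (isOpen_Ioo (a := (S l).u) (b := (S l).v)).preimage h

lemma notMem_sumInterior_of_mem {A : Set (DisjUnion S)} (hA : A ∈ sumBoundaryIntervals S)
    {s : DisjUnion S} (hs : s ∈ A) : s ∉ sumInterior S := by
  obtain ⟨l, _, ⟨p, hp, rfl⟩, rfl⟩ := hA
  obtain ⟨h1, h2⟩ := mem_inSum.1 hs
  obtain ⟨k, a⟩ := s
  change k = l at h1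
  subst h1
  have h3 := (connectedComponentIn_subset _ _ h2).2
  rintro ⟨h4, h5⟩
  rcases h3 with h | h
  · exact h4.ne' h
  · exact h5.ne h

lemma dense_sumInterior : Dense (sumInterior S) := by
  rintro ⟨l, p, hp⟩
  rw [mem_closure_iff]
  intro O hO hpO
  obtain ⟨W, hW, hWO⟩ := isOpen_induced_iff.1 (isOpen_sigma_iff.1 hO l)
  have hpW : p ∈ W := by
    have : (⟨p, hp⟩ : (S l).carrier) ∈ Subtype.val ⁻¹' W := by rw [hWO]; exact hpO
    exact this
  have hcl : p ∈ closure (univ ×ˢ Ioo (S l).u (S l).v : Set (ℝ × ℝ)) := by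
    rw [closure_prod_eq, closure_univ, closure_Ioo (S l).u_lt_v.ne]
    exact (S l).subset_closed hp
  obtain ⟨p', hp'W, hp'⟩ := mem_closure_iff.1 hcl W hW hpW
  refine ⟨⟨l, p', (S l).contains_open hp'⟩, ?_, hp'.2⟩
  have : (⟨p', (S l).contains_open hp'⟩ : (S l).carrier) ∈ Sigma.mk l ⁻¹' O := by
    rw [← hWO]; exact hp'W
  exact this

/-- Near a point of a boundary interval there are only points of this interval and of the
interior of the strip. -/
lemma inSum_union_sumInterior_mem_nhds {l : Λ} {p : ℝ × ℝ} (hp : p ∈ (S l).boundary) :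
    inSum S l (connectedComponentIn (S l).boundary p) ∪ sumInterior S ∈
      𝓝 (⟨l, p, hp.1⟩ : DisjUnion S) := by
  obtain ⟨O, hO, hOS⟩ := (S l).rel_open
  have hpO : p ∈ O := (hOS ▸ hp.1 : p ∈ O ∩ _).1
  obtain ⟨δ, hδ, hball⟩ := Metric.isOpen_iff.1 hO p hpO
  have huv := (S l).u_lt_v
  have hnear : ∀ᶠ a : (S l).carrier in 𝓝 ⟨p, hp.1⟩,
      dist (a : ℝ × ℝ) p < min δ ((S l).v - (S l).u) := by
    have h : ContinuousAt (fun a : (S l).carrier => (a : ℝ × ℝ)) ⟨p, hp.1⟩ :=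
      continuous_subtype_val.continuousAt
    exact h (Metric.ball_mem_nhds p (lt_min hδ (by linarith)))
  rw [Sigma.nhds_mk]
  refine mem_map.2 ?_
  filter_upwards [hnear] with ⟨a, ha⟩ had
  change dist a p < _ at had
  rw [Prod.dist_eq, max_lt_iff, Real.dist_eq, Real.dist_eq, lt_min_iff, lt_min_iff] at had
  obtain ⟨⟨h1, -⟩, -, h2⟩ := had
  have ha2 := ((S l).subset_closed ha).2
  by_cases hint : a.2 ∈ Ioo (S l).u (S l).v
  · exact Or.inr hint
  have hab : a.2 = (S l).u ∨ a.2 = (S l).v := by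
    by_contra hne
    rw [not_or] at hne
    exact hint ⟨lt_of_le_of_ne ha2.1 (Ne.symm hne.1), lt_of_le_of_ne ha2.2 hne.2⟩
  have heq : a.2 = p.2 := by
    have := abs_lt.1 h2
    rcases hab with h | h <;> rcases hp.2 with h' | h' <;> rw [h, h'] at this ⊢ <;> exfalso <;>
      linarith [this.1, this.2]
  refine Or.inl (mem_inSum.2 ⟨rfl, ?_⟩)
  have hseg : IsPreconnected ((fun x => (x, p.2)) '' Ioo (p.1 - δ) (p.1 + δ)) :=
    isPreconnected_Ioo.image _ (by fun_prop)
  refine hseg.subset_connectedComponentIn ⟨p.1, ⟨by linarith, by linarith⟩, rfl⟩ ?_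
    ⟨a.1, ?_, Prod.ext rfl heq.symm⟩
  · rintro _ ⟨x, hx, rfl⟩
    refine ⟨?_, hp.2⟩
    rw [hOS]
    refine ⟨hball ?_, mem_univ _, ((S l).subset_closed hp.1).2⟩
    rw [Metric.mem_ball, Prod.dist_eq, max_lt_iff, Real.dist_eq, Real.dist_eq, sub_self, abs_zero,
      abs_lt]
    exact ⟨⟨by linarith [hx.1], by linarith [hx.2]⟩, hδ⟩
  · have := abs_lt.1 h1
    exact ⟨by linarith [this.1], by linarith [this.2]⟩

end Strip

section

open Strip

variable {Z : Type*} {Λ : Type} {S : Λ → Strip} {q : DisjUnion S → Z}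

namespace Strip

/-- The restriction of a map from a disjoint union of strips to one of the strips, extended to the
plane. -/
noncomputable def planeMap (q : DisjUnion S → Z) (l : Λ) (p : ℝ × ℝ) : Z :=
  open Classical in
  if h : p ∈ (S l).carrier then q ⟨l, p, h⟩ else
    -- A default value off the strip: the image of a point halfway across.
    q ⟨l, (0, ((S l).u + (S l).v) / 2), (S l).mem_carrier_of_mem_Ioo
      ⟨by simp only; linarith [(S l).u_lt_v], by simp only; linarith [(S l).u_lt_v]⟩⟩

lemma planeMap_of_mem {l : Λ} {p : ℝ × ℝ} (h : p ∈ (S l).carrier) :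
    planeMap q l p = q ⟨l, p, h⟩ := dif_pos h

lemma image_inSum {l : Λ} {A : Set (ℝ × ℝ)} (hA : A ⊆ (S l).carrier) :
    q '' inSum S l A = planeMap q l '' A := by
  apply Subset.antisymm
  · rintro _ ⟨_, ⟨p, hp, rfl⟩, rfl⟩
    exact ⟨p, hp, planeMap_of_mem p.2⟩
  · rintro _ ⟨p, hp, rfl⟩
    exact ⟨⟨l, p, hA hp⟩, ⟨⟨p, hA hp⟩, hp, rfl⟩, (planeMap_of_mem _).symm⟩

lemma line_subset {T : Strip} {t : ℝ} (ht : t ∈ Ioo T.u T.v) :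
    (univ ×ˢ {t} : Set (ℝ × ℝ)) ⊆ T.carrier := fun p hp =>
  T.mem_carrier_of_mem_Ioo (by rw [show p.2 = t from hp.2]; exact ht)

lemma continuousOn_planeMap [TopologicalSpace Z] (hq : Continuous q) (l : Λ) :
    ContinuousOn (planeMap q l) (S l).carrier := by
  rw [continuousOn_iff_continuous_domRestrict]
  exact (hq.comp continuous_sigmaMk).congr fun p => (planeMap_of_mem p.2).symm

end Strip

variable [TopologicalSpace Z] {F : Foliation Z}

namespace IsStripedAtlas

lemma injOn_sumInterior (hq : IsStripedAtlas S q) : InjOn q (sumInterior S) := by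
  obtain ⟨Γ, X, Y, hX, hY, -, -, -, hinj, -⟩ := hq.gluing
  refine hinj.mono fun s hs => ?_
  rintro (h | h)
  · obtain ⟨γ, h⟩ := mem_iUnion.1 h
    exact notMem_sumInterior_of_mem (hX γ) h hs
  · obtain ⟨γ, h⟩ := mem_iUnion.1 h
    exact notMem_sumInterior_of_mem (hY γ) h hs

lemma injOn_planeMap (hq : IsStripedAtlas S q) (l : Λ) :
    InjOn (planeMap q l) (univ ×ˢ Ioo (S l).u (S l).v) := by
  intro p hp p' hp' h
  rw [planeMap_of_mem ((S l).contains_open hp), planeMap_of_mem ((S l).contains_open hp')] at h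
  have := hq.injOn_sumInterior (x₁ := ⟨l, p, (S l).contains_open hp⟩)
    (x₂ := ⟨l, p', (S l).contains_open hp'⟩) hp.2 hp'.2 h
  exact congrArg Subtype.val (eq_of_heq (Sigma.mk.inj this).2)

lemma continuousOn_planeMap (hq : IsStripedAtlas S q) (l : Λ) :
    ContinuousOn (planeMap q l) (univ ×ˢ Ioo (S l).u (S l).v) :=
  (Strip.continuousOn_planeMap hq.isQuotientMap.continuous l).mono (S l).contains_open

end IsStripedAtlas

namespace Foliation

lemma image_line_mem_leaves (hl : F.leaves = (fun A => q '' A) '' sumLeaves S) {l : Λ} {t : ℝ}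
    (ht : t ∈ Ioo (S l).u (S l).v) : planeMap q l '' (univ ×ˢ {t}) ∈ F.leaves := by
  rw [← image_inSum (line_subset ht), hl]
  exact ⟨_, ⟨l, _, Or.inl ⟨t, ht, rfl⟩, rfl⟩, rfl⟩

lemma image_mem_nhds_of_mem_sumInterior (hF : F.HasClosedLineLeaves) (hq : IsStripedAtlas S q)
    (hl : F.leaves = (fun A => q '' A) '' sumLeaves S) {s : DisjUnion S} (hs : s ∈ sumInterior S)
    {N : Set (DisjUnion S)} (hN : N ∈ 𝓝 s) : q '' N ∈ 𝓝 (q s) := by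
  obtain ⟨l, p, hp⟩ := s
  have hpI : p ∈ (univ : Set ℝ) ×ˢ Ioo (S l).u (S l).v := ⟨mem_univ _, hs⟩
  rw [Sigma.nhds_mk, mem_map, nhds_subtype_eq_comap] at hN
  obtain ⟨M, hM, hMN⟩ := mem_comap.1 hN
  have hM' := inter_mem hM ((isOpen_univ.prod isOpen_Ioo).mem_nhds hpI)
  have := image_mem_nhds_of_image_line hF (hq.continuousOn_planeMap l) (hq.injOn_planeMap l)
    (fun t ht => image_line_mem_leaves hl ht) hpI hM'
  rw [planeMap_of_mem hp] at this
  refine mem_of_superset this ?_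
  rintro _ ⟨p', ⟨hp', hpI'⟩, rfl⟩
  have hp'S := (S l).contains_open hpI'
  exact ⟨⟨l, p', hp'S⟩, hMN (show (⟨p', hp'S⟩ : (S l).carrier) ∈ Subtype.val ⁻¹' M from hp'),
    (planeMap_of_mem hp'S).symm⟩

lemma isOpen_image_sumInterior (hF : F.HasClosedLineLeaves) (hq : IsStripedAtlas S q)
    (hl : F.leaves = (fun A => q '' A) '' sumLeaves S) : IsOpen (q '' sumInterior S) := by
  rw [isOpen_iff_mem_nhds]
  rintro _ ⟨s, hs, rfl⟩
  exact image_mem_nhds_of_mem_sumInterior hF hq hl hs (isOpen_sumInterior.mem_nhds hs)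

/-- A striped atlas is one-to-one over the interiors of the strips. -/
lemma eq_of_q_eq_of_mem_sumInterior (hF : F.HasClosedLineLeaves) (hq : IsStripedAtlas S q)
    (hl : F.leaves = (fun A => q '' A) '' sumLeaves S) {s s' : DisjUnion S}
    (hs : s ∈ sumInterior S) (h : q s' = q s) : s' = s := by
  by_contra hne
  obtain ⟨O', O, hO', hO, hs'O', hsO, hd⟩ := t2_separation hne
  -- Interior points near `s'` go close to `q s`, hence to images of interior points near `s`.
  -- Injectivity on the interiors identifies them, although `s` and `s'` have disjoint
  -- neighbourhoods.
  have h1 := image_mem_nhds_of_mem_sumInterior hF hq hl hs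
    (inter_mem (hO.mem_nhds hsO) (isOpen_sumInterior.mem_nhds hs))
  rw [← h] at h1
  have h2 := hq.isQuotientMap.continuous.continuousAt h1
  obtain ⟨s'', ⟨hs1, hs2⟩, hs3⟩ := mem_closure_iff_nhds.1 (dense_sumInterior s') _
    (inter_mem h2 (hO'.mem_nhds hs'O'))
  obtain ⟨o, ⟨ho, hoI⟩, hoq⟩ := hs1
  have := hq.injOn_sumInterior hoI hs3 hoq
  exact Set.disjoint_left.1 hd hs2 (this ▸ ho)

/-- The lines inside the strips of a striped atlas are regular leaves. -/
lemma isRegularLeaf_image_line (hF : F.HasClosedLineLeaves) (hq : IsStripedAtlas S q)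
    (hl : F.leaves = (fun A => q '' A) '' sumLeaves S) {l : Λ} {t : ℝ}
    (ht : t ∈ Ioo (S l).u (S l).v) : F.IsRegularLeaf (planeMap q l '' (univ ×ˢ {t})) := by
  set f := planeMap q l with hf
  set A : Set (ℝ × ℝ) := univ ×ˢ Ioo (S l).u (S l).v
  have hfc : ContinuousOn f A := hq.continuousOn_planeMap l
  have hfi : InjOn f A := hq.injOn_planeMap l
  have hlines : ∀ t ∈ Ioo (S l).u (S l).v, f '' (univ ×ˢ {t}) ∈ F.leaves := fun t ht =>
    image_line_mem_leaves hl ht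
  have hAo : IsOpen A := isOpen_univ.prod isOpen_Ioo
  obtain ⟨ε, hε, hball⟩ : ∃ ε > 0, Icc (t - ε) (t + ε) ⊆ Ioo (S l).u (S l).v := by
    obtain ⟨δ, hδ, h⟩ := Metric.isOpen_iff.1 isOpen_Ioo t ht
    refine ⟨δ / 2, half_pos hδ, fun r hr => h ?_⟩
    rw [Metric.mem_ball, Real.dist_eq, abs_lt]
    constructor <;> linarith [hr.1, hr.2]
  have hmemA : ∀ x, ∀ s ∈ Icc (-1 : ℝ) 1, (x, t + ε * s) ∈ A := fun x s hs =>
    ⟨mem_univ _, hball ⟨by nlinarith [hs.1], by nlinarith [hs.2]⟩⟩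
  have hrel : ∀ p ∈ A, ∀ p' ∈ A, F.leafSetoid (f p) (f p') ↔ p.2 = p'.2 := by
    intro p hp p' hp'
    have h1 := eq_leaf_of_mem (hlines p'.2 hp'.2)
      (mem_image_of_mem f (show p' ∈ univ ×ˢ {p'.2} from ⟨mem_univ _, rfl⟩))
    constructor
    · intro h
      have h2 : f p ∈ f '' (univ ×ˢ {p'.2}) := h1 ▸ h
      obtain ⟨a, ⟨-, ha⟩, hap⟩ := h2
      have ha' : a.2 = p'.2 := ha
      rw [← hfi (show a ∈ A from ⟨mem_univ _, ha'.symm ▸ hp'.2⟩) hp hap, ha']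
    · intro h
      have h2 : f p ∈ F.leaf (f p') :=
        h1 ▸ mem_image_of_mem f (show p ∈ univ ×ˢ {p'.2} from ⟨mem_univ _, h⟩)
      exact h2
  have hsubA : univ ×ˢ Icc (t - ε) (t + ε) ⊆ A := prod_mono_right hball
  set U := f '' (univ ×ˢ Ioo (t - ε) (t + ε)) with hU
  set K := f '' (univ ×ˢ Icc (t - ε) (t + ε)) with hK
  -- Nothing outside the slab is mapped into its image, so the preimage of `K` is the slab, which is
  -- closed in the disjoint union.
  have hKcl : IsClosed K := by
    rw [hK, hf, ← image_inSum (hsubA.trans (S l).contains_open), ← hq.isQuotientMap.isClosed_preimage]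
    have : q ⁻¹' (q '' inSum S l (univ ×ˢ Icc (t - ε) (t + ε))) =
        inSum S l (univ ×ˢ Icc (t - ε) (t + ε)) := by
      refine Subset.antisymm ?_ (subset_preimage_image _ _)
      rintro s' ⟨s, hs, h⟩
      have hsI : s ∈ sumInterior S := by
        obtain ⟨p, hp, rfl⟩ := hs
        exact hball hp.2
      rwa [eq_of_q_eq_of_mem_sumInterior hF hq hl hsI h.symm]
    rw [this]
    exact IsClosedEmbedding.sigmaMk.isClosedMap _
      ((isClosed_univ.prod isClosed_Icc).preimage continuous_subtype_val)
  have hclU : closure U = K := by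
    apply Subset.antisymm
    · exact closure_minimal (image_mono (prod_mono_right Ioo_subset_Icc_self)) hKcl
    · have h1 : closure (univ ×ˢ Ioo (t - ε) (t + ε) : Set (ℝ × ℝ)) =
          univ ×ˢ Icc (t - ε) (t + ε) := by
        rw [closure_prod_eq, closure_univ, closure_Ioo (by linarith)]
      rw [hK, ← h1]
      exact ContinuousOn.image_closure (by rw [h1]; exact hfc.mono hsubA)
  have hemb : IsOpenEmbedding (A.domRestrict f) := by
    refine IsOpenEmbedding.of_continuous_injective_isOpenMap hfc.domRestrict
      (injOn_iff_injective.1 hfi) ?_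
    rw [isOpenMap_iff_nhds_le]
    rintro ⟨p, hp⟩ N hN
    have h1 : A.domRestrict f ⁻¹' N ∈ 𝓝 (⟨p, hp⟩ : A) := hN
    have h2 := image_mem_nhds_of_image_line hF hfc hfi hlines hp
      (hAo.isOpenEmbedding_subtypeVal.image_mem_nhds.2 h1)
    refine mem_of_superset h2 ?_
    rintro _ ⟨_, ⟨a, ha, rfl⟩, rfl⟩
    exact ha
  let j : ℝ × Icc (-1 : ℝ) 1 → A := fun p => ⟨(p.1, t + ε * p.2), hmemA _ _ p.2.2⟩
  have hjemb : IsEmbedding j := by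
    refine Function.LeftInverse.isEmbedding
      (f := fun a : A => ((a : ℝ × ℝ).1, projIcc (-1 : ℝ) 1 (by norm_num) (((a : ℝ × ℝ).2 - t) / ε)))
      ?_ ?_ ?_
    · rintro ⟨x, s⟩
      refine Prod.ext rfl ?_
      change projIcc (-1 : ℝ) 1 (by norm_num) ((t + ε * s - t) / ε) = s
      rw [add_sub_cancel_left, mul_div_cancel_left₀ _ hε.ne', projIcc_val]
    · exact (continuous_fst.comp continuous_subtype_val).prodMk (continuous_projIcc.comp (by fun_prop))
    · exact Continuous.subtype_mk (by fun_prop) _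
  have hκ := hemb.isEmbedding.comp hjemb
  have hrange : range (A.domRestrict f ∘ j) = closure U := by
    rw [hclU]
    apply Subset.antisymm
    · rintro _ ⟨⟨x, s⟩, rfl⟩
      exact ⟨_, ⟨mem_univ _, by nlinarith [s.2.1], by nlinarith [s.2.2]⟩, rfl⟩
    · rintro _ ⟨⟨x, r⟩, ⟨-, hr⟩, rfl⟩
      refine ⟨(x, ⟨(r - t) / ε, ?_⟩), ?_⟩
      · rw [mem_Icc, le_div_iff₀ hε, div_le_iff₀ hε]
        constructor <;> linarith [hr.1, hr.2]
      · change f (x, t + ε * ((r - t) / ε)) = f (x, r)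
        rw [mul_div_cancel₀ _ hε.ne', add_sub_cancel]
  let h : closure U ≃ₜ ℝ × Icc (-1 : ℝ) 1 :=
    (hκ.toHomeomorph.trans (Homeomorph.setCongr hrange)).symm
  have hh : ∀ a : closure U, (a : Z) = f ((h a).1, t + ε * (h a).2) := fun a => by
    have : h.symm (h a) = a := h.symm_apply_apply a
    exact (congrArg Subtype.val this).symm
  have hmem : ∀ a : closure U, ∀ T : Set ℝ, (∀ r ∈ T, r ∈ Ioo (S l).u (S l).v) →
      ((a : Z) ∈ f '' (univ ×ˢ T) ↔ t + ε * (h a).2 ∈ T) := by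
    intro a T hT
    rw [hh a]
    constructor
    · rintro ⟨p, ⟨-, hp⟩, hpa⟩
      rw [hfi ⟨mem_univ _, hT _ hp⟩ (hmemA _ _ (h a).2.2) hpa] at hp
      exact hp
    · intro ht'
      exact ⟨_, ⟨mem_univ _, ht'⟩, rfl⟩
  refine Or.inl ⟨?_, U, ?_, ?_, ?_, h, ?_, ?_, ?_⟩
  · rintro _ ⟨p, ⟨-, hp⟩, rfl⟩
    have hp' : p.2 = t := hp
    exact notMem_boundary_of_image_line hF hfc hfi hlines ⟨mem_univ _, hp'.symm ▸ ht⟩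
  · rw [isOpen_iff_mem_nhds]
    rintro _ ⟨p, hp, rfl⟩
    exact image_mem_nhds_of_image_line hF hfc hfi hlines (hsubA ⟨mem_univ _, Ioo_subset_Icc_self hp.2⟩)
      ((isOpen_univ.prod isOpen_Ioo).mem_nhds hp)
  · exact image_mono (prod_mono_right (singleton_subset_iff.2 ⟨by linarith, by linarith⟩))
  · rintro ω hω ⟨_, hω', p, hp, rfl⟩
    have hpA : p ∈ A := hsubA ⟨mem_univ _, Ioo_subset_Icc_self hp.2⟩
    have h1 := (eq_leaf_of_mem hω hω').trans (eq_leaf_of_mem (hlines p.2 hpA.2)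
      (mem_image_of_mem f (show p ∈ univ ×ˢ {p.2} from ⟨mem_univ _, rfl⟩))).symm
    rw [h1]
    exact image_mono (prod_mono_right (singleton_subset_iff.2 hp.2))
  · intro a b
    rw [hh a, hh b, hrel _ (hmemA _ _ (h a).2.2) _ (hmemA _ _ (h b).2.2)]
    simp [hε.ne', Subtype.ext_iff]
  · intro a
    refine (hmem a _ fun r hr => hball (Ioo_subset_Icc_self hr)).trans ?_
    constructor
    · intro h'
      constructor <;> nlinarith [h'.1, h'.2]
    · intro h'
      constructor <;> nlinarith [h'.1, h'.2]
  · intro a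
    rw [hmem a {t} fun r hr => by rw [mem_singleton_iff.1 hr]; exact ht]
    simp [hε.ne']

/-- Lines inside strips are regular, so singular leaves are images of boundary intervals and avoid
the image of the open strips. -/
theorem locallyFinite_of_admitsStripedAtlas (hF : F.HasClosedLineLeaves)
    (h : F.AdmitsStripedAtlas) : LocallyFinite (fun ω : F.singularLeaves => (ω : Set Z)) := by
  obtain ⟨Λ, -, S, q, hq, hl⟩ := h
  have hdisj : ∀ l, ∀ I ∈ (S l).boundaryIntervals,
      Disjoint (q '' inSum S l I) (q '' sumInterior S) := by
    intro l I hI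
    rw [Set.disjoint_left]
    rintro _ ⟨s, hs, rfl⟩ ⟨s', hs', h⟩
    have := eq_of_q_eq_of_mem_sumInterior hF hq hl hs' h.symm
    exact notMem_sumInterior_of_mem ⟨l, I, hI, rfl⟩ hs (this ▸ hs')
  have hsing : ∀ ω ∈ F.singularLeaves, Disjoint ω (q '' sumInterior S) := by
    rintro ω ⟨hω, hreg⟩
    rw [hl] at hω
    obtain ⟨_, ⟨l, L, ⟨t, ht, rfl⟩ | hL, rfl⟩, rfl⟩ := hω
    · refine absurd ?_ hreg
      simp only [image_inSum (line_subset ht)]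
      exact isRegularLeaf_image_line hF hq hl ht
    · exact hdisj l L hL
  rw [locallyFinite_coe_iff]
  intro z
  by_cases hz : z ∈ q '' sumInterior S
  · refine ⟨_, (isOpen_image_sumInterior hF hq hl).mem_nhds hz, finite_empty.subset ?_⟩
    rintro ω ⟨hω, w, hw, hw'⟩
    exact Set.disjoint_left.1 (hsing ω hω) hw hw'
  -- A boundary interval meeting the preimage lies over the leaf of `z` entirely, and together with
  -- the interior of its strip it is a neighbourhood of each of its points.
  have hopen : IsOpen (F.leaf z ∪ q '' sumInterior S) := by
    rw [← hq.isQuotientMap.isOpen_preimage, isOpen_iff_mem_nhds]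
    rintro ⟨l, p, hp⟩ hs
    by_cases hint : (⟨l, p, hp⟩ : DisjUnion S) ∈ sumInterior S
    · exact mem_of_superset (isOpen_sumInterior.mem_nhds hint) fun s hs => Or.inr ⟨s, hs, rfl⟩
    have hpb : p ∈ (S l).boundary := by
      refine ⟨hp, ?_⟩
      by_contra hne
      rw [not_or] at hne
      have := ((S l).subset_closed hp).2
      exact hint ⟨lt_of_le_of_ne this.1 (Ne.symm hne.1), lt_of_le_of_ne this.2 hne.2⟩
    have hpz : F.leafSetoid (q ⟨l, p, hp⟩) z := by
      refine hs.resolve_right ?_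
      rintro ⟨s', hs', h⟩
      exact hint (eq_of_q_eq_of_mem_sumInterior hF hq hl hs' h.symm ▸ hs')
    have hI : connectedComponentIn (S l).boundary p ∈ (S l).boundaryIntervals := ⟨p, hpb, rfl⟩
    have hleaf : q '' inSum S l (connectedComponentIn (S l).boundary p) = F.leaf z := by
      have h1 : q '' inSum S l (connectedComponentIn (S l).boundary p) ∈ F.leaves := by
        rw [hl]; exact ⟨_, ⟨l, _, Or.inr hI, rfl⟩, rfl⟩
      rw [eq_leaf_of_mem h1 (mem_image_of_mem q (mem_inSum.2 ⟨rfl, mem_connectedComponentIn hpb⟩ :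
        (⟨l, p, hp⟩ : DisjUnion S) ∈ _)), leaf_eq hpz]
    refine mem_of_superset (inSum_union_sumInterior_mem_nhds hpb) ?_
    rintro s (hs | hs)
    · exact Or.inl (hleaf ▸ mem_image_of_mem q hs)
    · exact Or.inr ⟨s, hs, rfl⟩
  refine ⟨_, hopen.mem_nhds (Or.inl (F.mem_leaf_self z)), (finite_singleton (F.leaf z)).subset ?_⟩
  rintro ω ⟨hω, w, hw, hw' | hw'⟩
  · exact (eq_leaf_of_mem hω.1 hw).trans (leaf_eq hw')
  · exact absurd hw' (Set.disjoint_left.1 (hsing ω hω) hw)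

end Foliation

end

theorem mainTheorem1 {Z : Type*} [TopologicalSpace Z] [T2Space Z] [SecondCountableTopology Z]
    (F : Foliation Z)
    (hline : ∀ ω ∈ F.leaves, Nonempty (ω ≃ₜ ℝ))
    (hclosed : ∀ ω ∈ F.leaves, IsClosed ω) :
    F.AdmitsStripedAtlas ↔
      LocallyFinite (fun ω : F.singularLeaves => (ω : Set Z)) := by
  have hF := F.hasClosedLineLeaves hline hclosed
  exact ⟨Foliation.locallyFinite_of_admitsStripedAtlas hF,
    Foliation.admitsStripedAtlas_of_locallyFinite hF⟩
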